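/- **Setting.** Let $n\ge 2$, let $\Omega\subset\mathbb{R}^n$ be a bounded Lipschitz domain with boundary $\Gamma$, surface measure $d\sigma$ and exterior unit normal $\nu$, let $t_1<t_2$, and put $Q=\Omega\times(t_1,t_2)$, $\Sigma=\Gamma\times(t_1,t_2)$. Fix constants $\varkappa\ge 1$, $\mathfrak m>0$, $\kappa>0$, $\delta>0$ and $\mathfrak b$. Let $\mathscr{M}(\Omega,\varkappa,\mathfrak m)$ be the set of symmetric matrices $A=(a_{k\ell})$ with $a_{k\ell}\in C^{2,1}(\overline\Omega)$, $\|A\|_{C^{2,1}(\overline\Omega)}\le\mathfrak m$ and $\varkappa^{-1}|\xi|^2\le\sum_{k,\ell}a_{k\ell}(x)\xi_\ell\xi_k\le\varkappa|\xi|^2$ for all $x\in\Omega$, $\xi\in\mathbb{R}^n$. Write $(U|V)_A=(AU|V)$, $|U|_A^2=(U|U)_A$, $|\mathbf{D}_Au|^2=|\nabla u|_A^2+|\partial_tu|^2$, and $$\mathcal{L}^w_{A,0}u=\operatorname{div}(A\nabla u)-\partial_t^2u,\qquad \mathcal{L}^w_{A}u=\mathcal{L}^w_{A,0}u+q_0\partial_tu+\sum_{j=1}^nq_j\partial_ju+pu,$$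 where $q_0,\dots,q_n,p\in L^\infty(Q;\mathbb{C})$ all have $L^\infty$-norm at most $\mathfrak m$. For $h\in C^2(\overline\Omega)$ let $\Theta_A(h)=2A\nabla^2hA+\Upsilon_A(h)$, where $(\Upsilon_A(h))_{k\ell}=\sum_m\Lambda^m_{k\ell}\,\partial_mh$ and $\Lambda^m_{k\ell}=-\sum_p\partial_pa_{k\ell}\,a_{pm}+2\sum_pa_{kp}\,\partial_pa_{\ell m}$. The function $h$ is *$A$-pseudo-convex with constant $\kappa$* if $\nabla h\neq0$ on $\overline\Omega$ and $(\Theta_A(h)(x)\xi|\xi)\ge\kappa|\xi|^2$ for all $x\in\overline\Omega$, $\xi\in\mathbb{R}^n$. Let $\psi(x,t)=\psi_0(x)+\psi_1(t)$ with $0\le\psi\in C^4(\overline Q)$ and $\|\psi\|_{C^4(\overline Q)}\le\mathfrak b$, such that $\psi_0$ is $A$-pseudo-convex with constant $\kappa$ in $\Omega$, $|\partial_t^2\psi_1|\le\varkappa^{-1}\kappa/4$ on $[t_1,t_2]$, and $$\min_{\overline Q}\left[|\nabla\psi_0|_A^2-(\partial_t\psi_1)^2\right]^2=\delta>0 .$$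 For $\lambda>0$ put $\phi=e^{\lambda\psi}$. Finally let $\partial_{\nu_A}\psi_0=(\nabla\psi_0|\nu)_A$, $\Gamma_+=\{x\in\Gamma:\ \partial_{\nu_A}\psi_0(x)>0\}$ and $\Sigma_+=\Gamma_+\times(t_1,t_2)$. **Theorem.** (a) There exist constants $\aleph,\lambda^*,\tau^*>0$, depending only on $\mathfrak d=(\Omega,t_1,t_2,\varkappa,\mathfrak m,\kappa,\delta,\mathfrak b)$, such that for all $A\in\mathscr{M}(\Omega,\varkappa,\mathfrak m)$ and $\psi$ as above, all $\lambda\ge\lambda^*$, $\tau\ge\tau^*$, and all real-valued $u\in H^2(Q)$ with $u=0$ on $\Sigma$ and $u=\partial_tu=0$ on $\Omega\times\{t_1,t_2\}$ (in the sense of traces), $$\aleph\int_Qe^{2\tau\phi}\left[\tau^3\lambda^4\phi^3u^2+\tau\lambda\phi|\mathbf{D}_Au|^2\right]dxdt\le\int_Qe^{2\tau\phi}\left(\mathcal{L}^w_{A,0}u\right)^2dxdt+\tau\lambda\int_{\Sigma_+}e^{2\tau\phi}\phi\,(\partial_\nu u)^2\,d\sigma dt .$$ (b) There exist constants $\aleph,\lambda^*,\tau^*>0$,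 depending only on $\mathfrak d$, such that for all $A$ and $\psi$ as in (a), all $q_0,\dots,q_n,p$ as above, all $\lambda\ge\lambda^*$, $\tau\ge\tau^*$, and all complex-valued $u\in H^2(Q)$ with $u=0$ on $\Sigma$ and $u=\partial_tu=0$ on $\Omega\times\{t_1,t_2\}$, $$\aleph\int_Qe^{2\tau\phi}\left[\tau^3\lambda^4\phi^3|u|^2+\tau\lambda\phi|\mathbf{D}_Au|^2\right]dxdt\le\int_Qe^{2\tau\phi}\left|\mathcal{L}^w_{A}u\right|^2dxdt+\tau\lambda\int_{\Sigma_+}e^{2\tau\phi}\phi\,|\partial_\nu u|^2\,d\sigma dt .$$ -/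

import Mathlib

open MeasureTheory Measure Set Filter Topology
open scoped ContDiff RealInnerProductSpace

noncomputable section

namespace WaveCarleman

/-! ### Weak derivatives and Sobolev spaces on an open set of a finite-dimensional space -/

section Sobolev

variable {V : Type*} [NormedAddCommGroup V] [NormedSpace ℝ V] [MeasureSpace V]
variable {F : Type*} [NormedAddCommGroup F] [NormedSpace ℝ F]

/-- `g` is the weak derivative of `f` on `D` in the direction `e`. -/
def IsWeakDeriv (D : Set V) (e : V) (f g : V → F) : Prop :=
  ∀ θ : V → ℝ, ContDiff ℝ ∞ θ → HasCompactSupport θ → tsupport θ ⊆ D →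
    ∫ z in D, (fderiv ℝ θ z e) • f z = - ∫ z in D, θ z • g z

/-- `f ∈ H¹(D)`: `f` and all its first order weak derivatives are in `L²(D)`. -/
def MemH1 (D : Set V) (f : V → F) : Prop :=
  MemLp f 2 (volume.restrict D) ∧
    ∀ e : V, ∃ g : V → F, MemLp g 2 (volume.restrict D) ∧ IsWeakDeriv D e f g

open Classical in
/-- The weak derivative in `L²(D)` of `f` in the direction `e` (unique up to null sets; the
value `0` is used when there is none). -/
def weakDeriv (D : Set V) (e : V) (f : V → F) : V → F :=
  if h : ∃ g : V → F, MemLp g 2 (volume.restrict D) ∧ IsWeakDeriv D e f g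
  then h.choose else 0

/-- `f ∈ H²(D)`. -/
def MemH2 (D : Set V) (f : V → F) : Prop :=
  MemH1 D f ∧ ∀ e : V, MemH1 D (weakDeriv D e f)

/-- `g ∈ L²(μ)` is the trace of `f ∈ H¹(D)` on the boundary of `D` endowed with the measure `μ`:
some sequence of smooth functions converges to `f` in `H¹(D)`, and their restrictions to the
boundary converge to `g` in `L²(μ)`. -/
def IsTrace (D : Set V) (μ : Measure V) (f g : V → F) : Prop :=
  MemLp g 2 μ ∧ ∃ v : ℕ → V → F, (∀ j, ContDiff ℝ ∞ (v j)) ∧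
    Tendsto (fun j => eLpNorm (v j - f) 2 (volume.restrict D)) atTop (𝓝 0) ∧
    (∀ e : V, Tendsto (fun j => eLpNorm (fun z => fderiv ℝ (v j) z e - weakDeriv D e f z) 2
      (volume.restrict D)) atTop (𝓝 0)) ∧
    Tendsto (fun j => eLpNorm (v j - g) 2 μ) atTop (𝓝 0)

open Classical in
/-- The trace operator `H¹(D) → L²(μ)`. -/
def trace (D : Set V) (μ : Measure V) (f : V → F) : V → F :=
  if h : ∃ g : V → F, IsTrace D μ f g then h.choose else 0

end Sobolev

/-! ### Lipschitz domains, boundary measure, exterior normal, space-time cylinder -/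

/-- The Euclidean space `ℝⁿ`. -/
abbrev E (n : ℕ) := EuclideanSpace ℝ (Fin n)

/-- A bounded Lipschitz domain of `ℝⁿ`: a bounded connected nonempty open set which, near each
boundary point, is the part lying strictly above (in some direction `e`) the graph over the
hyperplane orthogonal to `e` of a Lipschitz function. -/
structure IsLipschitzDomain {n : ℕ} (Ω : Set (E n)) : Prop where
  isOpen : IsOpen Ω
  isConnected : IsConnected Ω
  isBounded : Bornology.IsBounded Ω
  graph : ∀ x ∈ frontier Ω, ∃ (e : E n) (K : NNReal) (r : ℝ) (γ : E n → ℝ),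
    ‖e‖ = 1 ∧ 0 < r ∧ LipschitzWith K γ ∧
    ∀ y ∈ Metric.ball x r, y ∈ Ω ↔ γ (y - ⟪e, y⟫ • e) < ⟪e, y⟫

/-- The surface measure on the boundary `Γ` of `Ω`, that is the (Euclidean normalized)
`(n-1)`-dimensional Hausdorff measure restricted to `Γ`. -/
def surfaceMeasure {n : ℕ} (Ω : Set (E n)) : Measure (E n) :=
  (μHE[n - 1] : Measure (E n)).restrict (frontier Ω)

/-- `v` is the exterior unit normal of `Ω` at the boundary point `x`: up to `o(|y - x|)`, the set
`Ω` coincides near `x` with the half-space `(y - x | v) < 0`. -/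
def IsOuterNormal {n : ℕ} (Ω : Set (E n)) (x v : E n) : Prop :=
  ‖v‖ = 1 ∧ ∀ ε > (0 : ℝ), ∀ᶠ y in 𝓝 x,
    (y ∈ Ω → ⟪y - x, v⟫ ≤ ε * ‖y - x‖) ∧ (y ∉ Ω → -(ε * ‖y - x‖) ≤ ⟪y - x, v⟫)

open Classical in
/-- The exterior unit normal vector field `ν` (defined almost everywhere on `Γ`). -/
def outerNormal {n : ℕ} (Ω : Set (E n)) (x : E n) : E n :=
  if h : ∃ v : E n, IsOuterNormal Ω x v then h.choose else 0

/-- `Q = Ω × (t₁, t₂)`. -/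
def cyl {n : ℕ} (Ω : Set (E n)) (t₁ t₂ : ℝ) : Set (E n × ℝ) := Ω ×ˢ Ioo t₁ t₂

/-- The measure `dσ dt` on the lateral boundary `Σ = Γ × (t₁, t₂)`. -/
def lateralMeasure {n : ℕ} (Ω : Set (E n)) (t₁ t₂ : ℝ) : Measure (E n × ℝ) :=
  (surfaceMeasure Ω).prod (volume.restrict (Ioo t₁ t₂))

/-- The measure `dx δ_t` on `Ω × {t₁, t₂}`. -/
def endMeasure {n : ℕ} (Ω : Set (E n)) (t₁ t₂ : ℝ) : Measure (E n × ℝ) :=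
  ((volume : Measure (E n)).restrict Ω).prod (dirac t₁ + dirac t₂)

/-- The measure on the boundary of `Q`. -/
def boundaryMeasure {n : ℕ} (Ω : Set (E n)) (t₁ t₂ : ℝ) : Measure (E n × ℝ) :=
  lateralMeasure Ω t₁ t₂ + endMeasure Ω t₁ t₂

/-- The `i`-th spatial unit vector of `ℝⁿ × ℝ`. -/
def dirX {n : ℕ} (i : Fin n) : E n × ℝ := (EuclideanSpace.single i 1, 0)

/-- The time unit vector of `ℝⁿ × ℝ`. -/
def dirT {n : ℕ} : E n × ℝ := (0, 1)

/-! ### Coefficients, pseudo-convexity and Carleman weights -/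

/-- The classical partial derivative `∂ᵢ h`, on `closure Ω`. -/
def pd {n : ℕ} (Ω : Set (E n)) (i : Fin n) (h : E n → ℝ) (x : E n) : ℝ :=
  fderivWithin ℝ h (closure Ω) x (EuclideanSpace.single i 1)

/-- `a ∈ C^{2,1}(closure Ω)` with norm at most `m`. -/
structure C21Bound {n : ℕ} (Ω : Set (E n)) (m : ℝ) (a : E n → ℝ) : Prop where
  contDiffOn : ContDiffOn ℝ 2 a (closure Ω)
  bound : ∀ j : ℕ, j ≤ 2 → ∀ x ∈ closure Ω, ‖iteratedFDerivWithin ℝ j a (closure Ω) x‖ ≤ m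
  lipschitz : ∀ x ∈ closure Ω, ∀ y ∈ closure Ω,
    ‖iteratedFDerivWithin ℝ 2 a (closure Ω) x - iteratedFDerivWithin ℝ 2 a (closure Ω) y‖
      ≤ m * ‖x - y‖

/-- The class `𝓜(Ω, ϰ, m)` of symmetric uniformly elliptic matrices with `C^{2,1}` coefficients. -/
structure IsAdmissible {n : ℕ} (Ω : Set (E n)) (ϰ m : ℝ) (A : E n → Matrix (Fin n) (Fin n) ℝ) :
    Prop where
  symm : ∀ x ∈ closure Ω, (A x).IsSymm
  regular : ∀ k l, C21Bound Ω m (fun x => A x k l)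
  elliptic : ∀ x ∈ Ω, ∀ ξ : E n,
    ϰ⁻¹ * ‖ξ‖ ^ 2 ≤ ∑ k, ∑ l, A x k l * ξ l * ξ k ∧
    ∑ k, ∑ l, A x k l * ξ l * ξ k ≤ ϰ * ‖ξ‖ ^ 2

/-- `Λ_{kl}^m(A)`. -/
def Lam {n : ℕ} (Ω : Set (E n)) (A : E n → Matrix (Fin n) (Fin n) ℝ) (k l m : Fin n) (x : E n) :
    ℝ :=
  - ∑ p, pd Ω p (fun y => A y k l) x * A x p m
    + 2 * ∑ p, A x k p * pd Ω p (fun y => A y l m) x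

/-- The matrix `Υ_A(h)`. -/
def Ups {n : ℕ} (Ω : Set (E n)) (A : E n → Matrix (Fin n) (Fin n) ℝ) (h : E n → ℝ) (x : E n) :
    Matrix (Fin n) (Fin n) ℝ :=
  Matrix.of fun k l => ∑ m, Lam Ω A k l m x * pd Ω m h x

/-- The Hessian matrix `∇²h`. -/
def hess {n : ℕ} (Ω : Set (E n)) (h : E n → ℝ) (x : E n) : Matrix (Fin n) (Fin n) ℝ :=
  Matrix.of fun k l => pd Ω k (pd Ω l h) x

/-- The matrix `Θ_A(h) = 2 A ∇²h A + Υ_A(h)`. -/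
def Theta {n : ℕ} (Ω : Set (E n)) (A : E n → Matrix (Fin n) (Fin n) ℝ) (h : E n → ℝ) (x : E n) :
    Matrix (Fin n) (Fin n) ℝ :=
  (2 : ℝ) • (A x * hess Ω h x * A x) + Ups Ω A h x

/-- `h` is `A`-pseudo-convex with constant `κ > 0` in `Ω`. -/
structure IsPseudoConvex {n : ℕ} (Ω : Set (E n)) (A : E n → Matrix (Fin n) (Fin n) ℝ) (κ : ℝ)
    (h : E n → ℝ) : Prop where
  pos : 0 < κ
  contDiffOn : ContDiffOn ℝ 2 h (closure Ω)
  grad_ne_zero : ∀ x ∈ closure Ω, ∃ i, pd Ω i h x ≠ 0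
  convex : ∀ x ∈ closure Ω, ∀ ξ : E n,
    κ * ‖ξ‖ ^ 2 ≤ ∑ k, ∑ l, Theta Ω A h x k l * ξ l * ξ k

/-- `ψ(x,t) = ψ₀(x) + ψ₁(t)`. -/
def psi {n : ℕ} (ψ₀ : E n → ℝ) (ψ₁ : ℝ → ℝ) (z : E n × ℝ) : ℝ := ψ₀ z.1 + ψ₁ z.2

/-- `φ = exp (l ψ)`, where `l` is the parameter usually called lambda. -/
def phi {n : ℕ} (ψ₀ : E n → ℝ) (ψ₁ : ℝ → ℝ) (l : ℝ) (z : E n × ℝ) : ℝ :=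
  Real.exp (l * psi ψ₀ ψ₁ z)

/-- `[|∇ψ₀|_A² - (∂ₜψ₁)²]²` on the closure of `Q`. -/
def chiSq {n : ℕ} (Ω : Set (E n)) (t₁ t₂ : ℝ) (A : E n → Matrix (Fin n) (Fin n) ℝ)
    (ψ₀ : E n → ℝ) (ψ₁ : ℝ → ℝ) (z : E n × ℝ) : ℝ :=
  ((∑ k, ∑ l, A z.1 k l * pd Ω l ψ₀ z.1 * pd Ω k ψ₀ z.1)
    - (derivWithin ψ₁ (Icc t₁ t₂) z.2) ^ 2) ^ 2

/-- `φ = exp (l (ψ₀ + ψ₁))` is a weight function for the wave operator, with pseudo-convexity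
constant `κ`. -/
structure IsWaveWeight {n : ℕ} (Ω : Set (E n)) (t₁ t₂ : ℝ) (A : E n → Matrix (Fin n) (Fin n) ℝ)
    (ϰ κ : ℝ) (ψ₀ : E n → ℝ) (ψ₁ : ℝ → ℝ) : Prop where
  contDiffOn : ContDiffOn ℝ 4 (psi ψ₀ ψ₁) (closure (cyl Ω t₁ t₂))
  nonneg : ∀ z ∈ closure (cyl Ω t₁ t₂), 0 ≤ psi ψ₀ ψ₁ z
  pseudoConvex : IsPseudoConvex Ω A κ ψ₀
  nonchar : ∀ z ∈ closure (cyl Ω t₁ t₂), 0 < chiSq Ω t₁ t₂ A ψ₀ ψ₁ z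
  small : ∀ t ∈ Icc t₁ t₂, |iteratedDerivWithin 2 ψ₁ (Icc t₁ t₂) t| ≤ ϰ⁻¹ * κ / 4

/-- `‖ψ‖_{C⁴(closure Q)} ≤ b`. -/
def C4Bound {n : ℕ} (Ω : Set (E n)) (t₁ t₂ b : ℝ) (ψ : E n × ℝ → ℝ) : Prop :=
  ∀ j : ℕ, j ≤ 4 → ∀ z ∈ closure (cyl Ω t₁ t₂),
    ‖iteratedFDerivWithin ℝ j ψ (closure (cyl Ω t₁ t₂)) z‖ ≤ b

/-- `∂_{ν_A} ψ₀ = (∇ψ₀ | ν)_A` on the boundary of `Ω`. -/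
def conormal {n : ℕ} (Ω : Set (E n)) (A : E n → Matrix (Fin n) (Fin n) ℝ) (ψ₀ : E n → ℝ)
    (x : E n) : ℝ :=
  ∑ k, ∑ l, A x k l * pd Ω l ψ₀ x * outerNormal Ω x k

/-- `Σ₊ = Γ₊ × (t₁, t₂)`, with `Γ₊ = {x ∈ Γ | ∂_{ν_A} ψ₀ (x) > 0}`. -/
def sigmaPlus {n : ℕ} (Ω : Set (E n)) (t₁ t₂ : ℝ) (A : E n → Matrix (Fin n) (Fin n) ℝ)
    (ψ₀ : E n → ℝ) : Set (E n × ℝ) :=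
  {x | x ∈ frontier Ω ∧ 0 < conormal Ω A ψ₀ x} ×ˢ Ioo t₁ t₂

/-! ### Wave operators and boundary conditions -/

section Operators

variable {𝕜 : Type*} [RCLike 𝕜]

/-- `∂ᵢ u` on `Q`. -/
def dx {n : ℕ} (Ω : Set (E n)) (t₁ t₂ : ℝ) (i : Fin n) (u : E n × ℝ → 𝕜) : E n × ℝ → 𝕜 :=
  weakDeriv (cyl Ω t₁ t₂) (dirX i) u

/-- `∂ₜ u` on `Q`. -/
def dt {n : ℕ} (Ω : Set (E n)) (t₁ t₂ : ℝ) (u : E n × ℝ → 𝕜) : E n × ℝ → 𝕜 :=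
  weakDeriv (cyl Ω t₁ t₂) dirT u

/-- `𝓛_{A,0} u = div (A ∇u) - ∂ₜ² u`. -/
def waveOp₀ {n : ℕ} (Ω : Set (E n)) (t₁ t₂ : ℝ) (A : E n → Matrix (Fin n) (Fin n) ℝ)
    (u : E n × ℝ → 𝕜) (z : E n × ℝ) : 𝕜 :=
  (∑ k, dx Ω t₁ t₂ k (fun w => ∑ l, (A w.1 k l : 𝕜) * dx Ω t₁ t₂ l u w) z)
    - dt Ω t₁ t₂ (dt Ω t₁ t₂ u) z

/-- `𝓛_A u = 𝓛_{A,0} u + q₀ ∂ₜu + ∑ⱼ qⱼ ∂ⱼu + p u`. -/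
def waveOp {n : ℕ} (Ω : Set (E n)) (t₁ t₂ : ℝ) (A : E n → Matrix (Fin n) (Fin n) ℝ)
    (q₀ : E n × ℝ → 𝕜) (q : Fin n → E n × ℝ → 𝕜) (p : E n × ℝ → 𝕜)
    (u : E n × ℝ → 𝕜) (z : E n × ℝ) : 𝕜 :=
  waveOp₀ Ω t₁ t₂ A u z + q₀ z * dt Ω t₁ t₂ u z + (∑ j, q j z * dx Ω t₁ t₂ j u z) + p z * u z

/-- `f ∈ L^∞(Q)` with norm at most `m`. -/
def LinftyBound {n : ℕ} (Ω : Set (E n)) (t₁ t₂ m : ℝ) (f : E n × ℝ → 𝕜) : Prop :=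
  AEStronglyMeasurable f (volume.restrict (cyl Ω t₁ t₂)) ∧
    eLpNorm f ⊤ (volume.restrict (cyl Ω t₁ t₂)) ≤ ENNReal.ofReal m

/-- `|𝐃_A u|² = |∇_A u|² + |∂ₜu|²`, where `|∇_A u|² = (A ∇u | ∇u)`. -/
def energy {n : ℕ} (Ω : Set (E n)) (t₁ t₂ : ℝ) (A : E n → Matrix (Fin n) (Fin n) ℝ)
    (u : E n × ℝ → 𝕜) (z : E n × ℝ) : ℝ :=
  RCLike.re (∑ k, ∑ l, (A z.1 k l : 𝕜) * dx Ω t₁ t₂ l u z * star (dx Ω t₁ t₂ k u z))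
    + ‖dt Ω t₁ t₂ u z‖ ^ 2

/-- The trace on the boundary of `Q`. -/
def bdTrace {n : ℕ} (Ω : Set (E n)) (t₁ t₂ : ℝ) (u : E n × ℝ → 𝕜) : E n × ℝ → 𝕜 :=
  trace (cyl Ω t₁ t₂) (boundaryMeasure Ω t₁ t₂) u

/-- The normal derivative `∂_ν u = (∇u | ν)` on the lateral boundary. -/
def normalDeriv {n : ℕ} (Ω : Set (E n)) (t₁ t₂ : ℝ) (u : E n × ℝ → 𝕜) (z : E n × ℝ) : 𝕜 :=
  ∑ i, (outerNormal Ω z.1 i : 𝕜) * bdTrace Ω t₁ t₂ (dx Ω t₁ t₂ i u) z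

/-- `u ∈ H²(Q)`, `u = 0` on `Σ`, and `u = ∂ₜu = 0` on `Ω × {t₁, t₂}`. -/
structure IsAdmissibleFun {n : ℕ} (Ω : Set (E n)) (t₁ t₂ : ℝ) (u : E n × ℝ → 𝕜) : Prop where
  memH2 : MemH2 (cyl Ω t₁ t₂) u
  lateral : ∀ᵐ z ∂(lateralMeasure Ω t₁ t₂), bdTrace Ω t₁ t₂ u z = 0
  ends : ∀ᵐ z ∂(endMeasure Ω t₁ t₂),
    bdTrace Ω t₁ t₂ u z = 0 ∧ bdTrace Ω t₁ t₂ (dt Ω t₁ t₂ u) z = 0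

end Operators

end WaveCarleman

end

open WaveCarleman

noncomputable section

namespace WaveCarleman

/-! ### Partitions of unity and convergence in `L²` -/

/-! The wave operator is `P = div (b ∇ ·)` in the variables `(x, t)`, with `b` the indefinite block
matrix with blocks `A` and `-1`, and the core argument works for a general symmetric `b`. Put `v =
exp(τφ) w`, `X = b∇φ`, `a = (b∇φ|∇φ)`. Conjugation gives `exp(τφ) P w = div(b∇v) + τ² a v - 2τ X·∇v
- τ (div X) v`. Fix a constant `s`, let `𝒜` be the first two terms and `ℬ` the last two with `div X`
replaced by `div X - sλφ`, so that `𝒜 + ℬ` differs from the conjugated operator by `τsλφv`. The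
pointwise identity `Jet.identity` writes the product `𝒜ℬ` as `-τ` times the divergence of a flux,
plus `τλφ (Θ(∇v) - s (b∇v|∇v))`, a nonnegative square, a zero-order term with leading part
`2τ³λ⁴φ³β²v²`, and lower-order terms. Here `β = (b∇ψ|∇ψ) = |∇ψ₀|_A² - (∂ₜψ₁)²`.

Pseudo-convexity makes `Θ` coercive in the space directions only. Subtracting `s` times the
indefinite form `(b∇v|∇v)` transfers part of that coercivity to the time direction, and the
smallness of `∂ₜ²ψ₁` allows the choice `s = 3κ/(4ϰ)` (`isCarlemanData_wave`). The zero-order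
coercivity comes from `β² ≥ δ`. All remaining terms are absorbed for large `λ` (`Jet.absorption`),
and `4𝒜ℬ ≤ (𝒜 + ℬ)²` brings back the operator (`Jet.carleman`).

The inequality is integrated with the Gauss-Green formula. On the boundary `v = 0` and `∇v` is
parallel to the normal `N`, so the normal flux reduces to `exp(2τφ) λφ (bN|N)(b∇ψ|N)(∂_ν u)²`
(`tendsto_flux`). It vanishes on the ends; on the lateral side `(bN|N) = (Aν|ν) ≥ 0`, hence only the
part where `∂_{ν_A} ψ₀ > 0` can contribute (`lintegral_boundary_le`).

For `u ∈ H²` on a Lipschitz cylinder the analysis rests on a cone condition. Shifting into the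
domain and mollifying makes smooth functions dense in `H²` (`exists_smooth_approx`). Graph charts
yield a boundary measure, comparable to the surface measure, with an exact Gauss-Green formula
(`exists_gaussGreenMeasure`); comparability suffices because the constants may depend on `Ω`. A
transversal vector field bounds traces, and Stokes' formula shows that tangential derivatives of a
function with zero trace vanish (`IsAdmissibleFun.exists_approx`).

For part (b), the real estimate is added over real and imaginary parts, and the first- and
zero-order terms are absorbed by taking `τ` large. -/

theorem exists_smooth_partition {V : Type*} [NormedAddCommGroup V] [NormedSpace ℝ V]
    [FiniteDimensional ℝ V] {K : Set V} (hK : IsCompact K) (r : V → ℝ)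
    (hr : ∀ x ∈ K, 0 < r x) :
    ∃ (t : Finset V) (χ : V → V → ℝ), (∀ x ∈ t, x ∈ K) ∧ (∀ x, ContDiff ℝ ∞ (χ x)) ∧
      (∀ x ∈ t, HasCompactSupport (χ x)) ∧ (∀ x ∈ t, tsupport (χ x) ⊆ Metric.ball x (r x)) ∧
      (∀ x y, 0 ≤ χ x y) ∧ (∀ y ∈ K, ∑ x ∈ t, χ x y = 1) := by
  classical
  have : ProperSpace V := FiniteDimensional.proper_rclike ℝ V
  obtain ⟨t, htK, htc⟩ := hK.elim_nhds_subcover (fun x => Metric.ball x (r x))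
    (fun x hx => Metric.ball_mem_nhds x (hr x hx))
  obtain ⟨f, hf⟩ := SmoothPartitionOfUnity.exists_isSubordinate (modelWithCornersSelf ℝ V)
    hK.isClosed (fun x : t => Metric.ball (x : V) (r x)) (fun _ => Metric.isOpen_ball)
    (by intro y hy; obtain ⟨x, hx, hxy⟩ := mem_iUnion₂.1 (htc hy)
        exact mem_iUnion.2 ⟨⟨x, hx⟩, hxy⟩)
  refine ⟨t, fun x => if h : x ∈ t then f ⟨x, h⟩ else 0, htK, ?_, ?_, ?_, ?_, ?_⟩
  · intro x
    by_cases h : x ∈ t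
    · simp only [h, dif_pos]
      exact (f ⟨x, h⟩).contMDiff.contDiff
    · simp only [h, dif_neg, not_false_eq_true]; exact contDiff_const
  · intro x h
    simp only [h, dif_pos]
    exact HasCompactSupport.of_support_subset_isCompact (isCompact_closedBall x (r x))
      ((subset_tsupport _).trans ((hf ⟨x, h⟩).trans Metric.ball_subset_closedBall))
  · intro x h
    simp only [h, dif_pos]
    exact hf ⟨x, h⟩
  · intro x y
    by_cases h : x ∈ t
    · simp only [h, dif_pos]; exact f.nonneg _ _
    · simp [h]
  · intro y hy
    have := f.sum_eq_one hy
    rw [finsum_eq_sum_of_fintype] at this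
    rw [← this, ← Finset.sum_coe_sort t]
    exact Finset.sum_congr rfl fun x _ => by simp

/-! ### Calculus of strong `L²` convergence. -/

section L2

variable {α : Type*} [MeasurableSpace α] {μ : Measure α}

/-- `f j → g` in `L²(μ)`. -/
def TendstoL2 {F : Type*} [NormedAddCommGroup F] (μ : Measure α) (f : ℕ → α → F) (g : α → F) :
    Prop :=
  (∀ j, MemLp (f j) 2 μ) ∧ MemLp g 2 μ ∧
    Tendsto (fun j => eLpNorm (f j - g) 2 μ) atTop (𝓝 0)

variable {f f' : ℕ → α → ℝ} {g g' : α → ℝ}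

theorem TendstoL2.congr (h : TendstoL2 μ f g) (hf : ∀ j, f j =ᵐ[μ] f' j) (hg : g =ᵐ[μ] g') :
    TendstoL2 μ f' g' := by
  refine ⟨fun j => (memLp_congr_ae (hf j)).1 (h.1 j), (memLp_congr_ae hg).1 h.2.1, ?_⟩
  refine h.2.2.congr fun j => eLpNorm_congr_ae ((hf j).sub hg)

theorem TendstoL2.toLp (h : TendstoL2 μ f g) :
    Tendsto (fun j => (h.1 j).toLp (f j)) atTop (𝓝 (h.2.1.toLp g)) := by
  rw [tendsto_iff_norm_sub_tendsto_zero]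
  have := (ENNReal.tendsto_toReal ENNReal.zero_ne_top).comp h.2.2
  refine this.congr fun j => ?_
  rw [← MemLp.toLp_sub, Lp.norm_toLp]; rfl

/-- Continuity of the `L²` inner product. Every integral of the Carleman estimate is quadratic in
the function and its derivatives, so this is the tool by which identities for smooth functions pass
to the limit. -/
theorem TendstoL2.integral_mul (h : TendstoL2 μ f g) (h' : TendstoL2 μ f' g') :
    Tendsto (fun j => ∫ z, f j z * f' j z ∂μ) atTop (𝓝 (∫ z, g z * g' z ∂μ)) := by
  have key : ∀ (a b : α → ℝ) (ha : MemLp a 2 μ) (hb : MemLp b 2 μ),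
      ∫ z, a z * b z ∂μ = inner ℝ (hb.toLp b) (ha.toLp a) := by
    intro a b ha hb
    rw [L2.inner_def]
    refine integral_congr_ae ?_
    filter_upwards [ha.coeFn_toLp, hb.coeFn_toLp] with z h1 h2
    rw [h1, h2]; simp
  rw [key g g' h.2.1 h'.2.1]
  exact (h'.toLp.inner h.toLp).congr fun j => (key _ _ _ _).symm

theorem TendstoL2.add (h : TendstoL2 μ f g) (h' : TendstoL2 μ f' g') :
    TendstoL2 μ (fun j z => f j z + f' j z) (fun z => g z + g' z) := by
  refine ⟨fun j => (h.1 j).add (h'.1 j), h.2.1.add h'.2.1, ?_⟩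
  have h0 := h.2.2.add h'.2.2
  rw [add_zero] at h0
  refine tendsto_of_tendsto_of_tendsto_of_le_of_le tendsto_const_nhds h0 (fun _ => zero_le)
    fun j => ?_
  have : ((fun z => f j z + f' j z) - fun z => g z + g' z) = (f j - g) + (f' j - g') := by
    ext z; simp; ring
  rw [this]
  exact eLpNorm_add_le ((h.1 j).sub h.2.1).1 ((h'.1 j).sub h'.2.1).1 (by norm_num)

theorem TendstoL2.zero : TendstoL2 μ (fun _ _ => (0 : ℝ)) (fun _ => 0) := by
  refine ⟨fun j => MemLp.zero', MemLp.zero', ?_⟩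
  refine tendsto_const_nhds.congr fun j => ?_
  rw [sub_self, eLpNorm_zero]

theorem TendstoL2.sum {ι : Type*} (t : Finset ι) {f : ι → ℕ → α → ℝ} {g : ι → α → ℝ}
    (h : ∀ i ∈ t, TendstoL2 μ (f i) (g i)) :
    TendstoL2 μ (fun j z => ∑ i ∈ t, f i j z) (fun z => ∑ i ∈ t, g i z) := by
  classical
  induction t using Finset.induction_on with
  | empty => simpa using TendstoL2.zero
  | insert a t ha ih =>
    simp only [Finset.sum_insert ha]
    exact (h a (by simp)).add (ih fun i hi => h i (by simp [hi]))

theorem memLp_bdd_mul {c g : α → ℝ} (hc : AEStronglyMeasurable c μ) {C : ℝ}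
    (hC : ∀ᵐ z ∂μ, |c z| ≤ C) (hg : MemLp g 2 μ) : MemLp (fun z => c z * g z) 2 μ :=
  MemLp.of_le_mul hg (hc.mul hg.1) (c := C) (by
    filter_upwards [hC] with z hz
    rw [norm_mul]; exact mul_le_mul_of_nonneg_right hz (norm_nonneg _))

theorem TendstoL2.bdd_mul (h : TendstoL2 μ f g) {c : α → ℝ} (hc : AEStronglyMeasurable c μ)
    {C : ℝ} (hC : ∀ᵐ z ∂μ, |c z| ≤ C) :
    TendstoL2 μ (fun j z => c z * f j z) (fun z => c z * g z) := by
  refine ⟨fun j => memLp_bdd_mul hc hC (h.1 j), memLp_bdd_mul hc hC h.2.1, ?_⟩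
  have h0 := ENNReal.Tendsto.const_mul (a := ENNReal.ofReal C) h.2.2
    (Or.inr ENNReal.ofReal_ne_top)
  rw [mul_zero] at h0
  refine tendsto_of_tendsto_of_tendsto_of_le_of_le tendsto_const_nhds h0 (fun _ => zero_le)
    fun j => ?_
  refine eLpNorm_le_mul_eLpNorm_of_ae_le_mul ?_ 2
  filter_upwards [hC] with z hz
  have : ((fun z => c z * f j z) - fun z => c z * g z) z = c z * (f j - g) z := by
    simp; ring
  rw [this, norm_mul]; exact mul_le_mul_of_nonneg_right hz (norm_nonneg _)

/-- Domination up to a constant is enough to transfer convergence. It is used between the surface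
measure and the Gauss-Green measure, which are comparable but are never identified. -/
theorem TendstoL2.mono_measure {ν : Measure α} (h : TendstoL2 μ f g) {c : ENNReal} (hc : c ≠ ⊤)
    (hν : ν ≤ c • μ) : TendstoL2 ν f g := by
  have hcμ : ∀ {w : α → ℝ}, MemLp w 2 μ → MemLp w 2 ν := fun hw =>
    (hw.smul_measure hc).mono_measure hν
  refine ⟨fun j => hcμ (h.1 j), hcμ h.2.1, ?_⟩
  have h0 := ENNReal.Tendsto.const_mul (a := c ^ ((1 : ENNReal) / 2).toReal) h.2.2
    (Or.inr (ENNReal.rpow_ne_top_of_nonneg (by positivity) hc))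
  rw [mul_zero] at h0
  refine tendsto_of_tendsto_of_tendsto_of_le_of_le tendsto_const_nhds h0 (fun _ => zero_le)
    fun j => ?_
  refine (eLpNorm_mono_measure _ hν).trans ?_
  rw [eLpNorm_smul_measure_of_ne_top (by norm_num), smul_eq_mul]

theorem TendstoL2.ae_unique (h : TendstoL2 μ f g) (h' : TendstoL2 μ f g') : g =ᵐ[μ] g' := by
  have := tendsto_nhds_unique h.toLp h'.toLp
  exact (MemLp.toLp_eq_toLp_iff _ _).1 this

/-- A Cauchy sequence in `L²` converges. -/
theorem exists_tendstoL2 (hf : ∀ j, MemLp (f j) 2 μ)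
    (h : Tendsto (fun p : ℕ × ℕ => eLpNorm (f p.1 - f p.2) 2 μ) atTop (𝓝 0)) :
    ∃ g, TendstoL2 μ f g := by
  have hc : CauchySeq fun j => (hf j).toLp (f j) := by
    rw [cauchySeq_iff_tendsto_dist_atTop_0]
    refine ((ENNReal.tendsto_toReal ENNReal.zero_ne_top).comp h).congr fun p => ?_
    rw [dist_eq_norm, ← MemLp.toLp_sub, Lp.norm_toLp]; rfl
  obtain ⟨G, hG⟩ := cauchySeq_tendsto_of_complete hc
  refine ⟨G, hf, Lp.memLp G, ?_⟩
  rw [tendsto_iff_norm_sub_tendsto_zero] at hG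
  have h2 : ∀ j, eLpNorm (f j - (G : α → ℝ)) 2 μ = ENNReal.ofReal ‖(hf j).toLp (f j) - G‖ := by
    intro j
    rw [Lp.norm_def, ENNReal.ofReal_toReal (Lp.eLpNorm_ne_top _)]
    refine eLpNorm_congr_ae ?_
    filter_upwards [Lp.coeFn_sub ((hf j).toLp (f j)) G, (hf j).coeFn_toLp] with z h1 h2
    rw [h1, Pi.sub_apply, Pi.sub_apply, h2]
  simp_rw [h2]
  simpa using ENNReal.tendsto_ofReal hG

end L2

/-! ### Translations and mollification -/

section Mollify

variable {V : Type*} [NormedAddCommGroup V] [NormedSpace ℝ V] [FiniteDimensional ℝ V]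
  [MeasureSpace V] [BorelSpace V] [IsAddHaarMeasure (volume : Measure V)]

/-- Continuity of the translation action on `L²`, rewritten in terms of representatives. -/
theorem tendsto_eLpNorm_translate {f : V → ℝ} (hf : MemLp f 2 volume) :
    Tendsto (fun h : V => eLpNorm (fun z => f (h + z) - f z) 2 volume) (𝓝 0) (𝓝 0) := by
  have : ProperSpace V := FiniteDimensional.proper_rclike ℝ V
  haveI : Fact ((2 : ENNReal) ≠ ⊤) := ⟨by norm_num⟩
  have hc : Continuous fun h : V => DomAddAct.mk h +ᵥ hf.toLp f :=
    (DomAddAct.continuous_mk).vadd continuous_const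
  have h0 := (hc.tendsto 0)
  rw [tendsto_iff_norm_sub_tendsto_zero] at h0
  have h1 := ENNReal.tendsto_ofReal h0
  rw [ENNReal.ofReal_zero] at h1
  refine h1.congr fun h => ?_
  have hT : ∀ h : V, MemLp (fun z => f (h +ᵥ z)) 2 volume := fun h =>
    hf.comp_measurePreserving (measurePreserving_vadd h volume)
  rw [DomAddAct.mk_vadd_toLp, DomAddAct.mk_vadd_toLp, ← MemLp.toLp_sub (hT h) (hT 0), Lp.norm_toLp,
    ENNReal.ofReal_toReal ((hT h).sub (hT 0)).2.ne]
  refine eLpNorm_congr_ae (Eventually.of_forall fun z => ?_)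
  simp

/-- The mollification of `f` by the kernel `ρ` after a translation by `a`. -/
def mollify (ρ : V → ℝ) (a : V) (f : V → ℝ) (z : V) : ℝ := ∫ y, f y * ρ (z + a - y)

theorem mollify_congr {ρ : V → ℝ} {a : V} {f g : V → ℝ} (h : f =ᵐ[volume] g) :
    mollify ρ a f = mollify ρ a g := by
  ext z
  exact integral_congr_ae (h.mono fun y hy => by simp only [hy])

theorem mollify_eq_convolution (ρ : V → ℝ) (a : V) (f : V → ℝ) :
    mollify ρ a f = fun z =>
      (convolution f ρ (ContinuousLinearMap.mul ℝ ℝ) volume) (z + a) := rfl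

theorem contDiff_mollify {ρ : V → ℝ} (hρ : ContDiff ℝ ∞ ρ) (hc : HasCompactSupport ρ) (a : V)
    {f : V → ℝ} (hf : LocallyIntegrable f volume) : ContDiff ℝ ∞ (mollify ρ a f) := by
  rw [mollify_eq_convolution]
  exact (hc.contDiff_convolution_right (n := ⊤) _ hf hρ).comp (contDiff_id.add contDiff_const)

theorem fderiv_mollify {ρ : V → ℝ} (hρ : ContDiff ℝ ∞ ρ) (hc : HasCompactSupport ρ) (a : V)
    {f : V → ℝ} (hf : LocallyIntegrable f volume) (z e : V) :
    fderiv ℝ (mollify ρ a f) z e = ∫ y, f y * fderiv ℝ ρ (z + a - y) e := by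
  have h1 := hc.hasFDerivAt_convolution_right (ContinuousLinearMap.mul ℝ ℝ) (μ := volume) hf
    (hρ.of_le (by exact_mod_cast le_top)) (z + a)
  have h2 := h1.comp (f := fun z => z + a) z ((hasFDerivAt_id z).add_const a)
  change fderiv ℝ (convolution f ρ (ContinuousLinearMap.mul ℝ ℝ) volume ∘ fun z => z + a) z e = _
  rw [h2.fderiv]
  simp only [ContinuousLinearMap.comp_id]
  rw [convolution_def, ContinuousLinearMap.integral_apply]
  · simp [ContinuousLinearMap.precompR]
  · exact (hc.fderiv ℝ).convolutionExists_right
      ((ContinuousLinearMap.mul ℝ ℝ).precompR V) hf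
      (hρ.continuous_fderiv (by simp)) (z + a)

/-- The difference is the average, under the probability measure `ρ dy`, of the translation errors
`f((a - y) + z) - f z`. Jensen's inequality in `y` followed by Tonelli bounds its norm by the worst
translation error over the support of `ρ`. -/
theorem eLpNorm_mollify_sub_le {ρ : V → ℝ} (hρ : Continuous ρ) (hc : HasCompactSupport ρ)
    (h0 : ∀ y, 0 ≤ ρ y) (h1 : ∫ y, ρ y = 1) (a : V) {f : V → ℝ} (hf : MemLp f 2 volume)
    {ε : ENNReal}
    (hε : ∀ y, ρ y ≠ 0 → eLpNorm (fun z => f ((a - y) + z) - f z) 2 volume ≤ ε) :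
    eLpNorm (mollify ρ a f - f) 2 volume ≤ ε := by
  -- An everywhere measurable representative is needed so that the translation error is jointly
  -- measurable in `(z, y)`.
  wlog hfm : StronglyMeasurable f generalizing f
  · have hg := hf.1.stronglyMeasurable_mk
    have hfg := hf.1.ae_eq_mk
    rw [mollify_congr hfg, eLpNorm_congr_ae (EventuallyEq.rfl.sub hfg)]
    refine this ((memLp_congr_ae hfg).1 hf) (fun y hy => ?_) hg
    refine le_trans (le_of_eq (eLpNorm_congr_ae ?_)) (hε y hy)
    have h2 : (fun z => f ((a - y) + z)) =ᵐ[volume] fun z => hf.1.mk f ((a - y) + z) :=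
      (measurePreserving_add_left volume (a - y)).quasiMeasurePreserving.ae_eq_comp hfg
    filter_upwards [h2, hfg] with z hz hz'
    rw [hz, hz']
  set P : Measure V := volume.withDensity fun y => ENNReal.ofReal (ρ y) with hP
  have hρi : Integrable ρ volume := hρ.integrable_of_hasCompactSupport hc
  have hρm : Measurable fun y => ENNReal.ofReal (ρ y) := hρ.measurable.ennreal_ofReal
  haveI : IsProbabilityMeasure P := by
    constructor
    rw [hP, withDensity_apply _ MeasurableSet.univ, Measure.restrict_univ,
      ← ofReal_integral_eq_lintegral_ofReal hρi (Eventually.of_forall h0), h1, ENNReal.ofReal_one]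
  set G : V → V → ℝ := fun z y => f ((a - y) + z) - f z with hG
  have hGm : Measurable fun p : V × V => G p.1 p.2 := by
    refine Measurable.sub (hfm.measurable.comp ?_) (hfm.measurable.comp measurable_fst)
    fun_prop
  have hloc : LocallyIntegrable f volume := hf.locallyIntegrable (by norm_num)
  have hconv : ∀ z, Integrable (fun y => ρ y * f (z + a - y)) volume := fun z => by
    have := (hc.convolutionExists_left (ContinuousLinearMap.mul ℝ ℝ) hρ hloc (z + a))
    simpa [ConvolutionExistsAt] using this
  have hint : ∀ z, (mollify ρ a f - f) z = ∫ y, ρ y * G z y := by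
    intro z
    have e1 : mollify ρ a f z = ∫ y, ρ y * f (z + a - y) := by
      unfold mollify
      rw [← integral_sub_left_eq_self (fun y => f y * ρ (z + a - y)) volume (z + a)]
      refine integral_congr_ae (Eventually.of_forall fun y => ?_)
      simp [mul_comm]
    have e2 : f z = ∫ y, ρ y * f z := by rw [integral_mul_const, h1, one_mul]
    rw [Pi.sub_apply, e1, e2, ← integral_sub (hconv z) (hρi.mul_const _)]
    refine integral_congr_ae (Eventually.of_forall fun y => ?_)
    simp only [hG]
    rw [show a - y + z = z + a - y by abel]; ring
  have hle : ∀ z, ‖(mollify ρ a f - f) z‖ₑ ^ (2 : ℝ) ≤ ∫⁻ y, ‖G z y‖ₑ ^ (2 : ℝ) ∂P := by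
    intro z
    have b1 : ‖(mollify ρ a f - f) z‖ₑ ≤ eLpNorm (G z) 1 P := by
      rw [hint z, eLpNorm_one_eq_lintegral_enorm, hP,
        lintegral_withDensity_eq_lintegral_mul (g := fun y => ‖G z y‖ₑ) _ hρm
          (hGm.comp measurable_prodMk_left).enorm]
      refine (enorm_integral_le_lintegral_enorm _).trans (lintegral_mono fun y => ?_)
      simp only [Pi.mul_apply, enorm_mul]
      rw [Real.enorm_of_nonneg (h0 y)]
    have b2 : eLpNorm (G z) 1 P ≤ eLpNorm (G z) 2 P :=
      eLpNorm_le_eLpNorm_of_exponent_le (by norm_num)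
        (hGm.comp measurable_prodMk_left).aestronglyMeasurable
    refine (ENNReal.rpow_le_rpow (b1.trans b2) (by norm_num)).trans (le_of_eq ?_)
    rw [eLpNorm_eq_lintegral_rpow_enorm_toReal (by norm_num) (by norm_num), ← ENNReal.rpow_mul]
    simp
  have hsq : ∫⁻ z, ‖(mollify ρ a f - f) z‖ₑ ^ (2 : ℝ) ≤ ε ^ (2 : ℝ) := by
    refine (lintegral_mono hle).trans ?_
    rw [lintegral_lintegral_swap (hGm.enorm.pow_const _).aemeasurable]
    have : ∀ᵐ y ∂P, ∫⁻ z, ‖G z y‖ₑ ^ (2 : ℝ) ≤ ε ^ (2 : ℝ) := by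
      rw [hP, ae_withDensity_iff hρm]
      refine Eventually.of_forall fun y hy => ?_
      have hy' : ρ y ≠ 0 := fun h => hy (by simp [h])
      have := ENNReal.rpow_le_rpow (hε y hy') (z := 2) (by norm_num)
      refine le_trans (le_of_eq ?_) this
      rw [eLpNorm_eq_lintegral_rpow_enorm_toReal (by norm_num) (by norm_num), ← ENNReal.rpow_mul]
      simp [hG]
    refine (lintegral_mono_ae this).trans ?_
    rw [lintegral_const, measure_univ, mul_one]
  rw [eLpNorm_eq_lintegral_rpow_enorm_toReal (by norm_num) (by norm_num)]
  refine (ENNReal.rpow_le_rpow hsq (by positivity)).trans (le_of_eq ?_)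
  rw [← ENNReal.rpow_mul]; simp

end Mollify

/-! ### Weak derivatives -/

section WeakDerivatives

variable {V : Type*} [NormedAddCommGroup V] [NormedSpace ℝ V] [FiniteDimensional ℝ V]
  [MeasureSpace V] [BorelSpace V] [IsAddHaarMeasure (volume : Measure V)]
variable {F : Type*} [NormedAddCommGroup F] [NormedSpace ℝ F] [CompleteSpace F]

theorem integrable_testFunction_smul {D : Set V} {g : V → F}
    (hg : MemLp g 2 (volume.restrict D)) {θ : V → ℝ} (hθ : Continuous θ)
    (hc : HasCompactSupport θ) : Integrable (fun z => θ z • g z) (volume.restrict D) :=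
  (hg.locallyIntegrable (by norm_num)).integrable_smul_left_of_hasCompactSupport hθ hc

theorem IsWeakDeriv.ae_eq {D : Set V} (hD : IsOpen D) {e : V} {f g g' : V → F}
    (hg : MemLp g 2 (volume.restrict D)) (hg' : MemLp g' 2 (volume.restrict D))
    (h : IsWeakDeriv D e f g) (h' : IsWeakDeriv D e f g') : g =ᵐ[volume.restrict D] g' := by
  have : ProperSpace V := FiniteDimensional.proper_rclike ℝ V
  have key := hD.ae_eq_zero_of_integral_contDiff_smul_eq_zero (μ := volume) (f := g - g')
    (locallyIntegrableOn_of_locallyIntegrable_restrict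
      ((hg.sub hg').locallyIntegrable (by norm_num))) (by
      intro θ hθ hc hs
      have h0 : ∫ x, θ x • (g - g') x = ∫ x in D, θ x • (g - g') x := by
        refine (setIntegral_eq_integral_of_forall_compl_eq_zero fun x hx => ?_).symm
        rw [image_eq_zero_of_notMem_tsupport (fun hxs => hx (hs hxs)), zero_smul]
      rw [h0]
      simp only [Pi.sub_apply, smul_sub]
      rw [integral_sub (integrable_testFunction_smul hg hθ.continuous hc)
        (integrable_testFunction_smul hg' hθ.continuous hc)]
      have e1 := h θ hθ hc hs
      have e2 := h' θ hθ hc hs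
      rw [e1] at e2
      rw [neg_inj.1 e2, sub_self])
  rw [Filter.EventuallyEq, ae_restrict_iff' hD.measurableSet]
  filter_upwards [key] with z hz hzD
  exact sub_eq_zero.1 (hz hzD)

theorem MemH1.weakDeriv_spec {D : Set V} {f : V → F} (h : MemH1 D f) (e : V) :
    MemLp (weakDeriv D e f) 2 (volume.restrict D) ∧ IsWeakDeriv D e f (weakDeriv D e f) := by
  have h' := h.2 e
  unfold weakDeriv
  rw [dif_pos h']
  exact h'.choose_spec

theorem weakDeriv_ae_eq {D : Set V} (hD : IsOpen D) {e : V} {f g : V → F}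
    (hg : MemLp g 2 (volume.restrict D)) (h : IsWeakDeriv D e f g) :
    weakDeriv D e f =ᵐ[volume.restrict D] g := by
  have h' : ∃ g : V → F, MemLp g 2 (volume.restrict D) ∧ IsWeakDeriv D e f g := ⟨g, hg, h⟩
  have hs : MemLp (weakDeriv D e f) 2 (volume.restrict D) ∧
      IsWeakDeriv D e f (weakDeriv D e f) := by
    unfold weakDeriv
    rw [dif_pos h']
    exact h'.choose_spec
  exact hs.2.ae_eq hD hs.1 hg h

theorem IsWeakDeriv.congr {D : Set V} {e : V} {f f' g g' : V → F}
    (h : IsWeakDeriv D e f g) (hf : f =ᵐ[volume.restrict D] f')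
    (hg : g =ᵐ[volume.restrict D] g') : IsWeakDeriv D e f' g' := by
  intro θ hθ hc hs
  have := h θ hθ hc hs
  rw [integral_congr_ae (g := fun z => fderiv ℝ θ z e • f' z) (hf.mono fun z hz => by simp only [hz]),
    integral_congr_ae (f := fun z => θ z • g z) (g := fun z => θ z • g' z) (hg.mono fun z hz => by simp only [hz])] at this
  exact this

/-! ### Smooth approximation up to the boundary -/

/-- Near `z`, the closure of `D` is moved into `D` by small translations in a fixed direction,
with room proportional to the size of the translation. -/
def ConeCond (D : Set V) (z : V) : Prop :=
  ∃ (e : V) (r c s₀ : ℝ), 0 < r ∧ 0 < c ∧ 0 < s₀ ∧ ∀ y ∈ closure D, dist y z < r →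
    ∀ s, 0 < s → s ≤ s₀ → Metric.ball (y + s • e) (c * s) ⊆ D

/-- The extension of `f` by zero has no weak derivative across the boundary of `D`. At a point whose
shifted ball lies in `D`, however, `y ↦ ρ (z + a - y)` is an admissible test function, and the
definition of the weak derivative moves the derivative from the kernel to `f`. -/
theorem fderiv_mollify_indicator {D : Set V} (hD : IsOpen D) {ρ : V → ℝ} (hρ : ContDiff ℝ ∞ ρ)
    (hc : HasCompactSupport ρ) {η : ℝ} (hη : tsupport ρ ⊆ Metric.closedBall 0 η) {a z : V}
    (hz : Metric.closedBall (z + a) η ⊆ D) {e : V} {f g : V → ℝ}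
    (hf : MemLp f 2 (volume.restrict D)) (h : IsWeakDeriv D e f g) :
    fderiv ℝ (mollify ρ a (D.indicator f)) z e = mollify ρ a (D.indicator g) z := by
  have : ProperSpace V := FiniteDimensional.proper_rclike ℝ V
  have hf' : MemLp (D.indicator f) 2 volume := (memLp_indicator_iff_restrict hD.measurableSet).2 hf
  rw [fderiv_mollify hρ hc a (hf'.locallyIntegrable (by norm_num))]
  set θ : V → ℝ := fun y => ρ (z + a - y) with hθ
  have hθs : ContDiff ℝ ∞ θ := hρ.comp (contDiff_const.sub contDiff_id)
  have hd : ∀ y, fderiv ℝ θ y e = - fderiv ℝ ρ (z + a - y) e := by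
    intro y
    have h1 := ((hρ.differentiable (by simp)) (z + a - y)).hasFDerivAt.comp (f := fun y => z + a - y)
      y ((hasFDerivAt_id y).const_sub (z + a))
    have h2 : fderiv ℝ θ y = _ := h1.fderiv
    rw [h2]; simp
  have hθt : tsupport θ ⊆ Metric.closedBall (z + a) η := by
    refine closure_minimal (fun y hy => ?_) Metric.isClosed_closedBall
    have := hη (subset_tsupport _ hy)
    rw [mem_closedBall_zero_iff] at this
    rw [Metric.mem_closedBall, dist_comm, dist_eq_norm]
    exact this
  have hθc : HasCompactSupport θ :=
    HasCompactSupport.of_support_subset_isCompact (isCompact_closedBall (z + a) η)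
      ((subset_tsupport _).trans hθt)
  have key := h θ hθs hθc (hθt.trans hz)
  unfold mollify
  have e1 : ∀ (k : V → ℝ) (w : V → ℝ), ∫ y, D.indicator k y * w y = ∫ y in D, k y * w y := by
    intro k w
    rw [← integral_indicator hD.measurableSet]
    refine integral_congr_ae (Eventually.of_forall fun y => ?_)
    by_cases hy : y ∈ D <;> simp [hy]
  rw [e1, e1]
  have e2 : ∫ y in D, f y * fderiv ℝ ρ (z + a - y) e = - ∫ y in D, fderiv ℝ θ y e • f y := by
    rw [← integral_neg]
    refine integral_congr_ae (Eventually.of_forall fun y => ?_)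
    simp only [hd, smul_eq_mul]; ring
  rw [e2, key, neg_neg]
  refine integral_congr_ae (Eventually.of_forall fun y => ?_)
  simp only [hθ, smul_eq_mul]; ring

/-- The kernel radius is kept proportional to the shift, at half the opening `c` of the cone, so
that the shifted kernel sees only points of the domain while both lengths tend to zero. -/
theorem exists_mollifiers (e : V) {c s₀ : ℝ} (hc : 0 < c) (hs₀ : 0 < s₀) :
    ∃ (ρ : ℕ → V → ℝ) (s : ℕ → ℝ), (∀ j, 0 < s j) ∧ (∀ j, s j ≤ s₀) ∧
      (∀ j, ContDiff ℝ ∞ (ρ j)) ∧ (∀ j, HasCompactSupport (ρ j)) ∧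
      (∀ j, tsupport (ρ j) ⊆ Metric.closedBall 0 (c * s j / 2)) ∧
      ∀ f : V → ℝ, MemLp f 2 volume →
        TendstoL2 volume (fun j => mollify (ρ j) (s j • e) f) f := by
  have : ProperSpace V := FiniteDimensional.proper_rclike ℝ V
  set s : ℕ → ℝ := fun j => s₀ / (j + 1) with hs
  have hspos : ∀ j, 0 < s j := fun j => by positivity
  have hs0 : Tendsto s atTop (𝓝 0) := by
    have := (tendsto_one_div_add_atTop_nhds_zero_nat (𝕜 := ℝ)).const_mul s₀
    rw [mul_zero] at this
    exact this.congr fun j => by simp [hs, div_eq_mul_inv]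
  let B : ∀ j, ContDiffBump (0 : V) := fun j =>
    ⟨c * s j / 4, c * s j / 2, by have := hspos j; positivity, by have := mul_pos hc (hspos j); linarith⟩
  refine ⟨fun j => (B j).normed volume, s, hspos, fun j => ?_, fun j => (B j).contDiff_normed,
    fun j => (B j).hasCompactSupport_normed, fun j => (B j).tsupport_normed_eq.le, fun f hf => ?_⟩
  · rw [hs]; exact div_le_self hs₀.le (by simp)
  · have hmain : Tendsto (fun j => eLpNorm (mollify ((B j).normed volume) (s j • e) f - f) 2 volume)
        atTop (𝓝 0) := by
      rw [ENNReal.tendsto_nhds_zero]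
      intro ε hε
      have h1 := (ENNReal.tendsto_nhds_zero.1 (tendsto_eLpNorm_translate hf)) ε hε
      obtain ⟨δ, hδ, hball⟩ := Metric.eventually_nhds_iff.1 h1
      have h2 : Tendsto (fun j => s j * (‖e‖ + c)) atTop (𝓝 0) := by
        simpa using hs0.mul_const (‖e‖ + c)
      filter_upwards [h2.eventually (gt_mem_nhds hδ)] with j hj
      refine eLpNorm_mollify_sub_le (B j).continuous_normed (B j).hasCompactSupport_normed
        (B j).nonneg_normed (B j).integral_normed _ hf fun y hy => hball ?_
      have hy' : y ∈ Metric.ball (0 : V) (c * s j / 2) := by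
        rw [← (B j).support_normed_eq (μ := volume)]; exact hy
      rw [mem_ball_zero_iff] at hy'
      rw [dist_zero_right]
      calc ‖s j • e - y‖ ≤ ‖s j • e‖ + ‖y‖ := norm_sub_le _ _
        _ ≤ s j * ‖e‖ + c * s j / 2 := by
          rw [norm_smul, Real.norm_of_nonneg (hspos j).le]; linarith
        _ ≤ s j * (‖e‖ + c) := by nlinarith [mul_pos hc (hspos j)]
        _ < δ := hj
    have hloc := hf.locallyIntegrable (μ := volume) (by norm_num)
    refine ⟨fun j => ?_, hf, hmain⟩
    have hcont : Continuous (mollify ((B j).normed volume) (s j • e) f) :=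
      (contDiff_mollify (B j).contDiff_normed (B j).hasCompactSupport_normed _ hloc).continuous
    -- The crude bound by twice the norm of `f` only serves to show that each mollification lies in
    -- `L²`.
    have hbd : eLpNorm (mollify ((B j).normed volume) (s j • e) f - f) 2 volume
        ≤ 2 * eLpNorm f 2 volume := by
      refine eLpNorm_mollify_sub_le (B j).continuous_normed (B j).hasCompactSupport_normed
        (B j).nonneg_normed (B j).integral_normed _ hf fun y hy => ?_
      have hT : MemLp (fun z => f ((s j • e - y) + z)) 2 volume :=
        hf.comp_measurePreserving (measurePreserving_add_left volume _)
      refine (eLpNorm_sub_le hT.1 hf.1 (by norm_num)).trans (le_of_eq ?_)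
      have := eLpNorm_comp_measurePreserving (p := 2) hf.1
        (measurePreserving_add_left volume (s j • e - y))
      rw [two_mul]; congr 1
    have hm : MemLp (mollify ((B j).normed volume) (s j • e) f - f) 2 volume :=
      ⟨hcont.aestronglyMeasurable.sub hf.1,
        hbd.trans_lt (ENNReal.mul_lt_top (by norm_num) hf.2)⟩
    have := hm.add hf
    simpa using this

/-- The operators `T j` do not depend on `f`. Hence near `z` the derivative of `T j f` is `T j` of
the weak derivative, and the rule can be applied a second time to treat second derivatives. -/
theorem ConeCond.exists_approx {D : Set V} (hD : IsOpen D) {z : V} (h : ConeCond D z) :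
    ∃ r : ℝ, 0 < r ∧ ∃ T : ℕ → (V → ℝ) → V → ℝ,
      (∀ f, MemLp f 2 (volume.restrict D) → (∀ j, ContDiff ℝ ∞ (T j f)) ∧
        TendstoL2 (volume.restrict D) (fun j => T j f) f) ∧
      ∀ j e f g, MemLp f 2 (volume.restrict D) → IsWeakDeriv D e f g →
        ∀ y ∈ D, y ∈ Metric.ball z r → fderiv ℝ (T j f) y e = T j g y := by
  have : ProperSpace V := FiniteDimensional.proper_rclike ℝ V
  obtain ⟨e, r, c, s₀, hr, hc, hs₀, hcone⟩ := h
  obtain ⟨ρ, s, hs, hss₀, hρ, hρc, hρs, hlim⟩ := exists_mollifiers e hc hs₀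
  refine ⟨r, hr, fun j f => mollify (ρ j) (s j • e) (D.indicator f), fun f hf => ?_, ?_⟩
  · have hf' : MemLp (D.indicator f) 2 volume :=
      (memLp_indicator_iff_restrict hD.measurableSet).2 hf
    refine ⟨fun j => contDiff_mollify (hρ j) (hρc j) _ (hf'.locallyIntegrable (by norm_num)), ?_⟩
    have h1 := (hlim _ hf').mono_measure (ν := volume.restrict D) (c := 1) (by norm_num)
      (by rw [one_smul]; exact Measure.restrict_le_self)
    exact h1.congr (fun j => EventuallyEq.rfl) (indicator_ae_eq_restrict hD.measurableSet)
  · intro j e' f g hf hfg y hy hyz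
    refine fderiv_mollify_indicator hD (hρ j) (hρc j) (hρs j) ?_ hf hfg
    refine subset_trans (Metric.closedBall_subset_ball ?_)
      (hcone y (subset_closure hy) hyz (s j) (hs j) (hss₀ j))
    have := mul_pos hc (hs j); linarith

/-- Smooth functions are dense in `H²(D)` when `D` is bounded and satisfies the cone condition. -/
theorem exists_smooth_approx {D : Set V} (hD : IsOpen D) (hK : IsCompact (closure D))
    (hcone : ∀ z ∈ closure D, ConeCond D z) {f : V → ℝ} (hf : MemH2 D f) :
    ∃ v : ℕ → V → ℝ, (∀ j, ContDiff ℝ ∞ (v j)) ∧ TendstoL2 (volume.restrict D) v f ∧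
      (∀ e, TendstoL2 (volume.restrict D) (fun j z => fderiv ℝ (v j) z e) (weakDeriv D e f)) ∧
      ∀ e e', TendstoL2 (volume.restrict D)
        (fun j z => fderiv ℝ (fun y => fderiv ℝ (v j) y e) z e')
        (weakDeriv D e' (weakDeriv D e f)) := by
  classical
  have : ProperSpace V := FiniteDimensional.proper_rclike ℝ V
  choose! r hr T hT1 hT2 using fun z hz => (hcone z hz).exists_approx hD
  obtain ⟨t, χ, htK, hχ, hχc, hχs, -, hχ1⟩ := exists_smooth_partition hK r hr
  set μ := (volume : Measure V).restrict D with hμ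
  have hf0 := hf.1.1
  have hf1 := fun e => hf.1.weakDeriv_spec e
  have hf2 := fun e e' => (hf.2 e).weakDeriv_spec e'
  set f1 := fun e => weakDeriv D e f with hf1d
  set f2 := fun e e' => weakDeriv D e' (weakDeriv D e f) with hf2d
  have hmD : ∀ {p : V → Prop}, (∀ z ∈ D, p z) → ∀ᵐ z ∂μ, p z := fun hp =>
    (ae_restrict_iff' hD.measurableSet).2 (Eventually.of_forall hp)
  -- product rule for a smooth cut-off and a mollification
  have prod : ∀ x ∈ t, ∀ c : V → ℝ, ContDiff ℝ ∞ c → tsupport c ⊆ Metric.ball x (r x) →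
      ∀ (j : ℕ) (e : V) (k g : V → ℝ), MemLp k 2 μ → IsWeakDeriv D e k g → ∀ z ∈ D,
      HasFDerivAt (fun y => c y * T x j k y)
        (c z • fderiv ℝ (T x j k) z + T x j k z • fderiv ℝ c z) z ∧
      c z * fderiv ℝ (T x j k) z e = c z * T x j g z := by
    intro x hx c hc hcs j e k g hk hkg z hz
    refine ⟨((hc.differentiable (by simp)) z).hasFDerivAt.mul
      (((hT1 x (htK x hx) k hk).1 j).differentiable (by simp) z).hasFDerivAt, ?_⟩
    by_cases hzc : z ∈ tsupport c
    · rw [hT2 x (htK x hx) j e k g hk hkg z hz (hcs hzc)]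
    · rw [image_eq_zero_of_notMem_tsupport hzc]; simp
  have hdχ : ∀ x e, ContDiff ℝ ∞ fun y => fderiv ℝ (χ x) y e := fun x e =>
    ((hχ x).fderiv_right (m := ∞) (by simp)).clm_apply contDiff_const
  have hdχs : ∀ x ∈ t, ∀ e, tsupport (fun y => fderiv ℝ (χ x) y e) ⊆ Metric.ball x (r x) :=
    fun x hx e => (tsupport_fderiv_apply_subset ℝ e).trans (hχs x hx)
  have hdχc : ∀ x ∈ t, ∀ e, HasCompactSupport fun y => fderiv ℝ (χ x) y e :=
    fun x hx e => (hχc x hx).fderiv_apply ℝ e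
  have hddχ : ∀ x e e', Continuous fun y => fderiv ℝ (fun y => fderiv ℝ (χ x) y e) y e' :=
    fun x e e' => (((hdχ x e).fderiv_right (m := ∞) (by simp)).clm_apply contDiff_const).continuous
  have hddχc : ∀ x ∈ t, ∀ e e', HasCompactSupport fun y =>
      fderiv ℝ (fun y => fderiv ℝ (χ x) y e) y e' :=
    fun x hx e e' => (hdχc x hx e).fderiv_apply ℝ e'
  have hlim : ∀ x ∈ t, ∀ c : V → ℝ, Continuous c → HasCompactSupport c → ∀ k, MemLp k 2 μ →
      TendstoL2 μ (fun j z => c z * T x j k z) (fun z => c z * k z) := by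
    intro x hx c hc hcc k hk
    obtain ⟨C, hC⟩ := hcc.exists_bound_of_continuous hc
    exact ((hT1 x (htK x hx) k hk).2).bdd_mul hc.aestronglyMeasurable (Eventually.of_forall hC)
  -- derivatives of the partition of unity
  have s0 : ∀ z ∈ D, ∑ x ∈ t, χ x z = 1 := fun z hz => hχ1 z (subset_closure hz)
  have s1 : ∀ z ∈ D, ∀ e, ∑ x ∈ t, fderiv ℝ (χ x) z e = 0 := by
    intro z hz e
    have h1 : HasFDerivAt (fun y => ∑ x ∈ t, χ x y) (∑ x ∈ t, fderiv ℝ (χ x) z) z :=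
      HasFDerivAt.fun_sum fun x _ => ((hχ x).differentiable (by simp) z).hasFDerivAt
    have h2 : (fun y => ∑ x ∈ t, χ x y) =ᶠ[𝓝 z] fun _ => 1 := by
      filter_upwards [hD.mem_nhds hz] with y hy using s0 y hy
    have h3 := (h1.congr_of_eventuallyEq h2.symm).unique (hasFDerivAt_const (1 : ℝ) z)
    have := congrArg (fun L : V →L[ℝ] ℝ => L e) h3
    simpa using this
  have s2 : ∀ z ∈ D, ∀ e e', ∑ x ∈ t, fderiv ℝ (fun y => fderiv ℝ (χ x) y e) z e' = 0 := by
    intro z hz e e'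
    have h1 : HasFDerivAt (fun y => ∑ x ∈ t, fderiv ℝ (χ x) y e)
        (∑ x ∈ t, fderiv ℝ (fun y => fderiv ℝ (χ x) y e) z) z :=
      HasFDerivAt.fun_sum fun x _ => ((hdχ x e).differentiable (by simp) z).hasFDerivAt
    have h2 : (fun y => ∑ x ∈ t, fderiv ℝ (χ x) y e) =ᶠ[𝓝 z] fun _ => 0 := by
      filter_upwards [hD.mem_nhds hz] with y hy using s1 y hy e
    have h3 := (h1.congr_of_eventuallyEq h2.symm).unique (hasFDerivAt_const (0 : ℝ) z)
    have := congrArg (fun L : V →L[ℝ] ℝ => L e') h3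
    simpa using this
  -- Differentiating the cut-offs creates commutator terms. In the limit the approximants no longer
  -- depend on the patch, so these terms carry the factors `s1` and `s2`, which vanish.
  have d1 : ∀ j e, ∀ z ∈ D, fderiv ℝ (fun y => ∑ x ∈ t, χ x y * T x j f y) z e =
      ∑ x ∈ t, (χ x z * T x j (f1 e) z + fderiv ℝ (χ x) z e * T x j f z) := by
    intro j e z hz
    rw [(HasFDerivAt.fun_sum fun x hx =>
      (prod x hx (χ x) (hχ x) (hχs x hx) j e f (f1 e) hf0 (hf1 e).2 z hz).1).fderiv]
    simp only [FunLike.coe_sum, Finset.sum_apply, _root_.add_apply,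
      _root_.smul_apply, smul_eq_mul]
    refine Finset.sum_congr rfl fun x hx => ?_
    rw [(prod x hx (χ x) (hχ x) (hχs x hx) j e f (f1 e) hf0 (hf1 e).2 z hz).2, mul_comm (T x j f z)]
  have d2 : ∀ j e e', ∀ z ∈ D,
      fderiv ℝ (fun y => fderiv ℝ (fun y => ∑ x ∈ t, χ x y * T x j f y) y e) z e' =
      ∑ x ∈ t, ((χ x z * T x j (f2 e e') z + fderiv ℝ (χ x) z e' * T x j (f1 e) z) +
        (fderiv ℝ (χ x) z e * T x j (f1 e') z
          + fderiv ℝ (fun y => fderiv ℝ (χ x) y e) z e' * T x j f z)) := by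
    intro j e e' z hz
    have hev : (fun y => fderiv ℝ (fun y => ∑ x ∈ t, χ x y * T x j f y) y e) =ᶠ[𝓝 z]
        fun y => ∑ x ∈ t, (χ x y * T x j (f1 e) y + fderiv ℝ (χ x) y e * T x j f y) := by
      filter_upwards [hD.mem_nhds hz] with y hy using d1 j e y hy
    have p1 := fun x hx =>
      prod x hx (χ x) (hχ x) (hχs x hx) j e' (f1 e) (f2 e e') (hf1 e).1 (hf2 e e').2 z hz
    have p2 := fun x hx => prod x hx (fun y => fderiv ℝ (χ x) y e) (hdχ x e) (hdχs x hx e) j e' f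
      (f1 e') hf0 (hf1 e').2 z hz
    rw [hev.fderiv_eq, (HasFDerivAt.fun_sum fun x hx => (p1 x hx).1.fun_add (p2 x hx).1).fderiv]
    simp only [FunLike.coe_sum, Finset.sum_apply, _root_.add_apply,
      _root_.smul_apply, smul_eq_mul]
    refine Finset.sum_congr rfl fun x hx => ?_
    rw [(p1 x hx).2, (p2 x hx).2, mul_comm (T x j f z), mul_comm (T x j (f1 e) z)]
  refine ⟨fun j z => ∑ x ∈ t, χ x z * T x j f z, fun j => ?_, ?_, fun e => ?_, fun e e' => ?_⟩
  · exact ContDiff.sum fun x hx => (hχ x).mul ((hT1 x (htK x hx) f hf0).1 j)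
  · refine (TendstoL2.sum t fun x hx => hlim x hx (χ x) (hχ x).continuous (hχc x hx) f hf0).congr
      (fun j => EventuallyEq.rfl) (hmD fun z hz => ?_)
    simp only [← Finset.sum_mul, s0 z hz, one_mul]
  · refine (TendstoL2.sum t fun x hx =>
      (hlim x hx (χ x) (hχ x).continuous (hχc x hx) (f1 e) (hf1 e).1).add
      (hlim x hx _ (hdχ x e).continuous (hdχc x hx e) f hf0)).congr
      (fun j => hmD fun z hz => (d1 j e z hz).symm) (hmD fun z hz => ?_)
    simp only [Finset.sum_add_distrib, ← Finset.sum_mul, s0 z hz, s1 z hz e]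
    simp [hf1d]
  · refine (TendstoL2.sum t fun x hx =>
      ((hlim x hx (χ x) (hχ x).continuous (hχc x hx) (f2 e e') (hf2 e e').1).add
      (hlim x hx _ (hdχ x e').continuous (hdχc x hx e') (f1 e) (hf1 e).1)).add
      ((hlim x hx _ (hdχ x e).continuous (hdχc x hx e) (f1 e') (hf1 e').1).add
      (hlim x hx _ (hddχ x e e') (hddχc x hx e e') f hf0))).congr
      (fun j => hmD fun z hz => (d2 j e e' z hz).symm) (hmD fun z hz => ?_)
    simp only [Finset.sum_add_distrib, ← Finset.sum_mul]
    rw [s0 z hz, s1 z hz e, s1 z hz e', s2 z hz e e']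
    simp [hf2d]

end WeakDerivatives

/-! ### Geometry of Lipschitz domains -/

section Geometry

/-- The balls of radius `c s` around `z + s e` fill a convex set with nonempty interior, contained
in the closure of `D` and having `z` in its own closure. Such convex sets have unique derivatives at
`z`. -/
theorem ConeCond.uniqueDiffWithinAt {V : Type*} [NormedAddCommGroup V] [NormedSpace ℝ V]
    [MeasureSpace V] {D : Set V} {z : V} (hz : z ∈ closure D) (h : ConeCond D z) :
    UniqueDiffWithinAt ℝ (closure D) z := by
  obtain ⟨e, r, c, s₀, hr, hc, hs₀, hcone⟩ := h
  set C : Set V := {p | ∃ s, 0 < s ∧ s ≤ s₀ ∧ p ∈ Metric.ball (z + s • e) (c * s)} with hC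
  have hCD : C ⊆ closure D := by
    rintro p ⟨s, hs, hs', hp⟩
    exact subset_closure (hcone z hz (by simpa using hr) s hs hs' hp)
  have hconv : Convex ℝ C := by
    rintro p ⟨s, hs, hs', hp⟩ q ⟨s', hs1, hs1', hq⟩ a b ha hb hab
    rw [Metric.mem_ball, dist_eq_norm] at hp hq
    refine ⟨a * s + b * s', ?_, ?_, ?_⟩
    · rcases eq_or_lt_of_le ha with rfl | ha'
      · have : b = 1 := by linarith
        subst this; linarith
      · have := mul_pos ha' hs; have := mul_nonneg hb hs1.le; linarith
    · nlinarith
    · rw [Metric.mem_ball, dist_eq_norm]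
      have e1 : a • p + b • q - (z + (a * s + b * s') • e) =
          a • (p - (z + s • e)) + b • (q - (z + s' • e)) := by
        have : z = a • z + b • z := by rw [← add_smul, hab, one_smul]
        nth_rewrite 1 [this]
        simp only [smul_sub, smul_add, add_smul, mul_smul]; abel
      rw [e1]
      refine lt_of_le_of_lt (norm_add_le _ _) ?_
      rw [norm_smul, norm_smul, Real.norm_of_nonneg ha, Real.norm_of_nonneg hb]
      rcases eq_or_lt_of_le ha with rfl | ha'
      · have : b = 1 := by linarith
        subst this; linarith
      · have := mul_lt_mul_of_pos_left hp ha'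
        have := mul_le_mul_of_nonneg_left hq.le hb
        nlinarith
  have hball : Metric.ball (z + s₀ • e) (c * s₀) ⊆ C := fun p hp => ⟨s₀, hs₀, le_rfl, hp⟩
  have hint : (interior C).Nonempty :=
    ⟨z + s₀ • e, interior_maximal hball Metric.isOpen_ball
      (Metric.mem_ball_self (mul_pos hc hs₀))⟩
  have hzC : z ∈ closure C := by
    have hlim : Tendsto (fun s : ℝ => z + s • e) (𝓝[>] 0) (𝓝 z) := by
      have : Continuous fun s : ℝ => z + s • e := by fun_prop
      have := (this.tendsto 0).mono_left (nhdsWithin_le_nhds (s := Ioi 0))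
      simpa using this
    refine mem_closure_of_tendsto hlim ?_
    filter_upwards [Ioo_mem_nhdsGT hs₀] with s hs
    exact ⟨s, hs.1, hs.2.le, Metric.mem_ball_self (mul_pos hc hs.1)⟩
  exact (uniqueDiffWithinAt_convex hconv hint hzC).mono hCD

variable {n : ℕ} {Ω : Set (E n)}

/-- The projection to the hyperplane orthogonal to the unit vector `e`. -/
def perp (e y : E n) : E n := y - ⟪e, y⟫ • e

theorem norm_perp_le {e : E n} (he : ‖e‖ = 1) (y : E n) : ‖perp e y‖ ≤ 2 * ‖y‖ := by
  unfold perp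
  refine (norm_sub_le _ _).trans ?_
  rw [norm_smul, he, mul_one]
  have := abs_real_inner_le_norm e y
  rw [he, one_mul] at this
  rw [Real.norm_eq_abs]; linarith

theorem perp_add (e y v : E n) : perp e (y + v) = perp e y + perp e v := by
  simp only [perp, inner_add_right, add_smul]; abel

theorem perp_smul_self {e : E n} (he : ‖e‖ = 1) (s : ℝ) : perp e (s • e) = 0 := by
  simp [perp, inner_smul_right, real_inner_self_eq_norm_sq, he]

theorem continuous_perp (e : E n) : Continuous (perp e) := by
  unfold perp; fun_prop

/-- A graph chart of `Ω` in the ball of radius `r` around `x`. -/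
structure IsChart (Ω : Set (E n)) (x e : E n) (K : NNReal) (r : ℝ) (γ : E n → ℝ) : Prop where
  norm_e : ‖e‖ = 1
  pos : 0 < r
  lip : LipschitzWith K γ
  mem_iff : ∀ y ∈ Metric.ball x r, y ∈ Ω ↔ γ (perp e y) < ⟪e, y⟫

namespace IsChart

variable {x e : E n} {K : NNReal} {r : ℝ} {γ : E n → ℝ}

theorem le_of_mem_closure (h : IsChart Ω x e K r γ) {y : E n} (hy : y ∈ Metric.ball x r)
    (hyc : y ∈ closure Ω) : γ (perp e y) ≤ ⟪e, y⟫ := by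
  have hy' : y ∈ closure (Metric.ball x r ∩ Ω) :=
    Metric.isOpen_ball.inter_closure ⟨hy, hyc⟩
  have hcl : IsClosed {y : E n | γ (perp e y) ≤ ⟪e, y⟫} :=
    isClosed_le (h.lip.continuous.comp (continuous_perp e)) (by fun_prop)
  exact closure_minimal (fun p hp => ((h.mem_iff p hp.1).1 hp.2).le) hcl hy'

theorem eq_of_mem_frontier (hΩ : IsOpen Ω) (h : IsChart Ω x e K r γ) {y : E n}
    (hy : y ∈ Metric.ball x r) (hyc : y ∈ frontier Ω) : γ (perp e y) = ⟪e, y⟫ := by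
  refine le_antisymm (h.le_of_mem_closure hy hyc.1) ?_
  rw [hΩ.frontier_eq] at hyc
  exact not_lt.1 fun hlt => hyc.2 ((h.mem_iff y hy).2 hlt)

/-- The aperture `1 / (1 + 2K)` is what the Lipschitz constant permits: an error `v` lowers the
height by at most `‖v‖` and raises the graph by at most `2K‖v‖`, because the projection is only
estimated with norm `2`. The two together must stay below the vertical shift `s`. -/
theorem coneCond (h : IsChart Ω x e K r γ) : ConeCond Ω x := by
  have hr := h.pos
  have hK : (0 : ℝ) ≤ K := K.2
  refine ⟨e, r / 2, 1 / (1 + 2 * K), r / 4, by linarith, by positivity, by linarith, ?_⟩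
  intro y hy hyx s hs hs4 p hp
  set v := p - (y + s • e) with hv
  have hpv : p = y + (s • e + v) := by rw [hv]; abel
  rw [Metric.mem_ball, dist_eq_norm, ← hv, div_mul_eq_mul_div, one_mul, lt_div_iff₀ (by positivity)] at hp
  have hvs : ‖v‖ ≤ s := by nlinarith [norm_nonneg v]
  have hpx : p ∈ Metric.ball x r := by
    rw [Metric.mem_ball, dist_eq_norm]
    have : p - x = (y - x) + s • e + v := by rw [hpv]; abel
    rw [this]
    refine lt_of_le_of_lt (norm_add₃_le) ?_
    rw [norm_smul, h.norm_e, Real.norm_of_nonneg hs.le]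
    rw [dist_eq_norm] at hyx
    linarith
  have hyb : y ∈ Metric.ball x r := Metric.mem_ball.2 (by linarith)
  rw [h.mem_iff p hpx, hpv]
  have h1 := h.le_of_mem_closure hyb hy
  rw [perp_add, perp_add, perp_smul_self h.norm_e, zero_add, inner_add_right, inner_add_right,
    inner_smul_right, real_inner_self_eq_norm_sq, h.norm_e]
  have h2 : γ (perp e y + perp e v) ≤ γ (perp e y) + K * (2 * ‖v‖) := by
    have := h.lip.dist_le_mul (perp e y + perp e v) (perp e y)
    rw [dist_eq_norm, dist_eq_norm, add_sub_cancel_left, Real.norm_eq_abs] at this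
    have := (abs_le.1 this).2
    have := mul_le_mul_of_nonneg_left (norm_perp_le h.norm_e v) hK
    linarith
  have h3 : -‖v‖ ≤ ⟪e, v⟫ := by
    have := abs_real_inner_le_norm e v
    rw [h.norm_e, one_mul] at this
    exact (abs_le.1 this).1
  nlinarith

end IsChart

theorem IsLipschitzDomain.exists_chart (hΩ : IsLipschitzDomain Ω) {x : E n}
    (hx : x ∈ frontier Ω) : ∃ e K r γ, IsChart Ω x e K r γ := by
  obtain ⟨e, K, r, γ, h1, h2, h3, h4⟩ := hΩ.graph x hx
  exact ⟨e, K, r, γ, h1, h2, h3, h4⟩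

theorem IsLipschitzDomain.coneCond (hΩ : IsLipschitzDomain Ω) {x : E n} (hx : x ∈ closure Ω) :
    ConeCond Ω x := by
  by_cases hxΩ : x ∈ Ω
  · obtain ⟨r, hr, hb⟩ := Metric.isOpen_iff.1 hΩ.isOpen x hxΩ
    refine ⟨0, r / 2, 1, r / 2, by linarith, one_pos, by linarith, ?_⟩
    intro y _ hyx s hs hs2
    rw [smul_zero, add_zero, one_mul]
    refine (Metric.ball_subset_ball' ?_).trans hb
    linarith
  · obtain ⟨e, K, r, γ, h⟩ := hΩ.exists_chart (x := x) (by
      rw [hΩ.isOpen.frontier_eq]; exact ⟨hx, hxΩ⟩)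
    exact h.coneCond

theorem closure_cyl {t₁ t₂ : ℝ} (ht : t₁ < t₂) :
    closure (cyl Ω t₁ t₂) = closure Ω ×ˢ Icc t₁ t₂ := by
  rw [cyl, closure_prod_eq, closure_Ioo ht.ne]

/-- A spatial cone direction is combined with a time shift away from the nearer end. The product
carries the sup norm, so the two conditions decouple and the constants are minima. -/
theorem IsLipschitzDomain.coneCond_cyl (hΩ : IsLipschitzDomain Ω) {t₁ t₂ : ℝ} (ht : t₁ < t₂)
    {z : E n × ℝ} (hz : z ∈ closure (cyl Ω t₁ t₂)) : ConeCond (cyl Ω t₁ t₂) z := by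
  rw [closure_cyl ht] at hz
  obtain ⟨e, r, c, s₀, hr, hc, hs₀, hcone⟩ := hΩ.coneCond hz.1
  have key : ∃ ε : ℝ, ∀ t ∈ Icc t₁ t₂, dist t z.2 < (t₂ - t₁) / 8 → ∀ s, 0 < s →
      s ≤ (t₂ - t₁) / 8 → ∀ p, dist p (t + s * ε) < 1 / 2 * s → p ∈ Ioo t₁ t₂ := by
    rcases le_or_gt z.2 ((t₁ + t₂) / 2) with h | h
    · refine ⟨1, fun t ht' hd s hs hs' p hp => ?_⟩
      rw [Real.dist_eq, abs_lt] at hd hp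
      constructor <;> linarith [ht'.1, ht'.2]
    · refine ⟨-1, fun t ht' hd s hs hs' p hp => ?_⟩
      rw [Real.dist_eq, abs_lt] at hd hp
      constructor <;> linarith [ht'.1, ht'.2]
  obtain ⟨ε, hε⟩ := key
  refine ⟨(e, ε), min r ((t₂ - t₁) / 8), min c (1 / 2), min s₀ ((t₂ - t₁) / 8),
    lt_min hr (by linarith), lt_min hc (by norm_num), lt_min hs₀ (by linarith), ?_⟩
  intro y hy hyz s hs hs' p hp
  rw [closure_cyl ht] at hy
  rw [Prod.dist_eq, max_lt_iff] at hyz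
  rw [Metric.mem_ball, Prod.dist_eq, max_lt_iff] at hp
  refine ⟨hcone y.1 hy.1 (hyz.1.trans_le (min_le_left _ _)) s hs (hs'.trans (min_le_left _ _))
    (Metric.mem_ball.2 (hp.1.trans_le ?_)), hε y.2 hy.2 (hyz.2.trans_le (min_le_right _ _)) s hs
    (hs'.trans (min_le_right _ _)) p.2 (lt_of_lt_of_le hp.2 ?_)⟩
  · exact mul_le_mul_of_nonneg_right (min_le_left _ _) hs.le
  · exact mul_le_mul_of_nonneg_right (min_le_right _ _) hs.le

theorem IsLipschitzDomain.uniqueDiffOn (hΩ : IsLipschitzDomain Ω) :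
    UniqueDiffOn ℝ (closure Ω) := fun _ hx => (hΩ.coneCond hx).uniqueDiffWithinAt hx

theorem IsLipschitzDomain.uniqueDiffOn_cyl (hΩ : IsLipschitzDomain Ω) {t₁ t₂ : ℝ} (ht : t₁ < t₂) :
    UniqueDiffOn ℝ (closure (cyl Ω t₁ t₂)) :=
  fun _ hz => (hΩ.coneCond_cyl ht hz).uniqueDiffWithinAt hz

theorem IsLipschitzDomain.isCompact_closure (hΩ : IsLipschitzDomain Ω) : IsCompact (closure Ω) :=
  hΩ.isBounded.isCompact_closure

theorem IsLipschitzDomain.isCompact_closure_cyl (hΩ : IsLipschitzDomain Ω) {t₁ t₂ : ℝ}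
    (ht : t₁ < t₂) : IsCompact (closure (cyl Ω t₁ t₂)) := by
  rw [closure_cyl ht]; exact hΩ.isCompact_closure.prod isCompact_Icc

/-! ### Outer normals -/

/-- Move from `x` a little along `v - w`. This direction points outward for `v` and inward for `w`,
so the new point can lie neither in `Ω` nor outside it. -/
theorem IsOuterNormal.unique {x v w : E n} (hv : IsOuterNormal Ω x v) (hw : IsOuterNormal Ω x w) :
    v = w := by
  by_contra hne
  set d := v - w with hd
  have hd0 : d ≠ 0 := sub_ne_zero.2 hne
  have hdp : 0 < ‖d‖ := norm_pos_iff.2 hd0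
  have hvw : ⟪v, w⟫ < 1 := by
    have := real_inner_self_nonneg (x := v - w)
    have h2 : ‖v - w‖ ^ 2 = ‖v‖ ^ 2 - 2 * ⟪v, w⟫ + ‖w‖ ^ 2 := norm_sub_sq_real v w
    rw [hv.1, hw.1, ← hd] at h2
    nlinarith [sq_pos_of_pos hdp]
  set p := 1 - ⟪v, w⟫ with hp
  have hp0 : 0 < p := by linarith
  have e1 : ⟪d, v⟫ = p := by
    rw [hd, inner_sub_left, real_inner_self_eq_norm_sq, hv.1, real_inner_comm]; linarith
  have e2 : ⟪d, w⟫ = -p := by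
    rw [hd, inner_sub_left, real_inner_self_eq_norm_sq, hw.1]; linarith
  have hε : 0 < p / (2 * ‖d‖) := by positivity
  have hlim : Tendsto (fun t : ℝ => x + t • d) (𝓝[>] 0) (𝓝 x) := by
    have : Continuous fun t : ℝ => x + t • d := by fun_prop
    have := (this.tendsto 0).mono_left (nhdsWithin_le_nhds (s := Ioi 0))
    simpa using this
  obtain ⟨t, ⟨h1, h2⟩, ht⟩ := ((hlim.eventually ((hv.2 _ hε).and (hw.2 _ hε))).and
    (self_mem_nhdsWithin : ∀ᶠ t : ℝ in 𝓝[>] 0, 0 < t)).exists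
  have e3 : x + t • d - x = t • d := by abel
  rw [e3, inner_smul_left, norm_smul, Real.norm_of_nonneg ht.le] at h1 h2
  have e4 : p / (2 * ‖d‖) * (t * ‖d‖) = t * p / 2 := by field_simp
  rw [e4] at h1 h2
  simp only [e1, e2, conj_trivial] at h1 h2
  have htp := mul_pos ht hp0
  by_cases hy : x + t • d ∈ Ω
  · have := h1.1 hy; linarith
  · have := h2.2 hy; linarith

theorem IsOuterNormal.outerNormal_eq {x v : E n} (hv : IsOuterNormal Ω x v) :
    outerNormal Ω x = v := by
  have h : ∃ v : E n, IsOuterNormal Ω x v := ⟨v, hv⟩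
  unfold outerNormal
  rw [dif_pos h]
  exact h.choose_spec.unique hv

/-- The direction `e + (c/2) v` is still inside the open cone, hence enters `Ω`, hence has
nonpositive component along `v`. -/
theorem IsOuterNormal.inner_le_of_cone {x v e : E n} (hv : IsOuterNormal Ω x v) {c s₀ : ℝ}
    (hc : 0 < c) (hs₀ : 0 < s₀)
    (hcone : ∀ s, 0 < s → s ≤ s₀ → Metric.ball (x + s • e) (c * s) ⊆ Ω) :
    ⟪e, v⟫ ≤ -(c / 2) := by
  set d := e + (c / 2) • v with hd
  have hdv : ⟪d, v⟫ = ⟪e, v⟫ + c / 2 := by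
    rw [hd, inner_add_left, inner_smul_left, real_inner_self_eq_norm_sq, hv.1]; simp
  suffices h : ∀ ε > 0, ⟪d, v⟫ ≤ ε by
    have := le_of_forall_pos_le_add (a := ⟪d, v⟫) (b := 0) (by simpa using h)
    linarith
  intro ε hε
  have hM : 0 < ‖d‖ + 1 := by positivity
  have hlim : Tendsto (fun t : ℝ => x + t • d) (𝓝[>] 0) (𝓝 x) := by
    have : Continuous fun t : ℝ => x + t • d := by fun_prop
    have := (this.tendsto 0).mono_left (nhdsWithin_le_nhds (s := Ioi 0))
    simpa using this
  obtain ⟨t, h1, ht⟩ := ((hlim.eventually (hv.2 (ε / (‖d‖ + 1)) (by positivity))).and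
    (Ioo_mem_nhdsGT hs₀)).exists
  have hmem : x + t • d ∈ Ω := by
    refine hcone t ht.1 ht.2.le ?_
    rw [Metric.mem_ball, dist_eq_norm]
    have : x + t • d - (x + t • e) = (t * (c / 2)) • v := by
      rw [hd, smul_add, mul_smul]; abel
    have htc := mul_pos hc ht.1
    rw [this, norm_smul, hv.1, mul_one, Real.norm_of_nonneg (by nlinarith)]
    linarith
  have h2 := h1.1 hmem
  have e3 : x + t • d - x = t • d := by abel
  rw [e3, inner_smul_left, norm_smul, Real.norm_of_nonneg ht.1.le, conj_trivial] at h2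
  have h3 : ε / (‖d‖ + 1) * (t * ‖d‖) ≤ t * ε := by
    rw [div_mul_eq_mul_div, div_le_iff₀ hM]
    nlinarith [mul_pos ht.1 hε]
  exact le_of_mul_le_mul_left (h2.trans h3) ht.1

end Geometry

/-! ### The Gauss-Green formula above a Lipschitz graph -/

section Graph

variable {n : ℕ}

/-- The hyperplane orthogonal to `e`. -/
abbrev Hyp (e : E n) : Submodule ℝ (E n) := (Submodule.span ℝ {e})ᗮ

theorem inner_coe_hyp {e : E n} (w : Hyp e) : ⟪e, (w : E n)⟫ = 0 :=
  Submodule.mem_orthogonal_singleton_iff_inner_right.1 w.2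

theorem perp_mem {e : E n} (he : ‖e‖ = 1) (y : E n) : perp e y ∈ Hyp e := by
  rw [Submodule.mem_orthogonal_singleton_iff_inner_right, perp, inner_sub_right,
    inner_smul_right, real_inner_self_eq_norm_sq, he]
  ring

theorem perp_graph {e : E n} (he : ‖e‖ = 1) (w : Hyp e) (s : ℝ) :
    perp e ((w : E n) + s • e) = w := by
  rw [perp_add, perp_smul_self he, add_zero, perp, inner_coe_hyp, zero_smul, sub_zero]

theorem inner_graph {e : E n} (he : ‖e‖ = 1) (w : Hyp e) (s : ℝ) :
    ⟪e, (w : E n) + s • e⟫ = s := by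
  rw [inner_add_right, inner_coe_hyp, inner_smul_right, real_inner_self_eq_norm_sq, he]; ring

/-- Orthogonal coordinates adapted to `e`. -/
def hypEquiv {e : E n} (he : ‖e‖ = 1) : (Hyp e × ℝ) ≃L[ℝ] E n :=
  LinearEquiv.toContinuousLinearEquiv
    { toFun := fun p => (p.1 : E n) + p.2 • e
      map_add' := fun p q => by simp [add_smul]; abel
      map_smul' := fun c p => by simp [mul_smul]
      invFun := fun y => (⟨perp e y, perp_mem he y⟩, ⟪e, y⟫)
      left_inv := fun p => by
        ext1
        · exact Subtype.ext (perp_graph he p.1 p.2)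
        · exact inner_graph he p.1 p.2
      right_inv := fun y => by simp [perp] }

/-- The coordinates flattening the graph of `γ`. -/
def graphHomeo {e : E n} (he : ‖e‖ = 1) {γ : E n → ℝ} (hγ : Continuous γ) :
    (Hyp e × ℝ) ≃ₜ E n where
  toFun p := (p.1 : E n) + (γ p.1 + p.2) • e
  invFun y := (⟨perp e y, perp_mem he y⟩, ⟪e, y⟫ - γ (perp e y))
  left_inv p := by
    ext1
    · exact Subtype.ext (perp_graph he p.1 _)
    · simp only [inner_graph he, perp_graph he]; ring
  right_inv y := by simp [perp]
  continuous_toFun := by fun_prop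
  continuous_invFun := by
    have := continuous_perp e
    refine Continuous.prodMk (Continuous.subtype_mk this _) ?_
    fun_prop

theorem graphHomeo_apply {e : E n} (he : ‖e‖ = 1) {γ : E n → ℝ} (hγ : Continuous γ)
    (p : Hyp e × ℝ) : graphHomeo he hγ p = (p.1 : E n) + (γ p.1 + p.2) • e := rfl

/-- The shear by `γ` preserves the product measure, so the graph coordinates push it to the same
measure as a linear isomorphism, and uniqueness of Haar measure applies. The value of `c` is
irrelevant: it is absorbed into the boundary measure. -/
theorem exists_volume_eq_smul_map {e : E n} (he : ‖e‖ = 1) {γ : E n → ℝ} (hγ : Continuous γ) :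
    ∃ c : NNReal, c ≠ 0 ∧ (volume : Measure (E n)) =
      c • ((volume : Measure (Hyp e)).prod (volume : Measure ℝ)).map
        (graphHomeo he hγ) := by
  have hS : MeasurePreserving (fun p : Hyp e × ℝ => (p.1, γ p.1 + p.2))
      ((volume : Measure (Hyp e)).prod (volume : Measure ℝ))
      ((volume : Measure (Hyp e)).prod (volume : Measure ℝ)) := by
    refine (MeasurePreserving.id (volume : Measure (Hyp e))).skew_product (g := fun w s => γ w + s) ?_ ?_
    · exact ((hγ.comp (continuous_subtype_val.comp continuous_fst)).add continuous_snd).measurable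
    · exact Eventually.of_forall fun w => (measurePreserving_add_left volume _).map_eq
  have h1 : ((volume : Measure (Hyp e)).prod (volume : Measure ℝ)).map (graphHomeo he hγ) =
      ((volume : Measure (Hyp e)).prod (volume : Measure ℝ)).map (hypEquiv he) := by
    nth_rewrite 2 [← hS.map_eq]
    rw [Measure.map_map (hypEquiv he).continuous.measurable hS.measurable]
    rfl
  rw [h1]
  set ν := ((volume : Measure (Hyp e)).prod (volume : Measure ℝ)).map (hypEquiv he) with hν
  have : IsAddHaarMeasure ν := (hypEquiv he).isAddHaarMeasure_map _
  refine ⟨addHaarScalarFactor volume ν, (addHaarScalarFactor_pos_of_isAddHaarMeasure _ _).ne', ?_⟩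
  exact isAddLeftInvariant_eq_smul _ _

section GaussGreen

variable {e : E n} {γ : E n → ℝ} {K : NNReal}

/-- The segment between two points of the shifted graph may leave the epigraph, where nothing is
known about `F`. The path goes up by `K d`, across by `d` and down by at most `2 K d`, with `d` the
horizontal distance; this explains the factor `1 + 3K`, which does not depend on the height `s`. -/
theorem norm_sub_graph_le (he : ‖e‖ = 1) (hγ : LipschitzWith K γ) {F : E n → ℝ} {M : ℝ}
    (hd : ∀ y, γ (perp e y) < ⟪e, y⟫ → DifferentiableAt ℝ F y)
    (hM : ∀ y, γ (perp e y) < ⟪e, y⟫ → ‖fderiv ℝ F y‖ ≤ M) {s : ℝ} (hs : 0 < s) :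
    LipschitzWith (Real.toNNReal (M * (1 + 3 * K)))
      (fun w : Hyp e => F ((w : E n) + (γ w + s) • e)) := by
  have hK : (0 : ℝ) ≤ K := K.2
  have seg : ∀ p q : E n, (∀ y ∈ segment ℝ p q, γ (perp e y) < ⟪e, y⟫) →
      ‖F q - F p‖ ≤ M * ‖q - p‖ := fun p q h =>
    (convex_segment p q).norm_image_sub_le_of_norm_fderiv_le (𝕜 := ℝ) (fun y hy => hd y (h y hy))
      (fun y hy => hM y (h y hy)) (left_mem_segment ℝ p q) (right_mem_segment ℝ p q)
  have hlip : ∀ w w' : E n, γ w ≤ γ w' + K * ‖w - w'‖ := fun w w' => by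
    have := hγ.dist_le_mul w w'
    rw [dist_eq_norm, dist_eq_norm, Real.norm_eq_abs] at this
    have := (abs_le.1 this).2
    linarith
  have hM0 : 0 ≤ M := by
    refine le_trans (norm_nonneg _) (hM ((γ 0 + 1) • e) ?_)
    rw [perp_smul_self he, inner_smul_right, real_inner_self_eq_norm_sq, he]; linarith
  have vert : ∀ (w : Hyp e) (a b : ℝ), γ w < a → γ w < b →
      ‖F ((w : E n) + b • e) - F ((w : E n) + a • e)‖ ≤ M * |b - a| := by
    intro w a b ha hb
    refine (seg _ _ ?_).trans (le_of_eq ?_)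
    · rintro y ⟨p, q, hp, hq, hpq, rfl⟩
      have : p • ((w : E n) + a • e) + q • ((w : E n) + b • e) = (w : E n) + (p * a + q * b) • e := by
        have h1 : (w : E n) = p • (w : E n) + q • (w : E n) := by rw [← add_smul, hpq, one_smul]
        nth_rewrite 3 [h1]
        simp only [smul_add, add_smul, mul_smul]; abel
      rw [this, perp_graph he, inner_graph he]
      rcases eq_or_lt_of_le hp with rfl | hp'
      · have : q = 1 := by linarith
        subst this; linarith
      · have h1 := mul_lt_mul_of_pos_left ha hp'
        have h2 := mul_le_mul_of_nonneg_left hb.le hq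
        have h3 : p * γ w + q * γ w = γ w := by rw [← add_mul, hpq, one_mul]
        linarith
    · have : (w : E n) + b • e - ((w : E n) + a • e) = (b - a) • e := by rw [sub_smul]; abel
      rw [this, norm_smul, he, mul_one, Real.norm_eq_abs]
  refine LipschitzWith.of_dist_le_mul fun w w' => ?_
  rw [Real.coe_toNNReal _ (by positivity), dist_eq_norm, dist_eq_norm]
  set d := ‖w - w'‖ with hdd
  have hd' : ‖(w : E n) - (w' : E n)‖ = d := by rw [hdd]; rfl
  have hd'' : ‖(w' : E n) - (w : E n)‖ = d := by rw [norm_sub_rev, hd']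
  have hd0 : 0 ≤ d := norm_nonneg _
  have hKd : 0 ≤ K * d := by positivity
  set h := γ w + s + K * d with hh
  have l1 := hlip w w'
  have l2 := hlip w' w
  rw [hd'] at l1
  rw [hd''] at l2
  have b1 := vert w h (γ w + s) (by linarith) (by linarith)
  have b3 := vert w' (γ w' + s) h (by linarith) (by linarith)
  have b2 : ‖F ((w : E n) + h • e) - F ((w' : E n) + h • e)‖ ≤ M * d := by
    refine (seg _ _ ?_).trans (le_of_eq ?_)
    · rintro y ⟨p, q, hp, hq, hpq, rfl⟩
      have : p • ((w' : E n) + h • e) + q • ((w : E n) + h • e) =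
          ((p • w' + q • w : Hyp e) : E n) + h • e := by
        have h1 : h • e = p • (h • e) + q • (h • e) := by rw [← add_smul, hpq, one_smul]
        nth_rewrite 3 [h1]
        simp only [smul_add, Submodule.coe_add, Submodule.coe_smul]; abel
      rw [this, perp_graph he, inner_graph he]
      have l3 := hlip (p • w' + q • w : Hyp e) w
      have : ((p • w' + q • w : Hyp e) : E n) - w = p • ((w' : E n) - w) := by
        rw [Submodule.coe_add, Submodule.coe_smul, Submodule.coe_smul,
          show q = 1 - p by linarith, sub_smul, one_smul, smul_sub]
        abel
      rw [this, norm_smul, hd'', Real.norm_of_nonneg hp] at l3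
      have : p * d ≤ d := by nlinarith
      have := mul_le_mul_of_nonneg_left this hK
      linarith
    · have : (w : E n) + h • e - ((w' : E n) + h • e) = (w : E n) - w' := by abel
      rw [this, hd']
  have c1 : |γ w + s - h| = K * d := by
    rw [hh, show γ w + s - (γ w + s + K * d) = -(K * d) by ring, abs_neg, abs_of_nonneg hKd]
  have c3 : |h - (γ w' + s)| ≤ 2 * (K * d) := by
    rw [abs_le]; constructor <;> linarith
  rw [c1] at b1
  have c4 := mul_le_mul_of_nonneg_left c3 hM0
  calc ‖F (w + (γ w + s) • e) - F (w' + (γ w' + s) • e)‖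
      = ‖(F (w + (γ w + s) • e) - F (w + h • e)) + (F (w + h • e) - F (w' + h • e)) +
          (F (w' + h • e) - F (w' + (γ w' + s) • e))‖ := by congr 1; ring
    _ ≤ _ := norm_add₃_le
    _ ≤ M * (1 + 3 * K) * d := by linarith

/-- The Gauss-Green formula for functions supported in a bounded set, above a Lipschitz graph. -/
theorem graph_gauss_green (he : ‖e‖ = 1) (hγ : LipschitzWith K γ) {c : NNReal}
    (hc : (volume : Measure (E n)) =
      c • ((volume : Measure (Hyp e)).prod (volume : Measure ℝ)).map (graphHomeo he hγ.continuous))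
    {F : E n → ℝ} {M R : ℝ}
    (hd : ∀ y, γ (perp e y) < ⟪e, y⟫ → DifferentiableAt ℝ F y)
    (hM : ∀ y, γ (perp e y) < ⟪e, y⟫ → ‖fderiv ℝ F y‖ ≤ M)
    (hF : ContinuousOn F {y | γ (perp e y) ≤ ⟪e, y⟫})
    (hR : ∀ y, γ (perp e y) ≤ ⟪e, y⟫ → R < ‖y‖ → F y = 0) (v : E n) :
    ∫ y in {y | γ (perp e y) < ⟪e, y⟫}, fderiv ℝ F y v =
      c * ∫ w : Hyp e, (fderiv ℝ (fun w : Hyp e => γ w) w ⟨perp e v, perp_mem he v⟩ - ⟪e, v⟫) *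
        F ((w : E n) + γ w • e) := by
  have hK : (0 : ℝ) ≤ K := K.2
  set Ψ := graphHomeo he hγ.continuous with hΨ
  set π := (volume : Measure (Hyp e)).prod (volume : Measure ℝ) with hπ
  have hΨa : ∀ p, Ψ p = (p.1 : E n) + (γ p.1 + p.2) • e := fun p => rfl
  have hperp : ∀ p, perp e (Ψ p) = p.1 := fun p => perp_graph he p.1 _
  have hinn : ∀ p, ⟪e, Ψ p⟫ = γ p.1 + p.2 := fun p => inner_graph he p.1 _
  have hmem : ∀ p, γ (perp e (Ψ p)) < ⟪e, Ψ p⟫ ↔ 0 < p.2 := fun p => by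
    rw [hperp, hinn]; constructor <;> intro h <;> linarith
  have hmem' : ∀ p, γ (perp e (Ψ p)) ≤ ⟪e, Ψ p⟫ ↔ 0 ≤ p.2 := fun p => by
    rw [hperp, hinn]; constructor <;> intro h <;> linarith
  set R' := |R| + |γ 0| + K * (2 * |R|) with hR'
  have hbd : ∀ p, ‖Ψ p‖ ≤ R → ‖p.1‖ ≤ 2 * |R| ∧ p.2 ≤ R' := by
    intro p hp
    have hpR : ‖Ψ p‖ ≤ |R| := hp.trans (le_abs_self R)
    have h1 : ‖(p.1 : E n)‖ ≤ 2 * |R| := by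
      rw [← hperp]; exact (norm_perp_le he _).trans (by linarith)
    refine ⟨h1, ?_⟩
    have h2 : p.2 = ⟪e, Ψ p⟫ - γ p.1 := by rw [hinn]; ring
    have h3 : ⟪e, Ψ p⟫ ≤ |R| := by
      have := real_inner_le_norm e (Ψ p)
      rw [he, one_mul] at this
      linarith
    have h4 := hγ.dist_le_mul (p.1 : E n) 0
    rw [dist_eq_norm, dist_eq_norm, sub_zero, Real.norm_eq_abs] at h4
    have h5 := (abs_le.1 h4).1
    have h6 := mul_le_mul_of_nonneg_left h1 hK
    have h7 := neg_abs_le (γ 0)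
    rw [h2, hR']; linarith
  have hopen : IsOpen {y : E n | γ (perp e y) < ⟪e, y⟫} :=
    isOpen_lt (hγ.continuous.comp (continuous_perp e)) (by fun_prop)
  have hfz : ∀ y, γ (perp e y) < ⟪e, y⟫ → R < ‖y‖ → fderiv ℝ F y = 0 := by
    intro y hy hyR
    have : F =ᶠ[𝓝 y] fun _ => 0 := by
      filter_upwards [hopen.mem_nhds hy, (isOpen_lt continuous_const continuous_norm).mem_nhds hyR]
        with z hz hz'
      exact hR z (le_of_lt hz) hz'
    rw [this.fderiv_eq]; simp
  -- The derivative of `F` in flattened coordinates, extended by zero below the graph, so that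
  -- Fubini can be used on a full product space.
  set g : E n → Hyp e × ℝ → ℝ := fun a p => if 0 < p.2 then fderiv ℝ F (Ψ p) a else 0 with hg
  have hgm : ∀ a, Measurable (g a) := fun a =>
    Measurable.ite (measurableSet_lt measurable_const measurable_snd)
      ((measurable_fderiv_apply_const ℝ F a).comp Ψ.continuous.measurable) measurable_const
  have hgb : ∀ a p, ‖g a p‖ ≤ M * ‖a‖ ∨ g a p = 0 := by
    intro a p
    by_cases h : 0 < p.2
    · left
      simp only [hg, h, if_true]
      exact (ContinuousLinearMap.le_opNorm _ _).trans
        (mul_le_mul_of_nonneg_right (hM _ ((hmem p).2 h)) (norm_nonneg _))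
    · right; simp [hg, h]
  have hgz : ∀ a p, g a p ≠ 0 → ‖p.1‖ ≤ 2 * |R| ∧ 0 < p.2 ∧ p.2 ≤ R' := by
    intro a p hp
    by_cases h : 0 < p.2
    · simp only [hg, h, if_true] at hp
      have : ‖Ψ p‖ ≤ R := by
        by_contra hcon
        rw [hfz _ ((hmem p).2 h) (not_le.1 hcon)] at hp
        simp at hp
      exact ⟨(hbd p this).1, h, (hbd p this).2⟩
    · simp [hg, h] at hp
  have hbox : ∀ {k : Hyp e × ℝ → ℝ} {C : ℝ}, Measurable k → (∀ p, ‖k p‖ ≤ C) →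
      (∀ p, k p ≠ 0 → ‖p.1‖ ≤ 2 * |R| ∧ 0 < p.2 ∧ p.2 ≤ R') → Integrable k π := by
    intro k C hk hkC hkz
    have hB : IsCompact (Metric.closedBall (0 : Hyp e) (2 * |R|) ×ˢ Icc (0 : ℝ) R') :=
      (isCompact_closedBall _ _).prod isCompact_Icc
    have h1 : IntegrableOn k (Metric.closedBall (0 : Hyp e) (2 * |R|) ×ˢ Icc (0 : ℝ) R') π :=
      Measure.integrableOn_of_bounded (M := C) hB.measure_lt_top.ne hk.aestronglyMeasurable
        (Eventually.of_forall hkC)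
    refine h1.integrable_of_forall_notMem_eq_zero fun p hp => ?_
    by_contra hne
    obtain ⟨a1, a2, a3⟩ := hkz p hne
    exact hp ⟨by simpa using a1, a2.le, a3⟩
  have hM0 : 0 ≤ M := by
    refine le_trans (norm_nonneg _) (hM ((γ 0 + 1) • e) ?_)
    rw [perp_smul_self he, inner_smul_right, real_inner_self_eq_norm_sq, he]; linarith
  have hgC : ∀ a p, ‖g a p‖ ≤ M * ‖a‖ := fun a p => by
    rcases hgb a p with h | h
    · exact h
    · rw [h, norm_zero]; positivity
  have hgi : ∀ a, Integrable (g a) π := fun a => hbox (hgm a) (hgC a) (hgz a)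
  -- change of variables
  have step1 : ∀ a, ∫ y in {y | γ (perp e y) < ⟪e, y⟫}, fderiv ℝ F y a = c * ∫ p, g a p ∂π := by
    intro a
    rw [← integral_indicator hopen.measurableSet, hc, integral_smul_nnreal_measure,
      Ψ.measurableEmbedding.integral_map]
    rw [NNReal.smul_def, smul_eq_mul]
    congr 1
    refine integral_congr_ae (Eventually.of_forall fun p => ?_)
    simp only [hg, Set.indicator_apply, mem_ofPred_eq, hmem]
  -- vertical direction
  have step2 : ∀ w : Hyp e, ∫ s, g e (w, s) = - F ((w : E n) + γ w • e) := by
    intro w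
    have h0 : ∫ s, g e (w, s) = ∫ s in Ioi (0 : ℝ), fderiv ℝ F (Ψ (w, s)) e := by
      rw [← integral_indicator measurableSet_Ioi]
      refine integral_congr_ae (Eventually.of_forall fun s => ?_)
      simp only [hg, Set.indicator_apply, mem_Ioi]
    have hcs : Continuous fun s => Ψ (w, s) := Ψ.continuous.comp (by fun_prop)
    have hlast : ∀ s, R' < s → 0 ≤ s → F (Ψ (w, s)) = 0 := by
      intro s hs hs0
      refine hR _ ((hmem' (w, s)).2 hs0) ?_
      by_contra hcon
      exact absurd (hbd _ (not_lt.1 hcon)).2 (not_le.2 hs)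
    have hint : IntegrableOn (fun s => fderiv ℝ F (Ψ (w, s)) e) (Ioi 0) := by
      have hB : IntegrableOn (fun s => g e (w, s)) (Icc 0 R') :=
        Measure.integrableOn_of_bounded (M := M * ‖e‖) isCompact_Icc.measure_lt_top.ne
          ((hgm e).comp measurable_prodMk_left).aestronglyMeasurable
          (Eventually.of_forall fun s => hgC e _)
      have hI := hB.integrable_of_forall_notMem_eq_zero fun s hs => by
        by_contra hne
        obtain ⟨-, a2, a3⟩ := hgz _ _ hne
        exact hs ⟨a2.le, a3⟩
      refine (hI.integrableOn (s := Ioi 0)).congr_fun (fun s hs => ?_) measurableSet_Ioi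
      simp only [hg, mem_Ioi.1 hs, if_true]
    have := integral_Ioi_of_hasDerivAt_of_tendsto (f := fun s => F (Ψ (w, s)))
      (f' := fun s => fderiv ℝ F (Ψ (w, s)) e) (a := 0) (m := 0) ?_ ?_ hint ?_
    · rw [h0, this, zero_sub, hΨa]; simp
    · have h1 := hF (Ψ (w, 0)) ((hmem' (w, 0)).2 le_rfl)
      exact h1.comp (f := fun s : ℝ => Ψ (w, s)) (t := {y | γ (perp e y) ≤ ⟪e, y⟫}) hcs.continuousWithinAt
        (fun s hs => (hmem' (w, s)).2 hs)
    · intro s hs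
      have h1 := (hd _ ((hmem (w, s)).2 hs)).hasFDerivAt
      have h2 : HasDerivAt (fun s : ℝ => Ψ (w, s)) e s := by
        simp only [hΨa]
        have := (((hasDerivAt_id s).const_add (γ w)).smul_const e).const_add (w : E n)
        simpa using this
      exact h1.comp_hasDerivAt s h2
    · refine tendsto_const_nhds.congr' ?_
      filter_upwards [eventually_gt_atTop (max R' 0)] with s hs
      exact (hlast s ((le_max_left _ _).trans_lt hs) ((le_max_right _ _).trans hs.le)).symm
  -- horizontal directions
  set γW : Hyp e → ℝ := fun w => γ w with hγW
  have hγWl : LipschitzWith K γW := by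
    exact LipschitzWith.of_dist_le_mul fun w w' => hγ.dist_le_mul (w : E n) (w' : E n)
  have hγm : ∀ a, Measurable fun w => fderiv ℝ γW w a := fun a =>
    measurable_fderiv_apply_const ℝ γW a
  have hγb : ∀ w a, |fderiv ℝ γW w a| ≤ K * ‖a‖ := fun w a =>
    (ContinuousLinearMap.le_opNorm _ _).trans
      (mul_le_mul_of_nonneg_right (norm_fderiv_le_of_lipschitz ℝ hγWl) (norm_nonneg _))
  have hGi : ∀ a : Hyp e, Integrable (fun p : Hyp e × ℝ => fderiv ℝ γW p.1 a * g e p) π := by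
    intro a
    refine hbox (C := K * ‖a‖ * (M * ‖e‖)) (((hγm a).comp measurable_fst).mul (hgm e)) ?_ ?_
    · intro p
      rw [norm_mul]
      exact mul_le_mul (hγb _ _) (hgC e p) (norm_nonneg _) (by positivity)
    · intro p hp
      exact hgz e p (right_ne_zero_of_mul hp)
  -- On each slice at height `s > 0` the function is Lipschitz with compact support, so the integral
  -- of its line derivative vanishes. By Rademacher and the chain rule this line derivative is
  -- almost everywhere the horizontal derivative of `F` plus the slope of `γ` times the vertical
  -- one.
  have step3 : ∀ (a : Hyp e) (s : ℝ),
      ∫ w, (g (a : E n) (w, s) + fderiv ℝ γW w a * g e (w, s)) = 0 := by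
    intro a s
    by_cases hs : 0 < s
    swap
    · simp [hg, hs]
    set G : Hyp e → ℝ := fun w => F ((w : E n) + (γ w + s) • e) with hG
    have hGl := norm_sub_graph_le he hγ hd hM hs
    have hGc : HasCompactSupport G := by
      refine HasCompactSupport.intro (isCompact_closedBall (0 : Hyp e) (2 * |R|)) fun w hw => ?_
      refine hR _ ((hmem' (w, s)).2 hs.le) ?_
      by_contra hcon
      exact hw (by simpa using (hbd (w, s) (not_lt.1 hcon)).1)
    have h0 := LipschitzWith.integral_lineDeriv_mul_eq (μ := (volume : Measure (Hyp e)))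
      (f := fun _ => (1 : ℝ)) (LipschitzWith.const (1 : ℝ)) hGl hGc (-a)
    simp only [show ∀ x : Hyp e, lineDeriv ℝ (fun _ : Hyp e => (1 : ℝ)) x (-a) = 0 from
      fun x => by simp [lineDeriv], zero_mul, integral_zero, neg_neg, mul_one] at h0
    rw [h0]
    refine integral_congr_ae ?_
    filter_upwards [hγWl.ae_differentiableAt (μ := volume)] with w hw
    have h1 := (hd _ ((hmem (w, s)).2 hs)).hasFDerivAt
    have h2 : HasFDerivAt (fun w : Hyp e => (w : E n) + (γ w + s) • e)
        ((Hyp e).subtypeL + (fderiv ℝ γW w).smulRight e) w :=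
      (Hyp e).subtypeL.hasFDerivAt.add ((hw.hasFDerivAt.add_const s).smul_const e)
    have h3 := (h1.comp w h2).hasLineDerivAt a
    have h4 : lineDeriv ℝ G w a = _ := h3.lineDeriv
    rw [h4]
    simp [hg, hs]
  have step4 : ∀ a : Hyp e, ∫ p, g (a : E n) p ∂π =
      ∫ w, fderiv ℝ γW w a * F ((w : E n) + γ w • e) := by
    intro a
    have h1 : ∫ p, (g (a : E n) p + fderiv ℝ γW p.1 a * g e p) ∂π = 0 := by
      rw [hπ, integral_prod_symm (fun p => g (a : E n) p + fderiv ℝ γW p.1 a * g e p)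
        ((hgi a).add (hGi a))]
      simp only [step3, integral_zero]
    rw [integral_add (hgi a) (hGi a)] at h1
    have h2 : ∫ p, fderiv ℝ γW p.1 a * g e p ∂π =
        - ∫ w, fderiv ℝ γW w a * F ((w : E n) + γ w • e) := by
      rw [hπ, integral_prod _ (hGi a), ← integral_neg]
      refine integral_congr_ae (Eventually.of_forall fun w => ?_)
      simp only
      rw [integral_const_mul, step2]; ring
    linarith
  have step5 : ∫ p, g e p ∂π = - ∫ w : Hyp e, F ((w : E n) + γ w • e) := by
    rw [hπ, integral_prod _ (hgi e), ← integral_neg]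
    exact integral_congr_ae (Eventually.of_forall step2)
  rw [step1]
  congr 1
  have hsplit : ∀ p, g v p = g (perp e v) p + ⟪e, v⟫ * g e p := by
    intro p
    by_cases h : 0 < p.2
    · simp only [hg, h, if_true]
      have : v = perp e v + ⟪e, v⟫ • e := by simp [perp]
      nth_rewrite 1 [this]
      rw [map_add, map_smul, smul_eq_mul]
    · simp [hg, h]
  simp only [hsplit]
  have hFi : Integrable (fun w : Hyp e => F ((w : E n) + γ w • e)) := by
    have := (hgi e).integral_prod_left
    simpa [step2] using this.neg
  rw [integral_add (hgi _) ((hgi e).const_mul _), integral_const_mul, step5,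
    step4 ⟨perp e v, perp_mem he v⟩]
  have hi2 : Integrable (fun w : Hyp e => fderiv ℝ γW w ⟨perp e v, perp_mem he v⟩ *
      F ((w : E n) + γ w • e)) :=
    hFi.bdd_mul (hγm _).aestronglyMeasurable (Eventually.of_forall fun w => hγb w _)
  simp only [sub_mul]
  rw [integral_sub hi2 (hFi.const_mul _), integral_const_mul]
  ring

end GaussGreen

end Graph

/-! ### The boundary measure and the Gauss-Green formula on a Lipschitz domain -/

section BoundaryMeasure

/-- The normalizing factor depends on the dimension alone, so it is the same in both spaces. -/
theorem euclideanHausdorffMeasure_image_le {X Y : Type*} [EMetricSpace X] [MeasurableSpace X]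
    [BorelSpace X] [EMetricSpace Y] [MeasurableSpace Y] [BorelSpace Y] {L : NNReal} {f : X → Y}
    (hf : LipschitzWith L f) (d : ℕ) (s : Set X) :
    (μHE[d] : Measure Y) (f '' s) ≤ (L : ENNReal) ^ d * (μHE[d] : Measure X) s := by
  simp only [euclideanHausdorffMeasure_def, Measure.smul_apply, ENNReal.smul_def, smul_eq_mul]
  rw [mul_left_comm]
  refine mul_le_mul_right ?_ _
  have := hf.hausdorffMeasure_image_le (d := (d : ℝ)) (by positivity) s
  rwa [ENNReal.rpow_natCast] at this

variable {n : ℕ} {e : E n} {γ : E n → ℝ} {K : NNReal}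

/-- The graph map. -/
def graphMap (e : E n) (γ : E n → ℝ) (w : Hyp e) : E n := (w : E n) + γ w • e

/-- The non-normalized exterior normal to the epigraph of `γ`. -/
def graphNormal (e : E n) (γ : E n → ℝ) (w : Hyp e) : E n :=
  ((InnerProductSpace.toDual ℝ (Hyp e)).symm (fderiv ℝ (fun w : Hyp e => γ w) w) : E n) - e

theorem lipschitz_restrict (hγ : LipschitzWith K γ) : LipschitzWith K fun w : Hyp e => γ w :=
  LipschitzWith.of_dist_le_mul fun w w' => hγ.dist_le_mul (w : E n) (w' : E n)

theorem inner_graphNormal (he : ‖e‖ = 1) (w : Hyp e) (v : E n) :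
    ⟪graphNormal e γ w, v⟫ =
      fderiv ℝ (fun w : Hyp e => γ w) w ⟨perp e v, perp_mem he v⟩ - ⟪e, v⟫ := by
  set g := (InnerProductSpace.toDual ℝ (Hyp e)).symm (fderiv ℝ (fun w : Hyp e => γ w) w) with hg
  have h1 : fderiv ℝ (fun w : Hyp e => γ w) w ⟨perp e v, perp_mem he v⟩ =
      ⟪g, (⟨perp e v, perp_mem he v⟩ : Hyp e)⟫ := by
    rw [hg, InnerProductSpace.toDual_symm_apply]
  have h2 : ⟪(g : E n), e⟫ = 0 := by rw [real_inner_comm]; exact inner_coe_hyp g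
  rw [h1, graphNormal, ← hg, inner_sub_left, Submodule.coe_inner]
  simp only [perp]
  rw [inner_sub_right, inner_smul_right, h2]; ring

theorem one_le_norm_graphNormal (he : ‖e‖ = 1) (w : Hyp e) : 1 ≤ ‖graphNormal e γ w‖ := by
  have h := abs_real_inner_le_norm (graphNormal e γ w) e
  rw [he, mul_one, inner_graphNormal he, real_inner_self_eq_norm_sq, he] at h
  have h2 : (⟨perp e e, perp_mem he e⟩ : Hyp e) = 0 := by
    ext1
    simpa using perp_smul_self he (1 : ℝ)
  rw [h2, map_zero] at h
  simpa using h

theorem norm_graphNormal_le (he : ‖e‖ = 1) (hγ : LipschitzWith K γ) (w : Hyp e) :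
    ‖graphNormal e γ w‖ ≤ K + 1 := by
  refine (norm_sub_le _ _).trans ?_
  rw [he, ← Submodule.coe_norm, LinearIsometryEquiv.norm_map]
  exact add_le_add_left (norm_fderiv_le_of_lipschitz ℝ (lipschitz_restrict hγ)) 1

theorem measurable_graphNormal : Measurable (graphNormal e γ) := by
  refine Measurable.sub_const ?_ e
  exact measurable_subtype_coe.comp
    ((InnerProductSpace.toDual ℝ (Hyp e)).symm.continuous.measurable.comp (measurable_fderiv ℝ _))

theorem graphMap_eq (he : ‖e‖ = 1) (hγ : Continuous γ) (w : Hyp e) :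
    graphMap e γ w = graphHomeo he hγ (w, 0) := by
  rw [graphHomeo_apply, graphMap, add_zero]

theorem measurableEmbedding_graphMap (he : ‖e‖ = 1) (hγ : Continuous γ) :
    MeasurableEmbedding (graphMap e γ) := by
  have h1 : graphMap e γ = graphHomeo he hγ ∘ fun w => (w, (0 : ℝ)) :=
    funext (graphMap_eq he hγ)
  rw [h1]
  refine (graphHomeo he hγ).measurableEmbedding.comp ?_
  exact (Continuous.prodMk_left (0 : ℝ)).measurableEmbedding fun a b h => (Prod.ext_iff.1 h).1

theorem lipschitz_graphMap (he : ‖e‖ = 1) (hγ : LipschitzWith K γ) :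
    LipschitzWith (1 + K) (graphMap e γ) := by
  refine LipschitzWith.of_dist_le_mul fun w w' => ?_
  have h := (lipschitz_restrict (e := e) hγ).dist_le_mul w w'
  rw [dist_eq_norm, dist_eq_norm] at *
  have : graphMap e γ w - graphMap e γ w' = ((w - w' : Hyp e) : E n) + (γ w - γ w') • e := by
    simp only [graphMap, Submodule.coe_sub, sub_smul]; abel
  rw [this]
  refine (norm_add_le _ _).trans ?_
  rw [norm_smul, he, mul_one, NNReal.coe_add, NNReal.coe_one, add_mul, one_mul]
  exact add_le_add le_rfl h

variable {Ω : Set (E n)} {x : E n} {r : ℝ}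

theorem IsChart.mem_closure (h : IsChart Ω x e K r γ) {y : E n} (hy : y ∈ Metric.ball x r)
    (hyγ : γ (perp e y) ≤ ⟪e, y⟫) : y ∈ closure Ω := by
  have hlim : Tendsto (fun t : ℝ => y + t • e) (𝓝[>] 0) (𝓝 y) := by
    have : Continuous fun t : ℝ => y + t • e := by fun_prop
    have := (this.tendsto 0).mono_left (nhdsWithin_le_nhds (s := Ioi 0))
    simpa using this
  refine mem_closure_of_tendsto hlim ?_
  filter_upwards [hlim.eventually (Metric.isOpen_ball.mem_nhds hy),
    (self_mem_nhdsWithin : ∀ᶠ t : ℝ in 𝓝[>] 0, 0 < t)] with t ht ht0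
  have ht0' : 0 < t := ht0
  rw [h.mem_iff _ ht, perp_add, perp_smul_self h.norm_e, add_zero, inner_add_right,
    inner_smul_right, real_inner_self_eq_norm_sq, h.norm_e]
  linarith

theorem IsChart.graphMap_mem_frontier (hΩ : IsOpen Ω) (h : IsChart Ω x e K r γ) {w : Hyp e}
    (hw : graphMap e γ w ∈ Metric.ball x r) : graphMap e γ w ∈ frontier Ω := by
  have h1 : γ (perp e (graphMap e γ w)) = ⟪e, graphMap e γ w⟫ := by
    rw [graphMap, perp_graph h.norm_e, inner_graph h.norm_e]
  rw [hΩ.frontier_eq]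
  exact ⟨h.mem_closure hw h1.le, fun hm => ((h.mem_iff _ hw).1 hm).ne h1⟩

/-- In the chart, membership in `Ω` is the inequality `γ (perp e y) < ⟪e, y⟫`. The remainder in the
derivative of `γ` is then exactly the `o(|y - p|)` allowed in the definition of the normal, and
dividing by `‖N‖ ≥ 1` does not enlarge it. -/
theorem IsChart.isOuterNormal (h : IsChart Ω x e K r γ) {w : Hyp e}
    (hw : graphMap e γ w ∈ Metric.ball x r)
    (hd : DifferentiableAt ℝ (fun w : Hyp e => γ w) w) :
    IsOuterNormal Ω (graphMap e γ w) (‖graphNormal e γ w‖⁻¹ • graphNormal e γ w) := by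
  have he := h.norm_e
  set N := graphNormal e γ w with hN
  have hN1 : 1 ≤ ‖N‖ := one_le_norm_graphNormal he w
  have hN0 : 0 < ‖N‖ := by linarith
  refine ⟨by rw [norm_smul, norm_inv, norm_norm, inv_mul_cancel₀ hN0.ne'], fun ε hε => ?_⟩
  set p := graphMap e γ w with hp
  have hpp : perp e p = w := by rw [hp, graphMap, perp_graph he]
  have hpe : ⟪e, p⟫ = γ w := by rw [hp, graphMap, inner_graph he]
  have hproj : Tendsto (fun y : E n => (⟨perp e y, perp_mem he y⟩ : Hyp e)) (𝓝 p) (𝓝 w) := by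
    have hc : Continuous fun y : E n => (⟨perp e y, perp_mem he y⟩ : Hyp e) :=
      (continuous_perp e).subtype_mk _
    have h0 : (⟨perp e p, perp_mem he p⟩ : Hyp e) = w := Subtype.ext hpp
    have := hc.tendsto p
    rwa [h0] at this
  -- The tolerance is halved because the projection to the hyperplane is estimated with norm `2`.
  have hlo := (hd.hasFDerivAt.isLittleO.def (c := ε / 2) (by positivity))
  filter_upwards [hproj.eventually hlo, Metric.isOpen_ball.mem_nhds hw] with y hy hyb
  set η : Hyp e := ⟨perp e y, perp_mem he y⟩ - w with hη
  have hηe : (⟨perp e (y - p), perp_mem he (y - p)⟩ : Hyp e) = η := by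
    ext1
    have : perp e (y - p) + perp e p = perp e y := by rw [← perp_add, sub_add_cancel]
    rw [hη, Submodule.coe_sub]
    simp only
    rw [← this, hpp]; abel
  have hηn : ‖η‖ ≤ 2 * ‖y - p‖ := by
    rw [← hηe]; exact norm_perp_le he (y - p)
  have h1 : ⟪y - p, N⟫ = fderiv ℝ (fun w : Hyp e => γ w) w η - (⟪e, y⟫ - γ w) := by
    rw [real_inner_comm, hN, inner_graphNormal he, hηe, inner_sub_right, hpe]
  have h2 : |γ (perp e y) - γ w - fderiv ℝ (fun w : Hyp e => γ w) w η| ≤ ε * ‖y - p‖ := by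
    rw [Real.norm_eq_abs] at hy
    refine hy.trans ?_
    have := mul_le_mul_of_nonneg_left hηn (by positivity : 0 ≤ ε / 2)
    linarith
  have h3 := abs_le.1 h2
  rw [inner_smul_right, h1]
  set q := fderiv ℝ (fun w : Hyp e => γ w) w η - (⟪e, y⟫ - γ w) with hq
  have hy0 : 0 ≤ ε * ‖y - p‖ := by positivity
  have hinv : ‖N‖⁻¹ ≤ 1 := inv_le_one_of_one_le₀ hN1
  have hinv0 : 0 ≤ ‖N‖⁻¹ := by positivity
  constructor
  · intro hyΩ
    have h4 := (h.mem_iff y hyb).1 hyΩ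
    have hqle : q ≤ ε * ‖y - p‖ := by rw [hq]; linarith [h3.1]
    calc ‖N‖⁻¹ * q ≤ ‖N‖⁻¹ * (ε * ‖y - p‖) := mul_le_mul_of_nonneg_left hqle hinv0
      _ ≤ 1 * (ε * ‖y - p‖) := mul_le_mul_of_nonneg_right hinv hy0
      _ = _ := one_mul _
  · intro hyΩ
    have h4 := not_lt.1 fun hlt => hyΩ ((h.mem_iff y hyb).2 hlt)
    have hqle : -(ε * ‖y - p‖) ≤ q := by rw [hq]; linarith [h3.2]
    calc -(ε * ‖y - p‖) = -(1 * (ε * ‖y - p‖)) := by rw [one_mul]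
      _ ≤ -(‖N‖⁻¹ * (ε * ‖y - p‖)) := neg_le_neg (mul_le_mul_of_nonneg_right hinv hy0)
      _ = ‖N‖⁻¹ * -(ε * ‖y - p‖) := by ring
      _ ≤ ‖N‖⁻¹ * q := mul_le_mul_of_nonneg_left hqle hinv0

/-- `m` is a boundary measure of `Ω` in the ball `B`: it is comparable with the surface measure,
and satisfies the Gauss-Green formula for functions supported in `B`. -/
structure IsLocalBoundaryMeasure (Ω B : Set (E n)) (m : Measure (E n)) (C : NNReal) : Prop where
  finite : IsFiniteMeasure m
  le : m ≤ C • surfaceMeasure Ω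
  ge : (surfaceMeasure Ω).restrict B ≤ C • m
  normal : ∀ᵐ y ∂m, IsOuterNormal Ω y (outerNormal Ω y)
  meas : AEStronglyMeasurable (outerNormal Ω) m
  gaussGreen : ∀ (F : E n → ℝ) (S : Set (E n)) (M : ℝ), IsCompact S → S ⊆ B →
    (∀ y, y ∉ S → F y = 0) → ContinuousOn F (closure Ω) →
    (∀ y ∈ Ω, DifferentiableAt ℝ F y) → (∀ y ∈ Ω, ‖fderiv ℝ F y‖ ≤ M) → ∀ v,
    ∫ y in Ω, fderiv ℝ F y v = ∫ y, F y * ⟪outerNormal Ω y, v⟫ ∂m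

theorem volume_hyp (hn : 1 ≤ n) (he : ‖e‖ = 1) :
    (volume : Measure (Hyp e)) = μHE[n - 1] := by
  obtain ⟨k, rfl⟩ : ∃ k, n = k + 1 := ⟨n - 1, by omega⟩
  have : Fact (Module.finrank ℝ (E (k + 1)) = k + 1) := ⟨by simp⟩
  have h1 : Module.finrank ℝ (Hyp e) = k :=
    Submodule.finrank_orthogonal_span_singleton (by rintro rfl; simp at he)
  rw [← InnerProductSpace.euclideanHausdorffMeasure_eq_volume, h1]; rfl

theorem fderiv_eq_zero_of_notMem {F : E n → ℝ} {S : Set (E n)} (hS : IsCompact S)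
    (hF : ∀ y, y ∉ S → F y = 0) {y : E n} (hy : y ∉ S) :
    DifferentiableAt ℝ F y ∧ fderiv ℝ F y = 0 := by
  have h : F =ᶠ[𝓝 y] fun _ => 0 := by
    filter_upwards [hS.isClosed.isOpen_compl.mem_nhds hy] with z hz using hF z hz
  exact ⟨(differentiableAt_const (0 : ℝ)).congr_of_eventuallyEq h, by rw [h.fderiv_eq]; simp⟩

/-- The measure is the image under the graph map of `c ‖N‖ dw`, restricted to the part over the
ball; the density turns the unnormalized normal of `graph_gauss_green` into the unit normal.
Comparison with the Hausdorff measure needs no area formula: the graph map and its left inverse, the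
projection, are both Lipschitz, and `‖N‖` lies between `1` and `K + 1`. -/
theorem IsChart.exists_localBoundaryMeasure (hn : 1 ≤ n) (hΩ : IsOpen Ω)
    (h : IsChart Ω x e K r γ) :
    ∃ m C, IsLocalBoundaryMeasure Ω (Metric.ball x r) m C := by
  have he := h.norm_e
  have hγ := h.lip
  set B := Metric.ball x r with hB
  set Φ := graphMap e γ with hΦ
  set N := graphNormal e γ with hN
  obtain ⟨c, hc0, hc⟩ := exists_volume_eq_smul_map he hγ.continuous
  have hΦe : MeasurableEmbedding Φ := measurableEmbedding_graphMap he hγ.continuous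
  have hNm : Measurable N := measurable_graphNormal
  have hBm : MeasurableSet B := Metric.isOpen_ball.measurableSet
  set ρ : Hyp e → NNReal := fun w => c * ‖N w‖₊ with hρ
  have hρm : Measurable ρ := hNm.nnnorm.const_mul c
  set μW := ((volume : Measure (Hyp e)).restrict (Φ ⁻¹' B)).withDensity fun w => (ρ w : ENNReal)
    with hμW
  have hpre : MeasurableSet (Φ ⁻¹' B) := hΦe.measurable hBm
  have hms : ∀ s, MeasurableSet s → μW.map Φ s = ∫⁻ w in Φ ⁻¹' (s ∩ B), ρ w := by
    intro s hs
    rw [hΦe.map_apply, hμW, withDensity_apply _ (hΦe.measurable hs),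
      Measure.restrict_restrict (hΦe.measurable hs), preimage_inter]
  have hρle : ∀ w, (ρ w : ENNReal) ≤ (c * (K + 1) : NNReal) := fun w => by
    rw [ENNReal.coe_le_coe]
    refine mul_le_mul_right ?_ c
    exact_mod_cast norm_graphNormal_le he hγ w
  have hρge : ∀ w, (c : ENNReal) ≤ ρ w := fun w => by
    rw [ENNReal.coe_le_coe]
    refine le_mul_of_one_le_right c.2 ?_
    exact_mod_cast one_le_norm_graphNormal he w
  set P : E n → Hyp e := fun y => ⟨perp e y, perp_mem he y⟩ with hP
  have hPΦ : ∀ w, P (Φ w) = w := fun w => Subtype.ext (perp_graph he w _)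
  have hPlip : LipschitzWith 2 P := by
    refine LipschitzWith.of_dist_le_mul fun y y' => ?_
    rw [dist_eq_norm, dist_eq_norm]
    have h0 : perp e (y - y') = perp e y - perp e y' := by
      have : perp e (y - y') + perp e y' = perp e y := by rw [← perp_add, sub_add_cancel]
      rw [← this]; abel
    have : ‖P y - P y'‖ = ‖perp e (y - y')‖ := by rw [h0]; rfl
    rw [this]; exact norm_perp_le he _
  have hvol := volume_hyp hn he
  have hup : ∀ s : Set (E n), (volume : Measure (Hyp e)) (Φ ⁻¹' (s ∩ B)) ≤
      (2 : ENNReal) ^ (n - 1) * (μHE[n - 1] : Measure (E n)) (s ∩ frontier Ω) := by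
    intro s
    have h1 : Φ ⁻¹' (s ∩ B) ⊆ P '' (s ∩ frontier Ω) := fun w hw =>
      ⟨Φ w, ⟨hw.1, h.graphMap_mem_frontier hΩ hw.2⟩, hPΦ w⟩
    rw [hvol]
    refine (measure_mono h1).trans ?_
    exact euclideanHausdorffMeasure_image_le hPlip (n - 1) _
  have hlow : ∀ s : Set (E n), (μHE[n - 1] : Measure (E n)) (s ∩ B ∩ frontier Ω) ≤
      ((1 + K : NNReal) : ENNReal) ^ (n - 1) * (volume : Measure (Hyp e)) (Φ ⁻¹' (s ∩ B)) := by
    intro s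
    have h1 : s ∩ B ∩ frontier Ω ⊆ Φ '' (Φ ⁻¹' (s ∩ B)) := by
      intro y hy
      have hy' : Φ (P y) = y := by
        have := h.eq_of_mem_frontier hΩ hy.1.2 hy.2
        simp only [hΦ, graphMap, hP]
        rw [this, perp]; abel
      exact ⟨P y, by rw [mem_preimage, hy']; exact hy.1, hy'⟩
    rw [hvol]
    refine (measure_mono h1).trans ?_
    exact euclideanHausdorffMeasure_image_le (lipschitz_graphMap he hγ) (n - 1) _
  have hnormal : ∀ᵐ w ∂μW, IsOuterNormal Ω (Φ w) (‖N w‖⁻¹ • N w) := by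
    refine (withDensity_absolutelyContinuous _ _).ae_le ?_
    refine (ae_restrict_iff' hpre).2 ?_
    filter_upwards [(lipschitz_restrict (e := e) hγ).ae_differentiableAt (μ := volume)] with w hw hwB
    exact h.isOuterNormal hwB hw
  set C : NNReal := max (c * (K + 1) * 2 ^ (n - 1)) ((1 + K) ^ (n - 1) * c⁻¹) with hC
  refine ⟨μW.map Φ, C, ?_⟩
  refine ⟨⟨?_⟩, ?_, ?_, ?_, ?_, ?_⟩
  · rw [hms _ MeasurableSet.univ, univ_inter]
    have hb : Φ ⁻¹' B ⊆ Metric.closedBall 0 (2 * (‖x‖ + r)) := by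
      intro w hw
      rw [mem_closedBall_zero_iff]
      have h1 : ‖P (Φ w)‖ ≤ 2 * ‖Φ w‖ := norm_perp_le he _
      rw [hPΦ] at h1
      have h2 : dist (Φ w) x < r := hw
      rw [dist_eq_norm] at h2
      have h3 : ‖Φ w‖ ≤ ‖Φ w - x‖ + ‖x‖ := by simpa using norm_add_le (Φ w - x) x
      linarith
    refine (lintegral_mono hρle).trans_lt ?_
    rw [lintegral_const, Measure.restrict_apply_univ]
    exact ENNReal.mul_lt_top ENNReal.coe_lt_top
      ((measure_mono hb).trans_lt (isCompact_closedBall _ _).measure_lt_top)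
  · refine Measure.le_iff.2 fun s hs => ?_
    rw [hms s hs]
    refine (lintegral_mono hρle).trans ?_
    rw [lintegral_const, Measure.restrict_apply_univ]
    refine (mul_le_mul_right (hup s) _).trans ?_
    rw [Measure.smul_apply, surfaceMeasure, Measure.restrict_apply hs, ENNReal.smul_def,
      smul_eq_mul, ← mul_assoc]
    refine mul_le_mul_left ?_ _
    calc ((c * (K + 1) : NNReal) : ENNReal) * 2 ^ (n - 1)
        = ((c * (K + 1) * 2 ^ (n - 1) : NNReal) : ENNReal) := by push_cast; rfl
      _ ≤ C := ENNReal.coe_le_coe.2 (le_max_left _ _)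
  · refine Measure.le_iff.2 fun s hs => ?_
    rw [Measure.restrict_apply hs, surfaceMeasure, Measure.restrict_apply (hs.inter hBm),
      Measure.smul_apply, hms s hs]
    refine (hlow s).trans ?_
    have h1 : (c : ENNReal) * (volume : Measure (Hyp e)) (Φ ⁻¹' (s ∩ B)) ≤
        ∫⁻ w in Φ ⁻¹' (s ∩ B), ρ w := by
      rw [← Measure.restrict_apply_univ, ← lintegral_const]
      exact lintegral_mono hρge
    rw [ENNReal.smul_def, smul_eq_mul]
    have h2 : (((1 + K) ^ (n - 1) * c⁻¹ : NNReal) : ENNReal) ≤ C :=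
      ENNReal.coe_le_coe.2 (le_max_right _ _)
    refine le_trans ?_ (mul_le_mul' h2 h1)
    rw [ENNReal.coe_mul, mul_assoc, ← mul_assoc (_ : ENNReal) (c : ENNReal), ← ENNReal.coe_mul,
      inv_mul_cancel₀ hc0, ENNReal.coe_one, one_mul, ENNReal.coe_pow]
  · rw [hΦe.ae_map_iff]
    filter_upwards [hnormal] with w hw
    rw [hw.outerNormal_eq]; exact hw
  · refine ⟨fun y => ‖N (P y)‖⁻¹ • N (P y), ?_, ?_⟩
    · have h1 : Measurable fun y => N (P y) := hNm.comp hPlip.continuous.measurable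
      exact (h1.norm.inv.smul h1).stronglyMeasurable
    · rw [Filter.EventuallyEq, hΦe.ae_map_iff]
      filter_upwards [hnormal] with w hw
      rw [hw.outerNormal_eq, hPΦ]
  · intro F S M hS hSB hF0 hFc hFd hFM v
    have hoff := fun y (hy : y ∉ S) => fderiv_eq_zero_of_notMem hS hF0 hy
    have hmemΩ : ∀ y ∈ S, (y ∈ Ω ↔ γ (perp e y) < ⟪e, y⟫) := fun y hy => h.mem_iff y (hSB hy)
    have hopen : IsOpen {y : E n | γ (perp e y) < ⟪e, y⟫} :=
      isOpen_lt (hγ.continuous.comp (continuous_perp e)) (by fun_prop)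
    obtain ⟨R, hR⟩ := hS.isBounded.subset_closedBall (0 : E n)
    have key := graph_gauss_green he hγ hc (F := F) (M := max M 0) (R := R) ?_ ?_ ?_ ?_ v
    · have e1 : ∫ y in Ω, fderiv ℝ F y v =
          ∫ y in {y | γ (perp e y) < ⟪e, y⟫}, fderiv ℝ F y v := by
        rw [← integral_indicator hΩ.measurableSet, ← integral_indicator hopen.measurableSet]
        refine integral_congr_ae (Eventually.of_forall fun y => ?_)
        by_cases hy : y ∈ S
        · by_cases hyΩ : y ∈ Ω
          · rw [Set.indicator_of_mem hyΩ, Set.indicator_of_mem]; exact (hmemΩ y hy).1 hyΩ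
          · rw [Set.indicator_of_notMem hyΩ, Set.indicator_of_notMem]
            exact fun hh => hyΩ ((hmemΩ y hy).2 hh)
        · simp [Set.indicator_apply, (hoff y hy).2]
      rw [e1, key, hΦe.integral_map, hμW, integral_withDensity_eq_integral_smul hρm]
      rw [← integral_const_mul, ← integral_indicator hpre]
      have hae : ∀ᵐ w ∂(volume : Measure (Hyp e)), w ∈ Φ ⁻¹' B →
          IsOuterNormal Ω (Φ w) (‖N w‖⁻¹ • N w) := by
        filter_upwards [(lipschitz_restrict (e := e) hγ).ae_differentiableAt (μ := volume)]
          with w hw hwB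
        exact h.isOuterNormal hwB hw
      refine integral_congr_ae ?_
      filter_upwards [hae] with w hw
      by_cases hwB : w ∈ Φ ⁻¹' B
      · rw [Set.indicator_of_mem hwB, (hw hwB).outerNormal_eq, ← inner_graphNormal he w v,
          real_inner_smul_left]
        have h1 : ‖N w‖ ≠ 0 := by
          have := one_le_norm_graphNormal (γ := γ) he w
          rw [← hN] at this; linarith
        simp only [hρ, NNReal.smul_def, NNReal.coe_mul, coe_nnnorm, smul_eq_mul]
        change (c : ℝ) * (⟪N w, v⟫ * F (Φ w)) = _
        field_simp
      · rw [Set.indicator_of_notMem hwB]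
        have : F (Φ w) = 0 := hF0 _ fun hs => hwB (hSB hs)
        change (c : ℝ) * (_ * F (Φ w)) = 0
        rw [this]; ring
    · intro y hy
      by_cases hyS : y ∈ S
      · exact hFd y ((hmemΩ y hyS).2 hy)
      · exact (hoff y hyS).1
    · intro y hy
      by_cases hyS : y ∈ S
      · exact (hFM y ((hmemΩ y hyS).2 hy)).trans (le_max_left _ _)
      · rw [(hoff y hyS).2, norm_zero]; exact le_max_right _ _
    · intro y hy
      by_cases hyS : y ∈ S
      · have hyB := hSB hyS
        refine (hFc y (h.mem_closure hyB hy)).mono_of_mem_nhdsWithin ?_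
        filter_upwards [self_mem_nhdsWithin,
          mem_nhdsWithin_of_mem_nhds (Metric.isOpen_ball.mem_nhds hyB)] with z hz hzB
        exact h.mem_closure hzB hz
      · exact (hoff y hyS).1.continuousAt.continuousWithinAt
    · intro y _ hyR
      refine hF0 y fun hyS => ?_
      have := hR hyS
      rw [mem_closedBall_zero_iff] at this
      linarith

end BoundaryMeasure

/-! ### A boundary measure of a Lipschitz domain with an exact Gauss-Green formula -/

section GlobalBoundaryMeasure

variable {n : ℕ} {Ω : Set (E n)}

/-- `m` is a finite measure comparable with the surface measure for which the Gauss-Green formula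
holds. -/
structure IsGaussGreenMeasure (Ω : Set (E n)) (m : Measure (E n)) (C : NNReal) : Prop where
  finite : IsFiniteMeasure m
  le : m ≤ C • surfaceMeasure Ω
  ge : surfaceMeasure Ω ≤ C • m
  normal : ∀ᵐ y ∂m, IsOuterNormal Ω y (outerNormal Ω y)
  meas : AEStronglyMeasurable (outerNormal Ω) m
  gaussGreen : ∀ (F : E n → ℝ) (M : ℝ), ContinuousOn F (closure Ω) →
    (∀ y ∈ Ω, DifferentiableAt ℝ F y) → (∀ y ∈ Ω, ‖fderiv ℝ F y‖ ≤ M) → ∀ v,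
    ∫ y in Ω, fderiv ℝ F y v = ∫ y, F y * ⟪outerNormal Ω y, v⟫ ∂m

/-- A ball inside `Ω` does not meet the boundary, and the derivative of a compactly supported
function integrates to zero. Interior patches thus fit the same gluing as boundary patches. -/
theorem isLocalBoundaryMeasure_zero (hΩ : IsOpen Ω) {B : Set (E n)} (hB : B ⊆ Ω) :
    IsLocalBoundaryMeasure Ω B 0 0 := by
  refine ⟨inferInstance, Measure.zero_le _, ?_, by simp, ?_, ?_⟩
  · have h1 : (surfaceMeasure Ω).restrict B ≤ (surfaceMeasure Ω).restrict Ω :=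
      Measure.restrict_mono hB le_rfl
    rw [surfaceMeasure, Measure.restrict_restrict hΩ.measurableSet, inter_comm, hΩ.frontier_eq,
      sdiff_inter_self, Measure.restrict_empty] at h1
    simpa [surfaceMeasure, hΩ.frontier_eq] using h1
  · exact aestronglyMeasurable_zero_measure _
  · intro F S M hS hSB hF0 hFc hFd hFM v
    have hoff := fun y (hy : y ∉ S) => fderiv_eq_zero_of_notMem hS hF0 hy
    have hd : Differentiable ℝ F := fun y => by
      by_cases hy : y ∈ S
      · exact hFd y (hB (hSB hy))
      · exact (hoff y hy).1
    have hcs : HasCompactSupport F := HasCompactSupport.intro hS hF0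
    have hb : ∀ y, ‖fderiv ℝ F y v‖ ≤ max M 0 * ‖v‖ := fun y => by
      refine (ContinuousLinearMap.le_opNorm _ _).trans ?_
      refine mul_le_mul_of_nonneg_right ?_ (norm_nonneg _)
      by_cases hy : y ∈ S
      · exact (hFM y (hB (hSB hy))).trans (le_max_left _ _)
      · rw [(hoff y hy).2, norm_zero]; exact le_max_right _ _
    have hint : Integrable (fun y => fderiv ℝ F y v) := by
      have h1 : IntegrableOn (fun y => fderiv ℝ F y v) S := by
        refine Measure.integrableOn_of_bounded hS.measure_lt_top.ne
          (measurable_fderiv_apply_const ℝ F v).aestronglyMeasurable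
          (M := max M 0 * ‖v‖) (Eventually.of_forall hb)
      refine h1.integrable_of_forall_notMem_eq_zero fun y hy => ?_
      rw [(hoff y hy).2]; rfl
    rw [integral_zero_measure, setIntegral_eq_integral_of_forall_compl_eq_zero fun y hy => by
      rw [(hoff y fun h => hy (hB (hSB h))).2]; rfl]
    have := integral_mul_fderiv_eq_neg_fderiv_mul_of_integrable (μ := (volume : Measure (E n)))
      (f := fun _ => (1 : ℝ)) (g := F) (v := v) (by simp) (by simpa using hint)
      (by simpa using hd.continuous.integrable_of_hasCompactSupport hcs)
      (fun x _ => differentiableAt_const _) (fun x _ => hd x)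
    simpa using this

/-- The local measures are glued as the sum of `χ_x m_x`. The Gauss-Green formula is linear in `F`,
so it suffices to apply the local formulas to the functions `χ_x F`, whose sum is `F` on the
closure. -/
theorem IsLipschitzDomain.exists_gaussGreenMeasure (hn : 1 ≤ n) (hΩ : IsLipschitzDomain Ω) :
    ∃ m C, IsGaussGreenMeasure Ω m C := by
  have hloc : ∀ x : E n, ∃ (r : ℝ) (m : Measure (E n)) (C : NNReal), x ∈ closure Ω →
      0 < r ∧ IsLocalBoundaryMeasure Ω (Metric.ball x r) m C := by
    intro x
    by_cases hx : x ∈ closure Ω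
    · by_cases hxΩ : x ∈ Ω
      · obtain ⟨r, hr, hb⟩ := Metric.isOpen_iff.1 hΩ.isOpen x hxΩ
        exact ⟨r, 0, 0, fun _ => ⟨hr, isLocalBoundaryMeasure_zero hΩ.isOpen hb⟩⟩
      · have hxf : x ∈ frontier Ω := by
          rw [frontier, hΩ.isOpen.interior_eq]; exact ⟨hx, hxΩ⟩
        obtain ⟨e, K, r, γ, h⟩ := hΩ.exists_chart hxf
        obtain ⟨m, C, hm⟩ := h.exists_localBoundaryMeasure hn hΩ.isOpen
        exact ⟨r, m, C, fun _ => ⟨h.pos, hm⟩⟩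
    · exact ⟨0, 0, 0, fun h => absurd h hx⟩
  choose r m C hm using hloc
  obtain ⟨t, χ, htK, hχs, hχc, hχt, hχ0, hχ1⟩ :=
    exists_smooth_partition hΩ.isCompact_closure r fun x hx => (hm x hx).1
  have hL := fun x : t => (hm x (htK x x.2)).2
  have hfin := fun x : t => (hL x).finite
  have hχm : ∀ x, Measurable fun y => ENNReal.ofReal (χ x y) := fun x =>
    (hχs x).continuous.measurable.ennreal_ofReal
  have hbd : ∀ x : t, ∃ M : NNReal, ∀ y, χ x y ≤ M := fun x => by
    obtain ⟨M, hM⟩ := (hχs x).continuous.bounded_above_of_compact_support (hχc x x.2)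
    exact ⟨M.toNNReal, fun y => (le_abs_self _).trans ((hM y).trans (Real.le_coe_toNNReal M))⟩
  choose M hM using hbd
  have hdens : ∀ (x : t) (μ : Measure (E n)),
      μ.withDensity (fun y => ENNReal.ofReal (χ x y)) ≤ M x • μ := fun x μ => by
    refine (withDensity_mono (g := fun _ => (M x : ENNReal)) (Eventually.of_forall fun y => ?_)).trans
      (by rw [withDensity_const]; exact le_rfl)
    rw [← ENNReal.ofReal_coe_nnreal]; exact ENNReal.ofReal_le_ofReal (hM x y)
  set μ : t → Measure (E n) := fun x => (m x).withDensity fun y => ENNReal.ofReal (χ x y) with hμ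
  have hμfin : ∀ x, IsFiniteMeasure (μ x) := fun x => by
    have := hfin x
    exact isFiniteMeasure_of_le _ (hdens x _)
  have hμac : ∀ x, μ x ≪ m x := fun x => withDensity_absolutelyContinuous _ _
  have hχK : ∀ y ∈ closure Ω, ∑ x : t, χ x y = 1 := fun y hy => by
    rw [← hχ1 y hy]; exact Finset.sum_coe_sort t fun x => χ x y
  -- The summands `M x * C x` serve the upper comparison with the surface measure, the summands `C
  -- x` the lower one.
  refine ⟨Measure.sum μ, ∑ x : t, (M x * C x + C x), ?_⟩
  have hμσ : ∀ (x : t) s, MeasurableSet s → μ x s ≤ (M x * C x : NNReal) * surfaceMeasure Ω s := by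
    intro x s hs
    refine ((hdens x _) s).trans ?_
    rw [Measure.smul_apply, ENNReal.smul_def, smul_eq_mul, ENNReal.coe_mul, mul_assoc]
    refine mul_le_mul_right ((hL x).le s) _
  have hfront : ∀ x : t, ∀ᵐ y ∂(μ x), y ∈ closure Ω := fun x => by
    have h1 : μ x (closure Ω)ᶜ ≤ _ := hμσ x _ isClosed_closure.measurableSet.compl
    rw [surfaceMeasure, Measure.restrict_apply isClosed_closure.measurableSet.compl] at h1
    have h2 : (closure Ω)ᶜ ∩ frontier Ω = ∅ :=
      subset_empty_iff.1 fun y hy => hy.1 (frontier_subset_closure hy.2)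
    rw [h2, measure_empty, mul_zero] at h1
    exact le_antisymm h1 (zero_le)
  refine ⟨?_, ?_, ?_, ?_, ?_, ?_⟩
  · rw [Measure.sum_fintype]; infer_instance
  · refine Measure.le_iff.2 fun s hs => ?_
    rw [Measure.sum_fintype, Measure.finsetSum_apply, Measure.smul_apply, ENNReal.smul_def,
      smul_eq_mul, ENNReal.ofNNReal_finsetSum, Finset.sum_mul]
    refine Finset.sum_le_sum fun x _ => (hμσ x s hs).trans (mul_le_mul_left ?_ _)
    exact ENNReal.coe_le_coe.2 (le_add_of_nonneg_right (C x).2)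
  · refine Measure.le_iff.2 fun s hs => ?_
    have h1 : surfaceMeasure Ω s = ∑ x : t, ∫⁻ y in s, ENNReal.ofReal (χ x y) ∂surfaceMeasure Ω := by
      rw [← lintegral_finsetSum (Finset.univ : Finset t) fun x _ => hχm x, ← setLIntegral_one]
      refine lintegral_congr_ae (ae_restrict_of_ae ?_)
      filter_upwards [ae_restrict_mem isClosed_frontier.measurableSet] with y hy
      rw [← ENNReal.ofReal_sum_of_nonneg (s := (Finset.univ : Finset t)) fun x _ => hχ0 x y,
        hχK y (frontier_subset_closure hy), ENNReal.ofReal_one]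
    rw [h1, Measure.smul_apply, ENNReal.smul_def, smul_eq_mul, Measure.sum_fintype,
      Measure.finsetSum_apply, Finset.mul_sum]
    refine Finset.sum_le_sum fun x _ => ?_
    have hB : MeasurableSet (Metric.ball (x : E n) (r x)) := Metric.isOpen_ball.measurableSet
    have h2 : ∫⁻ y in s, ENNReal.ofReal (χ x y) ∂surfaceMeasure Ω =
        ∫⁻ y in s, ENNReal.ofReal (χ x y) ∂(surfaceMeasure Ω).restrict (Metric.ball x (r x)) := by
      rw [← Measure.restrict_comm (t := s) hB, ← lintegral_indicator hB]
      refine lintegral_congr fun y => ?_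
      by_cases hy : y ∈ Metric.ball (x : E n) (r x)
      · rw [indicator_of_mem hy]
      · rw [indicator_of_notMem hy, image_eq_zero_of_notMem_tsupport fun h => hy (hχt x x.2 h),
          ENNReal.ofReal_zero]
    have h3 := lintegral_mono' (Measure.restrict_mono (le_refl s) (hL x).ge)
      (le_refl fun y => ENNReal.ofReal (χ x y))
    rw [h2]
    refine h3.trans ?_
    rw [Measure.restrict_smul, ENNReal.smul_def, lintegral_smul_measure, smul_eq_mul, hμ,
      withDensity_apply _ hs]
    refine mul_le_mul_left (ENNReal.coe_le_coe.2 ?_) _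
    calc C x ≤ M x * C x + C x := le_add_of_nonneg_left (M x * C x).2
      _ ≤ _ := Finset.single_le_sum (f := fun x : t => M x * C x + C x) (fun _ _ => zero_le)
        (Finset.mem_univ x)
  · rw [Measure.ae_sum_iff]
    exact fun x => (hμac x).ae_le (hL x).normal
  · rw [aestronglyMeasurable_sum_measure_iff]
    exact fun x => (hL x).meas.mono_ac (hμac x)
  · intro F B hFc hFd hFB v
    obtain ⟨B₀, hB₀⟩ := hΩ.isCompact_closure.exists_bound_of_continuousOn hFc
    have hχ' : ∀ x : t, ∃ D : ℝ, ∀ y, ‖fderiv ℝ (χ x) y‖ ≤ D := fun x =>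
      ((hχs x).continuous_fderiv (by simp)).bounded_above_of_compact_support
        ((hχc x x.2).fderiv (𝕜 := ℝ))
    choose D hD using hχ'
    have hχd : ∀ x y, DifferentiableAt ℝ (χ x) y := fun x y =>
      (hχs x).differentiable (by simp) y
    have hd : ∀ x : t, ∀ y ∈ Ω, HasFDerivAt (fun z => χ x z * F z)
        (χ x y • fderiv ℝ F y + F y • fderiv ℝ (χ x) y) y := fun x y hy =>
      (hχd x y).hasFDerivAt.mul (hFd y hy).hasFDerivAt
    have hdB : ∀ x : t, ∀ y ∈ Ω, ‖fderiv ℝ (fun z => χ x z * F z) y‖ ≤ M x * B + B₀ * D x := by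
      intro x y hy
      rw [(hd x y hy).fderiv]
      refine (norm_add_le _ _).trans (add_le_add ?_ ?_)
      · rw [norm_smul, Real.norm_of_nonneg (hχ0 x y)]
        exact mul_le_mul (hM x y) (hFB y hy) (norm_nonneg _) (M x).2
      · rw [norm_smul]
        exact mul_le_mul (hB₀ y (subset_closure hy)) (hD x y) (norm_nonneg _)
          ((norm_nonneg _).trans (hB₀ y (subset_closure hy)))
    have hvol : volume Ω ≠ ⊤ := hΩ.isBounded.measure_lt_top.ne
    have hint : ∀ x : t, IntegrableOn (fun y => fderiv ℝ (fun z => χ x z * F z) y v) Ω := fun x =>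
      Measure.integrableOn_of_bounded hvol (measurable_fderiv_apply_const ℝ _ v).aestronglyMeasurable
        (M := (M x * B + B₀ * D x) * ‖v‖) <| (ae_restrict_iff' hΩ.isOpen.measurableSet).2 <|
          Eventually.of_forall fun y hy => (ContinuousLinearMap.le_opNorm _ _).trans
            (mul_le_mul_of_nonneg_right (hdB x y hy) (norm_nonneg _))
    have h1 : ∫ y in Ω, fderiv ℝ F y v =
        ∑ x : t, ∫ y in Ω, fderiv ℝ (fun z => χ x z * F z) y v := by
      rw [← integral_finsetSum _ fun x _ => hint x]
      refine setIntegral_congr_fun hΩ.isOpen.measurableSet fun y hy => ?_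
      have h2 : F =ᶠ[𝓝 y] fun z => ∑ x : t, χ x z * F z := by
        filter_upwards [hΩ.isOpen.mem_nhds hy] with z hz
        rw [← Finset.sum_mul, hχK z (subset_closure hz), one_mul]
      have h3 := HasFDerivAt.fun_sum fun (x : t) (_ : x ∈ Finset.univ) => hd x y hy
      change fderiv ℝ F y v = _
      rw [h2.fderiv_eq, h3.fderiv, FunLike.coe_sum, Finset.sum_apply]
      exact Finset.sum_congr rfl fun x _ => by rw [(hd x y hy).fderiv]
    have hFm : ∀ x : t, AEStronglyMeasurable F (μ x) := fun x => by
      rw [← Measure.restrict_eq_self_of_ae_mem (hfront x)]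
      exact hFc.aestronglyMeasurable isClosed_closure.measurableSet
    have hint2 : ∀ x : t, Integrable (fun y => F y * ⟪outerNormal Ω y, v⟫) (μ x) := fun x => by
      refine Integrable.of_bound
        ((hFm x).mul (((hL x).meas.mono_ac (hμac x)).inner aestronglyMeasurable_const))
        (B₀ * ‖v‖) ?_
      filter_upwards [hfront x, (hμac x).ae_le (hL x).normal] with y hy hy'
      rw [norm_mul]
      refine mul_le_mul (hB₀ y hy) ((norm_inner_le_norm _ _).trans ?_) (norm_nonneg _)
        ((norm_nonneg _).trans (hB₀ y hy))
      rw [hy'.1, one_mul]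
    rw [h1, Measure.sum_fintype, integral_finsetSum_measure fun x _ => hint2 x]
    refine Finset.sum_congr rfl fun x _ => ?_
    rw [(hL x).gaussGreen (fun z => χ x z * F z) (tsupport (χ x)) (M x * B + B₀ * D x) (hχc x x.2)
      (hχt x x.2) (fun y hy => by rw [image_eq_zero_of_notMem_tsupport hy, zero_mul])
      ((hχs x).continuous.continuousOn.mul hFc) (fun y hy => (hd x y hy).differentiableAt)
      (hdB x) v, integral_withDensity_eq_integral_toReal_smul (hχm x)
        (Eventually.of_forall fun _ => ENNReal.ofReal_lt_top)]
    refine integral_congr_ae (Eventually.of_forall fun y => ?_)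
    change χ x y * F y * _ = (ENNReal.ofReal (χ x y)).toReal * _
    rw [ENNReal.toReal_ofReal (hχ0 x y), mul_assoc]

end GlobalBoundaryMeasure

/-! ### The Gauss-Green formula on the cylinder -/

/-- The Gauss-Green formula on `D`, in the directions `dir i`, with the boundary measure `μ` and
the normal components `N · i`. -/
structure IsGaussGreen {V ι : Type*} [NormedAddCommGroup V] [NormedSpace ℝ V] [MeasureSpace V]
    (D : Set V) (dir : ι → V) (μ : Measure V) (N : V → ι → ℝ) : Prop where
  finite : IsFiniteMeasure μ
  ae_mem : ∀ᵐ z ∂μ, z ∈ closure D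
  meas : ∀ i, AEStronglyMeasurable (fun z => N z i) μ
  bound : ∀ᵐ z ∂μ, ∀ i, |N z i| ≤ 1
  green : ∀ F : V → ℝ, ContDiffOn ℝ 1 F (closure D) → ∀ i,
    ∫ z in D, fderivWithin ℝ F (closure D) z (dir i) = ∫ z, F z * N z i ∂μ

section CylinderGaussGreen

variable {n : ℕ} {Ω : Set (E n)} {t₁ t₂ : ℝ}

/-- The space-time coordinate directions. -/
def dirQ : Option (Fin n) → E n × ℝ
  | none => dirT
  | some i => dirX i

open Classical in
/-- The components of the exterior normal of the cylinder. -/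
def cylNormal (Ω : Set (E n)) (t₁ t₂ : ℝ) (z : E n × ℝ) : Option (Fin n) → ℝ
  | none => if z.2 ∈ Ioo t₁ t₂ then 0 else if z.2 = t₂ then 1 else -1
  | some i => if z.2 ∈ Ioo t₁ t₂ then outerNormal Ω z.1 i else 0

/-- The boundary measure of the cylinder built from a boundary measure of the base. -/
def cylMeasure (Ω : Set (E n)) (t₁ t₂ : ℝ) (m : Measure (E n)) : Measure (E n × ℝ) :=
  m.prod (volume.restrict (Ioo t₁ t₂)) + endMeasure Ω t₁ t₂

theorem isOpen_cyl (hΩ : IsLipschitzDomain Ω) : IsOpen (cyl Ω t₁ t₂) := hΩ.isOpen.prod isOpen_Ioo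

theorem volume_restrict_cyl : (volume : Measure (E n × ℝ)).restrict (cyl Ω t₁ t₂) =
    (volume.restrict Ω).prod (volume.restrict (Ioo t₁ t₂)) := by
  rw [Measure.prod_restrict]; rfl

theorem endMeasure_eq : endMeasure Ω t₁ t₂ =
    (volume.restrict Ω).map (fun x => (x, t₁)) + (volume.restrict Ω).map (fun x => (x, t₂)) := by
  rw [endMeasure, Measure.prod_add, Measure.prod_dirac, Measure.prod_dirac]

theorem measurableEmbedding_slice (t : ℝ) : MeasurableEmbedding fun x : E n => (x, t) :=
  (Continuous.prodMk_left t).measurableEmbedding fun _ _ h => (Prod.ext_iff.1 h).1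

theorem ae_endMeasure {p : E n × ℝ → Prop} : (∀ᵐ z ∂endMeasure Ω t₁ t₂, p z) ↔
    (∀ᵐ x ∂volume.restrict Ω, p (x, t₁)) ∧ ∀ᵐ x ∂volume.restrict Ω, p (x, t₂) := by
  rw [endMeasure_eq, ae_add_measure_iff, (measurableEmbedding_slice t₁).ae_map_iff,
    (measurableEmbedding_slice t₂).ae_map_iff]

variable {m : Measure (E n)} {C : NNReal}

theorem IsGaussGreenMeasure.ae_mem_frontier (hm : IsGaussGreenMeasure Ω m C) :
    ∀ᵐ y ∂m, y ∈ frontier Ω := by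
  have h1 : m ≪ surfaceMeasure Ω :=
    (Measure.absolutelyContinuous_of_le hm.le).trans (Measure.smul_absolutelyContinuous)
  exact h1.ae_le (ae_restrict_mem isClosed_frontier.measurableSet)

theorem ae_lateral (hm : IsGaussGreenMeasure Ω m C) :
    ∀ᵐ z ∂m.prod (volume.restrict (Ioo t₁ t₂)),
      z.1 ∈ frontier Ω ∧ IsOuterNormal Ω z.1 (outerNormal Ω z.1) ∧ z.2 ∈ Ioo t₁ t₂ := by
  have := hm.finite
  have h1 : ∀ᵐ z ∂m.prod (volume.restrict (Ioo t₁ t₂)),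
      z.1 ∈ frontier Ω ∧ IsOuterNormal Ω z.1 (outerNormal Ω z.1) :=
    quasiMeasurePreserving_fst.ae (hm.ae_mem_frontier.and hm.normal)
  have h2 : ∀ᵐ z ∂m.prod (volume.restrict (Ioo t₁ t₂)), z.2 ∈ Ioo t₁ t₂ :=
    quasiMeasurePreserving_snd.ae (ae_restrict_mem measurableSet_Ioo)
  filter_upwards [h1, h2] with z hz1 hz2 using ⟨hz1.1, hz1.2, hz2⟩

theorem isFiniteMeasure_endMeasure (hΩ : IsLipschitzDomain Ω) :
    IsFiniteMeasure (endMeasure Ω t₁ t₂) := by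
  have : IsFiniteMeasure ((volume : Measure (E n)).restrict Ω) :=
    ⟨by rw [Measure.restrict_apply_univ]; exact hΩ.isBounded.measure_lt_top⟩
  rw [endMeasure]; infer_instance

/-- Fubini in both cases: for a spatial direction the formula on `Ω` at each fixed time, for the
time direction the fundamental theorem of calculus at each fixed point. The normal has no time
component on the lateral side and no spatial component on the ends, so the cross contributions
vanish. -/
theorem cyl_isGaussGreen (hΩ : IsLipschitzDomain Ω) (ht : t₁ < t₂)
    (hm : IsGaussGreenMeasure Ω m C) :
    IsGaussGreen (cyl Ω t₁ t₂) dirQ (cylMeasure Ω t₁ t₂ m) (cylNormal Ω t₁ t₂) := by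
  have hmf := hm.finite
  have hef := isFiniteMeasure_endMeasure (t₁ := t₁) (t₂ := t₂) hΩ
  have hΩf : IsFiniteMeasure ((volume : Measure (E n)).restrict Ω) :=
    ⟨by rw [Measure.restrict_apply_univ]; exact hΩ.isBounded.measure_lt_top⟩
  have hK := hΩ.isCompact_closure_cyl ht
  have hU := hΩ.uniqueDiffOn_cyl ht
  have hKe := closure_cyl (Ω := Ω) ht
  have hlat := ae_lateral (t₁ := t₁) (t₂ := t₂) hm
  have hD : IsOpen (cyl Ω t₁ t₂) := isOpen_cyl hΩ
  set D := cyl Ω t₁ t₂ with hDdef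
  set K := closure D with hKdef
  set L := m.prod ((volume : Measure ℝ).restrict (Ioo t₁ t₂)) with hL
  have hfin : IsFiniteMeasure (cylMeasure Ω t₁ t₂ m) := by rw [cylMeasure]; infer_instance
  have hLK : ∀ᵐ z ∂L, z ∈ K := by
    filter_upwards [hlat] with z hz
    rw [hKe]; exact ⟨frontier_subset_closure hz.1, Ioo_subset_Icc_self hz.2.2⟩
  have hEK : ∀ᵐ z ∂endMeasure Ω t₁ t₂, z ∈ K := by
    rw [ae_endMeasure, hKe]
    constructor <;> filter_upwards [ae_restrict_mem hΩ.isOpen.measurableSet] with x hx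
    · exact ⟨subset_closure hx, left_mem_Icc.2 ht.le⟩
    · exact ⟨subset_closure hx, right_mem_Icc.2 ht.le⟩
  have hEN : ∀ᵐ z ∂endMeasure Ω t₁ t₂, z.2 ∉ Ioo t₁ t₂ := by
    rw [ae_endMeasure]; simp
  have hmem : ∀ᵐ z ∂cylMeasure Ω t₁ t₂ m, z ∈ K := by
    rw [cylMeasure, ae_add_measure_iff]; exact ⟨hLK, hEK⟩
  have hNs : ∀ i, (fun z => cylNormal Ω t₁ t₂ z (some i)) =ᵐ[L] fun z => outerNormal Ω z.1 i := by
    intro i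
    filter_upwards [hlat] with z hz
    simp only [cylNormal, if_pos hz.2.2]
  have hNs' : ∀ i, (fun z => cylNormal Ω t₁ t₂ z (some i)) =ᵐ[endMeasure Ω t₁ t₂] 0 := by
    intro i
    filter_upwards [hEN] with z hz
    simp only [cylNormal, if_neg hz]; rfl
  have hNn : (fun z => cylNormal Ω t₁ t₂ z none) =ᵐ[L] 0 := by
    filter_upwards [hlat] with z hz
    simp only [cylNormal, if_pos hz.2.2]; rfl
  have hmeasN : ∀ i, AEStronglyMeasurable (fun z => cylNormal Ω t₁ t₂ z i)
      (cylMeasure Ω t₁ t₂ m) := by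
    intro i
    rw [cylMeasure, aestronglyMeasurable_add_measure_iff]
    cases i with
    | none =>
      refine ⟨aestronglyMeasurable_const.congr hNn.symm, Measurable.aestronglyMeasurable ?_⟩
      exact Measurable.ite (measurable_snd measurableSet_Ioo) measurable_const
        (Measurable.ite (measurable_snd (measurableSet_singleton t₂)) measurable_const
          measurable_const)
    | some i =>
      refine ⟨AEStronglyMeasurable.congr ?_ (hNs i).symm,
        aestronglyMeasurable_const.congr (hNs' i).symm⟩
      have h1 : AEStronglyMeasurable (fun y => outerNormal Ω y i) m :=
        (EuclideanSpace.proj (𝕜 := ℝ) i).continuous.comp_aestronglyMeasurable hm.meas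
      exact h1.comp_fst
  have hbN : ∀ᵐ z ∂cylMeasure Ω t₁ t₂ m, ∀ i, |cylNormal Ω t₁ t₂ z i| ≤ 1 := by
    rw [cylMeasure, ae_add_measure_iff]
    constructor
    · filter_upwards [hlat] with z hz i
      cases i with
      | none => simp only [cylNormal, if_pos hz.2.2]; simp
      | some i =>
        simp only [cylNormal, if_pos hz.2.2]
        rw [← hz.2.1.1]
        exact PiLp.norm_apply_le (outerNormal Ω z.1) i
    · filter_upwards [hEN] with z hz i
      cases i with
      | none => simp only [cylNormal, if_neg hz]; split_ifs <;> simp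
      | some i => simp only [cylNormal, if_neg hz]; simp
  refine ⟨hfin, hmem, hmeasN, hbN, ?_⟩
  intro F hF i
  have hFc := hF.continuousOn
  obtain ⟨B, hB⟩ := hK.exists_bound_of_continuousOn hFc
  set g := fun z => fderivWithin ℝ F K z (dirQ i) with hg
  have hgc : ContinuousOn g K := (hF.continuousOn_fderivWithin hU le_rfl).clm_apply continuousOn_const
  have hgi : IntegrableOn g D := (hgc.integrableOn_compact hK).mono_set subset_closure
  have hgi' : Integrable g ((volume.restrict Ω).prod (volume.restrict (Ioo t₁ t₂))) := by
    rw [← volume_restrict_cyl]; exact hgi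
  have hFm : AEStronglyMeasurable F (cylMeasure Ω t₁ t₂ m) := by
    rw [← Measure.restrict_eq_self_of_ae_mem hmem]
    exact hFc.aestronglyMeasurable isClosed_closure.measurableSet
  have hFN : Integrable (fun z => F z * cylNormal Ω t₁ t₂ z i) (cylMeasure Ω t₁ t₂ m) := by
    refine Integrable.of_bound (hFm.mul (hmeasN i)) (B * 1) ?_
    filter_upwards [hmem, hbN] with z hz hz'
    rw [norm_mul]
    exact mul_le_mul (hB z hz) (hz' i) (norm_nonneg _) ((norm_nonneg _).trans (hB z hz))
  have hFd : ∀ z ∈ D, HasFDerivAt F (fderivWithin ℝ F K z) z := fun z hz =>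
    ((hF.differentiableOn (by simp)) z (subset_closure hz)).hasFDerivWithinAt.hasFDerivAt
      (mem_of_superset (hD.mem_nhds hz) subset_closure)
  rw [cylMeasure] at hFN ⊢
  rw [integral_add_measure hFN.left_of_add_measure hFN.right_of_add_measure, volume_restrict_cyl]
  cases i with
  | some i =>
    have h0 : ∫ z, F z * cylNormal Ω t₁ t₂ z (some i) ∂endMeasure Ω t₁ t₂ = 0 := by
      rw [integral_congr_ae (g := fun _ => (0 : ℝ)), integral_zero]
      filter_upwards [hNs' i] with z hz
      rw [hz]; simp
    rw [h0, add_zero, integral_prod_symm _ hgi', integral_prod_symm _ hFN.left_of_add_measure]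
    refine setIntegral_congr_fun measurableSet_Ioo fun t htt => ?_
    have hd : ∀ x ∈ Ω, HasFDerivAt (fun y => F (y, t))
        ((fderivWithin ℝ F K (x, t)).comp (ContinuousLinearMap.inl ℝ (E n) ℝ)) x := fun x hx =>
      (hFd (x, t) ⟨hx, htt⟩).comp x (hasFDerivAt_prodMk_left x t)
    obtain ⟨B', hB'⟩ := hK.exists_bound_of_continuousOn (hF.continuousOn_fderivWithin hU le_rfl)
    have key := hm.gaussGreen (fun y => F (y, t)) B'
      (hFc.comp (Continuous.prodMk_left t).continuousOn fun x hx => by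
        change (x, t) ∈ K
        rw [hKe]; exact ⟨hx, Ioo_subset_Icc_self htt⟩)
      (fun x hx => (hd x hx).differentiableAt) (fun x hx => by
        rw [(hd x hx).fderiv]
        refine (ContinuousLinearMap.opNorm_comp_le _ _).trans ?_
        refine (mul_le_of_le_one_right (norm_nonneg _)
          (ContinuousLinearMap.norm_inl_le_one ℝ (E n) ℝ)).trans ?_
        exact hB' _ (subset_closure ⟨hx, htt⟩)) (EuclideanSpace.single i 1)
    have e1 : ∫ x in Ω, g (x, t) = ∫ x in Ω, fderiv ℝ (fun y => F (y, t)) x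
        (EuclideanSpace.single i 1) := by
      refine setIntegral_congr_fun hΩ.isOpen.measurableSet fun x hx => ?_
      change _ = fderiv ℝ (fun y => F (y, t)) x (EuclideanSpace.single i 1)
      rw [(hd x hx).fderiv]; rfl
    change ∫ x in Ω, g (x, t) = ∫ x, F (x, t) * cylNormal Ω t₁ t₂ (x, t) (some i) ∂m
    rw [e1, key]
    refine integral_congr_ae (Eventually.of_forall fun x => ?_)
    have hx : cylNormal Ω t₁ t₂ (x, t) (some i) = outerNormal Ω x i := by
      simp only [cylNormal, if_pos htt]
    change _ = F (x, t) * cylNormal Ω t₁ t₂ (x, t) (some i)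
    rw [hx]
    simp [EuclideanSpace.inner_single_right]
  | none =>
    have h0 : ∫ z, F z * cylNormal Ω t₁ t₂ z none ∂L = 0 := by
      rw [integral_congr_ae (g := fun _ => (0 : ℝ)), integral_zero]
      filter_upwards [hNn] with z hz
      rw [hz]; simp
    have hE := hFN.right_of_add_measure
    rw [endMeasure_eq] at hE ⊢
    have hE1 := hE.left_of_add_measure
    have hE2 := hE.right_of_add_measure
    rw [h0, zero_add, integral_prod _ hgi', integral_add_measure hE1 hE2]
    rw [(measurableEmbedding_slice t₁).integrable_map_iff] at hE1
    rw [(measurableEmbedding_slice t₂).integrable_map_iff] at hE2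
    rw [(measurableEmbedding_slice t₁).integral_map, (measurableEmbedding_slice t₂).integral_map]
    refine Eq.trans ?_ (integral_add hE1 hE2)
    refine setIntegral_congr_fun hΩ.isOpen.measurableSet fun x hx => ?_
    have n1 : cylNormal Ω t₁ t₂ (x, t₁) none = -1 := by simp [cylNormal, ht.ne]
    have n2 : cylNormal Ω t₁ t₂ (x, t₂) none = 1 := by simp [cylNormal]
    simp only [Function.comp_apply, n1, n2]
    have hmaps : MapsTo (fun t : ℝ => (x, t)) (Icc t₁ t₂) K := fun t htt => by
      rw [hKe]; exact ⟨subset_closure hx, htt⟩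
    have hcg : ContinuousOn (fun t => g (x, t)) (Icc t₁ t₂) :=
      hgc.comp (Continuous.prodMk_right x).continuousOn hmaps
    have key := intervalIntegral.integral_eq_sub_of_hasDerivAt_of_le (f := fun t => F (x, t))
      (f' := fun t => g (x, t)) ht.le
      (hFc.comp (Continuous.prodMk_right x).continuousOn hmaps)
      (fun t htt => by
        have := ((hFd (x, t) ⟨hx, htt⟩).comp t (hasFDerivAt_prodMk_right x t)).hasDerivAt
        exact this)
      (by rw [← uIcc_of_le ht.le] at hcg; exact hcg.intervalIntegrable)
    rw [intervalIntegral.integral_of_le ht.le, integral_Ioc_eq_integral_Ioo] at key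
    rw [key]; ring

end CylinderGaussGreen

/-! ### The trace inequality -/

section TraceInequality

variable {V ι : Type*} [NormedAddCommGroup V] [NormedSpace ℝ V] [FiniteDimensional ℝ V]
  [MeasureSpace V] [BorelSpace V] [IsFiniteMeasureOnCompacts (volume : Measure V)] [Fintype ι]
  {D : Set V} {dir : ι → V} {μ : Measure V} {N : V → ι → ℝ}

theorem eLpNorm_sq_eq {α : Type*} [MeasurableSpace α] {μ : Measure α} {f : α → ℝ}
    (hf : MemLp f 2 μ) : eLpNorm f 2 μ ^ 2 = ENNReal.ofReal (∫ z, f z ^ 2 ∂μ) := by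
  have h1 := eLpNorm_nnreal_pow_eq_lintegral (f := f) (μ := μ) (p := 2) (by norm_num)
  have h2 : eLpNorm f 2 μ ^ 2 = ∫⁻ z, ‖f z‖ₑ ^ 2 ∂μ := by
    have h3 : ((2 : NNReal) : ℝ) = ((2 : ℕ) : ℝ) := by norm_num
    simp only [h3, ENNReal.rpow_natCast] at h1
    exact h1
  rw [h2, ofReal_integral_eq_lintegral_ofReal hf.integrable_sq
    (Eventually.of_forall fun z => sq_nonneg _)]
  refine lintegral_congr fun z => ?_
  rw [Real.enorm_eq_ofReal_abs, ← ENNReal.ofReal_pow (abs_nonneg _), sq_abs]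

theorem ContinuousOn.memLp_of_isCompact {α : Type*} [TopologicalSpace α] [T2Space α]
    [MeasurableSpace α] [BorelSpace α]
    {μ : Measure α} [IsFiniteMeasure μ] {K : Set α} (hK : IsCompact K) {f : α → ℝ}
    (hf : ContinuousOn f K) (hμ : ∀ᵐ z ∂μ, z ∈ K) {p : ENNReal} : MemLp f p μ := by
  obtain ⟨B, hB⟩ := hK.exists_bound_of_continuousOn hf
  refine MemLp.of_bound ?_ B ?_
  · rw [← Measure.restrict_eq_self_of_ae_mem hμ]
    exact hf.aestronglyMeasurable hK.isClosed.measurableSet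
  · filter_upwards [hμ] with z hz using hB z hz

theorem isFiniteMeasure_restrict_of_closure (hK : IsCompact (closure D)) :
    IsFiniteMeasure ((volume : Measure V).restrict D) :=
  ⟨by rw [Measure.restrict_apply_univ]
      exact (measure_mono subset_closure).trans_lt hK.measure_lt_top⟩

/-- The `L²` norm on the boundary is controlled by the `H¹` norm. -/
theorem IsGaussGreen.trace_inequality (h : IsGaussGreen D dir μ N) (hD : IsOpen D)
    (hK : IsCompact (closure D)) {X : V → ι → ℝ} (hX : ∀ i, ContDiff ℝ ∞ fun z => X z i) {c : ℝ}
    (hc : 0 < c) (hXN : ∀ᵐ z ∂μ, c ≤ ∑ i, X z i * N z i) :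
    ∃ C : ℝ, ∀ v : V → ℝ, ContDiff ℝ ∞ v →
      ∫ z, v z ^ 2 ∂μ ≤ C * ((∫ z in D, v z ^ 2) + ∑ i, ∫ z in D, fderiv ℝ v z (dir i) ^ 2) := by
  have hμf := h.finite
  have hDf := isFiniteMeasure_restrict_of_closure hK
  have hDK : ∀ᵐ z ∂(volume : Measure V).restrict D, z ∈ closure D := by
    filter_upwards [ae_restrict_mem hD.measurableSet] with z hz using subset_closure hz
  have hbd : ∀ i, ∃ M : ℝ, ∀ z ∈ closure D, |X z i| ≤ M ∧
      |fderiv ℝ (fun y => X y i) z (dir i)| ≤ M := fun i => by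
    obtain ⟨M₁, h1⟩ := hK.exists_bound_of_continuousOn (hX i).continuous.continuousOn
    obtain ⟨M₂, h2⟩ := hK.exists_bound_of_continuousOn
      (f := fun z => fderiv ℝ (fun y => X y i) z (dir i))
      (((hX i).continuous_fderiv (by simp)).clm_apply continuous_const).continuousOn
    exact ⟨max M₁ M₂, fun z hz => ⟨(h1 z hz).trans (le_max_left _ _),
      (h2 z hz).trans (le_max_right _ _)⟩⟩
  choose M hM using hbd
  refine ⟨c⁻¹ * ∑ i, 2 * |M i|, fun v hv => ?_⟩
  have hv' : ∀ i, Continuous fun z => fderiv ℝ v z (dir i) := fun i =>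
    (hv.continuous_fderiv (by simp)).clm_apply continuous_const
  have hi0 : Integrable (fun z => v z ^ 2) ((volume : Measure V).restrict D) :=
    memLp_one_iff_integrable.1 <| ContinuousOn.memLp_of_isCompact hK
      (hv.continuous.pow 2).continuousOn hDK
  have hi1 : ∀ i, Integrable (fun z => fderiv ℝ v z (dir i) ^ 2)
      ((volume : Measure V).restrict D) := fun i =>
    memLp_one_iff_integrable.1 <| ContinuousOn.memLp_of_isCompact hK
      ((hv' i).pow 2).continuousOn hDK
  have hiμ : Integrable (fun z => v z ^ 2) μ :=
    memLp_one_iff_integrable.1 <| ContinuousOn.memLp_of_isCompact hK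
      (hv.continuous.pow 2).continuousOn h.ae_mem
  have hiN : ∀ i, Integrable (fun z => v z ^ 2 * X z i * N z i) μ := fun i =>
    (memLp_one_iff_integrable.1 <| ContinuousOn.memLp_of_isCompact hK
      ((hv.continuous.pow 2).mul (hX i).continuous).continuousOn h.ae_mem).mul_bdd (c := 1) (h.meas i) (by
        filter_upwards [h.bound] with z hz using hz i)
  set A := ∫ z in D, v z ^ 2
  set G := ∑ i, ∫ z in D, fderiv ℝ v z (dir i) ^ 2
  have hA : 0 ≤ A := integral_nonneg fun z => sq_nonneg _
  have hG0 : ∀ i, 0 ≤ ∫ z in D, fderiv ℝ v z (dir i) ^ 2 := fun i =>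
    integral_nonneg fun z => sq_nonneg _
  -- Gauss-Green is applied to the field `v² X`: transversality makes its boundary flux dominate `c
  -- v²`, while its divergence is controlled by `v²` and `|∇v|²`.
  have h1 : c * ∫ z, v z ^ 2 ∂μ ≤ ∑ i, ∫ z, v z ^ 2 * X z i * N z i ∂μ := by
    rw [← integral_const_mul, ← integral_finsetSum _ fun i _ => hiN i]
    refine integral_mono_ae (hiμ.const_mul c) (integrable_finsetSum _ fun i _ => hiN i) ?_
    filter_upwards [hXN] with z hz
    calc c * v z ^ 2 ≤ (∑ i, X z i * N z i) * v z ^ 2 :=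
          mul_le_mul_of_nonneg_right hz (sq_nonneg _)
      _ = ∑ i, v z ^ 2 * X z i * N z i := by
          rw [Finset.sum_mul]; exact Finset.sum_congr rfl fun i _ => by ring
  have h2 : ∀ i, ∫ z, v z ^ 2 * X z i * N z i ∂μ ≤ 2 * |M i| * (A + G) := by
    intro i
    have hF : ContDiff ℝ 1 fun z => v z ^ 2 * X z i :=
      ((hv.pow 2).mul (hX i)).of_le (by simp)
    rw [← h.green _ hF.contDiffOn i]
    have h3 : ∫ z in D, fderivWithin ℝ (fun z => v z ^ 2 * X z i) (closure D) z (dir i) ≤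
        ∫ z in D, |M i| * (2 * v z ^ 2 + fderiv ℝ v z (dir i) ^ 2) := by
      have e1 : ∀ z ∈ D, fderivWithin ℝ (fun z => v z ^ 2 * X z i) (closure D) z (dir i) =
          v z ^ 2 * fderiv ℝ (fun y => X y i) z (dir i) +
            2 * v z * X z i * fderiv ℝ v z (dir i) := fun z hz => by
        rw [fderivWithin_of_mem_nhds (mem_of_superset (hD.mem_nhds hz) subset_closure)]
        have d1 := (hv.differentiable (by simp) z).hasFDerivAt
        have d2 := ((hX i).differentiable (by simp) z).hasFDerivAt
        have d3 : HasFDerivAt (fun z => v z ^ 2) _ z := d1.pow 2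
        have d4 : HasFDerivAt (fun z => v z ^ 2 * X z i) _ z := d3.mul d2
        rw [d4.fderiv]
        simp; ring
      rw [setIntegral_congr_fun hD.measurableSet e1]
      have hXi' : Continuous fun z => fderiv ℝ (fun y => X y i) z (dir i) :=
        ((hX i).continuous_fderiv (by simp)).clm_apply continuous_const
      refine integral_mono_ae ?_ (((hi0.const_mul 2).add (hi1 i)).const_mul _) ?_
      · refine memLp_one_iff_integrable.1 <| ContinuousOn.memLp_of_isCompact hK
          (Continuous.continuousOn ?_) hDK
        exact ((hv.continuous.pow 2).mul hXi').add
          (((continuous_const.mul hv.continuous).mul (hX i).continuous).mul (hv' i))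
      · filter_upwards [hDK] with z hz
        obtain ⟨b1, b2⟩ := hM i z hz
        replace b1 := b1.trans (le_abs_self _)
        replace b2 := b2.trans (le_abs_self _)
        set f := fderiv ℝ v z (dir i)
        set P := |M i|
        have hP : 0 ≤ P := abs_nonneg _
        have c1 : v z ^ 2 * fderiv ℝ (fun y => X y i) z (dir i) ≤ v z ^ 2 * P :=
          mul_le_mul_of_nonneg_left ((le_abs_self _).trans b2) (sq_nonneg _)
        have c2 : 2 * v z * X z i * f ≤ P * (v z ^ 2 + f ^ 2) := by
          have c3 : X z i * (2 * v z * f) ≤ P * |2 * v z * f| :=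
            (le_abs_self _).trans (by rw [abs_mul]; exact mul_le_mul_of_nonneg_right b1 (abs_nonneg _))
          have c4 : |2 * v z * f| ≤ v z ^ 2 + f ^ 2 := by
            rw [abs_le]; constructor <;> nlinarith [sq_nonneg (v z - f), sq_nonneg (v z + f)]
          nlinarith [mul_le_mul_of_nonneg_left c4 hP]
        change _ ≤ P * (2 * v z ^ 2 + f ^ 2)
        nlinarith
    refine h3.trans ?_
    rw [integral_const_mul, integral_add (hi0.const_mul 2) (hi1 i), integral_const_mul]
    have h4 : ∫ z in D, fderiv ℝ v z (dir i) ^ 2 ≤ G :=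
      Finset.single_le_sum (f := fun i => ∫ z in D, fderiv ℝ v z (dir i) ^ 2)
        (fun i _ => hG0 i) (Finset.mem_univ i)
    have h5 := abs_nonneg (M i)
    have h6 := hG0 i
    nlinarith [mul_le_mul_of_nonneg_left h4 h5, mul_nonneg h5 h6]
  have h3 := h1.trans (Finset.sum_le_sum fun i _ => h2 i)
  rw [← Finset.sum_mul] at h3
  rw [mul_assoc, ← div_eq_inv_mul, le_div_iff₀ hc]
  linarith

/-- The trace inequality in terms of `L²` norms. -/
theorem IsGaussGreen.eLpNorm_trace_le (h : IsGaussGreen D dir μ N) (hD : IsOpen D)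
    (hK : IsCompact (closure D)) {X : V → ι → ℝ} (hX : ∀ i, ContDiff ℝ ∞ fun z => X z i) {c : ℝ}
    (hc : 0 < c) (hXN : ∀ᵐ z ∂μ, c ≤ ∑ i, X z i * N z i) :
    ∃ C : NNReal, ∀ v : V → ℝ, ContDiff ℝ ∞ v → eLpNorm v 2 μ ≤ C *
      (eLpNorm v 2 (volume.restrict D) +
        ∑ i, eLpNorm (fun z => fderiv ℝ v z (dir i)) 2 (volume.restrict D)) := by
  obtain ⟨C, hC⟩ := h.trace_inequality hD hK hX hc hXN
  have hμf := h.finite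
  have hDf := isFiniteMeasure_restrict_of_closure hK
  have hDK : ∀ᵐ z ∂(volume : Measure V).restrict D, z ∈ closure D := by
    filter_upwards [ae_restrict_mem hD.measurableSet] with z hz using subset_closure hz
  refine ⟨(1 + |C|).toNNReal, fun v hv => ?_⟩
  have m0 : MemLp v 2 μ := ContinuousOn.memLp_of_isCompact hK hv.continuous.continuousOn h.ae_mem
  have m1 : MemLp v 2 (volume.restrict D) :=
    ContinuousOn.memLp_of_isCompact hK hv.continuous.continuousOn hDK
  have m2 : ∀ i, MemLp (fun z => fderiv ℝ v z (dir i)) 2 (volume.restrict D) := fun i =>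
    ContinuousOn.memLp_of_isCompact hK
      (((hv.continuous_fderiv (by simp)).clm_apply continuous_const).continuousOn) hDK
  rw [← ENNReal.pow_le_pow_left_iff two_ne_zero, mul_pow, eLpNorm_sq_eq m0]
  have hsq : ENNReal.ofReal ((∫ z in D, v z ^ 2) + ∑ i, ∫ z in D, fderiv ℝ v z (dir i) ^ 2) ≤
      (eLpNorm v 2 (volume.restrict D) +
        ∑ i, eLpNorm (fun z => fderiv ℝ v z (dir i)) 2 (volume.restrict D)) ^ 2 := by
    rw [ENNReal.ofReal_add (integral_nonneg fun z => sq_nonneg _)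
      (Finset.sum_nonneg fun i _ => integral_nonneg fun z => sq_nonneg _), ← eLpNorm_sq_eq m1,
      ENNReal.ofReal_sum_of_nonneg fun i _ => integral_nonneg fun z => sq_nonneg _]
    simp only [← fun i => eLpNorm_sq_eq (m2 i)]
    have hs : ∀ s : Finset ι,
        ∑ i ∈ s, eLpNorm (fun z => fderiv ℝ v z (dir i)) 2 (volume.restrict D) ^ 2 ≤
          (∑ i ∈ s, eLpNorm (fun z => fderiv ℝ v z (dir i)) 2 (volume.restrict D)) ^ 2 := fun s => by
      exact Finset.sum_sq_le_sq_sum_of_nonneg fun i _ => zero_le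
    refine (add_le_add le_rfl (hs Finset.univ)).trans ?_
    rw [add_sq]
    exact add_le_add le_self_add le_rfl
  refine le_trans ?_ (mul_le_mul_right hsq _)
  rw [← ENNReal.ofReal_coe_nnreal, ← ENNReal.ofReal_pow (NNReal.coe_nonneg _),
    ← ENNReal.ofReal_mul (by positivity)]
  refine ENNReal.ofReal_le_ofReal ((hC v hv).trans ?_)
  refine mul_le_mul_of_nonneg_right ?_ (add_nonneg (integral_nonneg fun z => sq_nonneg _)
    (Finset.sum_nonneg fun i _ => integral_nonneg fun z => sq_nonneg _))
  rw [Real.coe_toNNReal _ (by positivity)]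
  nlinarith [le_abs_self C, abs_nonneg C]

end TraceInequality

/-! ### A smooth field transversal to the boundary of the cylinder. -/

section CylinderTrace

variable {n : ℕ} {Ω : Set (E n)} {t₁ t₂ : ℝ} {m : Measure (E n)} {C : NNReal}

/-- In space, the opposite cone directions are averaged by a partition of unity; every direction
active at a boundary point makes a uniformly positive angle with the normal by `inner_le_of_cone`.
In time, an affine function running from `-1` to `1` matches the normal on the ends. -/
theorem exists_transversal (hΩ : IsLipschitzDomain Ω) (ht : t₁ < t₂)
    (hm : IsGaussGreenMeasure Ω m C) : ∃ (X : E n × ℝ → Option (Fin n) → ℝ) (c : ℝ),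
      (∀ i, ContDiff ℝ ∞ fun z => X z i) ∧ 0 < c ∧
      ∀ᵐ z ∂cylMeasure Ω t₁ t₂ m, c ≤ ∑ i, X z i * cylNormal Ω t₁ t₂ z i := by
  choose! e r c s₀ hr hc hs hcone using fun x (hx : x ∈ closure Ω) => hΩ.coneCond hx
  obtain ⟨t, χ, htK, hχs, -, hχt, hχ0, hχ1⟩ := exists_smooth_partition hΩ.isCompact_closure r hr
  obtain ⟨c₀, hc₀, hc₀'⟩ : ∃ c₀ : ℝ, 0 < c₀ ∧ ∀ x ∈ t, c₀ ≤ c x := by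
    rcases t.eq_empty_or_nonempty with rfl | hne
    · exact ⟨1, one_pos, by simp⟩
    · obtain ⟨x, hx, hx'⟩ := t.exists_min_image c hne
      exact ⟨c x, hc x (htK x hx), hx'⟩
  refine ⟨fun z i => match i with
    | none => (2 * z.2 - t₁ - t₂) / (t₂ - t₁)
    | some i => ∑ x ∈ t, χ x z.1 * (- e x i), min (c₀ / 2) 1, ?_, by positivity, ?_⟩
  · rintro (_ | i)
    · exact ((contDiff_const.mul contDiff_snd).sub contDiff_const |>.sub contDiff_const).div_const _
    · exact ContDiff.sum fun x _ => ((hχs x).comp contDiff_fst).mul contDiff_const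
  · rw [cylMeasure, ae_add_measure_iff]
    have hlen : t₂ - t₁ ≠ 0 := by linarith
    constructor
    · filter_upwards [ae_lateral (t₁ := t₁) (t₂ := t₂) hm] with z hz
      obtain ⟨hzf, hzn, hzt⟩ := hz
      rw [Fintype.sum_option]
      simp only [cylNormal, if_pos hzt, mul_zero, zero_add]
      have hzc := frontier_subset_closure hzf
      have h1 : ∑ i, (∑ x ∈ t, χ x z.1 * (- e x i)) * outerNormal Ω z.1 i =
          ∑ x ∈ t, χ x z.1 * (-⟪e x, outerNormal Ω z.1⟫) := by
        simp only [Finset.sum_mul]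
        rw [Finset.sum_comm]
        refine Finset.sum_congr rfl fun x _ => ?_
        rw [PiLp.inner_apply, ← Finset.sum_neg_distrib, Finset.mul_sum]
        refine Finset.sum_congr rfl fun i _ => ?_
        simp; ring
      rw [h1]
      refine (min_le_left _ _).trans ?_
      calc c₀ / 2 = ∑ x ∈ t, χ x z.1 * (c₀ / 2) := by rw [← Finset.sum_mul, hχ1 _ hzc, one_mul]
        _ ≤ _ := by
          refine Finset.sum_le_sum fun x hx => ?_
          by_cases h0 : χ x z.1 = 0
          · simp [h0]
          refine mul_le_mul_of_nonneg_left ?_ (hχ0 _ _)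
          have hb : z.1 ∈ Metric.ball x (r x) := hχt x hx (subset_tsupport _ h0)
          have := hzn.inner_le_of_cone (hc x (htK x hx)) (hs x (htK x hx))
            (hcone x (htK x hx) z.1 hzc hb)
          have := hc₀' x hx
          linarith
    · rw [ae_endMeasure]
      constructor <;> refine Eventually.of_forall fun x => (min_le_right _ _).trans ?_
      · rw [Fintype.sum_option]
        have h2 : (2 * t₁ - t₁ - t₂) / (t₂ - t₁) = -1 := by field_simp; ring
        simp [cylNormal, ht.ne, h2]
      · rw [Fintype.sum_option]
        have h2 : (2 * t₂ - t₁ - t₂) / (t₂ - t₁) = 1 := by field_simp; ring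
        simp [cylNormal, h2]

end CylinderTrace

/-! ### Traces on the boundary of the cylinder -/

theorem TendstoL2.sub {α : Type*} [MeasurableSpace α] {μ : Measure α} {f f' : ℕ → α → ℝ}
    {g g' : α → ℝ} (h : TendstoL2 μ f g) (h' : TendstoL2 μ f' g') :
    TendstoL2 μ (fun j z => f j z - f' j z) (fun z => g z - g' z) := by
  have h1 := h.add (h'.bdd_mul (c := fun _ => -1) aestronglyMeasurable_const (C := 1) (by simp))
  refine h1.congr (fun j => Eventually.of_forall fun z => ?_) (Eventually.of_forall fun z => ?_)
  · change f j z + -1 * f' j z = _; ring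
  · change g z + -1 * g' z = _; ring

theorem TendstoL2.eLpNorm_sub_tendsto {α : Type*} [MeasurableSpace α] {μ : Measure α}
    {f f' : ℕ → α → ℝ} {g : α → ℝ} (h : TendstoL2 μ f g) (h' : TendstoL2 μ f' g) :
    Tendsto (fun p : ℕ × ℕ => eLpNorm (fun z => f p.1 z - f' p.2 z) 2 μ) atTop (𝓝 0) := by
  have h1 : Tendsto (fun p : ℕ × ℕ => eLpNorm (f p.1 - g) 2 μ + eLpNorm (f' p.2 - g) 2 μ) atTop
      (𝓝 (0 + 0)) := by
    rw [← prod_atTop_atTop_eq]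
    exact (h.2.2.comp tendsto_fst).add (h'.2.2.comp tendsto_snd)
  rw [add_zero] at h1
  refine tendsto_of_tendsto_of_tendsto_of_le_of_le tendsto_const_nhds h1 (fun _ => zero_le)
    fun p => ?_
  have h2 : (fun z => f p.1 z - f' p.2 z) = (f p.1 - g) - (f' p.2 - g) := by
    funext z; simp
  change eLpNorm (fun z => f p.1 z - f' p.2 z) 2 μ ≤ _
  rw [h2]
  exact eLpNorm_sub_le ((h.1 _).1.sub h.2.1.1) ((h'.1 _).1.sub h.2.1.1) (by norm_num)

/-! ### Boundary limits of smooth approximations. -/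

section Limits

variable {V ι : Type*} [NormedAddCommGroup V] [NormedSpace ℝ V] [MeasureSpace V] [Fintype ι]
  {D : Set V} {dir : ι → V} {μ : Measure V} {C : NNReal}

/-- The trace bound is applied to the difference of two approximants of the same function. With
equal sequences it gives the Cauchy property, hence existence of a trace; with different ones it
gives uniqueness. -/
theorem tendsto_eLpNorm_trace (hC : ∀ v : V → ℝ, ContDiff ℝ ∞ v → eLpNorm v 2 μ ≤ C *
      (eLpNorm v 2 (volume.restrict D) +
        ∑ i, eLpNorm (fun z => fderiv ℝ v z (dir i)) 2 (volume.restrict D)))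
    {v v' : ℕ → V → ℝ} (hv : ∀ j, ContDiff ℝ ∞ (v j)) (hv' : ∀ j, ContDiff ℝ ∞ (v' j))
    {f : V → ℝ} {fi : ι → V → ℝ} (h0 : TendstoL2 (volume.restrict D) v f)
    (h1 : ∀ i, TendstoL2 (volume.restrict D) (fun j z => fderiv ℝ (v j) z (dir i)) (fi i))
    (h0' : TendstoL2 (volume.restrict D) v' f)
    (h1' : ∀ i, TendstoL2 (volume.restrict D) (fun j z => fderiv ℝ (v' j) z (dir i)) (fi i)) :
    Tendsto (fun p : ℕ × ℕ => eLpNorm (fun z => v p.1 z - v' p.2 z) 2 μ) atTop (𝓝 0) := by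
  have h2 := (h0.eLpNorm_sub_tendsto h0').add
    (tendsto_finsetSum Finset.univ fun i _ => (h1 i).eLpNorm_sub_tendsto (h1' i))
  have h3 := ENNReal.Tendsto.const_mul (a := (C : ENNReal)) h2 (Or.inr ENNReal.coe_ne_top)
  simp only [Finset.sum_const_zero, add_zero, mul_zero] at h3
  refine tendsto_of_tendsto_of_tendsto_of_le_of_le tendsto_const_nhds h3 (fun _ => zero_le)
    fun p => ?_
  refine (hC _ ((hv _).sub (hv' _))).trans ?_
  have h4 : ∀ i z, fderiv ℝ (fun z => v p.1 z - v' p.2 z) z (dir i) =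
      fderiv ℝ (v p.1) z (dir i) - fderiv ℝ (v' p.2) z (dir i) := fun i z => by
    rw [fderiv_fun_sub ((hv _).differentiable (by simp) z) ((hv' _).differentiable (by simp) z)]
    rfl
  simp only [h4]
  exact le_rfl

theorem exists_tendstoL2_trace (hC : ∀ v : V → ℝ, ContDiff ℝ ∞ v → eLpNorm v 2 μ ≤ C *
      (eLpNorm v 2 (volume.restrict D) +
        ∑ i, eLpNorm (fun z => fderiv ℝ v z (dir i)) 2 (volume.restrict D)))
    {v : ℕ → V → ℝ} (hv : ∀ j, ContDiff ℝ ∞ (v j)) (hvμ : ∀ j, MemLp (v j) 2 μ)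
    {f : V → ℝ} {fi : ι → V → ℝ} (h0 : TendstoL2 (volume.restrict D) v f)
    (h1 : ∀ i, TendstoL2 (volume.restrict D) (fun j z => fderiv ℝ (v j) z (dir i)) (fi i)) :
    ∃ g, TendstoL2 μ v g :=
  exists_tendstoL2 hvμ (tendsto_eLpNorm_trace hC hv hv h0 h1 h0 h1)

theorem tendstoL2_trace_unique (hC : ∀ v : V → ℝ, ContDiff ℝ ∞ v → eLpNorm v 2 μ ≤ C *
      (eLpNorm v 2 (volume.restrict D) +
        ∑ i, eLpNorm (fun z => fderiv ℝ v z (dir i)) 2 (volume.restrict D)))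
    {v v' : ℕ → V → ℝ} (hv : ∀ j, ContDiff ℝ ∞ (v j)) (hv' : ∀ j, ContDiff ℝ ∞ (v' j))
    {f g g' : V → ℝ} {fi : ι → V → ℝ} (h0 : TendstoL2 (volume.restrict D) v f)
    (h1 : ∀ i, TendstoL2 (volume.restrict D) (fun j z => fderiv ℝ (v j) z (dir i)) (fi i))
    (h0' : TendstoL2 (volume.restrict D) v' f)
    (h1' : ∀ i, TendstoL2 (volume.restrict D) (fun j z => fderiv ℝ (v' j) z (dir i)) (fi i))
    (hg : TendstoL2 μ v g) (hg' : TendstoL2 μ v' g') : g =ᵐ[μ] g' := by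
  have h2 := tendsto_eLpNorm_trace hC hv hv' h0 h1 h0' h1'
  have h3 := hg.sub hg'
  have h4 : TendstoL2 μ (fun j z => v j z - v' j z) (fun _ => 0) := by
    refine ⟨h3.1, MemLp.zero', ?_⟩
    have h5 : Tendsto (fun j : ℕ => (j, j)) atTop atTop := by
      rw [← prod_atTop_atTop_eq]; exact tendsto_id.prodMk tendsto_id
    refine (h2.comp h5).congr fun j => ?_
    change eLpNorm (fun z => v j z - v' j z) 2 μ = eLpNorm ((fun z => v j z - v' j z) - fun _ => 0) 2 μ
    congr 1; funext z; simp
  filter_upwards [h3.ae_unique h4] with z hz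
  linarith

end Limits

/-! ### Existence and uniqueness of traces on the cylinder. -/

section CylinderTraces

instance isAddHaarMeasure_volume_prod {n : ℕ} : (volume : Measure (E n × ℝ)).IsAddHaarMeasure :=
  inferInstanceAs ((volume : Measure (E n)).prod (volume : Measure ℝ)).IsAddHaarMeasure

variable {n : ℕ} {Ω : Set (E n)} {t₁ t₂ : ℝ} {m : Measure (E n)} {C : NNReal}

theorem prod_le_smul_prod {α β : Type*} [MeasurableSpace α] [MeasurableSpace β] {μ ν : Measure α}
    {ρ : Measure β} [SFinite μ] [SFinite ν] [SFinite ρ] {c : NNReal} (h : μ ≤ c • ν) :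
    μ.prod ρ ≤ c • ν.prod ρ := by
  refine Measure.le_iff.2 fun s hs => ?_
  rw [Measure.smul_apply, Measure.prod_apply hs, Measure.prod_apply hs, ENNReal.smul_def,
    ← lintegral_smul_measure]
  exact lintegral_mono' h le_rfl

theorem add_le_smul_add {α : Type*} [MeasurableSpace α] {μ ν ρ : Measure α} {c : NNReal}
    (h : μ ≤ c • ν) : μ + ρ ≤ ((c + 1 : NNReal) : ENNReal) • (ν + ρ) := by
  refine Measure.le_iff.2 fun s hs => ?_
  have h1 := h s
  rw [Measure.smul_apply, ENNReal.smul_def, smul_eq_mul] at h1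
  rw [Measure.smul_apply, Measure.add_apply, Measure.add_apply, smul_eq_mul, ENNReal.coe_add,
    ENNReal.coe_one]
  calc μ s + ρ s ≤ (c * ν s + ν s) + (c * ρ s + ρ s) :=
        add_le_add (h1.trans le_self_add) le_add_self
    _ = (c + 1) * (ν s + ρ s) := by ring

theorem IsGaussGreenMeasure.isFiniteMeasure_surfaceMeasure (hm : IsGaussGreenMeasure Ω m C) :
    IsFiniteMeasure (surfaceMeasure Ω) := by
  have := hm.finite
  exact isFiniteMeasure_of_le _ hm.ge

theorem boundaryMeasure_le (hm : IsGaussGreenMeasure Ω m C) :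
    boundaryMeasure Ω t₁ t₂ ≤ ((C + 1 : NNReal) : ENNReal) • cylMeasure Ω t₁ t₂ m := by
  have := hm.finite
  have := hm.isFiniteMeasure_surfaceMeasure
  exact add_le_smul_add (prod_le_smul_prod hm.ge)

theorem cylMeasure_le (hm : IsGaussGreenMeasure Ω m C) :
    cylMeasure Ω t₁ t₂ m ≤ ((C + 1 : NNReal) : ENNReal) • boundaryMeasure Ω t₁ t₂ := by
  have := hm.finite
  have := hm.isFiniteMeasure_surfaceMeasure
  exact add_le_smul_add (prod_le_smul_prod hm.le)

/-- Comparability in both directions gives the same null sets. The boundary conditions, stated for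
the surface measure, can therefore be used with the Gauss-Green measure. -/
theorem ae_boundaryMeasure_iff (hm : IsGaussGreenMeasure Ω m C)
    {p : E n × ℝ → Prop} :
    (∀ᵐ z ∂boundaryMeasure Ω t₁ t₂, p z) ↔ ∀ᵐ z ∂cylMeasure Ω t₁ t₂ m, p z :=
  ⟨fun h => ((Measure.absolutelyContinuous_of_le (cylMeasure_le hm)).trans
      Measure.smul_absolutelyContinuous).ae_le h,
    fun h => ((Measure.absolutelyContinuous_of_le (boundaryMeasure_le hm)).trans
      Measure.smul_absolutelyContinuous).ae_le h⟩

theorem exists_trace_bound (hΩ : IsLipschitzDomain Ω) (ht : t₁ < t₂)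
    (hm : IsGaussGreenMeasure Ω m C) :
    ∃ B : NNReal, ∀ v : E n × ℝ → ℝ, ContDiff ℝ ∞ v → eLpNorm v 2 (cylMeasure Ω t₁ t₂ m) ≤ B *
      (eLpNorm v 2 (volume.restrict (cyl Ω t₁ t₂)) +
        ∑ i, eLpNorm (fun z => fderiv ℝ v z (dirQ i)) 2 (volume.restrict (cyl Ω t₁ t₂))) := by
  obtain ⟨X, c, hX, hc, hXN⟩ := exists_transversal hΩ ht hm
  exact (cyl_isGaussGreen hΩ ht hm).eLpNorm_trace_le (isOpen_cyl hΩ)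
    (hΩ.isCompact_closure_cyl ht) hX hc hXN

theorem ae_mem_closure_cyl (hΩ : IsLipschitzDomain Ω) :
    ∀ᵐ z ∂(volume : Measure (E n × ℝ)).restrict (cyl Ω t₁ t₂), z ∈ closure (cyl Ω t₁ t₂) := by
  filter_upwards [ae_restrict_mem (isOpen_cyl hΩ).measurableSet] with z hz using subset_closure hz

theorem memLp_cyl (hΩ : IsLipschitzDomain Ω) (ht : t₁ < t₂) {v : E n × ℝ → ℝ}
    (hv : ContinuousOn v (closure (cyl Ω t₁ t₂))) {p : ENNReal} :
    MemLp v p (volume.restrict (cyl Ω t₁ t₂)) := by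
  have := isFiniteMeasure_restrict_of_closure (hΩ.isCompact_closure_cyl ht)
  exact ContinuousOn.memLp_of_isCompact (hΩ.isCompact_closure_cyl ht) hv (ae_mem_closure_cyl hΩ)

theorem memLp_cylMeasure (hΩ : IsLipschitzDomain Ω) (ht : t₁ < t₂)
    (hm : IsGaussGreenMeasure Ω m C) {v : E n × ℝ → ℝ}
    (hv : ContinuousOn v (closure (cyl Ω t₁ t₂))) {p : ENNReal} :
    MemLp v p (cylMeasure Ω t₁ t₂ m) := by
  have := (cyl_isGaussGreen hΩ ht hm).finite
  exact ContinuousOn.memLp_of_isCompact (hΩ.isCompact_closure_cyl ht) hv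
    (cyl_isGaussGreen hΩ ht hm).ae_mem

/-- Two traces of the same function agree. -/
theorem IsTrace.ae_eq (hn : 1 ≤ n) (hΩ : IsLipschitzDomain Ω) (ht : t₁ < t₂) {f g g' : E n × ℝ → ℝ}
    (hf : MemH1 (cyl Ω t₁ t₂) f) (hg : IsTrace (cyl Ω t₁ t₂) (boundaryMeasure Ω t₁ t₂) f g)
    (hg' : IsTrace (cyl Ω t₁ t₂) (boundaryMeasure Ω t₁ t₂) f g') :
    g =ᵐ[boundaryMeasure Ω t₁ t₂] g' := by
  obtain ⟨m, C, hm⟩ := hΩ.exists_gaussGreenMeasure hn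
  obtain ⟨B, hB⟩ := exists_trace_bound hΩ ht hm
  have key : ∀ {g}, IsTrace (cyl Ω t₁ t₂) (boundaryMeasure Ω t₁ t₂) f g → ∃ v : ℕ → E n × ℝ → ℝ,
      (∀ j, ContDiff ℝ ∞ (v j)) ∧ TendstoL2 (volume.restrict (cyl Ω t₁ t₂)) v f ∧
      (∀ e, TendstoL2 (volume.restrict (cyl Ω t₁ t₂)) (fun j z => fderiv ℝ (v j) z e)
        (weakDeriv (cyl Ω t₁ t₂) e f)) ∧ TendstoL2 (cylMeasure Ω t₁ t₂ m) v g := by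
    rintro g ⟨hg, v, hv, h0, h1, h2⟩
    refine ⟨v, hv, ⟨fun j => memLp_cyl hΩ ht (hv j).continuous.continuousOn, hf.1, h0⟩,
      fun e => ⟨fun j => memLp_cyl hΩ ht ?_, (hf.weakDeriv_spec e).1, h1 e⟩, ?_⟩
    · exact (((hv j).continuous_fderiv (by simp)).clm_apply continuous_const).continuousOn
    · refine TendstoL2.mono_measure ⟨fun j => ?_, hg, h2⟩ ENNReal.coe_ne_top (cylMeasure_le hm)
      exact ((memLp_cylMeasure hΩ ht hm (hv j).continuous.continuousOn).smul_measure
        ENNReal.coe_ne_top).mono_measure (boundaryMeasure_le hm)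
  obtain ⟨v, hv, h0, h1, h2⟩ := key hg
  obtain ⟨v', hv', h0', h1', h2'⟩ := key hg'
  refine (ae_boundaryMeasure_iff hm).2 ?_
  exact tendstoL2_trace_unique hB hv hv' h0 (fun i => h1 (dirQ i)) h0' (fun i => h1' (dirQ i)) h2 h2'

/-- A smooth approximating sequence converges to the trace on the boundary. -/
theorem exists_isTrace (hΩ : IsLipschitzDomain Ω) (ht : t₁ < t₂)
    (hm : IsGaussGreenMeasure Ω m C) {f : E n × ℝ → ℝ} {v : ℕ → E n × ℝ → ℝ}
    (hv : ∀ j, ContDiff ℝ ∞ (v j)) (h0 : TendstoL2 (volume.restrict (cyl Ω t₁ t₂)) v f)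
    (h1 : ∀ e, TendstoL2 (volume.restrict (cyl Ω t₁ t₂)) (fun j z => fderiv ℝ (v j) z e)
        (weakDeriv (cyl Ω t₁ t₂) e f)) :
    ∃ g, TendstoL2 (cylMeasure Ω t₁ t₂ m) v g ∧
      IsTrace (cyl Ω t₁ t₂) (boundaryMeasure Ω t₁ t₂) f g := by
  obtain ⟨B, hB⟩ := exists_trace_bound hΩ ht hm
  obtain ⟨g, hg⟩ := exists_tendstoL2_trace hB hv
    (fun j => memLp_cylMeasure hΩ ht hm (hv j).continuous.continuousOn) h0 fun i => h1 (dirQ i)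
  have hg' := hg.mono_measure ENNReal.coe_ne_top (boundaryMeasure_le (t₁ := t₁) (t₂ := t₂) hm)
  exact ⟨g, hg, hg'.2.1, v, hv, h0.2.2, fun e => (h1 e).2.2, hg'.2.2⟩

theorem trace_isTrace {f g : E n × ℝ → ℝ} 
    (h : IsTrace (cyl Ω t₁ t₂) (boundaryMeasure Ω t₁ t₂) f g) :
    IsTrace (cyl Ω t₁ t₂) (boundaryMeasure Ω t₁ t₂) f (bdTrace Ω t₁ t₂ f) := by
  have h' : ∃ g, IsTrace (cyl Ω t₁ t₂) (boundaryMeasure Ω t₁ t₂) f g := ⟨g, h⟩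
  rw [bdTrace, trace, dif_pos h']; exact h'.choose_spec

/-- The trace selected by choice is, almost everywhere, the limit of any smooth approximating
sequence; this is the form in which traces are used below. -/
theorem tendstoL2_bdTrace (hn : 1 ≤ n) (hΩ : IsLipschitzDomain Ω) (ht : t₁ < t₂)
    (hm : IsGaussGreenMeasure Ω m C) {f : E n × ℝ → ℝ} (hf : MemH1 (cyl Ω t₁ t₂) f)
    {v : ℕ → E n × ℝ → ℝ}
    (hv : ∀ j, ContDiff ℝ ∞ (v j)) (h0 : TendstoL2 (volume.restrict (cyl Ω t₁ t₂)) v f)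
    (h1 : ∀ e, TendstoL2 (volume.restrict (cyl Ω t₁ t₂)) (fun j z => fderiv ℝ (v j) z e)
        (weakDeriv (cyl Ω t₁ t₂) e f)) :
    TendstoL2 (cylMeasure Ω t₁ t₂ m) v (bdTrace Ω t₁ t₂ f) := by
  obtain ⟨g, hg, hg'⟩ := exists_isTrace hΩ ht hm hv h0 h1
  refine hg.congr (fun j => EventuallyEq.rfl) ?_
  exact (ae_boundaryMeasure_iff hm).1 (IsTrace.ae_eq hn hΩ ht hf hg' (trace_isTrace hg'))

end CylinderTraces

/-! ### Tangential derivatives of the trace -/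

section Stokes

variable {V ι : Type*} [NormedAddCommGroup V] [NormedSpace ℝ V] [FiniteDimensional ℝ V]
  [MeasureSpace V] [BorelSpace V] [IsFiniteMeasureOnCompacts (volume : Measure V)]
  {D : Set V} {dir : ι → V} {μ : Measure V} {N : V → ι → ℝ}

theorem contDiff_fderiv_apply {v : V → ℝ} (hv : ContDiff ℝ ∞ v) (e : V) :
    ContDiff ℝ ∞ fun z => fderiv ℝ v z e :=
  (hv.fderiv_right (m := ∞) (by simp)).clm_apply contDiff_const

theorem fderiv_fderiv_comm {v : V → ℝ} (hv : ContDiff ℝ ∞ v) (z e e' : V) :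
    fderiv ℝ (fun y => fderiv ℝ v y e) z e' = fderiv ℝ (fun y => fderiv ℝ v y e') z e := by
  have hd : DifferentiableAt ℝ (fderiv ℝ v) z :=
    (hv.fderiv_right (m := ∞) (by simp)).differentiable (by simp) z
  have h1 : ∀ e, fderiv ℝ (fun y => fderiv ℝ v y e) z = (fderiv ℝ (fderiv ℝ v) z).flip e := fun e =>
    (hd.hasFDerivAt.clm_apply (hasFDerivAt_const e z)).fderiv.trans (by ext; simp)
  rw [h1, h1]
  exact (hv.contDiffAt.isSymmSndFDerivAt (by simpa using WithTop.coe_le_coe.2 (le_top : (2 : ℕ∞) ≤ ⊤))) e' e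

theorem IsGaussGreen.green_mul (h : IsGaussGreen D dir μ N) (hD : IsOpen D) {f g : V → ℝ}
    (hf : ContDiff ℝ ∞ f) (hg : ContDiff ℝ ∞ g) (i : ι) :
    ∫ z, f z * g z * N z i ∂μ =
      ∫ z in D, (fderiv ℝ f z (dir i) * g z + f z * fderiv ℝ g z (dir i)) := by
  rw [← h.green _ ((hf.mul hg).of_le (by simp)).contDiffOn i]
  refine setIntegral_congr_fun hD.measurableSet fun z hz => ?_
  have d1 := (hf.differentiable (by simp) z).hasFDerivAt
  have d2 := (hg.differentiable (by simp) z).hasFDerivAt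
  have d3 : HasFDerivAt (fun z => f z * g z) _ z := d1.mul d2
  change fderivWithin ℝ _ _ z (dir i) = _
  rw [fderivWithin_of_mem_nhds (mem_of_superset (hD.mem_nhds hz) subset_closure), d3.fderiv]
  simp; ring

/-- After Gauss-Green the second derivatives cancel by symmetry, and both sides become the integral
over `D` of `∂ᵢθ ∂ₖv - ∂ₖθ ∂ᵢv`. In other words, `Nᵢ∂ₖ - Nₖ∂ᵢ` is tangential, and can be moved from
`v` to the test function. -/
theorem IsGaussGreen.stokes (h : IsGaussGreen D dir μ N) (hD : IsOpen D)
    (hK : IsCompact (closure D)) {v θ : V → ℝ} (hv : ContDiff ℝ ∞ v) (hθ : ContDiff ℝ ∞ θ)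
    (i k : ι) :
    ∫ z, θ z * fderiv ℝ v z (dir k) * N z i ∂μ - ∫ z, θ z * fderiv ℝ v z (dir i) * N z k ∂μ =
      ∫ z, v z * fderiv ℝ θ z (dir i) * N z k ∂μ - ∫ z, v z * fderiv ℝ θ z (dir k) * N z i ∂μ := by
  have hDf := isFiniteMeasure_restrict_of_closure hK
  have hDK : ∀ᵐ z ∂(volume : Measure V).restrict D, z ∈ closure D := by
    filter_upwards [ae_restrict_mem hD.measurableSet] with z hz using subset_closure hz
  have hv' := contDiff_fderiv_apply hv
  have hθ' := contDiff_fderiv_apply hθ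
  have hi : ∀ {f : V → ℝ}, ContDiff ℝ ∞ f → Integrable f ((volume : Measure V).restrict D) :=
    fun hf => memLp_one_iff_integrable.1 <| ContinuousOn.memLp_of_isCompact hK
      hf.continuous.continuousOn hDK
  have hc : ∀ {f g : V → ℝ} (_ : ContDiff ℝ ∞ f) (_ : ContDiff ℝ ∞ g) i,
      Integrable (fun z => fderiv ℝ f z (dir i) * g z + f z * fderiv ℝ g z (dir i))
        ((volume : Measure V).restrict D) := fun hf hg i =>
    hi (((contDiff_fderiv_apply hf _).mul hg).add (hf.mul (contDiff_fderiv_apply hg _)))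
  rw [h.green_mul hD hθ (hv' _), h.green_mul hD hθ (hv' _), h.green_mul hD hv (hθ' _),
    h.green_mul hD hv (hθ' _), ← integral_sub (hc hθ (hv' _) _) (hc hθ (hv' _) _),
    ← integral_sub (hc hv (hθ' _) _) (hc hv (hθ' _) _)]
  refine integral_congr_ae (Eventually.of_forall fun z => ?_)
  simp only [fderiv_fderiv_comm hv z (dir k) (dir i), fderiv_fderiv_comm hθ z (dir k) (dir i)]
  ring

/-- The tangential derivatives of a function with zero trace vanish. -/
theorem IsGaussGreen.tangential (h : IsGaussGreen D dir μ N) (hD : IsOpen D)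
    (hK : IsCompact (closure D)) {v : ℕ → V → ℝ} (hv : ∀ j, ContDiff ℝ ∞ (v j))
    (h0 : TendstoL2 μ v fun _ => 0) {U : ι → V → ℝ}
    (hU : ∀ i, TendstoL2 μ (fun j z => fderiv ℝ (v j) z (dir i)) (U i)) (i k : ι) :
    ∀ᵐ z ∂μ, N z i * U k z = N z k * U i z := by
  have hμ := h.finite
  have hN : ∀ i, ∀ᵐ z ∂μ, |N z i| ≤ 1 := fun i => by filter_upwards [h.bound] with z hz using hz i
  have hb : ∀ {θ : V → ℝ}, ContDiff ℝ ∞ θ → ∀ i, AEStronglyMeasurable (fun z => N z i * θ z) μ ∧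
      ∃ B : ℝ, ∀ᵐ z ∂μ, |N z i * θ z| ≤ B := fun {θ} hθ i => by
    obtain ⟨B, hB⟩ := hK.exists_bound_of_continuousOn hθ.continuous.continuousOn
    refine ⟨(h.meas i).mul hθ.continuous.aestronglyMeasurable, B, ?_⟩
    filter_upwards [hN i, h.ae_mem] with z hz hz'
    rw [abs_mul]
    calc |N z i| * |θ z| ≤ 1 * |θ z| := mul_le_mul_of_nonneg_right hz (abs_nonneg _)
      _ ≤ B := by rw [one_mul]; exact hB z hz'
  have one : TendstoL2 μ (fun _ _ => (1 : ℝ)) (fun _ => 1) :=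
    ⟨fun _ => memLp_const 1, memLp_const 1, by simp⟩
  have lim : ∀ {θ : V → ℝ}, ContDiff ℝ ∞ θ → ∀ {f : ℕ → V → ℝ} {g : V → ℝ}, TendstoL2 μ f g → ∀ i,
      Tendsto (fun j => ∫ z, N z i * θ z * f j z ∂μ) atTop (𝓝 (∫ z, N z i * θ z * g z ∂μ)) := by
    intro θ hθ f g hfg i
    obtain ⟨h1, B, h2⟩ := hb hθ i
    simpa using (hfg.bdd_mul h1 h2).integral_mul one
  have hint : ∀ i k, Integrable (fun z => N z i * U k z) μ := fun i k =>
    memLp_one_iff_integrable.1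
      ((memLp_bdd_mul (h.meas i) (hN i) (hU k).2.1).mono_exponent (by norm_num))
  have key : ∀ᵐ z ∂μ, N z i * U k z - N z k * U i z = 0 := by
    refine ae_eq_zero_of_integral_contDiff_smul_eq_zero
      ((hint i k).sub (hint k i)).locallyIntegrable fun θ hθ hθc => ?_
    have e1 : ∀ i, ContDiff ℝ ∞ fun z => fderiv ℝ θ z (dir i) := fun i => contDiff_fderiv_apply hθ _
    have l1 := (lim hθ (hU k) i).sub (lim hθ (hU i) k)
    have l2 := (lim (e1 i) h0 k).sub (lim (e1 k) h0 i)
    have l3 : ∀ j, ∫ z, N z i * θ z * fderiv ℝ (v j) z (dir k) ∂μ -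
        ∫ z, N z k * θ z * fderiv ℝ (v j) z (dir i) ∂μ =
        ∫ z, N z k * fderiv ℝ θ z (dir i) * v j z ∂μ -
          ∫ z, N z i * fderiv ℝ θ z (dir k) * v j z ∂μ := fun j => by
      convert h.stokes hD hK (hv j) hθ i k using 2 <;>
        exact integral_congr_ae (Eventually.of_forall fun z => by ring)
    simp only [l3] at l1
    have l4 := tendsto_nhds_unique l1 l2
    simp only [mul_zero, integral_zero, sub_zero] at l4
    rw [← l4]
    have b : ∀ i k, Integrable (fun z => N z i * θ z * U k z) μ := fun i k => by
      obtain ⟨h1, B, h2⟩ := hb hθ i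
      exact memLp_one_iff_integrable.1
        ((memLp_bdd_mul h1 h2 (hU k).2.1).mono_exponent (by norm_num))
    rw [← integral_sub (b i k) (b k i)]
    refine integral_congr_ae (Eventually.of_forall fun z => ?_)
    simp only [smul_eq_mul]; ring
  filter_upwards [key] with z hz
  linarith

end Stokes

/-! ### Boundary values of the gradient of an admissible function. -/

section Admissible

variable {n : ℕ} {Ω : Set (E n)} {t₁ t₂ : ℝ} {m : Measure (E n)} {C : NNReal}

/-- Smooth approximations of an admissible function, with convergence of the derivatives on the
boundary to multiples of the normal derivative. -/
theorem IsAdmissibleFun.exists_approx (hn : 1 ≤ n) (hΩ : IsLipschitzDomain Ω) (ht : t₁ < t₂)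
    (hm : IsGaussGreenMeasure Ω m C) {u : E n × ℝ → ℝ} (hu : IsAdmissibleFun Ω t₁ t₂ u) :
    ∃ v : ℕ → E n × ℝ → ℝ, (∀ j, ContDiff ℝ ∞ (v j)) ∧
      TendstoL2 (volume.restrict (cyl Ω t₁ t₂)) v u ∧
      (∀ e, TendstoL2 (volume.restrict (cyl Ω t₁ t₂)) (fun j z => fderiv ℝ (v j) z e)
        (weakDeriv (cyl Ω t₁ t₂) e u)) ∧
      (∀ e e', TendstoL2 (volume.restrict (cyl Ω t₁ t₂))
        (fun j z => fderiv ℝ (fun y => fderiv ℝ (v j) y e) z e')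
        (weakDeriv (cyl Ω t₁ t₂) e' (weakDeriv (cyl Ω t₁ t₂) e u))) ∧
      TendstoL2 (cylMeasure Ω t₁ t₂ m) v (fun _ => 0) ∧
      (∀ i, TendstoL2 (cylMeasure Ω t₁ t₂ m) (fun j z => fderiv ℝ (v j) z (dirQ i))
        (fun z => cylNormal Ω t₁ t₂ z i * normalDeriv Ω t₁ t₂ u z)) ∧
      ∀ᵐ z ∂endMeasure Ω t₁ t₂, normalDeriv Ω t₁ t₂ u z = 0 := by
  obtain ⟨v, hv, h0, h1, h2⟩ := exists_smooth_approx (isOpen_cyl hΩ) (hΩ.isCompact_closure_cyl ht)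
    (fun z hz => hΩ.coneCond_cyl ht hz) hu.memH2
  have hGG := cyl_isGaussGreen hΩ ht hm
  have t0 := tendstoL2_bdTrace hn hΩ ht hm hu.memH2.1 hv h0 h1
  have t1 := fun e => tendstoL2_bdTrace hn hΩ ht hm (hu.memH2.2 e)
    (fun j => contDiff_fderiv_apply (hv j) e) (h1 e) (h2 e)
  have hall : ∀ᵐ z ∂boundaryMeasure Ω t₁ t₂, bdTrace Ω t₁ t₂ u z = 0 := by
    rw [boundaryMeasure, ae_add_measure_iff]
    exact ⟨hu.lateral, by filter_upwards [hu.ends] with z hz using hz.1⟩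
  replace t0 : TendstoL2 (cylMeasure Ω t₁ t₂ m) v (fun _ => 0) :=
    t0.congr (fun j => EventuallyEq.rfl) ((ae_boundaryMeasure_iff hm).1 hall)
  refine ⟨v, hv, h0, h1, h2, t0, ?_⟩
  set U : Option (Fin n) → E n × ℝ → ℝ := fun i =>
    bdTrace Ω t₁ t₂ (weakDeriv (cyl Ω t₁ t₂) (dirQ i) u) with hU
  have htan := hGG.tangential (isOpen_cyl hΩ) (hΩ.isCompact_closure_cyl ht) hv t0
    (U := U) fun i => t1 (dirQ i)
  have htan' : ∀ᵐ z ∂cylMeasure Ω t₁ t₂ m, ∀ i k,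
      cylNormal Ω t₁ t₂ z i * U k z = cylNormal Ω t₁ t₂ z k * U i z :=
    ae_all_iff.2 fun i => ae_all_iff.2 fun k => htan i k
  have hend : ∀ᵐ z ∂endMeasure Ω t₁ t₂, U none z = 0 ∧ z.2 ∉ Ioo t₁ t₂ := by
    have h3 : ∀ᵐ z ∂endMeasure Ω t₁ t₂, z.2 ∉ Ioo t₁ t₂ := by rw [ae_endMeasure]; simp
    filter_upwards [hu.ends, h3] with z hz hz' using ⟨hz.2, hz'⟩
  -- On the lateral side, multiplying `Nᵢ Uₖ = Nₖ Uᵢ` by `Nₖ` and summing with `|ν| = 1` shows that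
  -- the gradient is normal. On the ends only the time component of `N` is nonzero, and since `∂ₜu =
  -- 0` there, the whole gradient vanishes.
  have hfin : ∀ᵐ z ∂cylMeasure Ω t₁ t₂ m, ∀ i,
      U i z = cylNormal Ω t₁ t₂ z i * normalDeriv Ω t₁ t₂ u z := by
    rw [cylMeasure, ae_add_measure_iff] at htan' ⊢
    have hnd : ∀ z, normalDeriv Ω t₁ t₂ u z = ∑ i, outerNormal Ω z.1 i * U (some i) z :=
      fun z => rfl
    constructor
    · filter_upwards [htan'.1, ae_lateral (t₁ := t₁) (t₂ := t₂) hm] with z hz hz' i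
      have hs : ∑ i, outerNormal Ω z.1 i * outerNormal Ω z.1 i = 1 := by
        have := hz'.2.1.1
        have h4 := EuclideanSpace.real_norm_sq_eq (outerNormal Ω z.1)
        rw [this] at h4
        simp only [← sq]; linarith
      have hc : ∀ i, cylNormal Ω t₁ t₂ z (some i) = outerNormal Ω z.1 i := fun i => by
        simp only [cylNormal, if_pos hz'.2.2]
      have hc0 : cylNormal Ω t₁ t₂ z none = 0 := by simp only [cylNormal, if_pos hz'.2.2]
      calc U i z = ∑ k, outerNormal Ω z.1 k * outerNormal Ω z.1 k * U i z := by
            rw [← Finset.sum_mul, hs, one_mul]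
        _ = ∑ k, cylNormal Ω t₁ t₂ z i * (outerNormal Ω z.1 k * U (some k) z) := by
            refine Finset.sum_congr rfl fun k _ => ?_
            have := hz i (some k)
            rw [hc] at this
            linear_combination -outerNormal Ω z.1 k * this
        _ = _ := by rw [← Finset.mul_sum, hnd]
    · filter_upwards [htan'.2, hend] with z hz hz'
      have hc : ∀ i, cylNormal Ω t₁ t₂ z (some i) = 0 := fun i => by
        simp only [cylNormal, if_neg hz'.2]
      have hc0 : cylNormal Ω t₁ t₂ z none ≠ 0 := by
        simp only [cylNormal, if_neg hz'.2]; split_ifs <;> norm_num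
      have h0 : ∀ i, U i z = 0 := by
        rintro (_ | i)
        · exact hz'.1
        · have := hz none (some i)
          rw [hc, zero_mul] at this
          exact (mul_eq_zero.1 this).resolve_left hc0
      intro i
      rw [hnd]
      simp only [h0, mul_zero, Finset.sum_const_zero]
  refine ⟨fun i => (t1 (dirQ i)).congr (fun j => EventuallyEq.rfl) (by
    filter_upwards [hfin] with z hz using hz i), ?_⟩
  rw [cylMeasure, ae_add_measure_iff] at hfin
  filter_upwards [hfin.2, hend] with z hz hz'
  have hs : normalDeriv Ω t₁ t₂ u z = ∑ i, outerNormal Ω z.1 i * U (some i) z := rfl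
  rw [hs]
  refine Finset.sum_eq_zero fun i _ => ?_
  rw [hz]
  simp only [cylNormal, if_neg hz'.2, zero_mul, mul_zero]

end Admissible

/-! ### The pointwise Carleman inequality -/

/-- The values at a point of a function `w`, of a matrix `b`, of the exponent `ψ`, and of their
derivatives, together with the parameters of the weight; `h₁` is the gradient of the divergence of
`b ∇ψ` and `r = exp (τ φ)`. -/
structure Jet (ι : Type*) where
  (τ lam φ r s w : ℝ)
  (w₁ ψ₁ h₁ : ι → ℝ)
  (w₂ ψ₂ b : ι → ι → ℝ)
  b₁ : ι → ι → ι → ℝ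

namespace Jet

variable {ι : Type*} [Fintype ι] (J : Jet ι)

/-- In terms of functions: `Y = b∇ψ`, `β = (b∇ψ|∇ψ)`, `h = div Y - s`, `v = exp(τφ) w`, `p = b∇v`,
`E = (b∇v|∇v)`, `X = b∇φ`, `S = X·∇v`, `a = (b∇φ|∇φ)` and `g = div X - sλφ`. A letter prefixed by
`d` is the formal derivative, the last index being the direction of differentiation; likewise in
`b₁`, `ψ₂`, `w₂` and `v₂`. Treating all these values as independent numbers makes the fundamental
identity purely algebraic. -/
def Y (i : ι) : ℝ := ∑ j, J.b i j * J.ψ₁ j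
def dY (k i : ι) : ℝ := ∑ j, (J.b₁ k j i * J.ψ₁ j + J.b k j * J.ψ₂ j i)
def β : ℝ := ∑ i, J.Y i * J.ψ₁ i
def dβ (k : ι) : ℝ := ∑ i, (J.dY i k * J.ψ₁ i + J.Y i * J.ψ₂ i k)
def h : ℝ := ∑ i, J.dY i i - J.s
def v : ℝ := J.r * J.w
def v₁ (i : ι) : ℝ := J.r * (J.w₁ i + J.τ * J.lam * J.φ * J.ψ₁ i * J.w)
def v₂ (j i : ι) : ℝ :=
  J.r * (J.τ * J.lam * J.φ * J.ψ₁ i * (J.w₁ j + J.τ * J.lam * J.φ * J.ψ₁ j * J.w) + J.w₂ j i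
    + J.τ * J.lam * J.φ * (J.lam * J.ψ₁ i * J.ψ₁ j * J.w + J.ψ₂ j i * J.w + J.ψ₁ j * J.w₁ i))
def p (i : ι) : ℝ := ∑ j, J.b i j * J.v₁ j
def dp (i k : ι) : ℝ := ∑ j, (J.b₁ i j k * J.v₁ j + J.b i j * J.v₂ j k)
def E : ℝ := ∑ i, J.p i * J.v₁ i
def dE (i : ι) : ℝ := ∑ k, (J.dp k i * J.v₁ k + J.p k * J.v₂ k i)
def X (i : ι) : ℝ := J.lam * J.φ * J.Y i
def dX (k i : ι) : ℝ := J.lam * J.φ * (J.dY k i + J.lam * J.ψ₁ i * J.Y k)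
def S : ℝ := ∑ i, J.X i * J.v₁ i
def dS (i : ι) : ℝ := ∑ k, (J.dX k i * J.v₁ k + J.X k * J.v₂ k i)
def g : ℝ := J.lam ^ 2 * J.φ * J.β + J.lam * J.φ * J.h
def dg (i : ι) : ℝ := J.lam ^ 3 * J.φ * J.ψ₁ i * J.β + J.lam ^ 2 * J.φ * J.dβ i
  + J.lam ^ 2 * J.φ * J.ψ₁ i * J.h + J.lam * J.φ * J.h₁ i
def a : ℝ := J.lam ^ 2 * J.φ ^ 2 * J.β
def da (i : ι) : ℝ := 2 * J.lam ^ 3 * J.φ ^ 2 * J.ψ₁ i * J.β + J.lam ^ 2 * J.φ ^ 2 * J.dβ i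

/-- The value of the flux. -/
def flux (i : ι) : ℝ :=
  2 * J.p i * J.S - J.X i * J.E + J.g * J.v * J.p i + J.τ ^ 2 * J.a * J.v ^ 2 * J.X i

/-- The value of the `i`-th derivative of the `i`-th component of the flux. -/
def dflux (i : ι) : ℝ :=
  2 * (J.dp i i * J.S + J.p i * J.dS i) - (J.dX i i * J.E + J.X i * J.dE i)
    + (J.dg i * J.v * J.p i + J.g * J.v₁ i * J.p i + J.g * J.v * J.dp i i)
    + J.τ ^ 2 * (J.da i * J.v ^ 2 * J.X i + 2 * J.a * J.v * J.v₁ i * J.X i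
      + J.a * J.v ^ 2 * J.dX i i)

/-- The second order operator applied to `w`. -/
def P : ℝ := ∑ i, ∑ j, (J.b₁ i j i * J.w₁ j + J.b i j * J.w₂ j i)

/-- The quadratic form which has to be coercive. -/
def Θ (ξ : ι → ℝ) : ℝ :=
  2 * ∑ i, ∑ k, (∑ j, J.b i j * ξ j) * J.dY k i * ξ k - ∑ i, ∑ k, ∑ j, J.Y i * J.b₁ k j i * ξ k * ξ j

theorem S_eq : J.S = J.lam * J.φ * ∑ i, J.Y i * J.v₁ i := by
  rw [S, Finset.mul_sum]
  exact Finset.sum_congr rfl fun i _ => by rw [X]; ring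

theorem sum_p_mul_ψ (hb : ∀ i j, J.b i j = J.b j i) :
    ∑ i, J.p i * J.ψ₁ i = ∑ i, J.Y i * J.v₁ i := by
  simp only [p, Y, Finset.sum_mul]
  rw [Finset.sum_comm]
  exact Finset.sum_congr rfl fun i _ => Finset.sum_congr rfl fun j _ => by rw [hb]; ring

/-- This is the conjugation of the operator by `exp(τφ)`. The last term compensates the `s` removed
from `div X` in the definition of `g`. -/
theorem r_mul_P (hb : ∀ i j, J.b i j = J.b j i) :
    J.r * J.P = ∑ i, J.dp i i - 2 * J.τ * J.S - J.τ * J.g * J.v + J.τ ^ 2 * J.a * J.v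
      - J.τ * J.s * J.lam * J.φ * J.v := by
  set c := J.τ * J.lam * J.φ with hc
  have e1 : ∑ i, J.dp i i = J.r * (J.P + c * J.w * ∑ i, J.dY i i + 2 * c * ∑ i, J.Y i * J.w₁ i
      + (c ^ 2 + c * J.lam) * J.w * J.β) := by
    have e2 : ∑ i, J.Y i * J.w₁ i = ∑ i, ∑ j, J.b i j * J.ψ₁ i * J.w₁ j := by
      simp only [Y, Finset.sum_mul]
      rw [Finset.sum_comm]
      exact Finset.sum_congr rfl fun i _ => Finset.sum_congr rfl fun j _ => by rw [hb]
    have e2' : ∑ i, J.Y i * J.w₁ i = ∑ i, ∑ j, J.b i j * J.ψ₁ j * J.w₁ i := by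
      simp only [Y, Finset.sum_mul]
    have e3 : 2 * c * ∑ i, J.Y i * J.w₁ i =
        c * (∑ i, ∑ j, J.b i j * J.ψ₁ i * J.w₁ j + ∑ i, ∑ j, J.b i j * J.ψ₁ j * J.w₁ i) := by
      rw [← e2, ← e2']; ring
    rw [e3]
    simp only [dp, P, dY, β, Y, Finset.sum_mul, Finset.mul_sum, ← Finset.sum_add_distrib]
    refine Finset.sum_congr rfl fun i _ => Finset.sum_congr rfl fun j _ => ?_
    simp only [v₁, v₂, ← hc]; ring
  have e4 : ∑ i, J.Y i * J.v₁ i = J.r * (∑ i, J.Y i * J.w₁ i + c * J.w * J.β) := by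
    simp only [β, Finset.mul_sum, ← Finset.sum_add_distrib]
    refine Finset.sum_congr rfl fun i _ => ?_
    simp only [v₁, ← hc]; ring
  rw [e1, J.S_eq, e4]
  simp only [g, a, h, v]
  have : J.τ * J.lam * J.φ = c := rfl
  rw [hc]; ring

/-- The Hessian of `v` is brought to the form it has in `∑ i, p i * dS i`. The two contributions
cancel in the divergence of the flux, where second derivatives then survive only through `div p`. -/
theorem sum_X_mul_dE (hb : ∀ i j, J.b i j = J.b j i) (hv : ∀ i j, J.v₂ i j = J.v₂ j i) :
    ∑ i, J.X i * J.dE i = ∑ i, ∑ k, ∑ j, J.X i * J.b₁ k j i * J.v₁ k * J.v₁ j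
      + 2 * ∑ i, ∑ k, J.p i * (J.X k * J.v₂ k i) := by
  have e1 : ∀ i, J.dE i = ∑ k, ∑ j, J.b₁ k j i * J.v₁ k * J.v₁ j + 2 * ∑ k, J.p k * J.v₂ k i := by
    intro i
    have e2 : ∑ k, J.p k * J.v₂ k i = ∑ k, ∑ j, J.b k j * J.v₂ j i * J.v₁ k := by
      simp only [p, Finset.sum_mul]
      rw [Finset.sum_comm]
      exact Finset.sum_congr rfl fun i _ => Finset.sum_congr rfl fun j _ => by rw [hb]; ring
    rw [dE, two_mul]
    conv_rhs => rw [e2, ← add_assoc]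
    rw [Finset.sum_add_distrib, ← e2]
    congr 1
    rw [e2, ← Finset.sum_add_distrib]
    refine Finset.sum_congr rfl fun k _ => ?_
    rw [dp, Finset.sum_mul, ← Finset.sum_add_distrib]
    exact Finset.sum_congr rfl fun j _ => by ring
  have e3 : ∑ i, ∑ k, J.p i * (J.X k * J.v₂ k i) = ∑ i, ∑ k, J.X i * (J.p k * J.v₂ k i) := by
    rw [Finset.sum_comm]
    exact Finset.sum_congr rfl fun i _ => Finset.sum_congr rfl fun j _ => by rw [hv]; ring
  rw [e3]
  simp only [e1, mul_add, Finset.sum_add_distrib, Finset.mul_sum]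
  congr 1
  · exact Finset.sum_congr rfl fun i _ => Finset.sum_congr rfl fun j _ =>
      Finset.sum_congr rfl fun k _ => by ring
  · exact Finset.sum_congr rfl fun i _ => Finset.sum_congr rfl fun j _ => by ring

theorem sum_dflux (hb : ∀ i j, J.b i j = J.b j i) (hv : ∀ i j, J.v₂ i j = J.v₂ j i) :
    ∑ i, J.dflux i = 2 * (∑ i, J.dp i i) * J.S + 2 * ∑ i, ∑ k, J.p i * J.dX k i * J.v₁ k
      - (∑ i, J.dX i i) * J.E - ∑ i, ∑ k, ∑ j, J.X i * J.b₁ k j i * J.v₁ k * J.v₁ j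
      + J.v * ∑ i, J.dg i * J.p i + J.g * J.E + J.g * J.v * ∑ i, J.dp i i
      + J.τ ^ 2 * (J.v ^ 2 * ∑ i, J.da i * J.X i + 2 * J.a * J.v * J.S
        + J.a * J.v ^ 2 * ∑ i, J.dX i i) := by
  have e1 := J.sum_X_mul_dE hb hv
  have e2 : ∑ i, J.p i * J.dS i = ∑ i, ∑ k, J.p i * J.dX k i * J.v₁ k
      + ∑ i, ∑ k, J.p i * (J.X k * J.v₂ k i) := by
    simp only [dS, Finset.mul_sum, ← Finset.sum_add_distrib]
    exact Finset.sum_congr rfl fun i _ => Finset.sum_congr rfl fun j _ => by ring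
  have e3 : ∑ i, J.dflux i = 2 * ((∑ i, J.dp i i) * J.S + ∑ i, J.p i * J.dS i)
      - ((∑ i, J.dX i i) * J.E + ∑ i, J.X i * J.dE i)
      + (J.v * ∑ i, J.dg i * J.p i + J.g * J.E + J.g * J.v * ∑ i, J.dp i i)
      + J.τ ^ 2 * (J.v ^ 2 * ∑ i, J.da i * J.X i + 2 * J.a * J.v * J.S
        + J.a * J.v ^ 2 * ∑ i, J.dX i i) := by
    have eE : J.E = ∑ i, J.p i * J.v₁ i := rfl
    have eS : J.S = ∑ i, J.X i * J.v₁ i := rfl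
    conv_rhs => rw [show J.g * J.E = ∑ i, J.g * (J.p i * J.v₁ i) by rw [eE, Finset.mul_sum],
      show 2 * J.a * J.v * J.S = ∑ i, 2 * J.a * J.v * (J.X i * J.v₁ i) by rw [eS, Finset.mul_sum]]
    simp only [Finset.sum_mul, Finset.mul_sum, ← Finset.sum_add_distrib, ← Finset.sum_sub_distrib]
    exact Finset.sum_congr rfl fun i _ => by rw [dflux]; ring
  rw [e3, e1, e2]; ring

/-- The fundamental identity. -/
theorem identity (hb : ∀ i j, J.b i j = J.b j i) (hv : ∀ i j, J.v₂ i j = J.v₂ j i) :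
    (∑ i, J.dp i i + J.τ ^ 2 * J.a * J.v) * (-2 * J.τ * J.S - J.τ * J.g * J.v) =
      -J.τ * ∑ i, J.dflux i + J.τ * (J.lam * J.φ * (J.Θ J.v₁ - J.s * J.E)
        + 2 * J.lam ^ 2 * J.φ * (∑ i, J.Y i * J.v₁ i) ^ 2
        + J.lam ^ 3 * J.φ * J.β * J.v * (∑ i, J.Y i * J.v₁ i)
        + J.lam ^ 2 * J.φ * J.v * (∑ i, J.dβ i * J.p i + J.h * ∑ i, J.Y i * J.v₁ i)
        + J.lam * J.φ * J.v * ∑ i, J.h₁ i * J.p i)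
      + J.τ ^ 3 * J.lam ^ 3 * J.φ ^ 3 * J.v ^ 2 *
        (2 * J.lam * J.β ^ 2 + ∑ i, J.Y i * J.dβ i + J.s * J.β) := by
  -- Differentiating the factor `φ` inside `X` produces the square `2λ²φ (Y·∇v)²`; differentiating
  -- `Y` and the coefficients produces `Θ`.
  have e1 : 2 * ∑ i, ∑ k, J.p i * J.dX k i * J.v₁ k
      - ∑ i, ∑ k, ∑ j, J.X i * J.b₁ k j i * J.v₁ k * J.v₁ j =
      J.lam * J.φ * J.Θ J.v₁ + 2 * J.lam ^ 2 * J.φ * (∑ i, J.Y i * J.v₁ i) ^ 2 := by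
    have e2 : ∑ i, ∑ k, J.p i * J.dX k i * J.v₁ k = J.lam * J.φ *
        ∑ i, ∑ k, J.p i * J.dY k i * J.v₁ k
        + J.lam ^ 2 * J.φ * ((∑ i, J.p i * J.ψ₁ i) * ∑ k, J.Y k * J.v₁ k) := by
      rw [Finset.sum_mul_sum]
      simp only [Finset.mul_sum, ← Finset.sum_add_distrib]
      exact Finset.sum_congr rfl fun i _ => Finset.sum_congr rfl fun j _ => by rw [dX]; ring
    have e3 : ∑ i, ∑ k, ∑ j, J.X i * J.b₁ k j i * J.v₁ k * J.v₁ j =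
        J.lam * J.φ * ∑ i, ∑ k, ∑ j, J.Y i * J.b₁ k j i * J.v₁ k * J.v₁ j := by
      simp only [Finset.mul_sum]
      exact Finset.sum_congr rfl fun i _ => Finset.sum_congr rfl fun j _ =>
        Finset.sum_congr rfl fun k _ => by rw [X]; ring
    rw [e2, e3, J.sum_p_mul_ψ hb, Θ]
    simp only [p]; ring
  have e4 : ∑ i, J.dX i i = J.lam ^ 2 * J.φ * J.β + J.lam * J.φ * ∑ i, J.dY i i := by
    rw [β]
    simp only [Finset.mul_sum, ← Finset.sum_add_distrib]
    exact Finset.sum_congr rfl fun i _ => by rw [dX]; ring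
  have e5 : ∑ i, J.dg i * J.p i = J.lam ^ 3 * J.φ * J.β * (∑ i, J.Y i * J.v₁ i)
      + J.lam ^ 2 * J.φ * (∑ i, J.dβ i * J.p i + J.h * ∑ i, J.Y i * J.v₁ i)
      + J.lam * J.φ * ∑ i, J.h₁ i * J.p i := by
    rw [← J.sum_p_mul_ψ hb]
    simp only [Finset.mul_sum, ← Finset.sum_add_distrib]
    exact Finset.sum_congr rfl fun i _ => by rw [dg]; ring
  have e6 : ∑ i, J.da i * J.X i = J.lam ^ 3 * J.φ ^ 3 *
      (2 * J.lam * J.β ^ 2 + ∑ i, J.Y i * J.dβ i) := by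
    have : 2 * J.lam * J.β ^ 2 = ∑ i, 2 * J.lam * J.β * (J.Y i * J.ψ₁ i) := by
      rw [← Finset.mul_sum]; change _ = _ * J.β; ring
    rw [this]
    simp only [Finset.mul_sum, ← Finset.sum_add_distrib]
    exact Finset.sum_congr rfl fun i _ => by rw [da, X]; ring
  -- Since `div X - g = sλφ`, once the flux is moved to the other side the shift appears exactly
  -- twice, as `-sE` in the gradient terms and as `sβ` in the zero-order term.
  rw [J.sum_dflux hb hv]
  have e7 : J.g = J.lam ^ 2 * J.φ * J.β + J.lam * J.φ * (∑ i, J.dY i i - J.s) := rfl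
  have e8 : J.a = J.lam ^ 2 * J.φ ^ 2 * J.β := rfl
  rw [e4, e5, e6]
  linear_combination J.τ * e1 + (J.τ * J.E + (-J.τ ^ 3 * J.a * J.v ^ 2)) * e7
    + J.τ ^ 3 * J.v ^ 2 * (J.lam * J.φ * J.s) * e8

end Jet

/-! ### Absorption of lower-order terms and the pointwise inequality. -/

namespace Jet

variable {ι : Type*} [Fintype ι] (J : Jet ι)

/-- The scalar absorption argument behind the pointwise Carleman inequality. -/
theorem absorption {τ lam φ s β T x y z V Q C c₀ δ : ℝ} (hτ : 1 ≤ τ) (hφ : 1 ≤ φ) (hl : 1 ≤ lam)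
    (hC : 0 < C) (hc₀ : 0 < c₀) (hδ : 0 < δ) (hβ : δ ≤ β ^ 2) (hT : |T| ≤ C) (hs : s ^ 2 ≤ C)
    (hy : y ^ 2 ≤ C * Q) (hz : z ^ 2 ≤ C * Q) (hlam : 2 * (2 * C + 2 * (C / c₀)) ≤ lam * δ) :
    τ * lam * φ * (c₀ / 2) * Q + τ ^ 3 * lam ^ 4 * φ ^ 3 * δ * V ^ 2
        + 1 / 2 * (τ ^ 2 * s ^ 2 * lam ^ 2 * φ ^ 2 * V ^ 2) ≤
      τ * (lam * φ * (c₀ * Q) + 2 * lam ^ 2 * φ * x ^ 2 + lam ^ 3 * φ * β * V * x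
        + lam ^ 2 * φ * V * y + lam * φ * V * z)
      + τ ^ 3 * lam ^ 3 * φ ^ 3 * V ^ 2 * (2 * lam * β ^ 2 + T) := by
  set Z := τ ^ 3 * lam ^ 3 * φ ^ 3 with hZ
  have hk : 1 ≤ τ * lam * φ := one_le_mul_of_one_le_of_one_le
    (one_le_mul_of_one_le_of_one_le hτ hl) hφ
  set k := τ * lam * φ with hkd
  have hk0 : 0 < k := by linarith
  have hZk : Z = k ^ 3 := by rw [hZ, hkd]; ring
  have hV : 0 ≤ V ^ 2 := sq_nonneg V
  -- Young's inequality with weight `c₀/4`. It is used for the two cross terms in `y` and `z`, which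
  -- together consume half of `c₀ Q`.
  have quad : ∀ {q t : ℝ}, q ^ 2 ≤ C * Q → -(c₀ / 4 * Q) - C / c₀ * t ^ 2 ≤ t * q := by
    intro q t hq
    have h1 : c₀ / (4 * C) * q ^ 2 ≤ c₀ / 4 * Q := by
      calc c₀ / (4 * C) * q ^ 2 ≤ c₀ / (4 * C) * (C * Q) :=
            mul_le_mul_of_nonneg_left hq (by positivity)
        _ = c₀ / 4 * Q := by field_simp
    have h2 : 0 ≤ c₀ / (4 * C) * (q + 2 * C / c₀ * t) ^ 2 := by positivity
    have h3 : c₀ / (4 * C) * (q + 2 * C / c₀ * t) ^ 2 =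
        c₀ / (4 * C) * q ^ 2 + t * q + C / c₀ * t ^ 2 := by field_simp; ring
    linarith
  -- Completing the square with `2λ²φx²`, the cross term with `x` costs one eighth of `λ⁴φβ²V²`;
  -- this leaves `15/8` of the available `2λβ²` once `λ²` is bounded by `(τλφ)²`.
  have b1 : -(lam ^ 4 * φ * β ^ 2 * V ^ 2 / 8) ≤
      2 * lam ^ 2 * φ * x ^ 2 + lam ^ 3 * φ * β * V * x := by
    have : 0 ≤ 2 * lam ^ 2 * φ * (x + lam * β * V / 4) ^ 2 := by positivity
    nlinarith
  have b2 := quad (t := lam * V) hy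
  have b3 := quad (t := V) hz
  have m1 : lam ^ 2 ≤ k ^ 2 := pow_le_pow_left₀ (by linarith) (by
    rw [hkd, mul_right_comm]; exact le_mul_of_one_le_left (by linarith)
      (one_le_mul_of_one_le_of_one_le hτ hφ)) 2
  -- With `k = τλφ ≥ 1` and `Z = k³`, all error terms are reduced to multiples of `Z V²` without any
  -- factor `λ`, except the one in `β²`.
  have kZ : ∀ {t : ℝ}, 0 ≤ t → t ≤ k ^ 2 → k * t ≤ Z := fun h0 h => by
    rw [hZk]; nlinarith
  have k1 : k * lam ^ 2 ≤ Z := kZ (sq_nonneg _) m1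
  have k2 : k * 1 ≤ Z := kZ zero_le_one (one_le_pow₀ hk)
  have k3 : k ^ 2 ≤ Z := by rw [hZk]; exact pow_le_pow_right₀ hk (by norm_num)
  have hβ0 : 0 ≤ β ^ 2 := sq_nonneg β
  have hZ0 : 0 ≤ Z := by rw [hZk]; positivity
  have d1 : τ * (lam ^ 4 * φ * β ^ 2 * V ^ 2 / 8) ≤ Z * lam * β ^ 2 * V ^ 2 / 8 := by
    have : k * lam ^ 2 * (lam * β ^ 2 * V ^ 2 / 8) ≤ Z * (lam * β ^ 2 * V ^ 2 / 8) :=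
      mul_le_mul_of_nonneg_right k1 (by positivity)
    calc _ = k * lam ^ 2 * (lam * β ^ 2 * V ^ 2 / 8) := by rw [hkd]; ring
      _ ≤ _ := this
      _ = _ := by ring
  have hCc : 0 ≤ C / c₀ := by positivity
  have d2 : k * (C / c₀ * (lam * V) ^ 2) ≤ Z * (C / c₀) * V ^ 2 := by
    calc _ = k * lam ^ 2 * (C / c₀ * V ^ 2) := by ring
      _ ≤ Z * (C / c₀ * V ^ 2) := mul_le_mul_of_nonneg_right k1 (by positivity)
      _ = _ := by ring
  have d3 : k * (C / c₀ * V ^ 2) ≤ Z * (C / c₀) * V ^ 2 := by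
    calc _ = k * 1 * (C / c₀ * V ^ 2) := by ring
      _ ≤ Z * (C / c₀ * V ^ 2) := mul_le_mul_of_nonneg_right k2 (by positivity)
      _ = _ := by ring
  have d4 : τ ^ 2 * s ^ 2 * lam ^ 2 * φ ^ 2 * V ^ 2 ≤ Z * C * V ^ 2 := by
    calc _ = k ^ 2 * s ^ 2 * V ^ 2 := by rw [hkd]; ring
      _ ≤ Z * C * V ^ 2 := mul_le_mul_of_nonneg_right
        (mul_le_mul k3 hs (sq_nonneg _) hZ0) hV
  have d5 : -(Z * C * V ^ 2) ≤ Z * V ^ 2 * T := by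
    have := mul_le_mul_of_nonneg_left (neg_le_of_abs_le hT) (mul_nonneg hZ0 hV)
    linarith
  -- The size of `λ` enters here: the error constants amount to at most `λδ/2`, so they and the
  -- desired `λδ` fit into `15/8 λβ²`.
  have d6 : Z * V ^ 2 * (2 * C + 2 * (C / c₀) + lam * δ) ≤ Z * V ^ 2 * (15 / 8 * (lam * β ^ 2)) := by
    refine mul_le_mul_of_nonneg_left ?_ (mul_nonneg hZ0 hV)
    have := mul_le_mul_of_nonneg_left hβ (by linarith : (0 : ℝ) ≤ lam)
    have h4 : 0 < lam * δ := by positivity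
    linarith
  have b1' := mul_le_mul_of_nonneg_left b1 (by linarith : (0 : ℝ) ≤ τ)
  have b2' := mul_le_mul_of_nonneg_left b2 hk0.le
  have b3' := mul_le_mul_of_nonneg_left b3 hk0.le
  have f1 : τ * (lam * φ * (c₀ * Q) + 2 * lam ^ 2 * φ * x ^ 2 + lam ^ 3 * φ * β * V * x
        + lam ^ 2 * φ * V * y + lam * φ * V * z) = k * (c₀ * Q)
        + τ * (2 * lam ^ 2 * φ * x ^ 2 + lam ^ 3 * φ * β * V * x) + k * (lam * V * y)
        + k * (V * z) := by rw [hkd]; ring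
  have f2 : τ ^ 3 * lam ^ 4 * φ ^ 3 * δ * V ^ 2 = Z * V ^ 2 * (lam * δ) := by rw [hZ]; ring
  rw [f1, f2]
  have hZC : 0 ≤ Z * C * V ^ 2 := by positivity
  linarith

/-- It combines `4AB ≤ (A + B)²` with `(p + q)² ≤ 2p² + 2q²`. -/
theorem mul_le_of_add_eq {A B p q : ℝ} (h : A + B = p + q) :
    A * B ≤ 1 / 2 * p ^ 2 + 1 / 2 * q ^ 2 := by
  have h7 : (A + B) ^ 2 = (p + q) ^ 2 := by rw [h]
  nlinarith [sq_nonneg (A - B), sq_nonneg (p - q)]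

theorem sub_sq_le (a b : ℝ) : (a - b) ^ 2 ≤ 2 * a ^ 2 + 2 * b ^ 2 := by
  nlinarith [sq_nonneg (a + b)]

theorem r_sq_mul_sum_le {C : ℝ} (hψ : ∑ i, J.ψ₁ i ^ 2 ≤ C) :
    J.r ^ 2 * ∑ i, J.w₁ i ^ 2 ≤
      2 * ∑ i, J.v₁ i ^ 2 + 2 * (J.τ * J.lam * J.φ) ^ 2 * C * J.v ^ 2 := by
  set k := J.τ * J.lam * J.φ with hk
  have h9 : J.r ^ 2 * ∑ i, J.w₁ i ^ 2 ≤
      2 * ∑ i, J.v₁ i ^ 2 + 2 * k ^ 2 * (∑ i, J.ψ₁ i ^ 2) * J.v ^ 2 := by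
    simp only [Finset.mul_sum, Finset.sum_mul, ← Finset.sum_add_distrib]
    refine Finset.sum_le_sum fun i _ => ?_
    have h10 : J.r ^ 2 * J.w₁ i ^ 2 = (J.v₁ i - k * J.ψ₁ i * J.v) ^ 2 := by rw [v₁, v, hk]; ring
    rw [h10]
    refine (sub_sq_le _ _).trans (le_of_eq ?_)
    ring
  refine h9.trans ?_
  have := mul_le_mul_of_nonneg_left hψ (by positivity : 0 ≤ 2 * k ^ 2 * J.v ^ 2)
  linarith

/-- The pointwise Carleman inequality. -/
theorem carleman {C c₀ δ : ℝ} (hb : ∀ i j, J.b i j = J.b j i) (hv : ∀ i j, J.v₂ i j = J.v₂ j i)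
    (hτ : 1 ≤ J.τ) (hφ : 1 ≤ J.φ) (hl : 1 ≤ J.lam) (hC : 0 < C) (hc₀ : 0 < c₀) (hδ : 0 < δ)
    (hβ : δ ≤ J.β ^ 2) (hΘ : ∀ ξ : ι → ℝ, c₀ * ∑ i, ξ i ^ 2 ≤
      J.Θ ξ - J.s * ∑ i, (∑ j, J.b i j * ξ j) * ξ i)
    (hT : |∑ i, J.Y i * J.dβ i + J.s * J.β| ≤ C) (hs : J.s ^ 2 ≤ C)
    (hy : (∑ i, J.dβ i * J.p i + J.h * ∑ i, J.Y i * J.v₁ i) ^ 2 ≤ C * ∑ i, J.v₁ i ^ 2)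
    (hz : (∑ i, J.h₁ i * J.p i) ^ 2 ≤ C * ∑ i, J.v₁ i ^ 2) (hψ : ∑ i, J.ψ₁ i ^ 2 ≤ C)
    (hlam : 2 * (2 * C + 2 * (C / c₀)) ≤ J.lam * δ) (hlam' : c₀ * C ≤ 2 * (J.lam * δ)) :
    J.r ^ 2 * (δ / 2 * (J.τ ^ 3 * J.lam ^ 4 * J.φ ^ 3 * J.w ^ 2)
        + c₀ / 8 * (J.τ * J.lam * J.φ * ∑ i, J.w₁ i ^ 2)) ≤
      1 / 2 * (J.r ^ 2 * J.P ^ 2) + J.τ * ∑ i, J.dflux i := by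
  have h1 := absorption (x := ∑ i, J.Y i * J.v₁ i) (V := J.v) hτ hφ hl hC hc₀ hδ hβ hT hs hy hz hlam
  have h2 := J.identity hb hv
  have h3 := J.r_mul_P hb
  set A := ∑ i, J.dp i i + J.τ ^ 2 * J.a * J.v with hA
  set B := -2 * J.τ * J.S - J.τ * J.g * J.v with hB
  -- The mismatch `τsλφv` between `A + B` and the conjugated operator costs only a term of order
  -- `τ²λ²φ²v²`, weaker than the zero-order term gained.
  have h4 : A * B ≤ 1 / 2 * (J.r ^ 2 * J.P ^ 2)
      + 1 / 2 * (J.τ ^ 2 * J.s ^ 2 * J.lam ^ 2 * J.φ ^ 2 * J.v ^ 2) := by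
    have h5 : A + B = J.r * J.P + J.τ * J.s * J.lam * J.φ * J.v := by rw [h3, hA, hB]; ring
    refine (mul_le_of_add_eq h5).trans (le_of_eq ?_)
    ring
  have h5 : J.E = ∑ i, (∑ j, J.b i j * J.v₁ j) * J.v₁ i := rfl
  have h6 := hΘ J.v₁
  rw [← h5] at h6
  set k := J.τ * J.lam * J.φ with hk
  have hk1 : 1 ≤ k := one_le_mul_of_one_le_of_one_le (one_le_mul_of_one_le_of_one_le hτ hl) hφ
  have h7 := mul_le_mul_of_nonneg_left h6 (by linarith : 0 ≤ k)
  have h8 := J.r_sq_mul_sum_le hψ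
  rw [← hk] at h8
  have h9 := mul_le_mul_of_nonneg_left h8 (by positivity : 0 ≤ c₀ / 8 * k)
  -- Returning from `∇v` to `r ∇w` costs a multiple of `k² v²`; it is paid with half of the
  -- zero-order coercivity.
  have h10 : c₀ / 8 * k * (2 * k ^ 2 * C * J.v ^ 2) ≤ k ^ 3 * J.v ^ 2 * (J.lam * δ / 2) := by
    calc _ = k ^ 3 * J.v ^ 2 * (c₀ * C / 4) := by ring
      _ ≤ _ := mul_le_mul_of_nonneg_left (by linarith) (by positivity)
  have h11 : J.r ^ 2 * (δ / 2 * (J.τ ^ 3 * J.lam ^ 4 * J.φ ^ 3 * J.w ^ 2)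
        + c₀ / 8 * (J.τ * J.lam * J.φ * ∑ i, J.w₁ i ^ 2)) =
      k ^ 3 * J.v ^ 2 * (J.lam * δ / 2) + c₀ / 8 * k * (J.r ^ 2 * ∑ i, J.w₁ i ^ 2) := by
    rw [v, hk]; ring
  have hQ0 : 0 ≤ ∑ i, J.v₁ i ^ 2 := Finset.sum_nonneg fun i _ => sq_nonneg _
  have h12 : 0 ≤ k * c₀ * ∑ i, J.v₁ i ^ 2 := by positivity
  have e1 : J.τ ^ 3 * J.lam ^ 4 * J.φ ^ 3 * δ * J.v ^ 2 = k ^ 3 * J.v ^ 2 * (J.lam * δ) := by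
    rw [hk]; ring
  rw [e1] at h1
  rw [h11]
  rw [h2] at h4
  have e2 : J.τ * (J.lam * J.φ * (J.Θ J.v₁ - J.s * J.E)) = k * (J.Θ J.v₁ - J.s * J.E) := by
    rw [hk]; ring
  have e3 : J.τ * (J.lam * J.φ * (c₀ * ∑ i, J.v₁ i ^ 2)) =
      k * (c₀ * ∑ i, J.v₁ i ^ 2) := by rw [hk]; ring
  clear_value A B k
  rw [mul_add, mul_add, mul_add, mul_add, e2] at h4
  rw [mul_add, mul_add, mul_add, mul_add, e3] at h1
  rw [add_assoc (2 * J.lam * J.β ^ 2)] at h4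
  linarith

end Jet

/-! ### Partial derivatives up to the boundary -/

section PartialDerivatives

variable {V : Type*} [NormedAddCommGroup V] [NormedSpace ℝ V] {K : Set V} {e : V} {z : V}

/-- The partial derivative of `F` on `K` in the direction `e`. -/
def pder (K : Set V) (e : V) (F : V → ℝ) (z : V) : ℝ := fderivWithin ℝ F K z e

/-- `F` is differentiable on `K` at `z`, with derivative `d` in the direction `e`. -/
def HasPD (K : Set V) (e : V) (F : V → ℝ) (d : ℝ) (z : V) : Prop :=
  ∃ L : V →L[ℝ] ℝ, HasFDerivWithinAt F L K z ∧ L e = d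

namespace HasPD

variable {F G : V → ℝ} {c d : ℝ}

theorem congr_deriv (h : HasPD K e F c z) (hcd : c = d) : HasPD K e F d z := hcd ▸ h

theorem pder_eq (h : HasPD K e F d z) (hK : UniqueDiffWithinAt ℝ K z) : pder K e F z = d := by
  obtain ⟨L, hL, rfl⟩ := h
  rw [pder, hL.fderivWithin hK]

theorem of_contDiffOn (hF : ContDiffOn ℝ 1 F K) (hz : z ∈ K) : HasPD K e F (pder K e F z) z :=
  ⟨_, (hF.differentiableOn (by simp) z hz).hasFDerivWithinAt, rfl⟩

theorem const (c : ℝ) : HasPD K e (fun _ => c) 0 z := ⟨0, hasFDerivWithinAt_const _ _ _, rfl⟩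

theorem add (hF : HasPD K e F c z) (hG : HasPD K e G d z) :
    HasPD K e (fun y => F y + G y) (c + d) z := by
  obtain ⟨L, hL, rfl⟩ := hF
  obtain ⟨L', hL', rfl⟩ := hG
  exact ⟨_, hL.add hL', rfl⟩

theorem sub (hF : HasPD K e F c z) (hG : HasPD K e G d z) :
    HasPD K e (fun y => F y - G y) (c - d) z := by
  obtain ⟨L, hL, rfl⟩ := hF
  obtain ⟨L', hL', rfl⟩ := hG
  exact ⟨_, hL.sub hL', rfl⟩

theorem mul (hF : HasPD K e F c z) (hG : HasPD K e G d z) :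
    HasPD K e (fun y => F y * G y) (c * G z + F z * d) z := by
  obtain ⟨L, hL, rfl⟩ := hF
  obtain ⟨L', hL', rfl⟩ := hG
  refine ⟨_, hL.mul hL', ?_⟩
  simp; ring

theorem const_mul (c : ℝ) (hG : HasPD K e G d z) : HasPD K e (fun y => c * G y) (c * d) z :=
  ((const c).mul hG).congr_deriv (by ring)

theorem exp (hF : HasPD K e F c z) :
    HasPD K e (fun y => Real.exp (F y)) (Real.exp (F z) * c) z := by
  obtain ⟨L, hL, rfl⟩ := hF
  exact ⟨_, hL.exp, rfl⟩

theorem sum {α : Type*} {t : Finset α} {F : α → V → ℝ} {c : α → ℝ}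
    (h : ∀ i ∈ t, HasPD K e (F i) (c i) z) :
    HasPD K e (fun y => ∑ i ∈ t, F i y) (∑ i ∈ t, c i) z := by
  classical
  induction t using Finset.induction_on with
  | empty => simpa using const 0
  | insert a t ha ih =>
    simp only [Finset.sum_insert ha]
    exact (h a (by simp)).add (ih fun i hi => h i (by simp [hi]))

end HasPD

theorem contDiffOn_pder (hK : UniqueDiffOn ℝ K) {F : V → ℝ} {k l : WithTop ℕ∞}
    (hF : ContDiffOn ℝ l F K) (hkl : k + 1 ≤ l) (e : V) : ContDiffOn ℝ k (pder K e F) K :=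
  (hF.fderivWithin hK hkl).clm_apply contDiffOn_const

theorem pder_eq_fderiv {F : V → ℝ} (hz : K ∈ 𝓝 z) : pder K e F z = fderiv ℝ F z e := by
  rw [pder, fderivWithin_of_mem_nhds hz]

theorem pder_comm {F : V → ℝ} (hF : ContDiffOn ℝ 2 F K) (hz : K ∈ 𝓝 z) (e e' : V) :
    pder K e' (pder K e F) z = pder K e (pder K e' F) z := by
  have hc : ContDiffAt ℝ 2 F z := hF.contDiffAt hz
  have hd : DifferentiableAt ℝ (fderiv ℝ F) z :=
    (hc.fderiv_right (m := 1) (by norm_num)).differentiableAt (by simp)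
  have h1 : ∀ e e', pder K e' (pder K e F) z = fderiv ℝ (fderiv ℝ F) z e' e := fun e e' => by
    rw [pder_eq_fderiv hz]
    have h2 : pder K e F =ᶠ[𝓝 z] fun y => fderiv ℝ F y e := by
      filter_upwards [eventually_mem_nhds_iff.2 hz] with y hy using pder_eq_fderiv hy
    rw [h2.fderiv_eq, (hd.hasFDerivAt.clm_apply (hasFDerivAt_const e z)).fderiv]
    simp
  rw [h1, h1]
  exact (hc.isSymmSndFDerivAt (by simp)) e' e

end PartialDerivatives

/-! ### The Carleman estimate for smooth functions -/

section JetFunctions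

variable {V ι : Type*} [NormedAddCommGroup V] [NormedSpace ℝ V] [Fintype ι]

/-- The divergence of `b ∇ψ`. -/
def divY (K : Set V) (dir : ι → V) (b : ι → ι → V → ℝ) (ψ : V → ℝ) (z : V) : ℝ :=
  ∑ i, ∑ j, (pder K (dir i) (b i j) z * pder K (dir j) ψ z
    + b i j z * pder K (dir i) (pder K (dir j) ψ) z)

/-- The jet of functions on `K`. -/
def jet (K : Set V) (dir : ι → V) (b : ι → ι → V → ℝ) (ψ : V → ℝ) (τ lam s : ℝ) (w : V → ℝ)
    (z : V) : Jet ι where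
  τ := τ
  lam := lam
  φ := Real.exp (lam * ψ z)
  r := Real.exp (τ * Real.exp (lam * ψ z))
  s := s
  w := w z
  w₁ i := pder K (dir i) w z
  ψ₁ i := pder K (dir i) ψ z
  h₁ i := pder K (dir i) (divY K dir b ψ) z
  w₂ j i := pder K (dir i) (pder K (dir j) w) z
  ψ₂ j i := pder K (dir i) (pder K (dir j) ψ) z
  b i j := b i j z
  b₁ i j k := pder K (dir k) (b i j) z

variable {K : Set V} {dir : ι → V} {b : ι → ι → V → ℝ} {ψ : V → ℝ} {τ lam s : ℝ} {w : V → ℝ}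
  {z : V}

/-- Two derivatives of `b` and three of `ψ` are what makes the divergence of `b∇ψ`, and with it `g`
and the flux, continuously differentiable up to the boundary, as Gauss-Green requires. -/
theorem contDiffOn_jet (hK : UniqueDiffOn ℝ K) (hb : ∀ i j, ContDiffOn ℝ 2 (b i j) K)
    (hψ : ContDiffOn ℝ 3 ψ K) (hw : ContDiffOn ℝ 2 w K) :
    ContDiffOn ℝ 1 (divY K dir b ψ) K ∧ ∀ i, ContDiffOn ℝ 1 (fun z =>
      (jet K dir b ψ τ lam s w z).flux i) K := by
  have b0 : ∀ i j, ContDiffOn ℝ 1 (b i j) K := fun i j => (hb i j).of_le (by norm_num)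
  have b1 : ∀ i j k, ContDiffOn ℝ 1 (pder K (dir k) (b i j)) K := fun i j k =>
    contDiffOn_pder hK (hb i j) (by norm_num) _
  have ψ0 : ContDiffOn ℝ 1 ψ K := hψ.of_le (by norm_num)
  have ψ1' : ∀ j, ContDiffOn ℝ 2 (pder K (dir j) ψ) K := fun j =>
    contDiffOn_pder hK hψ (by norm_num) _
  have ψ1 : ∀ j, ContDiffOn ℝ 1 (pder K (dir j) ψ) K := fun j => (ψ1' j).of_le (by norm_num)
  have ψ2 : ∀ i j, ContDiffOn ℝ 1 (pder K (dir i) (pder K (dir j) ψ)) K := fun i j =>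
    contDiffOn_pder hK (ψ1' j) (by norm_num) _
  have w0 : ContDiffOn ℝ 1 w K := hw.of_le (by norm_num)
  have w1 : ∀ j, ContDiffOn ℝ 1 (pder K (dir j) w) K := fun j =>
    contDiffOn_pder hK hw (by norm_num) _
  have hdiv : ContDiffOn ℝ 1 (divY K dir b ψ) K := by
    unfold divY
    exact ContDiffOn.sum fun i _ => ContDiffOn.sum fun j _ =>
      ((b1 i j i).mul (ψ1 j)).add ((b0 i j).mul (ψ2 i j))
  refine ⟨hdiv, fun i => ?_⟩
  set J := jet K dir b ψ τ lam s w
  have hφ : ContDiffOn ℝ 1 (fun z => (J z).φ) K := (contDiffOn_const.mul ψ0).exp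
  have hr : ContDiffOn ℝ 1 (fun z => (J z).r) K := (contDiffOn_const.mul hφ).exp
  have hv : ContDiffOn ℝ 1 (fun z => (J z).v) K := hr.mul w0
  have hv1 : ∀ j, ContDiffOn ℝ 1 (fun z => (J z).v₁ j) K := fun j =>
    hr.mul ((w1 j).add ((((contDiffOn_const (c := τ * lam)).mul hφ).mul (ψ1 j)).mul w0))
  have hp : ∀ j, ContDiffOn ℝ 1 (fun z => (J z).p j) K := fun j =>
    ContDiffOn.sum fun k _ => (b0 j k).mul (hv1 k)
  have hY : ∀ j, ContDiffOn ℝ 1 (fun z => (J z).Y j) K := fun j =>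
    ContDiffOn.sum fun k _ => (b0 j k).mul (ψ1 k)
  have hX : ∀ j, ContDiffOn ℝ 1 (fun z => (J z).X j) K := fun j =>
    ((contDiffOn_const (c := lam)).mul hφ).mul (hY j)
  have hE : ContDiffOn ℝ 1 (fun z => (J z).E) K := ContDiffOn.sum fun k _ => (hp k).mul (hv1 k)
  have hS : ContDiffOn ℝ 1 (fun z => (J z).S) K := ContDiffOn.sum fun k _ => (hX k).mul (hv1 k)
  have hβ : ContDiffOn ℝ 1 (fun z => (J z).β) K := ContDiffOn.sum fun k _ => (hY k).mul (ψ1 k)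
  have hh : ContDiffOn ℝ 1 (fun z => (J z).h) K := hdiv.sub contDiffOn_const
  have hg : ContDiffOn ℝ 1 (fun z => (J z).g) K :=
    (((contDiffOn_const (c := lam ^ 2)).mul hφ).mul hβ).add
      (((contDiffOn_const (c := lam)).mul hφ).mul hh)
  have ha : ContDiffOn ℝ 1 (fun z => (J z).a) K := ((contDiffOn_const (c := lam ^ 2)).mul (hφ.pow 2)).mul hβ
  exact (((((contDiffOn_const (c := 2)).mul (hp i)).mul hS).sub ((hX i).mul hE)).add
    ((hg.mul hv).mul (hp i))).add
      ((((contDiffOn_const (c := τ ^ 2)).mul ha).mul (hv.pow 2)).mul (hX i))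

/-- The bridge from the algebra of jets to calculus: the formal derivatives are the derivatives of
the corresponding functions, so `∑ i, dflux i` really is a divergence. -/
theorem hasPD_jet (hK : UniqueDiffOn ℝ K) (hb : ∀ i j, ContDiffOn ℝ 2 (b i j) K)
    (hψ : ContDiffOn ℝ 3 ψ K) (hw : ContDiffOn ℝ 2 w K) (hz : z ∈ K) (i : ι) :
    HasPD K (dir i) (fun z => (jet K dir b ψ τ lam s w z).β)
      ((jet K dir b ψ τ lam s w z).dβ i) z ∧
    HasPD K (dir i) (fun z => (jet K dir b ψ τ lam s w z).flux i)
      ((jet K dir b ψ τ lam s w z).dflux i) z := by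
  have pd : ∀ {F : V → ℝ} {k : WithTop ℕ∞}, ContDiffOn ℝ k F K → 1 ≤ k →
      HasPD K (dir i) F (pder K (dir i) F z) z := fun h hk => HasPD.of_contDiffOn (h.of_le hk) hz
  have b0 : ∀ j k, HasPD K (dir i) (b j k) _ z := fun j k => pd (hb j k) (by norm_num)
  have ψ0 : HasPD K (dir i) ψ _ z := pd hψ (by norm_num)
  have ψ1 : ∀ j, HasPD K (dir i) (pder K (dir j) ψ) _ z := fun j =>
    pd (contDiffOn_pder (k := 2) hK hψ (by norm_num) _) (by norm_num)
  have w0 : HasPD K (dir i) w _ z := pd hw (by norm_num)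
  have w1 : ∀ j, HasPD K (dir i) (pder K (dir j) w) _ z := fun j =>
    pd (contDiffOn_pder (k := 1) hK hw (by norm_num) _) (by norm_num)
  have hdiv : HasPD K (dir i) (divY K dir b ψ) _ z :=
    pd (contDiffOn_jet (dir := dir) (τ := τ) (lam := lam) (s := s) hK hb hψ hw).1 le_rfl
  set J := jet K dir b ψ τ lam s w
  have hφ : HasPD K (dir i) (fun z => (J z).φ) ((J z).lam * (J z).φ * (J z).ψ₁ i) z :=
    ((HasPD.const_mul lam ψ0).exp).congr_deriv
      (by change (J z).φ * ((J z).lam * (J z).ψ₁ i) = _; ring)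
  have hr : HasPD K (dir i) (fun z => (J z).r)
      ((J z).r * ((J z).τ * ((J z).lam * (J z).φ * (J z).ψ₁ i))) z := (hφ.const_mul τ).exp
  have hv : HasPD K (dir i) (fun z => (J z).v) ((J z).v₁ i) z :=
    (hr.mul w0).congr_deriv (by
      change (J z).r * ((J z).τ * ((J z).lam * (J z).φ * (J z).ψ₁ i)) * (J z).w
        + (J z).r * (J z).w₁ i = _
      rw [Jet.v₁]; ring)
  have hv1 : ∀ j, HasPD K (dir i) (fun z => (J z).v₁ j) ((J z).v₂ j i) z := fun j =>
    (hr.mul ((w1 j).add (((hφ.const_mul (τ * lam)).mul (ψ1 j)).mul w0))).congr_deriv (by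
      change (J z).r * ((J z).τ * ((J z).lam * (J z).φ * (J z).ψ₁ i)) *
          ((J z).w₁ j + (J z).τ * (J z).lam * (J z).φ * (J z).ψ₁ j * (J z).w)
        + (J z).r * ((J z).w₂ j i + ((((J z).τ * (J z).lam * ((J z).lam * (J z).φ * (J z).ψ₁ i))
          * (J z).ψ₁ j + (J z).τ * (J z).lam * (J z).φ * (J z).ψ₂ j i) * (J z).w
          + (J z).τ * (J z).lam * (J z).φ * (J z).ψ₁ j * (J z).w₁ i)) = _
      rw [Jet.v₂]; ring)
  have hp : ∀ j, HasPD K (dir i) (fun z => (J z).p j) ((J z).dp j i) z := fun j =>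
    HasPD.sum fun k _ => (b0 j k).mul (hv1 k)
  have hY : ∀ j, HasPD K (dir i) (fun z => (J z).Y j) ((J z).dY j i) z := fun j =>
    HasPD.sum fun k _ => (b0 j k).mul (ψ1 k)
  have hX : ∀ j, HasPD K (dir i) (fun z => (J z).X j) ((J z).dX j i) z := fun j =>
    ((hφ.const_mul lam).mul (hY j)).congr_deriv (by
      change (J z).lam * ((J z).lam * (J z).φ * (J z).ψ₁ i) * (J z).Y j
        + (J z).lam * (J z).φ * (J z).dY j i = _
      rw [Jet.dX]; ring)
  have hE : HasPD K (dir i) (fun z => (J z).E) ((J z).dE i) z :=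
    HasPD.sum fun k _ => (hp k).mul (hv1 k)
  have hS : HasPD K (dir i) (fun z => (J z).S) ((J z).dS i) z :=
    HasPD.sum fun k _ => (hX k).mul (hv1 k)
  have hβ : HasPD K (dir i) (fun z => (J z).β) ((J z).dβ i) z :=
    HasPD.sum fun k _ => (hY k).mul (ψ1 k)
  refine ⟨hβ, ?_⟩
  have hh : HasPD K (dir i) (fun z => (J z).h) ((J z).h₁ i) z :=
    (hdiv.sub (HasPD.const s)).congr_deriv (sub_zero _)
  have hg : HasPD K (dir i) (fun z => (J z).g) ((J z).dg i) z :=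
    (((hφ.const_mul (lam ^ 2)).mul hβ).add ((hφ.const_mul lam).mul hh)).congr_deriv (by
      change (J z).lam ^ 2 * ((J z).lam * (J z).φ * (J z).ψ₁ i) * (J z).β
        + (J z).lam ^ 2 * (J z).φ * (J z).dβ i
        + ((J z).lam * ((J z).lam * (J z).φ * (J z).ψ₁ i) * (J z).h
        + (J z).lam * (J z).φ * (J z).h₁ i) = _
      rw [Jet.dg]; ring)
  have ha : HasPD K (dir i) (fun z => (J z).a) ((J z).da i) z := by
    have h2 : HasPD K (dir i) (fun z => lam ^ 2 * ((J z).φ * (J z).φ) * (J z).β) _ z :=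
      ((hφ.mul hφ).const_mul (lam ^ 2)).mul hβ
    have h3 : (fun z => lam ^ 2 * ((J z).φ * (J z).φ) * (J z).β) = fun z => (J z).a := by
      funext y; rw [Jet.a, sq (J y).φ]; rfl
    rw [← h3]
    refine h2.congr_deriv ?_
    change (J z).lam ^ 2 * ((J z).lam * (J z).φ * (J z).ψ₁ i * (J z).φ
      + (J z).φ * ((J z).lam * (J z).φ * (J z).ψ₁ i)) * (J z).β
      + (J z).lam ^ 2 * ((J z).φ * (J z).φ) * (J z).dβ i = _
    rw [Jet.da]; ring
  have hf : HasPD K (dir i) (fun z => 2 * (J z).p i * (J z).S - (J z).X i * (J z).E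
      + (J z).g * (J z).v * (J z).p i + τ ^ 2 * (J z).a * ((J z).v * (J z).v) * (J z).X i) _ z :=
    ((((hp i).const_mul 2).mul hS).sub ((hX i).mul hE)).add ((hg.mul hv).mul (hp i)) |>.add
      (((ha.const_mul (τ ^ 2)).mul (hv.mul hv)).mul (hX i))
  have h3 : (fun z => 2 * (J z).p i * (J z).S - (J z).X i * (J z).E
      + (J z).g * (J z).v * (J z).p i + τ ^ 2 * (J z).a * ((J z).v * (J z).v) * (J z).X i) =
      fun z => (J z).flux i := by
    funext y; rw [Jet.flux, sq (J y).v]; rfl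
  rw [← h3]
  refine hf.congr_deriv ?_
  have : τ = (J z).τ := rfl
  rw [Jet.dflux, this]; ring

theorem jet_v₂_comm (hψ : ContDiffOn ℝ 3 ψ K) (hw : ContDiffOn ℝ 2 w K) (hz : K ∈ 𝓝 z) (i j : ι) :
    (jet K dir b ψ τ lam s w z).v₂ i j = (jet K dir b ψ τ lam s w z).v₂ j i := by
  set J := jet K dir b ψ τ lam s w z with hJ
  have h1 : J.w₂ i j = J.w₂ j i := pder_comm hw hz _ _
  have h2 : J.ψ₂ i j = J.ψ₂ j i := pder_comm (hψ.of_le (by norm_num)) hz _ _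
  rw [Jet.v₂, Jet.v₂, h1, h2]; ring

end JetFunctions

/-! ### Uniform bounds for the coefficients of the lower-order terms. -/

section Bounds

variable {ι : Type*} [Fintype ι]

theorem abs_sum_le_card_mul {f : ι → ℝ} {B : ℝ} (h : ∀ i, |f i| ≤ B) :
    |∑ i, f i| ≤ Fintype.card ι * B := by
  refine (Finset.abs_sum_le_sum_abs _ _).trans ?_
  refine (Finset.sum_le_sum fun i _ => h i).trans ?_
  simp

theorem abs_mul_le_mul {a b A B : ℝ} (ha : |a| ≤ A) (hb : |b| ≤ B) : |a * b| ≤ A * B := by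
  rw [abs_mul]
  exact mul_le_mul ha hb (abs_nonneg _) ((abs_nonneg _).trans ha)

theorem abs_add_le_add {a b A B : ℝ} (ha : |a| ≤ A) (hb : |b| ≤ B) : |a + b| ≤ A + B :=
  (abs_add_le _ _).trans (add_le_add ha hb)

theorem sq_sum_mul_le {f v : ι → ℝ} {B : ℝ} (h : ∀ i, |f i| ≤ B) :
    (∑ i, f i * v i) ^ 2 ≤ Fintype.card ι * B ^ 2 * ∑ i, v i ^ 2 := by
  refine (Finset.sum_mul_sq_le_sq_mul_sq _ _ _).trans ?_
  refine mul_le_mul_of_nonneg_right ?_ (Finset.sum_nonneg fun i _ => sq_nonneg _)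
  calc ∑ i, f i ^ 2 ≤ ∑ _i : ι, B ^ 2 := Finset.sum_le_sum fun i _ => by
        rw [← sq_abs]; exact pow_le_pow_left₀ (abs_nonneg _) (h i) 2
    _ = _ := by simp

/-- The bounds on the coefficients of the lower order terms. -/
theorem Jet.exists_bound (ι : Type*) [Fintype ι] (M : ℝ) (hM : 0 ≤ M) :
    ∃ C : ℝ, 0 < C ∧ ∀ J : Jet ι, (∀ i j, |J.b i j| ≤ M) → (∀ i j k, |J.b₁ i j k| ≤ M) →
      (∀ i, |J.ψ₁ i| ≤ M) → (∀ i j, |J.ψ₂ i j| ≤ M) → (∀ i, |J.h₁ i| ≤ M) → |J.s| ≤ M →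
      |∑ i, J.Y i * J.dβ i + J.s * J.β| ≤ C ∧ J.s ^ 2 ≤ C ∧
      (∑ i, J.dβ i * J.p i + J.h * ∑ i, J.Y i * J.v₁ i) ^ 2 ≤ C * ∑ i, J.v₁ i ^ 2 ∧
      (∑ i, J.h₁ i * J.p i) ^ 2 ≤ C * ∑ i, J.v₁ i ^ 2 ∧ ∑ i, J.ψ₁ i ^ 2 ≤ C := by
  set N : ℝ := ((Fintype.card ι : ℕ) : ℝ) with hN
  have hN0 : 0 ≤ N := Nat.cast_nonneg _
  set cY := N * (M * M) with hcY
  set cdY := N * (M * M + M * M) with hcdY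
  set cβ := N * (cY * M) with hcβ
  set cdβ := N * (cdY * M + cY * M) with hcdβ
  set ch := N * cdY + M with hch
  set B₁ := N * (cdβ * M) + ch * cY with hB₁
  set B₂ := N * (M * M) with hB₂
  set C₁ := N * (cY * cdβ) + M * cβ with hC₁
  have p1 : 0 ≤ C₁ := by positivity
  have p2 : 0 ≤ M ^ 2 := by positivity
  have p3 : 0 ≤ N * B₁ ^ 2 := by positivity
  have p4 : 0 ≤ N * B₂ ^ 2 := by positivity
  have p5 : 0 ≤ N * M ^ 2 := by positivity
  refine ⟨1 + C₁ + M ^ 2 + N * B₁ ^ 2 + N * B₂ ^ 2 + N * M ^ 2, by linarith, ?_⟩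
  intro J hb hb1 hψ1 hψ2 hh1 hs
  have bY : ∀ i, |J.Y i| ≤ cY := fun i => abs_sum_le_card_mul fun j => abs_mul_le_mul (hb i j) (hψ1 j)
  have bdY : ∀ k i, |J.dY k i| ≤ cdY := fun k i => abs_sum_le_card_mul fun j =>
    abs_add_le_add (abs_mul_le_mul (hb1 k j i) (hψ1 j)) (abs_mul_le_mul (hb k j) (hψ2 j i))
  have bβ : |J.β| ≤ cβ := abs_sum_le_card_mul fun j => abs_mul_le_mul (bY j) (hψ1 j)
  have bdβ : ∀ i, |J.dβ i| ≤ cdβ := fun i => abs_sum_le_card_mul fun j =>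
    abs_add_le_add (abs_mul_le_mul (bdY j i) (hψ1 j)) (abs_mul_le_mul (bY j) (hψ2 j i))
  have bh : |J.h| ≤ ch := by
    refine (abs_sub _ _).trans (add_le_add ?_ hs)
    exact abs_sum_le_card_mul fun i => bdY i i
  have hQ : 0 ≤ ∑ i, J.v₁ i ^ 2 := Finset.sum_nonneg fun i _ => sq_nonneg _
  have swap : ∀ q : ι → ℝ, ∑ i, q i * J.p i = ∑ j, (∑ i, q i * J.b i j) * J.v₁ j := fun q => by
    simp only [Jet.p, Finset.mul_sum, Finset.sum_mul]
    rw [Finset.sum_comm]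
    exact Finset.sum_congr rfl fun i _ => Finset.sum_congr rfl fun j _ => by ring
  refine ⟨?_, ?_, ?_, ?_, ?_⟩
  · refine (abs_add_le_add (abs_sum_le_card_mul fun i => abs_mul_le_mul (bY i) (bdβ i))
      (abs_mul_le_mul hs bβ)).trans ?_
    linarith
  · rw [← sq_abs]
    refine (pow_le_pow_left₀ (abs_nonneg _) hs 2).trans ?_
    linarith
  · have e1 : ∑ i, J.dβ i * J.p i + J.h * ∑ i, J.Y i * J.v₁ i =
        ∑ j, (∑ i, J.dβ i * J.b i j + J.h * J.Y j) * J.v₁ j := by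
      rw [swap, Finset.mul_sum, ← Finset.sum_add_distrib]
      exact Finset.sum_congr rfl fun j _ => by ring
    rw [e1]
    refine (sq_sum_mul_le (B := B₁) fun j => abs_add_le_add
      (abs_sum_le_card_mul fun i => abs_mul_le_mul (bdβ i) (hb i j))
      (abs_mul_le_mul bh (bY j))).trans (mul_le_mul_of_nonneg_right ?_ hQ)
    linarith
  · rw [swap]
    refine (sq_sum_mul_le (B := B₂) fun j =>
      abs_sum_le_card_mul fun i => abs_mul_le_mul (hh1 i) (hb i j)).trans
      (mul_le_mul_of_nonneg_right ?_ hQ)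
    linarith
  · calc ∑ i, J.ψ₁ i ^ 2 ≤ ∑ _i : ι, M ^ 2 := Finset.sum_le_sum fun i _ => by
          rw [← sq_abs]; exact pow_le_pow_left₀ (abs_nonneg _) (hψ1 i) 2
      _ = N * M ^ 2 := by simp [hN]
      _ ≤ _ := by linarith

end Bounds

/-! ### Hypotheses of the general estimate and its uniform threshold in `λ`. -/

section SmoothEstimate

variable {V ι : Type*} [NormedAddCommGroup V] [NormedSpace ℝ V] [Fintype ι]

/-- The hypotheses on the principal part `b` and on the exponent `ψ` in the Carleman estimate. -/
structure IsCarlemanData (K : Set V) (dir : ι → V) (b : ι → ι → V → ℝ) (ψ : V → ℝ)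
    (s c₀ δ M : ℝ) : Prop where
  contDiffOn_b : ∀ i j, ContDiffOn ℝ 2 (b i j) K
  contDiffOn_ψ : ContDiffOn ℝ 3 ψ K
  symm : ∀ z ∈ K, ∀ i j, b i j z = b j i z
  nonneg : ∀ z ∈ K, 0 ≤ ψ z
  b_le : ∀ z ∈ K, ∀ i j, |b i j z| ≤ M
  pder_b_le : ∀ z ∈ K, ∀ i j k, |pder K (dir k) (b i j) z| ≤ M
  pder_pder_b_le : ∀ z ∈ K, ∀ i j k l, |pder K (dir l) (pder K (dir k) (b i j)) z| ≤ M
  pder_ψ_le : ∀ z ∈ K, ∀ i, |pder K (dir i) ψ z| ≤ M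
  pder_pder_ψ_le : ∀ z ∈ K, ∀ i j, |pder K (dir j) (pder K (dir i) ψ) z| ≤ M
  pder_pder_pder_ψ_le : ∀ z ∈ K, ∀ i j k,
    |pder K (dir k) (pder K (dir j) (pder K (dir i) ψ)) z| ≤ M
  s_le : |s| ≤ M
  nonchar : ∀ z ∈ K, δ ≤ (∑ i, (∑ j, b i j z * pder K (dir j) ψ z) * pder K (dir i) ψ z) ^ 2
  -- The parameters and the function are set to zero in the jet because `Θ` involves only `b`, `ψ`
  -- and their derivatives.
  coercive : ∀ z ∈ K, ∀ ξ : ι → ℝ, c₀ * ∑ i, ξ i ^ 2 ≤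
    (jet K dir b ψ 0 0 s 0 z).Θ ξ - s * ∑ i, (∑ j, b i j z * ξ j) * ξ i

/-- The pointwise Carleman inequality for functions. -/
theorem exists_pointwise (ι : Type*) [Fintype ι] {c₀ δ M : ℝ} (hc₀ : 0 < c₀) (hδ : 0 < δ)
    (hM : 0 ≤ M) : ∃ lam₀ : ℝ, 1 ≤ lam₀ ∧ ∀ (V : Type) [NormedAddCommGroup V] [NormedSpace ℝ V]
      (K : Set V) (dir : ι → V) (b : ι → ι → V → ℝ) (ψ : V → ℝ) (s : ℝ), UniqueDiffOn ℝ K →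
      IsCarlemanData K dir b ψ s c₀ δ M → ∀ τ ≥ (1 : ℝ), ∀ lam ≥ lam₀, ∀ w : V → ℝ,
      ContDiffOn ℝ 2 w K → ∀ z, K ∈ 𝓝 z → ∀ J, J = jet K dir b ψ τ lam s w z →
      J.r ^ 2 * (δ / 2 * (J.τ ^ 3 * J.lam ^ 4 * J.φ ^ 3 * J.w ^ 2)
        + c₀ / 8 * (J.τ * J.lam * J.φ * ∑ i, J.w₁ i ^ 2)) ≤
      1 / 2 * (J.r ^ 2 * J.P ^ 2) + J.τ * ∑ i, J.dflux i := by
  set N : ℝ := ((Fintype.card ι : ℕ) : ℝ) with hN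
  have hN0 : 0 ≤ N := Nat.cast_nonneg _
  -- An enlarged bound covering also the gradient of `div (b∇ψ)`: four products of size `M * M` for
  -- each pair of indices.
  set B := M + N * (N * (M * M + M * M + (M * M + M * M))) with hB
  have hMB : M ≤ B := le_add_of_nonneg_right (by positivity)
  obtain ⟨C, hC, hbound⟩ := Jet.exists_bound ι B (hM.trans hMB)
  -- The three summands ensure `1 ≤ λ` and the two lower bounds on `λδ` required by `Jet.carleman`.
  refine ⟨1 + 2 * (2 * C + 2 * (C / c₀)) / δ + c₀ * C / δ, ?_, ?_⟩
  · have h1 : 0 ≤ 2 * (2 * C + 2 * (C / c₀)) / δ := by positivity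
    have h2 : 0 ≤ c₀ * C / δ := by positivity
    linarith
  intro V _ _ K dir b ψ s hK h τ hτ lam hlam w hw z hz J hJ
  have hzK : z ∈ K := mem_of_mem_nhds hz
  have h1 : 0 ≤ 2 * (2 * C + 2 * (C / c₀)) / δ := by positivity
  have h2 : 0 ≤ c₀ * C / δ := by positivity
  have hlam1 : 1 ≤ lam := by linarith
  have hh1 : ∀ k, |J.h₁ k| ≤ B := fun k => by
    have hpd : HasPD K (dir k) (divY K dir b ψ) _ z := HasPD.sum fun i _ => HasPD.sum fun j _ =>
      ((HasPD.of_contDiffOn (contDiffOn_pder (k := 1) hK (h.contDiffOn_b i j) (by norm_num) (dir i))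
          hzK).mul (HasPD.of_contDiffOn ((contDiffOn_pder (k := 2) hK h.contDiffOn_ψ (by norm_num)
          (dir j)).of_le (by norm_num)) hzK)).add
        ((HasPD.of_contDiffOn ((h.contDiffOn_b i j).of_le (by norm_num)) hzK).mul
          (HasPD.of_contDiffOn (contDiffOn_pder (k := 1) hK (contDiffOn_pder (k := 2) hK
            h.contDiffOn_ψ (by norm_num) (dir j)) (by norm_num) (dir i)) hzK))
    rw [hJ]
    change |pder K (dir k) (divY K dir b ψ) z| ≤ B
    rw [hpd.pder_eq (hK z hzK)]
    refine le_trans (abs_sum_le_card_mul fun i => abs_sum_le_card_mul fun j => abs_add_le_add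
      (abs_add_le_add (abs_mul_le_mul (h.pder_pder_b_le z hzK i j i k) (h.pder_ψ_le z hzK j))
        (abs_mul_le_mul (h.pder_b_le z hzK i j i) (h.pder_pder_ψ_le z hzK j k)))
      (abs_add_le_add (abs_mul_le_mul (h.pder_b_le z hzK i j k) (h.pder_pder_ψ_le z hzK j i))
        (abs_mul_le_mul (h.b_le z hzK i j) (h.pder_pder_pder_ψ_le z hzK j i k)))) ?_
    linarith
  obtain ⟨hT, hs, hy, hz', hψ⟩ := hbound J
    (fun i j => by rw [hJ]; exact (h.b_le z hzK i j).trans hMB)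
    (fun i j k => by rw [hJ]; exact (h.pder_b_le z hzK i j k).trans hMB)
    (fun i => by rw [hJ]; exact (h.pder_ψ_le z hzK i).trans hMB)
    (fun i j => by rw [hJ]; exact (h.pder_pder_ψ_le z hzK i j).trans hMB) hh1
    (by rw [hJ]; exact h.s_le.trans hMB)
  have e1 : J.τ = τ := by rw [hJ]; rfl
  have e2 : J.lam = lam := by rw [hJ]; rfl
  refine J.carleman (by rw [hJ]; exact h.symm z hzK)
    (by rw [hJ]; exact jet_v₂_comm h.contDiffOn_ψ hw hz) (by rw [e1]; exact hτ) ?_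
    (by rw [e2]; exact hlam1) hC hc₀ hδ (by rw [hJ]; exact h.nonchar z hzK)
    (by rw [hJ]; exact h.coercive z hzK) hT hs hy hz' hψ ?_ ?_
  · rw [hJ]
    exact Real.one_le_exp (mul_nonneg (by linarith) (h.nonneg z hzK))
  · rw [e2]
    have h3 : 2 * (2 * C + 2 * (C / c₀)) / δ ≤ lam := by linarith
    exact (div_le_iff₀ hδ).1 h3
  · rw [e2]
    have h3 : c₀ * C / δ ≤ lam := by linarith
    have h4 := (div_le_iff₀ hδ).1 h3
    have h5 : 0 < lam * δ := by positivity
    linarith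

end SmoothEstimate

/-! ### Integration of the pointwise inequality and the limit of its boundary term. -/

section Limit

variable {V ι : Type} [NormedAddCommGroup V] [NormedSpace ℝ V] [FiniteDimensional ℝ V]
  [MeasureSpace V] [BorelSpace V] [IsFiniteMeasureOnCompacts (volume : Measure V)] [Fintype ι]
  {D : Set V} {dir : ι → V} {μ : Measure V} {N : V → ι → ℝ}
  {b : ι → ι → V → ℝ} {ψ : V → ℝ} {s c₀ δ M τ lam : ℝ}

theorem TendstoL2.cont_mul {α : Type*} [TopologicalSpace α] [T2Space α] [MeasurableSpace α]
    [BorelSpace α] {μ : Measure α} {K : Set α} (hK : IsCompact K) (hμ : ∀ᵐ z ∂μ, z ∈ K)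
    {f : ℕ → α → ℝ} {g c : α → ℝ} (h : TendstoL2 μ f g) (hc : ContinuousOn c K) :
    TendstoL2 μ (fun j z => c z * f j z) (fun z => c z * g z) := by
  obtain ⟨B, hB⟩ := hK.exists_bound_of_continuousOn hc
  refine h.bdd_mul (C := B) ?_ ?_
  · rw [← Measure.restrict_eq_self_of_ae_mem hμ]
    exact hc.aestronglyMeasurable hK.isClosed.measurableSet
  · filter_upwards [hμ] with z hz using hB z hz

theorem pder_eq_of_contDiff {K : Set V} (hK : UniqueDiffOn ℝ K) {w : V → ℝ} (hw : ContDiff ℝ ∞ w)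
    {z : V} (hz : z ∈ K) (e : V) : pder K e w z = fderiv ℝ w z e := by
  rw [pder, (hw.differentiable (by simp) z).fderivWithin (hK z hz)]

theorem pder_pder_eq_of_contDiff {K : Set V} (hK : UniqueDiffOn ℝ K) {w : V → ℝ}
    (hw : ContDiff ℝ ∞ w) {z : V} (hz : z ∈ K) (e e' : V) :
    pder K e' (pder K e w) z = fderiv ℝ (fun y => fderiv ℝ w y e) z e' := by
  rw [← pder_eq_of_contDiff hK (contDiff_fderiv_apply hw e) hz, pder, pder,
    fderivWithin_congr (fun y hy => pder_eq_of_contDiff hK hw hy e)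
      (pder_eq_of_contDiff hK hw hz e)]

theorem continuousOn_jet {K : Set V} (hK : UniqueDiffOn ℝ K)
    (h : IsCarlemanData K dir b ψ s c₀ δ M) :
    ContinuousOn (fun z => (jet K dir b ψ τ lam s 0 z).φ) K ∧
    ContinuousOn (fun z => (jet K dir b ψ τ lam s 0 z).r) K ∧
    (∀ i, ContinuousOn (fun z => (jet K dir b ψ τ lam s 0 z).ψ₁ i) K) ∧
    (∀ i j, ContinuousOn (fun z => (jet K dir b ψ τ lam s 0 z).b i j) K) ∧
    (∀ i j k, ContinuousOn (fun z => (jet K dir b ψ τ lam s 0 z).b₁ i j k) K) ∧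
    (∀ i, ContinuousOn (fun z => (jet K dir b ψ τ lam s 0 z).X i) K) ∧
    ContinuousOn (fun z => (jet K dir b ψ τ lam s 0 z).g) K ∧
    ContinuousOn (fun z => (jet K dir b ψ τ lam s 0 z).a) K := by
  have b0 : ∀ i j, ContinuousOn (b i j) K := fun i j => (h.contDiffOn_b i j).continuousOn
  have b1 : ∀ i j k, ContinuousOn (pder K (dir k) (b i j)) K := fun i j k =>
    (contDiffOn_pder (k := 1) hK (h.contDiffOn_b i j) (by norm_num) _).continuousOn
  have ψ1 : ∀ j, ContinuousOn (pder K (dir j) ψ) K := fun j =>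
    (contDiffOn_pder (k := 1) hK h.contDiffOn_ψ (by norm_num) _).continuousOn
  have hdiv := (contDiffOn_jet (dir := dir) (τ := τ) (lam := lam) (s := s) hK h.contDiffOn_b
    h.contDiffOn_ψ (contDiffOn_const (c := (0 : ℝ)))).1.continuousOn
  set J := jet K dir b ψ τ lam s 0
  have hφ : ContinuousOn (fun z => (J z).φ) K :=
    (continuousOn_const.mul h.contDiffOn_ψ.continuousOn).rexp
  have hr : ContinuousOn (fun z => (J z).r) K := (continuousOn_const.mul hφ).rexp
  have hY : ∀ j, ContinuousOn (fun z => (J z).Y j) K := fun j =>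
    continuousOn_finsetSum _ fun k _ => (b0 j k).mul (ψ1 k)
  have hβ : ContinuousOn (fun z => (J z).β) K :=
    continuousOn_finsetSum _ fun k _ => (hY k).mul (ψ1 k)
  have hh : ContinuousOn (fun z => (J z).h) K := hdiv.sub continuousOn_const
  refine ⟨hφ, hr, ψ1, b0, b1, fun i => ?_, ?_, ?_⟩
  · exact ((continuousOn_const (c := lam)).mul hφ).mul (hY i)
  · exact (((continuousOn_const (c := lam ^ 2)).mul hφ).mul hβ).add
      (((continuousOn_const (c := lam)).mul hφ).mul hh)
  · exact ((continuousOn_const (c := lam ^ 2)).mul (hφ.pow 2)).mul hβ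

/-- The integrated estimate for smooth functions. -/
theorem carleman_smooth (hGG : IsGaussGreen D dir μ N) (hD : IsOpen D)
    (hK : IsCompact (closure D)) (hU : UniqueDiffOn ℝ (closure D))
    (h : IsCarlemanData (closure D) dir b ψ s c₀ δ M) {w : V → ℝ} (hw : ContDiff ℝ ∞ w)
    {J : V → Jet ι} (hJ : J = jet (closure D) dir b ψ τ lam s w)
    (hpt : ∀ z ∈ D, (J z).r ^ 2 * (δ / 2 * (τ ^ 3 * lam ^ 4 * (J z).φ ^ 3 * (J z).w ^ 2)
        + c₀ / 8 * (τ * lam * (J z).φ * ∑ i, (J z).w₁ i ^ 2)) ≤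
      1 / 2 * ((J z).r ^ 2 * (J z).P ^ 2) + τ * ∑ i, (J z).dflux i) :
    ∫ z in D, (J z).r ^ 2 * (δ / 2 * (τ ^ 3 * lam ^ 4 * (J z).φ ^ 3 * (J z).w ^ 2)
        + c₀ / 8 * (τ * lam * (J z).φ * ∑ i, (J z).w₁ i ^ 2)) ≤
      1 / 2 * (∫ z in D, (J z).r ^ 2 * (J z).P ^ 2) + τ * ∫ z, ∑ i, (J z).flux i * N z i ∂μ := by
  have hμ := hGG.finite
  have hDf := isFiniteMeasure_restrict_of_closure hK
  have hDK : ∀ᵐ z ∂(volume : Measure V).restrict D, z ∈ closure D := by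
    filter_upwards [ae_restrict_mem hD.measurableSet] with z hz using subset_closure hz
  have hi : ∀ {f : V → ℝ}, ContinuousOn f (closure D) →
      Integrable f ((volume : Measure V).restrict D) := fun hf =>
    memLp_one_iff_integrable.1 (ContinuousOn.memLp_of_isCompact hK hf hDK)
  obtain ⟨hφ, hr, -, hb, hb1, -, -, -⟩ := continuousOn_jet (τ := τ) (lam := lam) hU h
  have hw2 : ContDiffOn ℝ 2 w (closure D) := (hw.of_le ENat.LEInfty.out).contDiffOn
  obtain ⟨-, hflux⟩ := contDiffOn_jet (dir := dir) (τ := τ) (lam := lam) (s := s) hU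
    h.contDiffOn_b h.contDiffOn_ψ hw2
  have hφ' : ContinuousOn (fun z => (J z).φ) (closure D) := by rw [hJ]; exact hφ
  have hr' : ContinuousOn (fun z => (J z).r) (closure D) := by rw [hJ]; exact hr
  have hw0' : ContinuousOn (fun z => (J z).w) (closure D) := by
    rw [hJ]; exact hw.continuous.continuousOn
  have hw1' : ∀ i, ContinuousOn (fun z => (J z).w₁ i) (closure D) := fun i => by
    rw [hJ]; exact (contDiffOn_pder (k := 1) hU hw2 (by norm_num) _).continuousOn
  have hP' : ContinuousOn (fun z => (J z).P) (closure D) := by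
    refine continuousOn_finsetSum _ fun i _ => continuousOn_finsetSum _ fun j _ => ?_
    refine ContinuousOn.add (ContinuousOn.mul ?_ (hw1' j)) (ContinuousOn.mul ?_ ?_)
    · rw [hJ]; exact hb1 i j i
    · rw [hJ]; exact hb i j
    · rw [hJ]
      exact (contDiffOn_pder (k := 0) hU (contDiffOn_pder (k := 1) hU hw2 (by norm_num) _)
        (by norm_num) _).continuousOn
  have hflux' : ∀ i, ContDiffOn ℝ 1 (fun z => (J z).flux i) (closure D) := fun i => by
    rw [hJ]; exact hflux i
  have hd : ∀ i, ∀ z ∈ D, (J z).dflux i =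
      fderivWithin ℝ (fun z => (J z).flux i) (closure D) z (dir i) := fun i z hz => by
    rw [hJ]
    exact ((hasPD_jet hU h.contDiffOn_b h.contDiffOn_ψ hw2 (subset_closure hz) i).2.pder_eq
      (hU z (subset_closure hz))).symm
  have hdi : ∀ i, Integrable (fun z => (J z).dflux i) ((volume : Measure V).restrict D) := fun i => by
    refine (hi (((hflux' i).continuousOn_fderivWithin hU le_rfl).clm_apply
      (continuousOn_const (c := dir i)))).congr ?_
    filter_upwards [ae_restrict_mem hD.measurableSet] with z hz using (hd i z hz).symm
  have hPi : Integrable (fun z => (J z).r ^ 2 * (J z).P ^ 2) ((volume : Measure V).restrict D) :=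
    hi ((hr'.pow 2).mul (hP'.pow 2))
  have hfN : ∀ i, Integrable (fun z => (J z).flux i * N z i) μ := fun i =>
    (memLp_one_iff_integrable.1 <| ContinuousOn.memLp_of_isCompact hK
      (hflux' i).continuousOn hGG.ae_mem).mul_bdd (c := 1) (hGG.meas i) (by
        filter_upwards [hGG.bound] with z hz using hz i)
  have h1 : ∫ z in D, (1 / 2 * ((J z).r ^ 2 * (J z).P ^ 2) + τ * ∑ i, (J z).dflux i) =
      1 / 2 * (∫ z in D, (J z).r ^ 2 * (J z).P ^ 2) + τ * ∫ z, ∑ i, (J z).flux i * N z i ∂μ := by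
    rw [integral_add (hPi.const_mul _) ((integrable_finsetSum _ fun i _ => hdi i).const_mul _),
      integral_const_mul, integral_const_mul, integral_finsetSum _ fun i _ => hdi i,
      integral_finsetSum _ fun i _ => hfN i]
    congr 2
    refine Finset.sum_congr rfl fun i _ => ?_
    rw [← hGG.green _ (hflux' i) i]
    exact setIntegral_congr_fun hD.measurableSet fun z hz => hd i z hz
  rw [← h1]
  refine integral_mono_ae (hi ?_) ((hPi.const_mul _).add
    ((integrable_finsetSum _ fun i _ => hdi i).const_mul _)) ?_
  · exact (hr'.pow 2).mul ((continuousOn_const.mul ((continuousOn_const.mul (hφ'.pow 3)).mul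
      (hw0'.pow 2))).add (continuousOn_const.mul ((continuousOn_const.mul hφ').mul
      (continuousOn_finsetSum _ fun i _ => (hw1' i).pow 2))))
  · filter_upwards [ae_restrict_mem hD.measurableSet] with z hz using hpt z hz

/-- The boundary term in the limit. -/
theorem tendsto_flux (hGG : IsGaussGreen D dir μ N)
    (hK : IsCompact (closure D)) (hU : UniqueDiffOn ℝ (closure D))
    (h : IsCarlemanData (closure D) dir b ψ s c₀ δ M) {v : ℕ → V → ℝ}
    (hv : ∀ j, ContDiff ℝ ∞ (v j)) {G : V → ℝ} (h0 : TendstoL2 μ v fun _ => 0)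
    (h1 : ∀ i, TendstoL2 μ (fun j z => fderiv ℝ (v j) z (dir i)) fun z => N z i * G z) :
    Tendsto (fun j => ∫ z, ∑ i, (jet (closure D) dir b ψ τ lam s (v j) z).flux i * N z i ∂μ) atTop
      (𝓝 (∫ z, Real.exp (τ * Real.exp (lam * ψ z)) ^ 2 * (lam * Real.exp (lam * ψ z)) * G z ^ 2 *
        ((∑ i, (∑ j, b i j z * N z j) * N z i) *
          ∑ i, (∑ j, b i j z * pder (closure D) (dir j) ψ z) * N z i) ∂μ)) := by
  have hμ := hGG.finite
  have hKμ := hGG.ae_mem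
  obtain ⟨hφ, hr, hψ1, hb, hb1, hX, hg, ha⟩ := continuousOn_jet (τ := τ) (lam := lam) hU h
  set J₀ := jet (closure D) dir b ψ τ lam s 0 with hJ₀
  set J := fun j => jet (closure D) dir b ψ τ lam s (v j) with hJ
  have cm := fun {f : ℕ → V → ℝ} {g c : V → ℝ} (hf : TendstoL2 μ f g)
    (hc : ContinuousOn c (closure D)) => hf.cont_mul hK hKμ hc
  have Nm := fun {f : ℕ → V → ℝ} {g : V → ℝ} (hf : TendstoL2 μ f g) i =>
    hf.bdd_mul (C := 1) (hGG.meas i) (by filter_upwards [hGG.bound] with z hz using hz i)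
  have tv : TendstoL2 μ (fun j z => (J j z).v) fun _ => 0 :=
    (cm h0 hr).congr (fun j => EventuallyEq.rfl) (Eventually.of_forall fun z => by simp)
  -- The limit of `∇v` on the boundary: the part coming from the derivative of the exponential
  -- disappears because the trace of `v` is zero.
  set W : ι → V → ℝ := fun k z => (J₀ z).r * (N z k * G z) with hW
  have tv1 : ∀ k, TendstoL2 μ (fun j z => (J j z).v₁ k) (W k) := fun k => by
    refine (cm ((h1 k).add (cm h0 (((continuousOn_const (c := τ * lam)).mul hφ).mul (hψ1 k)))) hr).congr
      (fun j => ?_) (Eventually.of_forall fun z => by simp [hW])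
    filter_upwards [hKμ] with z hz
    have : (J j z).w₁ k = fderiv ℝ (v j) z (dir k) := pder_eq_of_contDiff hU (hv j) hz _
    rw [Jet.v₁, this]; rfl
  set p : ι → V → ℝ := fun i z => ∑ k, b i k z * W k z with hp
  have tp : ∀ i, TendstoL2 μ (fun j z => (J j z).p i) (p i) := fun i =>
    TendstoL2.sum Finset.univ fun k _ => cm (tv1 k) (hb i k)
  set S : V → ℝ := fun z => ∑ k, (J₀ z).X k * W k z with hS
  have tS : TendstoL2 μ (fun j z => (J j z).S) S :=
    TendstoL2.sum Finset.univ fun k _ => cm (tv1 k) (hX k)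
  have tpN : TendstoL2 μ (fun j z => ∑ i, N z i * (J j z).p i) (fun z => ∑ i, N z i * p i z) :=
    TendstoL2.sum Finset.univ fun i _ => Nm (tp i) i
  have XNm := fun {f : ℕ → V → ℝ} {g : V → ℝ} (hf : TendstoL2 μ f g) =>
    TendstoL2.sum Finset.univ fun i (_ : i ∈ (Finset.univ : Finset ι)) => cm (Nm hf i) (hX i)
  have tE : ∀ k, TendstoL2 μ (fun j z => ∑ i, (J₀ z).X i * (N z i * (J j z).p k))
      (fun z => ∑ i, (J₀ z).X i * (N z i * p k z)) := fun k => XNm (tp k)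
  have tg : TendstoL2 μ (fun j z => (J₀ z).g * (J j z).v) fun z => (J₀ z).g * 0 := cm tv hg
  have ta : TendstoL2 μ (fun j z => ∑ i, (J₀ z).X i * (N z i * (τ ^ 2 * (J₀ z).a * (J j z).v)))
      (fun z => ∑ i, (J₀ z).X i * (N z i * (τ ^ 2 * (J₀ z).a * 0))) :=
    XNm (cm tv (continuousOn_const.mul ha))
  have int : ∀ {f f' : V → ℝ}, MemLp f 2 μ → MemLp f' 2 μ → Integrable (fun z => f z * f' z) μ :=
    fun hf hf' => hf.integrable_mul hf'
  -- Each term of the flux is arranged as a product of two factors converging in `L²`; for `(X·N) E`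
  -- this means splitting `E` over its index `k`.
  have key := (((tpN.integral_mul tS).const_mul 2).sub
    (tendsto_finsetSum Finset.univ fun k _ => (tE k).integral_mul (tv1 k))).add
      ((tg.integral_mul tpN).add (ta.integral_mul tv))
  have e1 : ∀ j, ∫ z, ∑ i, (J j z).flux i * N z i ∂μ =
      2 * ∫ z, (∑ i, N z i * (J j z).p i) * (J j z).S ∂μ
        - ∑ k, ∫ z, (∑ i, (J₀ z).X i * (N z i * (J j z).p k)) * (J j z).v₁ k ∂μ
        + (∫ z, (J₀ z).g * (J j z).v * ∑ i, N z i * (J j z).p i ∂μ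
          + ∫ z, (∑ i, (J₀ z).X i * (N z i * (τ ^ 2 * (J₀ z).a * (J j z).v))) * (J j z).v ∂μ) := by
    intro j
    have i1 : Integrable (fun z => 2 * ((∑ i, N z i * (J j z).p i) * (J j z).S)) μ :=
      (int (tpN.1 j) (tS.1 j)).const_mul 2
    have i2 : ∀ k, Integrable
        (fun z => (∑ i, (J₀ z).X i * (N z i * (J j z).p k)) * (J j z).v₁ k) μ :=
      fun k => int ((tE k).1 j) ((tv1 k).1 j)
    have i2' : Integrable
        (fun z => ∑ k, (∑ i, (J₀ z).X i * (N z i * (J j z).p k)) * (J j z).v₁ k) μ :=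
      integrable_finsetSum _ fun k _ => i2 k
    have i12 : Integrable (fun z => 2 * ((∑ i, N z i * (J j z).p i) * (J j z).S)
        - ∑ k, (∑ i, (J₀ z).X i * (N z i * (J j z).p k)) * (J j z).v₁ k) μ := i1.sub i2'
    have i3 : Integrable (fun z => (J₀ z).g * (J j z).v * ∑ i, N z i * (J j z).p i) μ :=
      int (tg.1 j) (tpN.1 j)
    have i4 : Integrable (fun z =>
        (∑ i, (J₀ z).X i * (N z i * (τ ^ 2 * (J₀ z).a * (J j z).v))) * (J j z).v) μ :=
      int (ta.1 j) (tv.1 j)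
    have i34 : Integrable (fun z => (J₀ z).g * (J j z).v * (∑ i, N z i * (J j z).p i)
        + (∑ i, (J₀ z).X i * (N z i * (τ ^ 2 * (J₀ z).a * (J j z).v))) * (J j z).v) μ := i3.add i4
    rw [← integral_const_mul, ← integral_finsetSum _ fun k _ => i2 k, ← integral_sub i1 i2',
      ← integral_add i3 i4, ← integral_add i12 i34]
    refine integral_congr_ae (Eventually.of_forall fun z => ?_)
    simp only
    have eE : ∑ k, (∑ i, (J₀ z).X i * (N z i * (J j z).p k)) * (J j z).v₁ k =
        (∑ i, (J₀ z).X i * N z i) * (J j z).E := by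
      rw [Jet.E, Finset.mul_sum]
      refine Finset.sum_congr rfl fun k _ => ?_
      rw [Finset.sum_mul, Finset.sum_mul]
      exact Finset.sum_congr rfl fun i _ => by ring
    rw [eE]
    simp only [Finset.sum_mul, Finset.mul_sum, ← Finset.sum_sub_distrib, ← Finset.sum_add_distrib]
    refine Finset.sum_congr rfl fun i _ => ?_
    have x1 : (J j z).X i = (J₀ z).X i := rfl
    have x2 : (J j z).g = (J₀ z).g := rfl
    have x3 : (J j z).a = (J₀ z).a := rfl
    have x4 : (J j z).τ = τ := rfl
    rw [Jet.flux, x1, x2, x3, x4]; ring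
  change Tendsto (fun j => ∫ z, ∑ i, (J j z).flux i * N z i ∂μ) atTop _
  simp only [e1]
  -- The terms containing `v` vanish in the limit. With the gradient along `N`, the remainder `2
  -- (p·N) S - (X·N) E` becomes twice a quantity minus itself.
  convert key using 2
  have m1 : Integrable (fun z => 2 * ((∑ i, N z i * p i z) * S z)) μ :=
    (int tpN.2.1 tS.2.1).const_mul 2
  have m2 : ∀ k, Integrable (fun z => (∑ i, (J₀ z).X i * (N z i * p k z)) * W k z) μ :=
    fun k => int (tE k).2.1 (tv1 k).2.1
  simp only [mul_zero, zero_mul, Finset.sum_const_zero, integral_zero, add_zero]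
  rw [← integral_const_mul, ← integral_finsetSum _ fun k _ => m2 k,
      ← integral_sub m1 (integrable_finsetSum _ fun k _ => m2 k)]
  refine integral_congr_ae (Eventually.of_forall fun z => ?_)
  simp only
  have r1 : Real.exp (τ * Real.exp (lam * ψ z)) = (J₀ z).r := rfl
  have r2 : lam * Real.exp (lam * ψ z) = (J₀ z).lam * (J₀ z).φ := rfl
  have y1 : ∑ i, (J₀ z).X i * N z i = (J₀ z).lam * (J₀ z).φ *
      ∑ i, (∑ j, b i j z * pder (closure D) (dir j) ψ z) * N z i := by
    rw [Finset.mul_sum]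
    exact Finset.sum_congr rfl fun i _ => by rw [Jet.X, mul_assoc]; rfl
  have y2 : S z = (J₀ z).r * G z * ∑ i, (J₀ z).X i * N z i := by
    rw [hS, Finset.mul_sum]
    exact Finset.sum_congr rfl fun i _ => by simp only [hW]; ring
  have y3 : ∀ i, p i z = (J₀ z).r * G z * ∑ j, b i j z * N z j := fun i => by
    rw [hp, Finset.mul_sum]
    exact Finset.sum_congr rfl fun j _ => by simp only [hW]; ring
  have y4 : ∑ i, N z i * p i z = (J₀ z).r * G z * ∑ i, (∑ j, b i j z * N z j) * N z i := by
    rw [Finset.mul_sum]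
    exact Finset.sum_congr rfl fun j _ => by rw [y3]; ring
  have y5 : ∑ k, (∑ i, (J₀ z).X i * (N z i * p k z)) * W k z =
      (J₀ z).r * G z * (∑ i, (J₀ z).X i * N z i) * ∑ i, N z i * p i z := by
    rw [Finset.mul_sum]
    refine Finset.sum_congr rfl fun k _ => ?_
    have : ∑ i, (J₀ z).X i * (N z i * p k z) = (∑ i, (J₀ z).X i * N z i) * p k z := by
      rw [Finset.sum_mul]; exact Finset.sum_congr rfl fun i _ => by ring
    rw [this]; simp only [hW]; ring
  rw [r1, r2, y5, y4, y2, y1]; ring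

end Limit

/-! ### The integrated estimate for limits of smooth functions. -/

section Limit

variable {V ι : Type} [NormedAddCommGroup V] [NormedSpace ℝ V] [FiniteDimensional ℝ V]
  [MeasureSpace V] [BorelSpace V] [IsFiniteMeasureOnCompacts (volume : Measure V)] [Fintype ι]
  {D : Set V} {dir : ι → V} {μ : Measure V} {N : V → ι → ℝ}
  {b : ι → ι → V → ℝ} {ψ : V → ℝ} {s c₀ δ M τ lam : ℝ}

/-- The integrated estimate for limits of smooth functions. -/
theorem carleman_limit (hGG : IsGaussGreen D dir μ N) (hD : IsOpen D)
    (hK : IsCompact (closure D)) (hU : UniqueDiffOn ℝ (closure D))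
    (h : IsCarlemanData (closure D) dir b ψ s c₀ δ M)
    (hpt : ∀ w : V → ℝ, ContDiffOn ℝ 2 w (closure D) → ∀ z, closure D ∈ 𝓝 z →
      ∀ J, J = jet (closure D) dir b ψ τ lam s w z →
      J.r ^ 2 * (δ / 2 * (J.τ ^ 3 * J.lam ^ 4 * J.φ ^ 3 * J.w ^ 2)
        + c₀ / 8 * (J.τ * J.lam * J.φ * ∑ i, J.w₁ i ^ 2)) ≤
      1 / 2 * (J.r ^ 2 * J.P ^ 2) + J.τ * ∑ i, J.dflux i)
    {v : ℕ → V → ℝ} (hv : ∀ j, ContDiff ℝ ∞ (v j)) {u : V → ℝ} {u₁ : ι → V → ℝ}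
    {u₂ : ι → ι → V → ℝ} {G : V → ℝ}
    (t0 : TendstoL2 (volume.restrict D) v u)
    (t1 : ∀ i, TendstoL2 (volume.restrict D) (fun j z => fderiv ℝ (v j) z (dir i)) (u₁ i))
    (t2 : ∀ i k, TendstoL2 (volume.restrict D)
      (fun j z => fderiv ℝ (fun y => fderiv ℝ (v j) y (dir k)) z (dir i)) (u₂ k i))
    (h0 : TendstoL2 μ v fun _ => 0)
    (h1 : ∀ i, TendstoL2 μ (fun j z => fderiv ℝ (v j) z (dir i)) fun z => N z i * G z) :
    ∫ z in D, Real.exp (τ * Real.exp (lam * ψ z)) ^ 2 *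
        (δ / 2 * (τ ^ 3 * lam ^ 4 * Real.exp (lam * ψ z) ^ 3 * u z ^ 2)
          + c₀ / 8 * (τ * lam * Real.exp (lam * ψ z) * ∑ i, u₁ i z ^ 2)) ≤
      1 / 2 * (∫ z in D, Real.exp (τ * Real.exp (lam * ψ z)) ^ 2 *
        (∑ i, ∑ j, (pder (closure D) (dir i) (b i j) z * u₁ j z + b i j z * u₂ j i z)) ^ 2)
      + τ * ∫ z, Real.exp (τ * Real.exp (lam * ψ z)) ^ 2 * (lam * Real.exp (lam * ψ z)) *
        G z ^ 2 * ((∑ i, (∑ j, b i j z * N z j) * N z i) *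
          ∑ i, (∑ j, b i j z * pder (closure D) (dir j) ψ z) * N z i) ∂μ := by
  have hDf := isFiniteMeasure_restrict_of_closure (D := D) hK
  have hDK : ∀ᵐ z ∂(volume : Measure V).restrict D, z ∈ closure D := by
    filter_upwards [ae_restrict_mem hD.measurableSet] with z hz using subset_closure hz
  have hDN : ∀ z ∈ D, closure D ∈ 𝓝 z := fun z hz =>
    mem_of_superset (hD.mem_nhds hz) subset_closure
  obtain ⟨hφ, hr, hψ1, hb, hb1, -, -, -⟩ := continuousOn_jet (τ := τ) (lam := lam) hU h
  set J := fun j => jet (closure D) dir b ψ τ lam s (v j) with hJ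
  have cm := fun {f : ℕ → V → ℝ} {g c : V → ℝ} (hf : TendstoL2 (volume.restrict D) f g)
    (hc : ContinuousOn c (closure D)) => hf.cont_mul hK hDK hc
  set φ : V → ℝ := fun z => Real.exp (lam * ψ z) with hφd
  set r : V → ℝ := fun z => Real.exp (τ * φ z) with hrd
  replace hφ : ContinuousOn φ (closure D) := hφ
  replace hr : ContinuousOn r (closure D) := hr
  have tw1 : ∀ i, TendstoL2 (volume.restrict D) (fun j z => (J j z).w₁ i) (u₁ i) := fun i =>
    (t1 i).congr (fun j => by
      filter_upwards [hDK] with z hz using (pder_eq_of_contDiff hU (hv j) hz _).symm) EventuallyEq.rfl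
  have tw2 : ∀ i k, TendstoL2 (volume.restrict D) (fun j z => (J j z).w₂ k i) (u₂ k i) :=
    fun i k => (t2 i k).congr (fun j => by
      filter_upwards [hDK] with z hz using
        (pder_pder_eq_of_contDiff hU (hv j) hz _ _).symm) EventuallyEq.rfl
  set P : V → ℝ := fun z =>
    ∑ i, ∑ j, (pder (closure D) (dir i) (b i j) z * u₁ j z + b i j z * u₂ j i z) with hP
  have tP : TendstoL2 (volume.restrict D) (fun j z => r z * (J j z).P) (fun z => r z * P z) :=
    cm (TendstoL2.sum Finset.univ fun i _ => TendstoL2.sum Finset.univ fun k _ =>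
      (cm (tw1 k) (hb1 i k i)).add (cm (tw2 i k) (hb i k))) hr
  have key := ((tP.integral_mul tP).const_mul (1 / 2)).add
    ((tendsto_flux (s := s) (τ := τ) (lam := lam) hGG hK hU h hv h0 h1).const_mul τ)
  set c3 : V → ℝ := fun z => r z ^ 2 * (δ / 2 * (τ ^ 3 * lam ^ 4 * φ z ^ 3)) with hc3
  set c1 : V → ℝ := fun z => r z ^ 2 * (c₀ / 8 * (τ * lam * φ z)) with hc1
  have hc3' : ContinuousOn c3 (closure D) :=
    (hr.pow 2).mul (continuousOn_const.mul (continuousOn_const.mul (hφ.pow 3)))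
  have hc1' : ContinuousOn c1 (closure D) :=
    (hr.pow 2).mul (continuousOn_const.mul (continuousOn_const.mul hφ))
  have lkey := ((cm t0 hc3').integral_mul t0).add (tendsto_finsetSum Finset.univ fun i _ =>
    (cm (tw1 i) hc1').integral_mul (tw1 i))
  have split : ∀ (f : V → ℝ) (f₁ : ι → V → ℝ), MemLp f 2 (volume.restrict D) →
      (∀ i, MemLp (f₁ i) 2 (volume.restrict D)) →
      MemLp (fun z => c3 z * f z) 2 (volume.restrict D) →
      (∀ i, MemLp (fun z => c1 z * f₁ i z) 2 (volume.restrict D)) →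
      ∫ z in D, r z ^ 2 * (δ / 2 * (τ ^ 3 * lam ^ 4 * φ z ^ 3 * f z ^ 2)
          + c₀ / 8 * (τ * lam * φ z * ∑ i, f₁ i z ^ 2)) =
        (∫ z in D, c3 z * f z * f z) + ∑ i, ∫ z in D, c1 z * f₁ i z * f₁ i z := by
    intro f f₁ hf hf1 hcf hcf1
    have i1 : Integrable (fun z => c3 z * f z * f z) (volume.restrict D) := hcf.integrable_mul hf
    have i2 : ∀ i, Integrable (fun z => c1 z * f₁ i z * f₁ i z) (volume.restrict D) :=
      fun i => (hcf1 i).integrable_mul (hf1 i)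
    rw [← integral_finsetSum _ fun i _ => i2 i,
      ← integral_add i1 (integrable_finsetSum _ fun i _ => i2 i)]
    refine integral_congr_ae (Eventually.of_forall fun z => ?_)
    simp only [hc3, hc1, mul_add, Finset.mul_sum]
    congr 1
    · ring
    · exact Finset.sum_congr rfl fun i _ => by ring
  have e1 : ∫ z in D, r z ^ 2 * P z ^ 2 = ∫ z in D, r z * P z * (r z * P z) :=
    integral_congr_ae (Eventually.of_forall fun z => by simp only; ring)
  rw [split u u₁ t0.2.1 (fun i => (t1 i).2.1) (cm t0 hc3').2.1 fun i => (cm (tw1 i) hc1').2.1, e1]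
  refine le_of_tendsto_of_tendsto' lkey key fun j => ?_
  have hj := carleman_smooth hGG hD hK hU h (hv j) (J := J j) rfl fun z hz =>
    hpt (v j) (((hv j).of_le ENat.LEInfty.out).contDiffOn) z (hDN z hz) _ rfl
  have e2 : ∫ z in D, (J j z).r ^ 2 * (J j z).P ^ 2 =
      ∫ z in D, r z * (J j z).P * (r z * (J j z).P) :=
    integral_congr_ae (Eventually.of_forall fun z => by
      change r z ^ 2 * (J j z).P ^ 2 = _; ring)
  rw [e2] at hj
  rw [← split (v j) (fun i z => (J j z).w₁ i) (t0.1 j) (fun i => (tw1 i).1 j)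
    ((cm t0 hc3').1 j) fun i => (cm (tw1 i) hc1').1 j]
  exact hj

end Limit

/-! ### The wave operator as an instance of the general estimate -/

section PartialDerivativeBounds

variable {V : Type*} [NormedAddCommGroup V] [NormedSpace ℝ V] {K : Set V} {e e' e'' z : V}
  {F G : V → ℝ} {B : ℝ}

theorem pder_congr (h : EqOn F G K) (hz : z ∈ K) : pder K e F z = pder K e G z := by
  rw [pder, pder, fderivWithin_congr h (h hz)]

theorem norm_iteratedFDerivWithin_pder_le (hK : UniqueDiffOn ℝ K) {k : ℕ}
    (hF : ContDiffOn ℝ (k + 1 : ℕ) F K) (he : ‖e‖ ≤ 1) (hz : z ∈ K) :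
    ‖iteratedFDerivWithin ℝ k (pder K e F) K z‖ ≤ ‖iteratedFDerivWithin ℝ (k + 1) F K z‖ := by
  have h1 : ContDiffOn ℝ k (fderivWithin ℝ F K) K := hF.fderivWithin hK (by push_cast; exact le_rfl)
  refine (norm_iteratedFDerivWithin_clm_apply_const (h1 z hz) hK hz le_rfl).trans ?_
  rw [norm_iteratedFDerivWithin_fderivWithin hK hz]
  exact mul_le_of_le_one_left (norm_nonneg _) he

theorem abs_pder_le (hK : UniqueDiffOn ℝ K) (hF : ContDiffOn ℝ (1 : ℕ) F K) (he : ‖e‖ ≤ 1)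
    (hz : z ∈ K) : |pder K e F z| ≤ ‖iteratedFDerivWithin ℝ 1 F K z‖ := by
  refine le_trans (le_of_eq ?_) (norm_iteratedFDerivWithin_pder_le (k := 0) hK hF he hz)
  rw [norm_iteratedFDerivWithin_zero, Real.norm_eq_abs]

theorem abs_pder_pder_le (hK : UniqueDiffOn ℝ K) (hF : ContDiffOn ℝ (2 : ℕ) F K) (he : ‖e‖ ≤ 1)
    (he' : ‖e'‖ ≤ 1) (hz : z ∈ K) :
    |pder K e' (pder K e F) z| ≤ ‖iteratedFDerivWithin ℝ 2 F K z‖ :=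
  (abs_pder_le hK (contDiffOn_pder hK hF (by norm_num) e) he' hz).trans
    (norm_iteratedFDerivWithin_pder_le (k := 1) hK hF he hz)

theorem abs_pder_pder_pder_le (hK : UniqueDiffOn ℝ K) (hF : ContDiffOn ℝ (3 : ℕ) F K)
    (he : ‖e‖ ≤ 1) (he' : ‖e'‖ ≤ 1) (he'' : ‖e''‖ ≤ 1) (hz : z ∈ K) :
    |pder K e'' (pder K e' (pder K e F)) z| ≤ ‖iteratedFDerivWithin ℝ 3 F K z‖ :=
  (abs_pder_pder_le hK (contDiffOn_pder hK hF (by norm_num) e) he' he'' hz).trans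
    (norm_iteratedFDerivWithin_pder_le (k := 2) hK hF he hz)

variable {W : Type*} [NormedAddCommGroup W] [NormedSpace ℝ W] {L : Set W}

theorem HasPD.comp_fst {f : V → ℝ} {d : ℝ} {p e : V × W} (h : HasPD K e.1 f d p.1) :
    HasPD (K ×ˢ L) e (fun z => f z.1) d p := by
  obtain ⟨T, hT, rfl⟩ := h
  exact ⟨T.comp (ContinuousLinearMap.fst ℝ V W),
    hT.comp p hasFDerivWithinAt_fst fun _ hx => hx.1, rfl⟩

theorem HasPD.comp_snd {f : W → ℝ} {d : ℝ} {p e : V × W} (h : HasPD L e.2 f d p.2) :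
    HasPD (K ×ˢ L) e (fun z => f z.2) d p := by
  obtain ⟨T, hT, rfl⟩ := h
  exact ⟨T.comp (ContinuousLinearMap.snd ℝ V W),
    hT.comp p hasFDerivWithinAt_snd fun _ hx => hx.2, rfl⟩

end PartialDerivativeBounds

/-! ### The pseudo-convexity matrix read as the quadratic form of the identity. -/

section QuadraticForm

variable {ι : Type*} [Fintype ι]

theorem sum_mul_mul_eq_dotProduct (M : Matrix ι ι ℝ) (ξ : ι → ℝ) :
    ∑ k, ∑ l, M k l * ξ l * ξ k = dotProduct ξ (M.mulVec ξ) := by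
  simp only [dotProduct, Matrix.mulVec]
  refine Finset.sum_congr rfl fun k _ => ?_
  rw [Finset.mul_sum]
  exact Finset.sum_congr rfl fun l _ => by ring

theorem sum_conj_mul_mul {a : Matrix ι ι ℝ} (ha : a.IsSymm) (H : Matrix ι ι ℝ) (ξ : ι → ℝ) :
    ∑ k, ∑ l, (a * H * a) k l * ξ l * ξ k =
      ∑ i, ∑ k, (∑ j, a i j * ξ j) * (∑ l, a k l * H i l) * ξ k := by
  rw [sum_mul_mul_eq_dotProduct, ← Matrix.mulVec_mulVec, ← Matrix.mulVec_mulVec,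
    Matrix.dotProduct_mulVec]
  have : Matrix.vecMul ξ a = a.mulVec ξ := by rw [← Matrix.vecMul_transpose, ha.eq]
  rw [this]
  simp only [dotProduct, Matrix.mulVec]
  refine Finset.sum_congr rfl fun i _ => ?_
  have inner : ∑ k, (∑ l, a k l * H i l) * ξ k = ∑ l, H i l * ∑ k, a l k * ξ k := by
    simp only [Finset.sum_mul, Finset.mul_sum]
    rw [Finset.sum_comm]
    refine Finset.sum_congr rfl fun l _ => Finset.sum_congr rfl fun k _ => ?_
    rw [ha.apply l k]; ring
  rw [← inner, Finset.mul_sum]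
  exact Finset.sum_congr rfl fun k _ => by ring

/-- The quadratic form of `Θ`, for a matrix `a` with derivatives `d p k l = ∂ₚ aₖₗ`, a gradient `g`
and a Hessian `H`. -/
theorem sum_theta_eq {a : Matrix ι ι ℝ} (ha : a.IsSymm) (H : Matrix ι ι ℝ) (d : ι → ι → ι → ℝ)
    (g ξ : ι → ℝ) :
    ∑ k, ∑ l, ((2 : ℝ) • (a * H * a) + Matrix.of fun k l => ∑ m, (-∑ p, d p k l * a p m
      + 2 * ∑ p, a k p * d p l m) * g m) k l * ξ l * ξ k =
    2 * (∑ i, ∑ k, (∑ j, a i j * ξ j) * (∑ j, (d i k j * g j + a k j * H i j)) * ξ k)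
      - ∑ i, ∑ k, ∑ j, (∑ l, a i l * g l) * d i k j * ξ k * ξ j := by
  -- The part `-∂a·a` of `Λ` is the derivative of `a` along the field `a g`. The part `2 a ∂a`,
  -- joined with `2 a H a`, is the derivative of the field `a g` itself.
  have h1 : ∑ k, ∑ l, (∑ m, (∑ p, d p k l * a p m) * g m) * ξ l * ξ k =
      ∑ i, ∑ k, ∑ j, (∑ l, a i l * g l) * d i k j * ξ k * ξ j := by
    rw [Finset.sum_comm (f := fun i k => ∑ j, (∑ l, a i l * g l) * d i k j * ξ k * ξ j)]
    refine Finset.sum_congr rfl fun k _ => ?_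
    refine Eq.trans (Finset.sum_congr rfl fun l _ => ?_) Finset.sum_comm
    simp only [Finset.sum_mul]
    rw [Finset.sum_comm]
    exact Finset.sum_congr rfl fun p _ => Finset.sum_congr rfl fun m _ => by ring
  have h2 : ∑ k, ∑ l, (∑ m, (∑ p, a k p * d p l m) * g m) * ξ l * ξ k =
      ∑ i, ∑ k, (∑ j, a i j * ξ j) * (∑ j, d i k j * g j) * ξ k := by
    rw [Finset.sum_comm]
    rw [Finset.sum_comm (f := fun i k => (∑ j, a i j * ξ j) * (∑ j, d i k j * g j) * ξ k)]
    refine Finset.sum_congr rfl fun l _ => ?_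
    have : ∀ p, (∑ j, a p j * ξ j) * (∑ j, d p l j * g j) * ξ l =
        ∑ k, ∑ j, a k p * d p l j * g j * ξ l * ξ k := fun p => by
      simp only [Finset.sum_mul, Finset.mul_sum]
      rw [Finset.sum_comm]
      refine Finset.sum_congr rfl fun k _ => Finset.sum_congr rfl fun j _ => ?_
      rw [ha.apply k p]; ring
    simp only [this]
    rw [Finset.sum_comm]
    refine Finset.sum_congr rfl fun k _ => ?_
    rw [Finset.sum_comm]
    simp only [Finset.sum_mul]
  have h3 := sum_conj_mul_mul ha H ξ
  have h4 : ∑ i, ∑ k, (∑ j, a i j * ξ j) * (∑ j, (d i k j * g j + a k j * H i j)) * ξ k =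
      (∑ i, ∑ k, (∑ j, a i j * ξ j) * (∑ j, d i k j * g j) * ξ k) +
      ∑ i, ∑ k, (∑ j, a i j * ξ j) * (∑ l, a k l * H i l) * ξ k := by
    simp only [← Finset.sum_add_distrib]
    refine Finset.sum_congr rfl fun i _ => Finset.sum_congr rfl fun k _ => ?_
    rw [Finset.sum_add_distrib]; ring
  have h5 : ∀ k l, ((2 : ℝ) • (a * H * a) + Matrix.of fun k l => ∑ m, (-∑ p, d p k l * a p m
      + 2 * ∑ p, a k p * d p l m) * g m) k l * ξ l * ξ k =
      2 * ((∑ m, (∑ p, a k p * d p l m) * g m) * ξ l * ξ k) + 2 * ((a * H * a) k l * ξ l * ξ k)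
        - (∑ m, (∑ p, d p k l * a p m) * g m) * ξ l * ξ k := fun k l => by
    have h6 : ∑ m, (-∑ p, d p k l * a p m + 2 * ∑ p, a k p * d p l m) * g m =
        2 * (∑ m, (∑ p, a k p * d p l m) * g m) - ∑ m, (∑ p, d p k l * a p m) * g m := by
      rw [Finset.mul_sum, ← Finset.sum_sub_distrib]
      exact Finset.sum_congr rfl fun m _ => by ring
    rw [Matrix.add_apply, Matrix.smul_apply, Matrix.of_apply, h6, smul_eq_mul]
    ring
  rw [h4, ← h1, ← h2, ← h3]
  simp only [h5, Finset.sum_sub_distrib, Finset.sum_add_distrib, ← Finset.mul_sum]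
  ring

end QuadraticForm

/-- The coefficients of the principal part of the wave operator. -/
def waveCoeff {n : ℕ} (A : E n → Matrix (Fin n) (Fin n) ℝ) : Option (Fin n) → Option (Fin n) →
    E n → ℝ
  | none, none => fun _ => -1
  | none, some _ => fun _ => 0
  | some _, none => fun _ => 0
  | some k, some l => fun x => A x k l

/-! ### Verification of the general hypotheses for the wave operator. -/

section WaveData

variable {n : ℕ} {Ω : Set (E n)} {t₁ t₂ ϰ m κ δ B : ℝ} {A : E n → Matrix (Fin n) (Fin n) ℝ}
  {ψ₀ : E n → ℝ} {ψ₁ : ℝ → ℝ}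

theorem pder_fst (hΩ : IsLipschitzDomain Ω) (ht : t₁ < t₂) {f : E n → ℝ}
    (hf : ContDiffOn ℝ 1 f (closure Ω)) (e : E n × ℝ) {z : E n × ℝ}
    (hz : z ∈ closure (cyl Ω t₁ t₂)) :
    pder (closure (cyl Ω t₁ t₂)) e (fun z => f z.1) z = pder (closure Ω) e.1 f z.1 := by
  refine HasPD.pder_eq ?_ (hΩ.uniqueDiffOn_cyl ht z hz)
  rw [closure_cyl ht] at hz ⊢
  exact (HasPD.of_contDiffOn hf hz.1).comp_fst

theorem pder_zero {V : Type*} [NormedAddCommGroup V] [NormedSpace ℝ V] (K : Set V) (f : V → ℝ)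
    (z : V) : pder K 0 f z = 0 := by
  rw [pder, map_zero]

/-- Freezing one variable exhibits each summand, up to a constant, as a restriction of the sum. -/
theorem contDiffOn_of_psi (hΩ : IsLipschitzDomain Ω) (ht : t₁ < t₂)
    (h : ContDiffOn ℝ 4 (psi ψ₀ ψ₁) (closure (cyl Ω t₁ t₂))) :
    ContDiffOn ℝ 4 ψ₀ (closure Ω) ∧ ContDiffOn ℝ 4 ψ₁ (Icc t₁ t₂) := by
  rw [closure_cyl ht] at h
  obtain ⟨x₀, hx₀⟩ := hΩ.isConnected.nonempty
  constructor
  · have h1 : ContDiffOn ℝ 4 (fun x : E n => psi ψ₀ ψ₁ (x, t₁)) (closure Ω) :=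
      h.comp (contDiff_id.prodMk contDiff_const).contDiffOn
        fun x hx => ⟨hx, left_mem_Icc.2 ht.le⟩
    refine (h1.sub (contDiffOn_const (c := ψ₁ t₁))).congr fun x _ => ?_
    simp [psi]
  · have h1 : ContDiffOn ℝ 4 (fun t : ℝ => psi ψ₀ ψ₁ (x₀, t)) (Icc t₁ t₂) :=
      h.comp (contDiff_const.prodMk contDiff_id).contDiffOn
        fun t ht' => ⟨subset_closure hx₀, ht'⟩
    refine (h1.sub (contDiffOn_const (c := ψ₀ x₀))).congr fun x _ => ?_
    simp [psi]

theorem pder_psi (hΩ : IsLipschitzDomain Ω) (ht : t₁ < t₂)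
    (h : ContDiffOn ℝ 4 (psi ψ₀ ψ₁) (closure (cyl Ω t₁ t₂))) (e : E n × ℝ) {z : E n × ℝ}
    (hz : z ∈ closure (cyl Ω t₁ t₂)) :
    pder (closure (cyl Ω t₁ t₂)) e (psi ψ₀ ψ₁) z =
      pder (closure Ω) e.1 ψ₀ z.1 + pder (Icc t₁ t₂) e.2 ψ₁ z.2 := by
  obtain ⟨h0, h1⟩ := contDiffOn_of_psi hΩ ht h
  refine HasPD.pder_eq ?_ (hΩ.uniqueDiffOn_cyl ht z hz)
  rw [closure_cyl ht] at hz ⊢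
  exact ((HasPD.of_contDiffOn (h0.of_le (by norm_num)) hz.1).comp_fst).add
    ((HasPD.of_contDiffOn (h1.of_le (by norm_num)) hz.2).comp_snd)

theorem pder_pder_psi (hΩ : IsLipschitzDomain Ω) (ht : t₁ < t₂)
    (h : ContDiffOn ℝ 4 (psi ψ₀ ψ₁) (closure (cyl Ω t₁ t₂))) (e e' : E n × ℝ) {z : E n × ℝ}
    (hz : z ∈ closure (cyl Ω t₁ t₂)) :
    pder (closure (cyl Ω t₁ t₂)) e' (pder (closure (cyl Ω t₁ t₂)) e (psi ψ₀ ψ₁)) z =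
      pder (closure Ω) e'.1 (pder (closure Ω) e.1 ψ₀) z.1
        + pder (Icc t₁ t₂) e'.2 (pder (Icc t₁ t₂) e.2 ψ₁) z.2 := by
  obtain ⟨h0, h1⟩ := contDiffOn_of_psi hΩ ht h
  rw [pder_congr (fun y hy => pder_psi hΩ ht h e hy) hz]
  refine HasPD.pder_eq ?_ (hΩ.uniqueDiffOn_cyl ht z hz)
  rw [closure_cyl ht] at hz ⊢
  exact ((HasPD.of_contDiffOn (contDiffOn_pder hΩ.uniqueDiffOn h0 (by norm_num) _) hz.1).comp_fst).add
    ((HasPD.of_contDiffOn (contDiffOn_pder (uniqueDiffOn_Icc ht) h1 (by norm_num) _) hz.2).comp_snd)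

theorem waveCoeff_bound (hA : IsAdmissible Ω ϰ m A) (hm : 0 < m) (i j : Option (Fin n)) :
    ContDiffOn ℝ 2 (waveCoeff A i j) (closure Ω) ∧ ∀ k : ℕ, k ≤ 2 → ∀ x ∈ closure Ω,
      ‖iteratedFDerivWithin ℝ k (waveCoeff A i j) (closure Ω) x‖ ≤ m + 1 := by
  have hconst : ∀ c : ℝ, |c| ≤ 1 → ContDiffOn ℝ 2 (fun _ : E n => c) (closure Ω) ∧
      ∀ k : ℕ, k ≤ 2 → ∀ x ∈ closure Ω,
      ‖iteratedFDerivWithin ℝ k (fun _ : E n => c) (closure Ω) x‖ ≤ m + 1 := by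
    refine fun c hc => ⟨contDiffOn_const, fun k _ x hx => ?_⟩
    rcases k with _ | k
    · rw [norm_iteratedFDerivWithin_zero, Real.norm_eq_abs]; linarith
    · rw [iteratedFDerivWithin_succ_const]; simp; linarith
  rcases i with _ | k <;> rcases j with _ | l
  · exact hconst (-1) (by norm_num)
  · exact hconst 0 (by norm_num)
  · exact hconst 0 (by norm_num)
  · exact ⟨(hA.regular k l).contDiffOn, fun i hi x hx =>
      ((hA.regular k l).bound i hi x hx).trans (by linarith)⟩

/-- Ellipticity is assumed on `Ω` only; by continuity of the coefficients it reaches the boundary,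
where it controls the sign of the boundary term. -/
theorem elliptic_closure (hA : IsAdmissible Ω ϰ m A) {x : E n} (hx : x ∈ closure Ω)
    (ξ : Fin n → ℝ) : ϰ⁻¹ * ∑ i, ξ i ^ 2 ≤ ∑ k, ∑ l, A x k l * ξ l * ξ k ∧
    ∑ k, ∑ l, A x k l * ξ l * ξ k ≤ ϰ * ∑ i, ξ i ^ 2 := by
  have hc : ContinuousOn (fun x => ∑ k, ∑ l, A x k l * ξ l * ξ k) (closure Ω) :=
    continuousOn_finsetSum _ fun k _ => continuousOn_finsetSum _ fun l _ =>
      ((hA.regular k l).contDiffOn.continuousOn.mul continuousOn_const).mul continuousOn_const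
  have hξ : ‖(WithLp.toLp 2 ξ : E n)‖ ^ 2 = ∑ i, ξ i ^ 2 := EuclideanSpace.real_norm_sq_eq _
  rw [← hξ]
  exact ⟨le_on_closure (fun y hy => (hA.elliptic y hy (WithLp.toLp 2 ξ)).1) continuousOn_const hc hx,
    le_on_closure (fun y hy => (hA.elliptic y hy (WithLp.toLp 2 ξ)).2) hc continuousOn_const hx⟩

theorem norm_dirQ (i : Option (Fin n)) :
    ‖(dirQ i : E n × ℝ)‖ ≤ 1 ∧ ‖(dirQ i : E n × ℝ).1‖ ≤ 1 := by
  rcases i with _ | i <;> simp [dirQ, dirT, dirX, Prod.norm_def]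

/-- Choice of the constants: with `s = 3κ/(4ϰ)` the spatial form keeps at least `κ - sϰ = κ/4`. In
time, `2∂ₜ²ψ₁ ≥ -κ/(2ϰ)` and the block `-1` contributes `+s`, which leaves `κ/(4ϰ)`. The smaller of
the two is `c₀`. Mixed space-time terms are absent because `ψ` is a sum of separate functions and
`A` does not depend on time. -/
theorem isCarlemanData_wave (hΩ : IsLipschitzDomain Ω) (ht : t₁ < t₂) (hϰ : 1 ≤ ϰ) (hm : 0 < m)
    (hκ : 0 < κ) (hA : IsAdmissible Ω ϰ m A) (hw : IsWaveWeight Ω t₁ t₂ A ϰ κ ψ₀ ψ₁)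
    (hδ : IsLeast (chiSq Ω t₁ t₂ A ψ₀ ψ₁ '' closure (cyl Ω t₁ t₂)) δ)
    (hB : C4Bound Ω t₁ t₂ B (psi ψ₀ ψ₁)) :
    IsCarlemanData (closure (cyl Ω t₁ t₂)) dirQ (fun i j z => waveCoeff A i j z.1) (psi ψ₀ ψ₁)
      (3 * κ / (4 * ϰ)) (κ / (4 * ϰ)) δ (|B| + m + 1 + κ) := by
  have hU := hΩ.uniqueDiffOn_cyl ht
  have hUΩ := hΩ.uniqueDiffOn
  obtain ⟨hψ0, hψ1⟩ := contDiffOn_of_psi hΩ ht hw.contDiffOn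
  have hBM : B ≤ |B| + m + 1 + κ := (le_abs_self B).trans (by linarith)
  have hmM : m + 1 ≤ |B| + m + 1 + κ := by linarith [abs_nonneg B]
  have hfst : ∀ z ∈ closure (cyl Ω t₁ t₂), z.1 ∈ closure Ω := fun z hz => by
    rw [closure_cyl ht] at hz; exact hz.1
  have hsnd : ∀ z ∈ closure (cyl Ω t₁ t₂), z.2 ∈ Icc t₁ t₂ := fun z hz => by
    rw [closure_cyl ht] at hz; exact hz.2
  have hb := fun i j => (waveCoeff_bound hA hm i j).1
  have pb : ∀ e, ∀ z ∈ closure (cyl Ω t₁ t₂), ∀ i j, pder (closure (cyl Ω t₁ t₂)) e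
      (fun z => waveCoeff A i j z.1) z = pder (closure Ω) e.1 (waveCoeff A i j) z.1 :=
    fun e z hz i j => pder_fst hΩ ht ((hb i j).of_le (by norm_num)) e hz
  have ppb : ∀ e e', ∀ z ∈ closure (cyl Ω t₁ t₂), ∀ i j, pder (closure (cyl Ω t₁ t₂)) e'
      (pder (closure (cyl Ω t₁ t₂)) e (fun z => waveCoeff A i j z.1)) z =
        pder (closure Ω) e'.1 (pder (closure Ω) e.1 (waveCoeff A i j)) z.1 :=
    fun e e' z hz i j => by
      rw [pder_congr (fun y hy => pb e y hy i j) hz]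
      exact pder_fst hΩ ht (contDiffOn_pder hUΩ (hb i j) (by norm_num) _) e' hz
  have hψ4 := hw.contDiffOn
  have d0 : ∀ z ∈ closure (cyl Ω t₁ t₂), ∀ i, pder (closure (cyl Ω t₁ t₂)) (dirQ i) (psi ψ₀ ψ₁) z =
      match i with
      | none => derivWithin ψ₁ (Icc t₁ t₂) z.2
      | some i => pd Ω i ψ₀ z.1 := fun z hz i => by
    rw [pder_psi hΩ ht hψ4 _ hz]
    rcases i with _ | i
    · change pder (closure Ω) 0 ψ₀ z.1 + derivWithin ψ₁ (Icc t₁ t₂) z.2 = _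
      rw [pder_zero, zero_add]
    · change pd Ω i ψ₀ z.1 + pder (Icc t₁ t₂) 0 ψ₁ z.2 = _
      rw [pder_zero, add_zero]
  have z0 : ∀ f : E n → ℝ, pder (closure Ω) 0 f = 0 := fun f => funext fun z => pder_zero _ _ _
  have z1 : ∀ f : ℝ → ℝ, pder (Icc t₁ t₂) 0 f = 0 := fun f => funext fun z => pder_zero _ _ _
  have c0 : ∀ e z c, pder (closure Ω) e (fun _ : E n => (c : ℝ)) z = 0 := fun e z c => by
    rw [pder, fderivWithin_fun_const]; rfl
  have c1 : ∀ e z c, pder (Icc t₁ t₂) e (fun _ : ℝ => (c : ℝ)) z = 0 := fun e z c => by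
    rw [pder, fderivWithin_fun_const]; rfl
  have hchar : ∀ z ∈ closure (cyl Ω t₁ t₂), ∑ i, (∑ j, waveCoeff A i j z.1 *
      pder (closure (cyl Ω t₁ t₂)) (dirQ j) (psi ψ₀ ψ₁) z) *
        pder (closure (cyl Ω t₁ t₂)) (dirQ i) (psi ψ₀ ψ₁) z =
      (∑ k, ∑ l, A z.1 k l * pd Ω l ψ₀ z.1 * pd Ω k ψ₀ z.1)
        - (derivWithin ψ₁ (Icc t₁ t₂) z.2) ^ 2 := fun z hz => by
    simp only [d0 z hz, Fintype.sum_option, waveCoeff, zero_mul, Finset.sum_const_zero, add_zero,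
      zero_add, Finset.sum_mul]
    ring
  refine
    { contDiffOn_b := fun i j => (hb i j).comp contDiffOn_fst hfst
      contDiffOn_ψ := hψ4.of_le (by norm_num)
      symm := fun z hz i j => ?_
      nonneg := hw.nonneg
      b_le := fun z hz i j => ?_
      pder_b_le := fun z hz i j k => ?_
      pder_pder_b_le := fun z hz i j k l => ?_
      pder_ψ_le := fun z hz i => ?_
      pder_pder_ψ_le := fun z hz i j => ?_
      pder_pder_pder_ψ_le := fun z hz i j k => ?_
      s_le := ?_
      nonchar := fun z hz => ?_
      coercive := fun z hz ξ => ?_ }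
  · rcases i with _ | i <;> rcases j with _ | j <;> try rfl
    exact (hA.symm _ (hfst z hz)).apply j i
  · have := (waveCoeff_bound hA hm i j).2 0 (by norm_num) z.1 (hfst z hz)
    rw [norm_iteratedFDerivWithin_zero, Real.norm_eq_abs] at this
    exact this.trans hmM
  · rw [pb _ z hz]
    exact ((abs_pder_le hUΩ ((hb i j).of_le (by norm_num)) (norm_dirQ k).2 (hfst z hz)).trans
      ((waveCoeff_bound hA hm i j).2 1 (by norm_num) z.1 (hfst z hz))).trans hmM
  · rw [ppb _ _ z hz]
    exact ((abs_pder_pder_le hUΩ (hb i j) (norm_dirQ k).2 (norm_dirQ l).2 (hfst z hz)).trans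
      ((waveCoeff_bound hA hm i j).2 2 (by norm_num) z.1 (hfst z hz))).trans hmM
  · exact ((abs_pder_le hU (hψ4.of_le (by norm_num)) (norm_dirQ i).1 hz).trans
      (hB 1 (by norm_num) z hz)).trans hBM
  · exact ((abs_pder_pder_le hU (hψ4.of_le (by norm_num)) (norm_dirQ i).1 (norm_dirQ j).1 hz).trans
      (hB 2 (by norm_num) z hz)).trans hBM
  · exact ((abs_pder_pder_pder_le hU (hψ4.of_le (by norm_num)) (norm_dirQ i).1 (norm_dirQ j).1
      (norm_dirQ k).1 hz).trans (hB 3 (by norm_num) z hz)).trans hBM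
  · rw [abs_of_nonneg (by positivity)]
    have : 3 * κ / (4 * ϰ) ≤ κ := by
      rw [div_le_iff₀ (by positivity)]; nlinarith
    linarith [abs_nonneg B]
  · rw [hchar z hz]
    exact hδ.2 ⟨z, hz, rfl⟩
  · have d1 : ∀ i j, pder (closure (cyl Ω t₁ t₂)) (dirQ i)
        (pder (closure (cyl Ω t₁ t₂)) (dirQ j) (psi ψ₀ ψ₁)) z =
        match i, j with
        | none, none => iteratedDerivWithin 2 ψ₁ (Icc t₁ t₂) z.2
        | none, some _ => 0
        | some _, none => 0
        | some i, some j => pd Ω i (pd Ω j ψ₀) z.1 := fun i j => by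
      rw [pder_pder_psi hΩ ht hψ4 _ _ hz]
      rcases i with _ | i <;> rcases j with _ | j <;>
        simp only [dirQ, dirT, dirX, z0, z1, Pi.zero_apply, zero_add, add_zero]
      · rw [iteratedDerivWithin_succ, iteratedDerivWithin_one]; rfl
      · exact c1 _ _ 0
      · exact c0 _ _ 0
      · rfl
    have d2 : ∀ i j k, pder (closure (cyl Ω t₁ t₂)) (dirQ k) (fun z => waveCoeff A i j z.1) z =
        match i, j, k with
        | some i, some j, some k => pd Ω k (fun y => A y i j) z.1
        | _, _, _ => 0 := fun i j k => by
      rw [pb _ z hz]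
      rcases i with _ | i <;> rcases j with _ | j <;> rcases k with _ | k <;>
        simp only [dirQ, dirT, dirX, z0, Pi.zero_apply, waveCoeff, c0] <;> rfl
    have hx := hfst z hz
    set a : Matrix (Fin n) (Fin n) ℝ := A z.1 with ha
    set η : Fin n → ℝ := fun i => ξ (some i) with hη
    have hpc := hw.pseudoConvex.convex z.1 hx (WithLp.toLp 2 η)
    rw [EuclideanSpace.real_norm_sq_eq] at hpc
    have hth := sum_theta_eq (hA.symm _ hx) (hess Ω ψ₀ z.1)
      (fun p k l => pd Ω p (fun y => A y k l) z.1) (fun i => pd Ω i ψ₀ z.1) η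
    have hell := (elliptic_closure hA hx η).2
    have hsm := abs_le.1 (hw.small z.2 (hsnd z hz))
    have e1 : (jet (closure (cyl Ω t₁ t₂)) dirQ (fun i j z => waveCoeff A i j z.1) (psi ψ₀ ψ₁) 0 0
        (3 * κ / (4 * ϰ)) 0 z).Θ ξ = (∑ k, ∑ l, Theta Ω A ψ₀ z.1 k l * η l * η k)
          + 2 * iteratedDerivWithin 2 ψ₁ (Icc t₁ t₂) z.2 * ξ none ^ 2 := by
      refine Eq.trans ?_ (congrArg (· + _) hth.symm)
      simp only [Jet.Θ, Jet.dY, Jet.Y, jet, d0 z hz, d1, d2]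
      simp only [Fintype.sum_option, waveCoeff, zero_mul, mul_zero, Finset.sum_const_zero, add_zero, zero_add, hess, Matrix.of_apply]
      ring
    have e2 : ∑ i, (∑ j, waveCoeff A i j z.1 * ξ j) * ξ i =
        (∑ k, ∑ l, A z.1 k l * η l * η k) - ξ none ^ 2 := by
      simp only [Fintype.sum_option, waveCoeff, zero_mul, Finset.sum_const_zero, add_zero,
        zero_add, Finset.sum_mul]
      ring
    rw [e1, e2, Fintype.sum_option]
    change κ * ∑ i, η i ^ 2 ≤ ∑ k, ∑ l, Theta Ω A ψ₀ z.1 k l * η l * η k at hpc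
    change κ / (4 * ϰ) * (ξ none ^ 2 + ∑ i, η i ^ 2) ≤ _
    set X := ∑ i, η i ^ 2
    have hX : 0 ≤ X := Finset.sum_nonneg fun i _ => sq_nonneg _
    have hϰ0 : 0 < ϰ := by linarith
    have h1 : 3 * κ / (4 * ϰ) * (∑ k, ∑ l, A z.1 k l * η l * η k) ≤ 3 * κ / 4 * X := by
      refine (mul_le_mul_of_nonneg_left hell (by positivity)).trans (le_of_eq ?_)
      field_simp
    have h2 : κ / (4 * ϰ) * X ≤ κ / 4 * X := by
      refine mul_le_mul_of_nonneg_right ?_ hX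
      exact div_le_div_of_nonneg_left hκ.le (by norm_num) (by linarith)
    have h3 : -(κ / (4 * ϰ)) * ξ none ^ 2 ≤
        iteratedDerivWithin 2 ψ₁ (Icc t₁ t₂) z.2 * ξ none ^ 2 := by
      refine mul_le_mul_of_nonneg_right (le_trans (le_of_eq ?_) hsm.1) (sq_nonneg _)
      field_simp
    have h4 : 3 * κ / (4 * ϰ) = 3 * (κ / (4 * ϰ)) := by ring
    rw [h4] at h1 ⊢
    linarith

end WaveData

/-! ### Products with weakly differentiable functions -/

section Product

variable {V ι : Type} [NormedAddCommGroup V] [NormedSpace ℝ V] [FiniteDimensional ℝ V]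
  [MeasureSpace V] [BorelSpace V] [IsFiniteMeasureOnCompacts (volume : Measure V)] [Fintype ι]
  {D : Set V} {dir : ι → V} {μ : Measure V} {N : V → ι → ℝ}

theorem TendstoL2.const {α : Type*} [MeasurableSpace α] {μ : Measure α} {g : α → ℝ}
    (hg : MemLp g 2 μ) : TendstoL2 μ (fun _ => g) g :=
  ⟨fun _ => hg, hg, by simp⟩

/-- Leibniz' rule by approximation. Gauss-Green for `θ a w_j` has no boundary term, since `θ` is
supported in `D` while the boundary measure charges only its complement; all terms are then linear
in `w_j` and its derivative and pass to the limit. -/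
theorem IsGaussGreen.isWeakDeriv_mul (hGG : IsGaussGreen D dir μ N) (hμD : ∀ᵐ z ∂μ, z ∉ D)
    (hD : IsOpen D) (hK : IsCompact (closure D)) (hU : UniqueDiffOn ℝ (closure D)) {a : V → ℝ}
    (ha : ContDiffOn ℝ 1 a (closure D)) {w : ℕ → V → ℝ} (hw : ∀ j, ContDiff ℝ ∞ (w j))
    {f g : V → ℝ} {i : ι} (t0 : TendstoL2 (volume.restrict D) w f)
    (t1 : TendstoL2 (volume.restrict D) (fun j z => fderiv ℝ (w j) z (dir i)) g) :
    IsWeakDeriv D (dir i) (fun z => a z * f z)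
      (fun z => pder (closure D) (dir i) a z * f z + a z * g z) := by
  intro θ hθ hθc hθs
  have hDf := isFiniteMeasure_restrict_of_closure (D := D) hK
  have hDK : ∀ᵐ z ∂(volume : Measure V).restrict D, z ∈ closure D := by
    filter_upwards [ae_restrict_mem hD.measurableSet] with z hz using subset_closure hz
  have cm : ∀ {c : V → ℝ}, ContinuousOn c (closure D) → MemLp c 2 (volume.restrict D) :=
    fun hc => ContinuousOn.memLp_of_isCompact hK hc hDK
  have hdθ : ContinuousOn (fun z => fderiv ℝ θ z (dir i)) (closure D) :=
    (contDiff_fderiv_apply hθ _).continuous.continuousOn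
  have hda : ContinuousOn (pder (closure D) (dir i) a) (closure D) :=
    (contDiffOn_pder (k := 0) hU ha (by simp) _).continuousOn
  have hθ0 : ContinuousOn θ (closure D) := hθ.continuous.continuousOn
  have k1 := cm (hdθ.mul ha.continuousOn)
  have k2 := cm (hθ0.mul hda)
  have k3 := cm (hθ0.mul ha.continuousOn)
  have lim := (((TendstoL2.const k1).integral_mul t0).add ((TendstoL2.const k2).integral_mul t0)).add
    ((TendstoL2.const k3).integral_mul t1)
  have split : ∀ {p q : V → ℝ}, MemLp p 2 (volume.restrict D) → MemLp q 2 (volume.restrict D) →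
      (∫ z in D, fderiv ℝ θ z (dir i) * a z * p z) +
        (∫ z in D, θ z * pder (closure D) (dir i) a z * p z) + (∫ z in D, θ z * a z * q z) =
      (∫ z in D, fderiv ℝ θ z (dir i) • (a z * p z)) +
        ∫ z in D, θ z • (pder (closure D) (dir i) a z * p z + a z * q z) := by
    intro p q hp hq
    have i2 : Integrable (fun z => θ z * pder (closure D) (dir i) a z * p z) (volume.restrict D) :=
      k2.integrable_mul hp
    have i3 : Integrable (fun z => θ z * a z * q z) (volume.restrict D) := k3.integrable_mul hq
    rw [add_assoc, ← integral_add i2 i3]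
    congr 1 <;>
    exact integral_congr_ae (Eventually.of_forall fun z => by simp only [smul_eq_mul]; ring)
  have hzero : ∀ j, (∫ z in D, fderiv ℝ θ z (dir i) * a z * w j z) +
      (∫ z in D, θ z * pder (closure D) (dir i) a z * w j z) +
      (∫ z in D, θ z * a z * fderiv ℝ (w j) z (dir i)) = 0 := fun j => by
    have hF : ContDiffOn ℝ 1 (fun z => θ z * a z * w j z) (closure D) :=
      ((hθ.of_le ENat.LEInfty.out).contDiffOn.mul ha).mul ((hw j).of_le ENat.LEInfty.out).contDiffOn
    have h0 : ∫ z, θ z * a z * w j z * N z i ∂μ = 0 := by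
      refine integral_eq_zero_of_ae ?_
      filter_upwards [hμD] with z hz
      have : θ z = 0 := image_eq_zero_of_notMem_tsupport fun h => hz (hθs h)
      simp [this]
    have h1 := hGG.green _ hF i
    rw [h0] at h1
    have i1 : Integrable (fun z => fderiv ℝ θ z (dir i) * a z * w j z) (volume.restrict D) :=
      k1.integrable_mul (t0.1 j)
    have i2 : Integrable (fun z => θ z * pder (closure D) (dir i) a z * w j z)
      (volume.restrict D) := k2.integrable_mul (t0.1 j)
    have i12 : Integrable (fun z => fderiv ℝ θ z (dir i) * a z * w j z
      + θ z * pder (closure D) (dir i) a z * w j z) (volume.restrict D) := i1.add i2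
    have i3 : Integrable (fun z => θ z * a z * fderiv ℝ (w j) z (dir i)) (volume.restrict D) :=
      k3.integrable_mul (t1.1 j)
    rw [← integral_add i1 i2, ← integral_add i12 i3, ← h1]
    refine setIntegral_congr_fun hD.measurableSet fun z hz => ?_
    have hz' := subset_closure hz
    have p1 := HasPD.of_contDiffOn (e := dir i) (hθ.of_le ENat.LEInfty.out).contDiffOn hz'
    have p2 := HasPD.of_contDiffOn (e := dir i) ha hz'
    have p3 := HasPD.of_contDiffOn (e := dir i) ((hw j).of_le ENat.LEInfty.out).contDiffOn hz'
    have p4 := ((p1.mul p2).mul p3).pder_eq (hU z hz')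
    rw [pder_eq_of_contDiff hU hθ hz', pder_eq_of_contDiff hU (hw j) hz'] at p4
    exact (p4.trans (by ring)).symm
  have hlim : Tendsto (fun _ : ℕ => (0 : ℝ)) atTop (𝓝 _) := lim.congr fun j => hzero j
  have h0 := tendsto_nhds_unique hlim tendsto_const_nhds
  have h1 := split t0.2.1 t1.2.1
  have h2 := h1.symm.trans h0
  exact eq_neg_of_add_eq_zero_left h2

theorem isWeakDeriv_sum {V α : Type*} [NormedAddCommGroup V] [NormedSpace ℝ V]
    [FiniteDimensional ℝ V] [MeasureSpace V] [IsFiniteMeasureOnCompacts (volume : Measure V)]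
    [BorelSpace V] {D : Set V} (hK : IsFiniteMeasure ((volume : Measure V).restrict D))
    {e : V} (s : Finset α) {f g : α → V → ℝ} (hf : ∀ l ∈ s, MemLp (f l) 2 (volume.restrict D))
    (hg : ∀ l ∈ s, MemLp (g l) 2 (volume.restrict D)) (h : ∀ l ∈ s, IsWeakDeriv D e (f l) (g l)) :
    IsWeakDeriv D e (fun z => ∑ l ∈ s, f l z) (fun z => ∑ l ∈ s, g l z) := by
  intro θ hθ hc hs
  have hb : ∀ {c : V → ℝ} {p : V → ℝ}, Continuous c → HasCompactSupport c →
      MemLp p 2 (volume.restrict D) → Integrable (fun z => c z * p z) (volume.restrict D) :=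
    fun hc hcc hp => (hp.integrable (by norm_num)).bdd_mul (c := _)
      hc.aestronglyMeasurable (Eventually.of_forall (hcc.exists_bound_of_continuous hc).choose_spec)
  simp only [smul_eq_mul, Finset.mul_sum]
  rw [integral_finsetSum _ fun l hl => hb (contDiff_fderiv_apply hθ e).continuous
      (hc.fderiv_apply ℝ e) (hf l hl),
    integral_finsetSum _ fun l hl => hb hθ.continuous hc (hg l hl), ← Finset.sum_neg_distrib]
  exact Finset.sum_congr rfl fun l hl => h l hl θ hθ hc hs

end Product

/-! ### The wave operator in nondivergence form. -/

section WaveOperator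

variable {n : ℕ} {Ω : Set (E n)} {t₁ t₂ ϰ m : ℝ} {A : E n → Matrix (Fin n) (Fin n) ℝ}

theorem cylMeasure_ae_notMem {ρ : Measure (E n)} {C : NNReal} (hΩ : IsLipschitzDomain Ω)
    (hρ : IsGaussGreenMeasure Ω ρ C) : ∀ᵐ z ∂cylMeasure Ω t₁ t₂ ρ, z ∉ cyl Ω t₁ t₂ := by
  rw [cylMeasure, ae_add_measure_iff]
  constructor
  · filter_upwards [ae_lateral (t₁ := t₁) (t₂ := t₂) hρ] with z hz hz'
    have h1 := hz.1
    rw [hΩ.isOpen.frontier_eq] at h1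
    exact h1.2 hz'.1
  · have h3 : ∀ᵐ z ∂endMeasure Ω t₁ t₂, z.2 ∉ Ioo t₁ t₂ := by rw [ae_endMeasure]; simp
    filter_upwards [h3] with z hz hz' using hz hz'.2

/-- The weak derivatives of the components of `A ∇u`. -/
theorem isWeakDeriv_conormal (hn : 1 ≤ n) (hΩ : IsLipschitzDomain Ω) (ht : t₁ < t₂)
    (hA : IsAdmissible Ω ϰ m A) {u : E n × ℝ → ℝ} (hu : MemH2 (cyl Ω t₁ t₂) u) (k : Fin n) :
    MemLp (fun z => ∑ l, (pder (closure (cyl Ω t₁ t₂)) (dirX k) (fun y => A y.1 k l) z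
      * dx Ω t₁ t₂ l u z + A z.1 k l * dx Ω t₁ t₂ k (dx Ω t₁ t₂ l u) z)) 2
        (volume.restrict (cyl Ω t₁ t₂)) ∧
    IsWeakDeriv (cyl Ω t₁ t₂) (dirX k) (fun z => ∑ l, A z.1 k l * dx Ω t₁ t₂ l u z)
      (fun z => ∑ l, (pder (closure (cyl Ω t₁ t₂)) (dirX k) (fun y => A y.1 k l) z
        * dx Ω t₁ t₂ l u z + A z.1 k l * dx Ω t₁ t₂ k (dx Ω t₁ t₂ l u) z)) := by
  obtain ⟨ρ, C, hρ⟩ := hΩ.exists_gaussGreenMeasure hn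
  have hGG := cyl_isGaussGreen hΩ ht hρ
  have hK := hΩ.isCompact_closure_cyl ht
  have hU := hΩ.uniqueDiffOn_cyl ht
  have hD := isOpen_cyl (t₁ := t₁) (t₂ := t₂) hΩ
  obtain ⟨v, hv, h0, h1, h2⟩ := exists_smooth_approx hD hK (fun z hz => hΩ.coneCond_cyl ht hz) hu
  have hDf := isFiniteMeasure_restrict_of_closure (D := cyl Ω t₁ t₂) hK
  have hDK : ∀ᵐ z ∂(volume : Measure (E n × ℝ)).restrict (cyl Ω t₁ t₂), z ∈ closure (cyl Ω t₁ t₂) := by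
    filter_upwards [ae_restrict_mem hD.measurableSet] with z hz using subset_closure hz
  have ha : ∀ l, ContDiffOn ℝ 1 (fun y : E n × ℝ => A y.1 k l) (closure (cyl Ω t₁ t₂)) := fun l =>
    ((hA.regular k l).contDiffOn.of_le (by norm_num)).comp contDiffOn_fst fun z hz => by
      rw [closure_cyl ht] at hz; exact hz.1
  have hda : ∀ l, ContinuousOn (pder (closure (cyl Ω t₁ t₂)) (dirX k)
      (fun y : E n × ℝ => A y.1 k l)) (closure (cyl Ω t₁ t₂)) := fun l =>
    (contDiffOn_pder (k := 0) hU (ha l) (by simp) _).continuousOn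
  have hmem : ∀ l, MemLp (fun z => pder (closure (cyl Ω t₁ t₂)) (dirX k) (fun y => A y.1 k l) z
      * dx Ω t₁ t₂ l u z + A z.1 k l * dx Ω t₁ t₂ k (dx Ω t₁ t₂ l u) z) 2
        (volume.restrict (cyl Ω t₁ t₂)) := fun l =>
    (((h1 (dirX l)).cont_mul hK hDK (hda l)).add
      ((h2 (dirX l) (dirX k)).cont_mul hK hDK (ha l).continuousOn)).2.1
  refine ⟨memLp_finsetSum _ fun l _ => hmem l, ?_⟩
  exact isWeakDeriv_sum hDf Finset.univ
    (fun l _ => ((h1 (dirX l)).cont_mul hK hDK (ha l).continuousOn).2.1) (fun l _ => hmem l)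
    fun l _ => hGG.isWeakDeriv_mul (i := some k) (cylMeasure_ae_notMem hΩ hρ) hD hK hU (ha l)
      (fun j => contDiff_fderiv_apply (hv j) (dirX l)) (h1 (dirX l)) (h2 (dirX l) (dirX k))

/-- The operator is defined through weak derivatives of `A∇u`, whereas the limit of the smooth
estimate produces the expanded expression; Leibniz' rule and uniqueness of weak derivatives identify
the two. -/
theorem waveOp₀_ae_eq (hn : 1 ≤ n) (hΩ : IsLipschitzDomain Ω) (ht : t₁ < t₂)
    (hA : IsAdmissible Ω ϰ m A) {u : E n × ℝ → ℝ} (hu : MemH2 (cyl Ω t₁ t₂) u) :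
    waveOp₀ Ω t₁ t₂ A u =ᵐ[volume.restrict (cyl Ω t₁ t₂)] fun z => ∑ i, ∑ j,
      (pder (closure (cyl Ω t₁ t₂)) (dirQ i) (fun y => waveCoeff A i j y.1) z
        * weakDeriv (cyl Ω t₁ t₂) (dirQ j) u z + waveCoeff A i j z.1
        * weakDeriv (cyl Ω t₁ t₂) (dirQ i) (weakDeriv (cyl Ω t₁ t₂) (dirQ j) u) z) := by
  have h1 := fun k => isWeakDeriv_conormal hn hΩ ht hA hu k
  have h2 := fun k => weakDeriv_ae_eq (isOpen_cyl hΩ) (h1 k).1 (h1 k).2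
  filter_upwards [ae_all_iff.2 h2, ae_restrict_mem (isOpen_cyl hΩ).measurableSet] with z hz hzD
  have c0 : ∀ e c, pder (closure (cyl Ω t₁ t₂)) e (fun _ => (c : ℝ)) z = 0 := fun e c => by
    rw [pder, fderivWithin_fun_const]; rfl
  have e1 : waveOp₀ Ω t₁ t₂ A u z = (∑ k, weakDeriv (cyl Ω t₁ t₂) (dirX k)
      (fun z => ∑ l, A z.1 k l * dx Ω t₁ t₂ l u z) z) - dt Ω t₁ t₂ (dt Ω t₁ t₂ u) z := rfl
  rw [e1, Finset.sum_congr rfl fun k _ => hz k]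
  simp only [Fintype.sum_option, waveCoeff, c0, zero_mul, Finset.sum_const_zero, add_zero, zero_add]
  simp only [dirQ, dx, dt]
  ring

end WaveOperator

/-! ### The Carleman estimate for real-valued functions -/

/-- If `f` is integrable, the negative part is dropped; otherwise the left side is zero by
convention. Right-hand sides can thus be converted without proving integrability. -/
theorem ofReal_integral_le_lintegral {α : Type*} [MeasurableSpace α] {μ : Measure α} (f : α → ℝ) :
    ENNReal.ofReal (∫ z, f z ∂μ) ≤ ∫⁻ z, ENNReal.ofReal (f z) ∂μ := by
  by_cases hf : Integrable f μ
  · rw [integral_eq_lintegral_pos_part_sub_lintegral_neg_part hf]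
    refine (ENNReal.ofReal_le_ofReal ?_).trans ENNReal.ofReal_toReal_le
    linarith [ENNReal.toReal_nonneg (a := ∫⁻ a, ENNReal.ofReal (-f a) ∂μ)]
  · rw [integral_undef hf]; simp

section RealEstimate

variable {n : ℕ} {Ω : Set (E n)} {t₁ t₂ ϰ m κ δ B : ℝ} {A : E n → Matrix (Fin n) (Fin n) ℝ}
  {ψ₀ : E n → ℝ} {ψ₁ : ℝ → ℝ}

/-- The boundary term is controlled by its part on `Σ₊`. -/
theorem lintegral_boundary_le {ρ : Measure (E n)} {C : NNReal} (hΩ : IsLipschitzDomain Ω)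
    (ht : t₁ < t₂) (hϰ : 0 ≤ ϰ) (hA : IsAdmissible Ω ϰ m A) (hρ : IsGaussGreenMeasure Ω ρ C)
    {s c₀ M : ℝ} (hM : 0 ≤ M)
    (hψ : ContDiffOn ℝ 4 (psi ψ₀ ψ₁) (closure (cyl Ω t₁ t₂)))
    (h : IsCarlemanData (closure (cyl Ω t₁ t₂)) dirQ (fun i j z => waveCoeff A i j z.1)
      (psi ψ₀ ψ₁) s c₀ δ M) {lam τ : ℝ} (hlam : 0 ≤ lam) {G : E n × ℝ → ℝ}
    (hG : ∀ᵐ z ∂endMeasure Ω t₁ t₂, G z = 0) :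
    ∫⁻ z, ENNReal.ofReal (Real.exp (τ * phi ψ₀ ψ₁ lam z) ^ 2 * (lam * phi ψ₀ ψ₁ lam z) * G z ^ 2 *
        ((∑ i, (∑ j, waveCoeff A i j z.1 * cylNormal Ω t₁ t₂ z j) * cylNormal Ω t₁ t₂ z i) *
          ∑ i, (∑ j, waveCoeff A i j z.1 * pder (closure (cyl Ω t₁ t₂)) (dirQ j) (psi ψ₀ ψ₁) z) *
            cylNormal Ω t₁ t₂ z i)) ∂cylMeasure Ω t₁ t₂ ρ ≤
      ENNReal.ofReal (C * (lam * (ϰ * (n * (n * (M * M)))))) *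
        ∫⁻ z in sigmaPlus Ω t₁ t₂ A ψ₀, ENNReal.ofReal (Real.exp (2 * τ * phi ψ₀ ψ₁ lam z) *
          phi ψ₀ ψ₁ lam z * G z ^ 2) ∂lateralMeasure Ω t₁ t₂ := by
  have hfin := hρ.finite
  have hfin' := hρ.isFiniteMeasure_surfaceMeasure
  set f : E n × ℝ → ℝ := fun z => Real.exp (τ * phi ψ₀ ψ₁ lam z) ^ 2 * (lam * phi ψ₀ ψ₁ lam z)
    * G z ^ 2 * ((∑ i, (∑ j, waveCoeff A i j z.1 * cylNormal Ω t₁ t₂ z j) * cylNormal Ω t₁ t₂ z i) *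
      ∑ i, (∑ j, waveCoeff A i j z.1 * pder (closure (cyl Ω t₁ t₂)) (dirQ j) (psi ψ₀ ψ₁) z) *
        cylNormal Ω t₁ t₂ z i) with hf
  set g : E n × ℝ → ENNReal := fun z => ENNReal.ofReal (Real.exp (2 * τ * phi ψ₀ ψ₁ lam z) *
          phi ψ₀ ψ₁ lam z * G z ^ 2) with hg
  set k : ℝ := lam * (ϰ * (n * (n * (M * M)))) with hk
  have hk0 : 0 ≤ k := by positivity
  have hend : ∫⁻ z, ENNReal.ofReal (f z) ∂endMeasure Ω t₁ t₂ = 0 := by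
    refine (lintegral_congr_ae ?_).trans lintegral_zero
    filter_upwards [hG] with z hz
    simp [hf, hz]
  have hlat : ∀ᵐ z ∂ρ.prod (volume.restrict (Ioo t₁ t₂)),
      ENNReal.ofReal (f z) ≤ ENNReal.ofReal k * (sigmaPlus Ω t₁ t₂ A ψ₀).indicator g z := by
    filter_upwards [ae_lateral (t₁ := t₁) (t₂ := t₂) hρ] with z hz
    have hzΩ : z.1 ∈ closure Ω := frontier_subset_closure hz.1
    have hzK : z ∈ closure (cyl Ω t₁ t₂) := by
      rw [closure_cyl ht]; exact ⟨hzΩ, Ioo_subset_Icc_self hz.2.2⟩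
    have hc : ∀ i, cylNormal Ω t₁ t₂ z (some i) = outerNormal Ω z.1 i := fun i => by
      simp only [cylNormal, if_pos hz.2.2]
    have hc0 : cylNormal Ω t₁ t₂ z none = 0 := by simp only [cylNormal, if_pos hz.2.2]
    have hν := hz.2.1.1
    have hν1 : ∑ i, outerNormal Ω z.1 i ^ 2 = 1 := by
      rw [← EuclideanSpace.real_norm_sq_eq, hν, one_pow]
    have hν2 : ∀ i, |outerNormal Ω z.1 i| ≤ 1 := fun i => by
      rw [← hν]; exact PiLp.norm_apply_le (outerNormal Ω z.1) i
    have hell := elliptic_closure hA hzΩ (outerNormal Ω z.1)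
    rw [hν1, mul_one, mul_one] at hell
    have hp : ∀ i, pder (closure (cyl Ω t₁ t₂)) (dirQ (some i)) (psi ψ₀ ψ₁) z = pd Ω i ψ₀ z.1 :=
      fun i => by
        rw [pder_psi hΩ ht hψ _ hzK]
        change pd Ω i ψ₀ z.1 + pder (Icc t₁ t₂) 0 ψ₁ z.2 = _
        rw [pder_zero, add_zero]
    have e1 : ∑ i, (∑ j, waveCoeff A i j z.1 * cylNormal Ω t₁ t₂ z j) * cylNormal Ω t₁ t₂ z i =
        ∑ k, ∑ l, A z.1 k l * outerNormal Ω z.1 l * outerNormal Ω z.1 k := by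
      simp only [Fintype.sum_option, hc, hc0, waveCoeff, zero_mul, mul_zero, zero_add,
        Finset.sum_mul, Finset.sum_const_zero]
    have e2 : ∑ i, (∑ j, waveCoeff A i j z.1 * pder (closure (cyl Ω t₁ t₂)) (dirQ j)
        (psi ψ₀ ψ₁) z) * cylNormal Ω t₁ t₂ z i = conormal Ω A ψ₀ z.1 := by
      simp only [Fintype.sum_option, hc, hc0, waveCoeff, zero_mul, mul_zero, zero_add, hp,
        Finset.sum_mul, conormal]
    have hcon : |conormal Ω A ψ₀ z.1| ≤ n * (n * (M * M)) := by
      have h1 : |conormal Ω A ψ₀ z.1| ≤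
          Fintype.card (Fin n) * (Fintype.card (Fin n) * (M * M * 1)) :=
        abs_sum_le_card_mul fun k => abs_sum_le_card_mul fun l => abs_mul_le_mul
          (abs_mul_le_mul (h.b_le z hzK (some k) (some l))
            (by rw [← hp]; exact h.pder_ψ_le z hzK (some l))) (hν2 k)
      simpa using h1
    have hφ : 0 < phi ψ₀ ψ₁ lam z := Real.exp_pos _
    have hr : Real.exp (τ * phi ψ₀ ψ₁ lam z) ^ 2 = Real.exp (2 * τ * phi ψ₀ ψ₁ lam z) := by
      rw [sq, ← Real.exp_add]; congr 1; ring
    have hfz : f z = Real.exp (2 * τ * phi ψ₀ ψ₁ lam z) * (lam * phi ψ₀ ψ₁ lam z) * G z ^ 2 *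
        ((∑ k, ∑ l, A z.1 k l * outerNormal Ω z.1 l * outerNormal Ω z.1 k)
          * conormal Ω A ψ₀ z.1) := by
      rw [hf]; simp only; rw [e1, e2, hr]
    set q := ∑ k, ∑ l, A z.1 k l * outerNormal Ω z.1 l * outerNormal Ω z.1 k
    have hq0 : 0 ≤ q := le_trans (inv_nonneg.2 hϰ) hell.1
    have hw0 : 0 ≤ Real.exp (2 * τ * phi ψ₀ ψ₁ lam z) * (lam * phi ψ₀ ψ₁ lam z) * G z ^ 2 := by
      positivity
    -- The factor `(Aν|ν)` lies between `0` and `ϰ`, so the sign is that of the conormal derivative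
    -- of `ψ₀`. Where the latter is nonpositive, `ENNReal.ofReal` sends the contribution to zero.
    by_cases hpos : 0 < conormal Ω A ψ₀ z.1
    · have hmem : z ∈ sigmaPlus Ω t₁ t₂ A ψ₀ := ⟨⟨hz.1, hpos⟩, hz.2.2⟩
      rw [indicator_of_mem hmem, hg, ← ENNReal.ofReal_mul hk0, hfz]
      refine ENNReal.ofReal_le_ofReal ?_
      have h1 : q * conormal Ω A ψ₀ z.1 ≤ ϰ * (n * (n * (M * M))) :=
        mul_le_mul hell.2 ((le_abs_self _).trans hcon) hpos.le hϰ
      refine (mul_le_mul_of_nonneg_left h1 hw0).trans (le_of_eq ?_)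
      rw [hk]; ring
    · rw [hfz, ENNReal.ofReal_of_nonpos]
      · exact zero_le
      · exact mul_nonpos_of_nonneg_of_nonpos hw0
          (mul_nonpos_of_nonneg_of_nonpos hq0 (not_lt.1 hpos))
  change ∫⁻ z, ENNReal.ofReal (f z) ∂cylMeasure Ω t₁ t₂ ρ ≤ _
  rw [cylMeasure, lintegral_add_measure, hend, add_zero, ENNReal.ofReal_mul C.coe_nonneg, mul_assoc,
    ENNReal.ofReal_coe_nnreal]
  refine (lintegral_mono_ae hlat).trans ((lintegral_mono' (prod_le_smul_prod hρ.le) le_rfl).trans ?_)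
  rw [lintegral_smul_measure, lintegral_const_mul' _ _ ENNReal.ofReal_ne_top, ENNReal.smul_def,
    smul_eq_mul]
  exact mul_le_mul' le_rfl (mul_le_mul' le_rfl (lintegral_indicator_le _ _))

/-- The integrand on the left-hand side of the Carleman estimate. -/
def carlemanDensity (Ω : Set (E n)) (t₁ t₂ : ℝ) (ψ₀ : E n → ℝ) (ψ₁ : ℝ → ℝ) (lam τ : ℝ)
    (u : E n × ℝ → ℝ) (z : E n × ℝ) : ℝ :=
  Real.exp (2 * τ * phi ψ₀ ψ₁ lam z) * (τ ^ 3 * lam ^ 4 * phi ψ₀ ψ₁ lam z ^ 3 * u z ^ 2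
    + τ * lam * phi ψ₀ ψ₁ lam z * ∑ i, weakDeriv (cyl Ω t₁ t₂) (dirQ i) u z ^ 2)

theorem integrable_carlemanDensity (hΩ : IsLipschitzDomain Ω) (ht : t₁ < t₂)
    (hψ : ContinuousOn (psi ψ₀ ψ₁) (closure (cyl Ω t₁ t₂))) (a b : ℝ) {lam τ : ℝ}
    {u : E n × ℝ → ℝ} (hu : MemH1 (cyl Ω t₁ t₂) u) :
    Integrable (fun z => Real.exp (2 * τ * phi ψ₀ ψ₁ lam z) *
      (a * (τ ^ 3 * lam ^ 4 * phi ψ₀ ψ₁ lam z ^ 3 * u z ^ 2)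
      + b * (τ * lam * phi ψ₀ ψ₁ lam z * ∑ i, weakDeriv (cyl Ω t₁ t₂) (dirQ i) u z ^ 2)))
      (volume.restrict (cyl Ω t₁ t₂)) := by
  have hφ : ContinuousOn (phi ψ₀ ψ₁ lam) (closure (cyl Ω t₁ t₂)) :=
    (continuousOn_const.mul hψ).rexp
  have hr : ContinuousOn (fun z => Real.exp (2 * τ * phi ψ₀ ψ₁ lam z)) (closure (cyl Ω t₁ t₂)) :=
    (continuousOn_const.mul hφ).rexp
  have key : ∀ {c f : E n × ℝ → ℝ}, ContinuousOn c (closure (cyl Ω t₁ t₂)) →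
      MemLp f 2 (volume.restrict (cyl Ω t₁ t₂)) →
      Integrable (fun z => c z * f z * f z) (volume.restrict (cyl Ω t₁ t₂)) := fun hc hf =>
    ((TendstoL2.const hf).cont_mul (hΩ.isCompact_closure_cyl ht) (ae_mem_closure_cyl hΩ)
      hc).2.1.integrable_mul hf
  have h1 := key (c := fun z => Real.exp (2 * τ * phi ψ₀ ψ₁ lam z) *
    (a * τ ^ 3 * lam ^ 4 * phi ψ₀ ψ₁ lam z ^ 3)) (hr.mul (continuousOn_const.mul (hφ.pow 3))) hu.1
  have h2 := fun i => key (c := fun z => Real.exp (2 * τ * phi ψ₀ ψ₁ lam z) *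
    (b * τ * lam * phi ψ₀ ψ₁ lam z)) (hr.mul (continuousOn_const.mul hφ))
    (hu.weakDeriv_spec (dirQ i)).1
  refine (h1.add (integrable_finsetSum Finset.univ fun i _ => h2 i)).congr
    (Eventually.of_forall fun z => ?_)
  simp only [Pi.add_apply, mul_add, Finset.mul_sum]
  congr 1
  · ring
  · exact Finset.sum_congr rfl fun i _ => by ring

/-- The Carleman estimate for real-valued functions. -/
theorem carleman_real (hn : 1 ≤ n) (hΩ : IsLipschitzDomain Ω) (ht : t₁ < t₂) (hϰ : 1 ≤ ϰ)
    (hm : 0 < m) (hκ : 0 < κ) (hδ : 0 < δ) : ∃ c lam₀ : ℝ, 0 < c ∧ 1 ≤ lam₀ ∧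
      ∀ A : E n → Matrix (Fin n) (Fin n) ℝ, IsAdmissible Ω ϰ m A →
      ∀ (ψ₀ : E n → ℝ) (ψ₁ : ℝ → ℝ), IsWaveWeight Ω t₁ t₂ A ϰ κ ψ₀ ψ₁ →
      IsLeast (chiSq Ω t₁ t₂ A ψ₀ ψ₁ '' closure (cyl Ω t₁ t₂)) δ →
      C4Bound Ω t₁ t₂ B (psi ψ₀ ψ₁) →
      ∀ lam ≥ lam₀, ∀ τ ≥ (1 : ℝ), ∀ u : E n × ℝ → ℝ, IsAdmissibleFun Ω t₁ t₂ u →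
        ENNReal.ofReal c * ∫⁻ z in cyl Ω t₁ t₂,
            ENNReal.ofReal (carlemanDensity Ω t₁ t₂ ψ₀ ψ₁ lam τ u z)
          ≤ (∫⁻ z in cyl Ω t₁ t₂, ENNReal.ofReal
              (Real.exp (2 * τ * phi ψ₀ ψ₁ lam z) * waveOp₀ Ω t₁ t₂ A u z ^ 2))
            + ENNReal.ofReal (τ * lam) *
              ∫⁻ z in sigmaPlus Ω t₁ t₂ A ψ₀, ENNReal.ofReal
                (Real.exp (2 * τ * phi ψ₀ ψ₁ lam z) * phi ψ₀ ψ₁ lam z *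
                  normalDeriv Ω t₁ t₂ u z ^ 2) ∂(lateralMeasure Ω t₁ t₂) := by
  obtain ⟨ρ, C, hρ⟩ := hΩ.exists_gaussGreenMeasure hn
  have hϰ0 : 0 < ϰ := by linarith
  set M := |B| + m + 1 + κ with hMdef
  have hM : 0 ≤ M := by positivity
  set c₀ := κ / (4 * ϰ) with hc₀d
  have hc₀ : 0 < c₀ := by positivity
  obtain ⟨lam₀, hlam₀, hpt⟩ := exists_pointwise (Option (Fin n)) hc₀ hδ hM
  set K : ℝ := C * (ϰ * (n * (n * (M * M)))) with hKd
  have hK0 : 0 ≤ K := by positivity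
  set c' := min (δ / 2) (c₀ / 8) with hc'
  have hc'0 : 0 < c' := lt_min (by positivity) (by positivity)
  -- `K` is the coefficient left before the boundary integral. Multiplication by `(1 + K)⁻¹` brings
  -- it, and the coefficient of the interior integral, to at most `1`.
  refine ⟨(1 + K)⁻¹ * c', lam₀, by positivity, hlam₀, ?_⟩
  intro A hA ψ₀ ψ₁ hw hleast hB lam hlam τ hτ u hu
  have hlam0 : 0 ≤ lam := by linarith
  have hτ0 : 0 ≤ τ := by linarith
  have hdata := isCarlemanData_wave hΩ ht hϰ hm hκ hA hw hleast hB
  obtain ⟨v, hv, t0, t1, t2, b0, b1, hend⟩ := hu.exists_approx hn hΩ ht hρ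
  have hmain := carleman_limit (cyl_isGaussGreen hΩ ht hρ) (isOpen_cyl hΩ)
    (hΩ.isCompact_closure_cyl ht) (hΩ.uniqueDiffOn_cyl ht) hdata
    (hpt _ _ _ _ _ _ (hΩ.uniqueDiffOn_cyl ht) hdata τ hτ lam hlam) hv t0 (fun i => t1 (dirQ i))
    (fun i k => t2 (dirQ k) (dirQ i)) b0 b1
  set W : E n × ℝ → ℝ := fun z => Real.exp (2 * τ * phi ψ₀ ψ₁ lam z) with hW
  have hr : ∀ z, Real.exp (τ * Real.exp (lam * psi ψ₀ ψ₁ z)) ^ 2 = W z := fun z => by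
    rw [sq, ← Real.exp_add, hW]; simp only [phi]; congr 1; ring
  set X := ∫⁻ z in cyl Ω t₁ t₂, ENNReal.ofReal (carlemanDensity Ω t₁ t₂ ψ₀ ψ₁ lam τ u z) with hX
  set Y := ∫⁻ z in cyl Ω t₁ t₂, ENNReal.ofReal (W z * waveOp₀ Ω t₁ t₂ A u z ^ 2) with hY
  set Z := ∫⁻ z in sigmaPlus Ω t₁ t₂ A ψ₀, ENNReal.ofReal
    (W z * phi ψ₀ ψ₁ lam z * normalDeriv Ω t₁ t₂ u z ^ 2) ∂(lateralMeasure Ω t₁ t₂) with hZ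
  have hφ : ∀ z, 0 < phi ψ₀ ψ₁ lam z := fun z => Real.exp_pos _
  have hden : ∀ z, 0 ≤ carlemanDensity Ω t₁ t₂ ψ₀ ψ₁ lam τ u z := fun z => by
    have := hφ z
    have : 0 ≤ ∑ i, weakDeriv (cyl Ω t₁ t₂) (dirQ i) u z ^ 2 :=
      Finset.sum_nonneg fun i _ => sq_nonneg _
    rw [carlemanDensity]; positivity
  have hψc := hw.contDiffOn.continuousOn
  have hint : Integrable (carlemanDensity Ω t₁ t₂ ψ₀ ψ₁ lam τ u)
      (volume.restrict (cyl Ω t₁ t₂)) := by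
    refine (integrable_carlemanDensity hΩ ht hψc 1 1 (lam := lam) (τ := τ) hu.memH2.1).congr
      (Eventually.of_forall fun z => ?_)
    simp only [one_mul, carlemanDensity]
  simp only [hr] at hmain
  have s1 : c' * ∫ z in cyl Ω t₁ t₂, carlemanDensity Ω t₁ t₂ ψ₀ ψ₁ lam τ u z ≤
      ∫ z in cyl Ω t₁ t₂, W z * (δ / 2 * (τ ^ 3 * lam ^ 4 * Real.exp (lam * psi ψ₀ ψ₁ z) ^ 3 * u z ^ 2)
        + c₀ / 8 * (τ * lam * Real.exp (lam * psi ψ₀ ψ₁ z) *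
          ∑ i, weakDeriv (cyl Ω t₁ t₂) (dirQ i) u z ^ 2)) := by
    rw [← integral_const_mul]
    refine integral_mono (hint.const_mul _) (integrable_carlemanDensity hΩ ht hψc _ _ hu.memH2.1)
      fun z => ?_
    have h1 := hφ z
    have h2 : 0 ≤ ∑ i, weakDeriv (cyl Ω t₁ t₂) (dirQ i) u z ^ 2 :=
      Finset.sum_nonneg fun i _ => sq_nonneg _
    have hp : Real.exp (lam * psi ψ₀ ψ₁ z) = phi ψ₀ ψ₁ lam z := rfl
    simp only [carlemanDensity, hp]
    rw [mul_left_comm, mul_add]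
    refine mul_le_mul_of_nonneg_left (add_le_add ?_ ?_) (Real.exp_pos _).le
    · exact mul_le_mul_of_nonneg_right (min_le_left _ _) (by positivity)
    · exact mul_le_mul_of_nonneg_right (min_le_right _ _) (by positivity)
  have s1' : ENNReal.ofReal c' * X = ENNReal.ofReal
      (c' * ∫ z in cyl Ω t₁ t₂, carlemanDensity Ω t₁ t₂ ψ₀ ψ₁ lam τ u z) := by
    rw [ENNReal.ofReal_mul hc'0.le, ofReal_integral_eq_lintegral_ofReal hint
      (Eventually.of_forall hden)]
  have s2 : ENNReal.ofReal (1 / 2 * (∫ z in cyl Ω t₁ t₂, W z * (∑ i, ∑ j,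
      (pder (closure (cyl Ω t₁ t₂)) (dirQ i) (fun y => waveCoeff A i j y.1) z
        * weakDeriv (cyl Ω t₁ t₂) (dirQ j) u z + waveCoeff A i j z.1
        * weakDeriv (cyl Ω t₁ t₂) (dirQ i) (weakDeriv (cyl Ω t₁ t₂) (dirQ j) u) z)) ^ 2)) ≤ Y := by
    refine (ENNReal.ofReal_le_ofReal (q := _) ?_).trans
      ((ofReal_integral_le_lintegral fun z => W z * (∑ i, ∑ j,
        (pder (closure (cyl Ω t₁ t₂)) (dirQ i) (fun y => waveCoeff A i j y.1) z
        * weakDeriv (cyl Ω t₁ t₂) (dirQ j) u z + waveCoeff A i j z.1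
        * weakDeriv (cyl Ω t₁ t₂) (dirQ i) (weakDeriv (cyl Ω t₁ t₂) (dirQ j) u) z)) ^ 2).trans
      (le_of_eq (lintegral_congr_ae ?_)))
    · exact mul_le_of_le_one_left (integral_nonneg fun z =>
        mul_nonneg (Real.exp_pos _).le (sq_nonneg _)) (by norm_num)
    · filter_upwards [waveOp₀_ae_eq hn hΩ ht hA hu.memH2] with z hz
      rw [hz]
  have s3 := (mul_le_mul_right ((ofReal_integral_le_lintegral _).trans (lintegral_boundary_le hΩ ht
    hϰ0.le hA hρ hM hw.contDiffOn hdata hlam0 (τ := τ) hend)) (ENNReal.ofReal τ))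
  rw [← ENNReal.ofReal_mul hτ0, ← mul_assoc, ← ENNReal.ofReal_mul hτ0] at s3
  have s4 : τ * (C * (lam * (ϰ * (n * (n * (M * M)))))) = K * (τ * lam) := by rw [hKd]; ring
  rw [s4, ENNReal.ofReal_mul hK0, mul_assoc] at s3
  have total : ENNReal.ofReal c' * X ≤
      Y + ENNReal.ofReal K * (ENNReal.ofReal (τ * lam) * Z) := by
    rw [s1']
    refine (ENNReal.ofReal_le_ofReal (s1.trans hmain)).trans (ENNReal.ofReal_add_le.trans
      (add_le_add s2 ?_))
    refine le_trans (le_of_eq ?_) s3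
    congr 3
    funext z
    simp only [phi, ← hr]
  have hi1 : (1 + K)⁻¹ ≤ 1 := inv_le_one_of_one_le₀ (by linarith)
  have hi2 : (1 + K)⁻¹ * K ≤ 1 := by
    rw [inv_mul_le_iff₀ (by linarith)]; linarith
  rw [ENNReal.ofReal_mul (by positivity), mul_assoc]
  refine (mul_le_mul_right total _).trans ?_
  rw [mul_add, ← mul_assoc (ENNReal.ofReal (1 + K)⁻¹) (ENNReal.ofReal K),
    ← ENNReal.ofReal_mul (by positivity)]
  refine add_le_add (mul_le_of_le_one_left zero_le ?_) (mul_le_of_le_one_left zero_le ?_)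
  · exact ENNReal.ofReal_le_one.2 hi1
  · exact ENNReal.ofReal_le_one.2 hi2

end RealEstimate

/-! ### Real and imaginary parts -/

section WeakDerivativesParts

variable {V : Type*} [NormedAddCommGroup V] [NormedSpace ℝ V] [FiniteDimensional ℝ V]
  [MeasureSpace V] [BorelSpace V] [IsAddHaarMeasure (volume : Measure V)]
  {F F' : Type*} [NormedAddCommGroup F] [NormedSpace ℝ F] [CompleteSpace F]
  [NormedAddCommGroup F'] [NormedSpace ℝ F'] [CompleteSpace F'] {D : Set V} {e : V}

theorem IsWeakDeriv.clm_comp {f g : V → F} (h : IsWeakDeriv D e f g)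
    (hf : MemLp f 2 (volume.restrict D)) (hg : MemLp g 2 (volume.restrict D)) (L : F →L[ℝ] F') :
    IsWeakDeriv D e (fun z => L (f z)) (fun z => L (g z)) := by
  intro θ hθ hc hs
  have i1 : Integrable (fun z => (fderiv ℝ θ z e) • f z) (volume.restrict D) :=
    integrable_testFunction_smul hf ((hθ.continuous_fderiv (by simp)).clm_apply continuous_const)
      (hc.fderiv_apply ℝ e)
  have i2 := integrable_testFunction_smul hg hθ.continuous hc
  simp only [← map_smul]
  rw [L.integral_comp_comm i1, L.integral_comp_comm i2, h θ hθ hc hs, map_neg]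

theorem MemH1.clm_comp {f : V → F} (hf : MemH1 D f) (L : F →L[ℝ] F') :
    MemH1 D (fun z => L (f z)) :=
  ⟨L.comp_memLp' hf.1, fun e => ⟨_, L.comp_memLp' (hf.weakDeriv_spec e).1,
    (hf.weakDeriv_spec e).2.clm_comp hf.1 (hf.weakDeriv_spec e).1 L⟩⟩

theorem MemH1.weakDeriv_clm_comp (hD : IsOpen D) {f : V → F} (hf : MemH1 D f) (L : F →L[ℝ] F')
    (e : V) : weakDeriv D e (fun z => L (f z)) =ᵐ[volume.restrict D] fun z => L (weakDeriv D e f z) :=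
  weakDeriv_ae_eq hD (L.comp_memLp' (hf.weakDeriv_spec e).1)
    ((hf.weakDeriv_spec e).2.clm_comp hf.1 (hf.weakDeriv_spec e).1 L)

theorem MemH1.congr {f f' : V → F} (hf : MemH1 D f) (h : f =ᵐ[volume.restrict D] f') :
    MemH1 D f' :=
  ⟨(memLp_congr_ae h).1 hf.1, fun e => ⟨_, (hf.weakDeriv_spec e).1,
    (hf.weakDeriv_spec e).2.congr h EventuallyEq.rfl⟩⟩

theorem MemH1.weakDeriv_congr (hD : IsOpen D) {f f' : V → F} (hf : MemH1 D f)
    (h : f =ᵐ[volume.restrict D] f') (e : V) :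
    weakDeriv D e f' =ᵐ[volume.restrict D] weakDeriv D e f :=
  weakDeriv_ae_eq hD (hf.weakDeriv_spec e).1 ((hf.weakDeriv_spec e).2.congr h EventuallyEq.rfl)

theorem MemH2.clm_comp (hD : IsOpen D) {f : V → F} (hf : MemH2 D f) (L : F →L[ℝ] F') :
    MemH2 D (fun z => L (f z)) :=
  ⟨hf.1.clm_comp L, fun e => ((hf.2 e).clm_comp L).congr (hf.1.weakDeriv_clm_comp hD L e).symm⟩

theorem isWeakDeriv_of_re_im {f g : V → ℂ} (hf : MemLp f 2 (volume.restrict D))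
    (hg : MemLp g 2 (volume.restrict D)) (hre : IsWeakDeriv D e (fun z => (f z).re) fun z => (g z).re)
    (him : IsWeakDeriv D e (fun z => (f z).im) fun z => (g z).im) : IsWeakDeriv D e f g := by
  intro θ hθ hc hs
  have i1 : Integrable (fun z => (fderiv ℝ θ z e) • f z) (volume.restrict D) :=
    integrable_testFunction_smul hf ((hθ.continuous_fderiv (by simp)).clm_apply continuous_const)
      (hc.fderiv_apply ℝ e)
  have i2 := integrable_testFunction_smul hg hθ.continuous hc
  have key : ∀ L : ℂ →L[ℝ] ℝ, IsWeakDeriv D e (fun z => L (f z)) (fun z => L (g z)) →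
      L (∫ z in D, (fderiv ℝ θ z e) • f z) = L (- ∫ z in D, θ z • g z) := fun L hL => by
    rw [map_neg, ← L.integral_comp_comm i1, ← L.integral_comp_comm i2]
    simp only [map_smul]
    exact hL θ hθ hc hs
  exact Complex.ext (key Complex.reCLM hre) (key Complex.imCLM him)

variable {μ : Measure V}

theorem IsTrace.congr (hD : IsOpen D) {f f' g : V → F} (hg : IsTrace D μ f g) (hf : MemH1 D f)
    (h : f =ᵐ[volume.restrict D] f') : IsTrace D μ f' g := by
  obtain ⟨h0, v, hv, h1, h2, h3⟩ := hg
  refine ⟨h0, v, hv, h1.congr fun j => eLpNorm_congr_ae (EventuallyEq.rfl.sub h), fun e => ?_, h3⟩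
  refine (h2 e).congr fun j => eLpNorm_congr_ae ?_
  filter_upwards [hf.weakDeriv_congr hD h e] with z hz
  rw [hz]

theorem IsTrace.clm_comp (hD : IsOpen D) {f g : V → ℂ} (hf : MemH1 D f) (h : IsTrace D μ f g)
    {L : ℂ →L[ℝ] ℝ} (hL : ∀ z, |L z| ≤ ‖z‖) :
    IsTrace D μ (fun z => L (f z)) (fun z => L (g z)) := by
  obtain ⟨h0, v, hv, h1, h2, h3⟩ := h
  have key : ∀ {ν : Measure V} {a : ℕ → V → ℂ} {b : ℕ → V → ℝ},
      (∀ j, ∀ᵐ z ∂ν, b j z = L (a j z)) → Tendsto (fun j => eLpNorm (a j) 2 ν) atTop (𝓝 0) →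
      Tendsto (fun j => eLpNorm (b j) 2 ν) atTop (𝓝 0) := fun hb ha =>
    tendsto_of_tendsto_of_tendsto_of_le_of_le tendsto_const_nhds ha (fun _ => zero_le)
      fun j => eLpNorm_mono_ae (by
        filter_upwards [hb j] with z hz
        rw [hz]; exact hL _)
  refine ⟨L.comp_memLp' h0, fun j z => L (v j z), fun j => L.contDiff.comp (hv j),
    key (fun j => Eventually.of_forall fun z => (map_sub L _ _).symm) h1, fun e => ?_,
    key (fun j => Eventually.of_forall fun z => (map_sub L _ _).symm) h3⟩
  refine key (fun j => ?_) (h2 e)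
  filter_upwards [hf.weakDeriv_clm_comp hD L e] with z hz
  have : HasFDerivAt (fun z => L (v j z)) (L.comp (fderiv ℝ (v j) z)) z :=
    L.hasFDerivAt.comp z ((hv j).differentiable (by simp) z).hasFDerivAt
  rw [hz, this.fderiv, map_sub]; rfl

theorem eLpNorm_add_mul_I_le {ν : Measure V} {a b : V → ℝ} (ha : AEStronglyMeasurable a ν)
    (hb : AEStronglyMeasurable b ν) :
    eLpNorm (fun z => (a z : ℂ) + b z * Complex.I) 2 ν ≤ eLpNorm a 2 ν + eLpNorm b 2 ν := by
  have h1 : eLpNorm (fun z => (a z : ℂ)) 2 ν = eLpNorm a 2 ν :=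
    eLpNorm_congr_norm_ae (Eventually.of_forall fun z => by simp)
  have h2 : eLpNorm (fun z => (b z : ℂ) * Complex.I) 2 ν = eLpNorm b 2 ν :=
    eLpNorm_congr_norm_ae (Eventually.of_forall fun z => by simp)
  rw [← h1, ← h2]
  exact eLpNorm_add_le (Complex.continuous_ofReal.comp_aestronglyMeasurable ha)
    ((Complex.continuous_ofReal.comp_aestronglyMeasurable hb).mul_const _) (by norm_num)

/-- Smooth approximations of the two parts are recombined. The lemma supplies existence of complex
traces, without which the selected trace would be the default value zero. -/
theorem isTrace_of_re_im (hD : IsOpen D) {f : V → ℂ} {g h : V → ℝ} (hf : MemH1 D f)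
    (hg : IsTrace D μ (fun z => (f z).re) g) (hh : IsTrace D μ (fun z => (f z).im) h) :
    IsTrace D μ f (fun z => (g z : ℂ) + h z * Complex.I) := by
  obtain ⟨a0, v, hv, a1, a2, a3⟩ := hg
  obtain ⟨b0, w, hw, b1, b2, b3⟩ := hh
  have m0 := memLp_re_im_iff.2 hf.1
  have key : ∀ {ν : Measure V} {a b : ℕ → V → ℝ} {c : ℕ → V → ℂ},
      (∀ j, AEStronglyMeasurable (a j) ν) → (∀ j, AEStronglyMeasurable (b j) ν) →
      (∀ j, ∀ᵐ z ∂ν, c j z = (a j z : ℂ) + b j z * Complex.I) →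
      Tendsto (fun j => eLpNorm (a j) 2 ν) atTop (𝓝 0) →
      Tendsto (fun j => eLpNorm (b j) 2 ν) atTop (𝓝 0) →
      Tendsto (fun j => eLpNorm (c j) 2 ν) atTop (𝓝 0) := fun {ν a b c} ha hb hc ta tb => by
    have := ta.add tb
    rw [add_zero] at this
    refine tendsto_of_tendsto_of_tendsto_of_le_of_le tendsto_const_nhds this (fun _ => zero_le)
      fun j => ?_
    rw [eLpNorm_congr_ae (hc j)]
    exact eLpNorm_add_mul_I_le (ha j) (hb j)
  have hvm : ∀ {ν : Measure V} j, AEStronglyMeasurable (v j) ν := fun j =>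
    (hv j).continuous.aestronglyMeasurable
  have hwm : ∀ {ν : Measure V} j, AEStronglyMeasurable (w j) ν := fun j =>
    (hw j).continuous.aestronglyMeasurable
  refine ⟨memLp_re_im_iff.1 ⟨by simpa using a0, by simpa using b0⟩,
    fun j z => (v j z : ℂ) + w j z * Complex.I, fun j => ?_, ?_, fun e => ?_, ?_⟩
  · exact (Complex.ofRealCLM.contDiff.comp (hv j)).add
      ((Complex.ofRealCLM.contDiff.comp (hw j)).mul contDiff_const)
  · refine key (fun j => (hvm j).sub m0.1.1) (fun j => (hwm j).sub m0.2.1)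
      (fun j => Eventually.of_forall fun z => ?_) a1 b1
    apply Complex.ext <;> simp
  · have d1 := (hf.clm_comp Complex.reCLM).weakDeriv_spec e
    have d2 := (hf.clm_comp Complex.imCLM).weakDeriv_spec e
    refine key (fun j => ?_) (fun j => ?_) (fun j => ?_) (a2 e) (b2 e)
    · exact (contDiff_fderiv_apply (hv j) e).continuous.aestronglyMeasurable.sub d1.1.1
    · exact (contDiff_fderiv_apply (hw j) e).continuous.aestronglyMeasurable.sub d2.1.1
    · filter_upwards [hf.weakDeriv_clm_comp hD Complex.reCLM e,
        hf.weakDeriv_clm_comp hD Complex.imCLM e] with z h1 h2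
      have e1 : HasFDerivAt (fun z => (v j z : ℂ) + w j z * Complex.I) _ z :=
        (Complex.ofRealCLM.hasFDerivAt.comp z ((hv j).differentiable (by simp) z).hasFDerivAt).add
        ((Complex.ofRealCLM.hasFDerivAt.comp z
          ((hw j).differentiable (by simp) z).hasFDerivAt).mul_const Complex.I)
      change weakDeriv D e (fun z => (f z).re) z = (weakDeriv D e f z).re at h1
      change weakDeriv D e (fun z => (f z).im) z = (weakDeriv D e f z).im at h2
      rw [e1.fderiv, h1, h2]
      apply Complex.ext <;> simp
  · refine key (fun j => (hvm j).sub a0.1) (fun j => (hwm j).sub b0.1)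
      (fun j => Eventually.of_forall fun z => ?_) a3 b3
    apply Complex.ext <;> simp

end WeakDerivativesParts

/-! ### Real and imaginary parts of traces, normal derivatives and the wave operator. -/

section Parts

variable {n : ℕ} {Ω : Set (E n)} {t₁ t₂ ϰ m : ℝ} {A : E n → Matrix (Fin n) (Fin n) ℝ}
  {u : E n × ℝ → ℂ} {L : ℂ →L[ℝ] ℝ}

theorem exists_isTrace_of_memH2 (hn : 1 ≤ n) (hΩ : IsLipschitzDomain Ω) (ht : t₁ < t₂)
    {u : E n × ℝ → ℝ} (hu : MemH2 (cyl Ω t₁ t₂) u) :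
    (∃ g, IsTrace (cyl Ω t₁ t₂) (boundaryMeasure Ω t₁ t₂) u g) ∧
    ∀ e, ∃ g, IsTrace (cyl Ω t₁ t₂) (boundaryMeasure Ω t₁ t₂) (weakDeriv (cyl Ω t₁ t₂) e u) g := by
  obtain ⟨ρ, C, hρ⟩ := hΩ.exists_gaussGreenMeasure hn
  obtain ⟨v, hv, h0, h1, h2⟩ := exists_smooth_approx (isOpen_cyl hΩ) (hΩ.isCompact_closure_cyl ht)
    (fun z hz => hΩ.coneCond_cyl ht hz) hu
  refine ⟨?_, fun e => ?_⟩
  · obtain ⟨g, -, hg⟩ := exists_isTrace hΩ ht hρ hv h0 h1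
    exact ⟨g, hg⟩
  · obtain ⟨g, -, hg⟩ := exists_isTrace hΩ ht hρ (fun j => contDiff_fderiv_apply (hv j) e) (h1 e)
      (h2 e)
    exact ⟨g, hg⟩

theorem isTrace_bdTrace {f : E n × ℝ → ℂ}
    (h : ∃ g, IsTrace (cyl Ω t₁ t₂) (boundaryMeasure Ω t₁ t₂) f g) :
    IsTrace (cyl Ω t₁ t₂) (boundaryMeasure Ω t₁ t₂) f (bdTrace Ω t₁ t₂ f) := by
  rw [bdTrace, trace, dif_pos h]; exact h.choose_spec

theorem exists_isTrace_complex (hn : 1 ≤ n) (hΩ : IsLipschitzDomain Ω) (ht : t₁ < t₂)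
    (hu : MemH2 (cyl Ω t₁ t₂) u) :
    (∃ g, IsTrace (cyl Ω t₁ t₂) (boundaryMeasure Ω t₁ t₂) u g) ∧
    ∀ e, ∃ g, IsTrace (cyl Ω t₁ t₂) (boundaryMeasure Ω t₁ t₂) (weakDeriv (cyl Ω t₁ t₂) e u) g := by
  have hD := isOpen_cyl (t₁ := t₁) (t₂ := t₂) hΩ
  have hr := hu.clm_comp hD Complex.reCLM
  have hi := hu.clm_comp hD Complex.imCLM
  obtain ⟨⟨g, hg⟩, hg'⟩ := exists_isTrace_of_memH2 hn hΩ ht hr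
  obtain ⟨⟨k, hk⟩, hk'⟩ := exists_isTrace_of_memH2 hn hΩ ht hi
  refine ⟨⟨_, isTrace_of_re_im hD hu.1 hg hk⟩, fun e => ?_⟩
  obtain ⟨g, hg⟩ := hg' e
  obtain ⟨k, hk⟩ := hk' e
  exact ⟨_, isTrace_of_re_im hD (hu.2 e)
    (hg.congr hD (hr.2 e) (hu.1.weakDeriv_clm_comp hD Complex.reCLM e))
    (hk.congr hD (hi.2 e) (hu.1.weakDeriv_clm_comp hD Complex.imCLM e))⟩

/-- Both sides are traces of the same real function, so uniqueness of real traces applies. This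
requires knowing beforehand that the complex trace exists. -/
theorem bdTrace_clm_comp (hn : 1 ≤ n) (hΩ : IsLipschitzDomain Ω) (ht : t₁ < t₂)
    (hu : MemH2 (cyl Ω t₁ t₂) u) (hL : ∀ z, |L z| ≤ ‖z‖) :
    (bdTrace Ω t₁ t₂ (fun z => L (u z)) =ᵐ[boundaryMeasure Ω t₁ t₂]
      fun z => L (bdTrace Ω t₁ t₂ u z)) ∧
    ∀ e, bdTrace Ω t₁ t₂ (weakDeriv (cyl Ω t₁ t₂) e (fun z => L (u z)))
      =ᵐ[boundaryMeasure Ω t₁ t₂] fun z => L (bdTrace Ω t₁ t₂ (weakDeriv (cyl Ω t₁ t₂) e u) z) := by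
  have hD := isOpen_cyl (t₁ := t₁) (t₂ := t₂) hΩ
  obtain ⟨h0, h1⟩ := exists_isTrace_complex hn hΩ ht hu
  refine ⟨?_, fun e => ?_⟩
  · have h2 := (isTrace_bdTrace h0).clm_comp hD hu.1 hL
    exact IsTrace.ae_eq hn hΩ ht (hu.1.clm_comp L) (trace_isTrace h2) h2
  · have h2 := ((isTrace_bdTrace (h1 e)).clm_comp hD (hu.2 e) hL).congr hD ((hu.2 e).clm_comp L)
      (hu.1.weakDeriv_clm_comp hD L e).symm
    exact IsTrace.ae_eq hn hΩ ht ((hu.clm_comp hD L).2 e) (trace_isTrace h2) h2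

theorem lateralMeasure_le : lateralMeasure Ω t₁ t₂ ≤ boundaryMeasure Ω t₁ t₂ :=
  Measure.le_add_right le_rfl

theorem endMeasure_le : endMeasure Ω t₁ t₂ ≤ boundaryMeasure Ω t₁ t₂ :=
  Measure.le_add_left le_rfl

theorem IsAdmissibleFun.clm_comp (hn : 1 ≤ n) (hΩ : IsLipschitzDomain Ω) (ht : t₁ < t₂)
    (hu : IsAdmissibleFun Ω t₁ t₂ u) (hL : ∀ z, |L z| ≤ ‖z‖) :
    IsAdmissibleFun Ω t₁ t₂ fun z => L (u z) := by
  obtain ⟨h0, h1⟩ := bdTrace_clm_comp hn hΩ ht hu.memH2 hL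
  refine ⟨hu.memH2.clm_comp (isOpen_cyl hΩ) L, ?_, ?_⟩
  · filter_upwards [hu.lateral, (Measure.absolutelyContinuous_of_le lateralMeasure_le).ae_le h0]
      with z hz hz'
    rw [hz', hz, map_zero]
  · filter_upwards [hu.ends, (Measure.absolutelyContinuous_of_le endMeasure_le).ae_le h0,
      (Measure.absolutelyContinuous_of_le endMeasure_le).ae_le (h1 dirT)] with z hz hz' hz''
    refine ⟨by rw [hz', hz.1, map_zero], ?_⟩
    have h3 := hz.2
    rw [dt] at h3 ⊢
    rw [hz'', h3, map_zero]

theorem normalDeriv_clm_comp (hn : 1 ≤ n) (hΩ : IsLipschitzDomain Ω) (ht : t₁ < t₂)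
    (hu : MemH2 (cyl Ω t₁ t₂) u) (hL : ∀ z, |L z| ≤ ‖z‖) :
    normalDeriv Ω t₁ t₂ (fun z => L (u z)) =ᵐ[lateralMeasure Ω t₁ t₂]
      fun z => L (normalDeriv Ω t₁ t₂ u z) := by
  have h1 := fun i : Fin n => (Measure.absolutelyContinuous_of_le lateralMeasure_le).ae_le
    ((bdTrace_clm_comp hn hΩ ht hu hL).2 (dirX i))
  filter_upwards [ae_all_iff.2 h1] with z hz
  rw [normalDeriv, normalDeriv, _root_.map_sum]
  refine Finset.sum_congr rfl fun i _ => ?_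
  rw [dx, hz i, ← RCLike.real_smul_eq_coe_mul, ← RCLike.real_smul_eq_coe_mul, map_smul]
  rfl

/-- The delicate point is the outer weak derivative of the complex field `A∇u`, which has its
intended meaning only if it exists. A weak derivative is assembled from those of the real and
imaginary parts; then `L` commutes with the operator by uniqueness. -/
theorem waveOp₀_clm_comp (hn : 1 ≤ n) (hΩ : IsLipschitzDomain Ω) (ht : t₁ < t₂)
    (hA : IsAdmissible Ω ϰ m A) (hu : MemH2 (cyl Ω t₁ t₂) u) (L : ℂ →L[ℝ] ℝ) :
    waveOp₀ Ω t₁ t₂ A (fun z => L (u z)) =ᵐ[volume.restrict (cyl Ω t₁ t₂)]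
      fun z => L (waveOp₀ Ω t₁ t₂ A u z) := by
  have hD := isOpen_cyl (t₁ := t₁) (t₂ := t₂) hΩ
  set D := cyl Ω t₁ t₂ with hDdef
  set f : Fin n → E n × ℝ → ℂ := fun k w => ∑ l, (RCLike.ofReal (A w.1 k l) : ℂ) * dx Ω t₁ t₂ l u w
    with hf
  set fr : (ℂ →L[ℝ] ℝ) → Fin n → E n × ℝ → ℝ := fun T k w =>
    ∑ l, A w.1 k l * dx Ω t₁ t₂ l (fun z => T (u z)) w with hfr
  have hTf : ∀ (T : ℂ →L[ℝ] ℝ) k, (fun z => T (f k z)) =ᵐ[volume.restrict D] fr T k := fun T k => by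
    filter_upwards [ae_all_iff.2 fun l => hu.1.weakDeriv_clm_comp hD T (dirX l)] with z hz
    simp only [hf, hfr, _root_.map_sum]
    refine Finset.sum_congr rfl fun l _ => ?_
    rw [← RCLike.real_smul_eq_coe_mul, map_smul, dx, dx, hz l, smul_eq_mul]
  have hcon := fun (T : ℂ →L[ℝ] ℝ) k => isWeakDeriv_conormal hn hΩ ht hA (hu.clm_comp hD T) k
  have hfm : ∀ T : ℂ →L[ℝ] ℝ, ∀ k, MemLp (fr T k) 2 (volume.restrict D) := fun T k => by
    refine memLp_finsetSum _ fun l _ => ?_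
    exact ((TendstoL2.const ((hu.clm_comp hD T).1.weakDeriv_spec (dirX l)).1).cont_mul
      (hΩ.isCompact_closure_cyl ht) (ae_mem_closure_cyl hΩ) (c := fun z => A z.1 k l)
      ((hA.regular k l).contDiffOn.continuousOn.comp continuousOn_fst fun z hz => by
        rw [closure_cyl ht] at hz; exact hz.1)).2.1
  have hfc : ∀ k, MemLp (f k) 2 (volume.restrict D) := fun k =>
    memLp_re_im_iff.1 ⟨(memLp_congr_ae (hTf Complex.reCLM k)).2 (hfm _ k),
      (memLp_congr_ae (hTf Complex.imCLM k)).2 (hfm _ k)⟩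
  have hex : ∀ k, ∃ g : E n × ℝ → ℂ, MemLp g 2 (volume.restrict D) ∧
      IsWeakDeriv D (dirX k) (f k) g := fun k => by
    obtain ⟨mr, wr⟩ := hcon Complex.reCLM k
    obtain ⟨mi, wi⟩ := hcon Complex.imCLM k
    have hm : MemLp (fun z => (((∑ l, (pder (closure D) (dirX k) (fun y => A y.1 k l) z
      * dx Ω t₁ t₂ l (fun z => Complex.reCLM (u z)) z + A z.1 k l *
        dx Ω t₁ t₂ k (dx Ω t₁ t₂ l (fun z => Complex.reCLM (u z))) z) : ℝ) : ℂ)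
      + ((∑ l, (pder (closure D) (dirX k) (fun y => A y.1 k l) z
      * dx Ω t₁ t₂ l (fun z => Complex.imCLM (u z)) z + A z.1 k l *
        dx Ω t₁ t₂ k (dx Ω t₁ t₂ l (fun z => Complex.imCLM (u z))) z) : ℝ) : ℂ) * Complex.I)) 2
        (volume.restrict D) := memLp_re_im_iff.1 ⟨by simpa using mr, by simpa using mi⟩
    refine ⟨_, hm, isWeakDeriv_of_re_im (hfc k) hm ?_ ?_⟩
    · refine wr.congr (hTf Complex.reCLM k).symm (Eventually.of_forall fun z => ?_)
      simp [hDdef]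
    · refine wi.congr (hTf Complex.imCLM k).symm (Eventually.of_forall fun z => ?_)
      simp [hDdef]
  have hspec : ∀ k, MemLp (weakDeriv D (dirX k) (f k)) 2 (volume.restrict D) ∧
      IsWeakDeriv D (dirX k) (f k) (weakDeriv D (dirX k) (f k)) := fun k => by
    have h := hex k
    unfold weakDeriv
    rw [dif_pos h]
    exact h.choose_spec
  have h1 : ∀ k, weakDeriv D (dirX k) (fr L k) =ᵐ[volume.restrict D]
      fun z => L (weakDeriv D (dirX k) (f k) z) := fun k =>
    weakDeriv_ae_eq hD (L.comp_memLp' (hspec k).1)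
      (((hspec k).2.clm_comp (hfc k) (hspec k).1 L).congr (hTf L k) EventuallyEq.rfl)
  have h2 : dt Ω t₁ t₂ (dt Ω t₁ t₂ fun z => L (u z)) =ᵐ[volume.restrict D]
      fun z => L (dt Ω t₁ t₂ (dt Ω t₁ t₂ u) z) :=
    (((hu.2 dirT).clm_comp L).weakDeriv_congr hD (hu.1.weakDeriv_clm_comp hD L dirT).symm dirT).trans
      ((hu.2 dirT).weakDeriv_clm_comp hD L dirT)
  filter_upwards [ae_all_iff.2 h1, h2] with z hz1 hz2
  have e1 : waveOp₀ Ω t₁ t₂ A (fun z => L (u z)) z =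
      (∑ k, weakDeriv D (dirX k) (fr L k) z) - dt Ω t₁ t₂ (dt Ω t₁ t₂ fun z => L (u z)) z := rfl
  have e2 : waveOp₀ Ω t₁ t₂ A u z =
      (∑ k, weakDeriv D (dirX k) (f k) z) - dt Ω t₁ t₂ (dt Ω t₁ t₂ u) z := rfl
  rw [e1, e2, map_sub, _root_.map_sum, hz2, Finset.sum_congr rfl fun k _ => hz1 k]

end Parts

/-! ### The Carleman estimate with lower-order terms -/

section Final

variable {n : ℕ} {Ω : Set (E n)} {t₁ t₂ ϰ m κ δ B : ℝ} {A : E n → Matrix (Fin n) (Fin n) ℝ}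
  {ψ₀ : E n → ℝ} {ψ₁ : ℝ → ℝ}

theorem energy_real_le (hϰ : 1 ≤ ϰ) (hA : IsAdmissible Ω ϰ m A) (u : E n × ℝ → ℝ) {z : E n × ℝ}
    (hz : z ∈ cyl Ω t₁ t₂) :
    energy Ω t₁ t₂ A u z ≤ ϰ * ∑ i, weakDeriv (cyl Ω t₁ t₂) (dirQ i) u z ^ 2 := by
  have h := (elliptic_closure hA (subset_closure hz.1)
    (WithLp.toLp 2 fun i => dx Ω t₁ t₂ i u z)).2
  have h2 : dt Ω t₁ t₂ u z ^ 2 ≤ ϰ * dt Ω t₁ t₂ u z ^ 2 :=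
    le_mul_of_one_le_left (sq_nonneg _) hϰ
  rw [Fintype.sum_option, mul_add, add_comm]
  refine le_trans (le_of_eq ?_) (add_le_add h h2)
  simp [energy]

theorem energy_complex_le (hϰ : 1 ≤ ϰ) (hA : IsAdmissible Ω ϰ m A) (u : E n × ℝ → ℂ)
    {z : E n × ℝ} (hz : z ∈ cyl Ω t₁ t₂) :
    energy Ω t₁ t₂ A u z ≤ ϰ * ∑ i, ‖weakDeriv (cyl Ω t₁ t₂) (dirQ i) u z‖ ^ 2 := by
  have hr := (elliptic_closure hA (subset_closure hz.1)
    (WithLp.toLp 2 fun i => (dx Ω t₁ t₂ i u z).re)).2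
  have hi := (elliptic_closure hA (subset_closure hz.1)
    (WithLp.toLp 2 fun i => (dx Ω t₁ t₂ i u z).im)).2
  have h2 : ‖dt Ω t₁ t₂ u z‖ ^ 2 ≤ ϰ * ‖dt Ω t₁ t₂ u z‖ ^ 2 :=
    le_mul_of_one_le_left (sq_nonneg _) hϰ
  have h3 := add_le_add (add_le_add hr hi) h2
  have e1 : ∑ i, ‖weakDeriv (cyl Ω t₁ t₂) (dirQ i) u z‖ ^ 2 =
      (∑ i, (dx Ω t₁ t₂ i u z).re ^ 2 + ∑ i, (dx Ω t₁ t₂ i u z).im ^ 2)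
        + ‖dt Ω t₁ t₂ u z‖ ^ 2 := by
    rw [Fintype.sum_option, add_comm, ← Finset.sum_add_distrib]
    congr 1
    refine Finset.sum_congr rfl fun i _ => ?_
    rw [Complex.sq_norm, Complex.normSq_apply, ← sq, ← sq]; rfl
  rw [e1, mul_add, mul_add]
  refine le_trans (le_of_eq ?_) h3
  rw [energy, ← Finset.sum_add_distrib]
  congr 1
  rw [_root_.map_sum]
  refine Finset.sum_congr rfl fun k _ => ?_
  rw [_root_.map_sum, ← Finset.sum_add_distrib]
  refine Finset.sum_congr rfl fun l _ => ?_
  simp [mul_assoc]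
  ring

theorem LinftyBound.ae_norm_le {f : E n × ℝ → ℂ} (hm : 0 ≤ m) (hf : LinftyBound Ω t₁ t₂ m f) :
    ∀ᵐ z ∂volume.restrict (cyl Ω t₁ t₂), ‖f z‖ ≤ m := by
  have h := hf.2
  rw [eLpNorm_exponent_top] at h
  filter_upwards [ae_le_eLpNormEssSup (f := f) (μ := volume.restrict (cyl Ω t₁ t₂))] with z hz
  have h1 := hz.trans h
  rwa [← ofReal_norm, ENNReal.ofReal_le_ofReal_iff hm] at h1

/-- Two applications of `(a + b)² ≤ 2a² + 2b²` separate the operator, the `n + 1` first-order terms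
and the zero-order term; Cauchy-Schwarz on the first-order terms gives the factor `n + 1`. -/
theorem norm_sq_waveOp₀_le {q₀ p u : E n × ℝ → ℂ} {q : Fin n → E n × ℝ → ℂ} {z : E n × ℝ}
    (h0 : ‖q₀ z‖ ≤ m) (hq : ∀ j, ‖q j z‖ ≤ m) (hp : ‖p z‖ ≤ m) :
    ‖waveOp₀ Ω t₁ t₂ A u z‖ ^ 2 ≤ 2 * ‖waveOp Ω t₁ t₂ A q₀ q p u z‖ ^ 2 +
      4 * (n + 1) * m ^ 2 * (‖u z‖ ^ 2 + ∑ i, ‖weakDeriv (cyl Ω t₁ t₂) (dirQ i) u z‖ ^ 2) := by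
  set S := ∑ i, ‖weakDeriv (cyl Ω t₁ t₂) (dirQ i) u z‖ with hS
  have hm : 0 ≤ m := (norm_nonneg _).trans h0
  have hS0 : 0 ≤ S := Finset.sum_nonneg fun i _ => norm_nonneg _
  have e : waveOp₀ Ω t₁ t₂ A u z = waveOp Ω t₁ t₂ A q₀ q p u z -
      ((q₀ z * dt Ω t₁ t₂ u z + ∑ j, q j z * dx Ω t₁ t₂ j u z) + p z * u z) := by
    rw [waveOp]; ring
  have h1 : ‖(q₀ z * dt Ω t₁ t₂ u z + ∑ j, q j z * dx Ω t₁ t₂ j u z) + p z * u z‖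
      ≤ m * S + m * ‖u z‖ := by
    refine (norm_add_le _ _).trans (add_le_add ((norm_add_le _ _).trans ?_) ?_)
    · rw [hS, Fintype.sum_option, mul_add, Finset.mul_sum]
      refine add_le_add ?_ ((norm_sum_le _ _).trans (Finset.sum_le_sum fun j _ => ?_))
      · rw [norm_mul]; exact mul_le_mul_of_nonneg_right h0 (norm_nonneg _)
      · rw [norm_mul]; exact mul_le_mul_of_nonneg_right (hq j) (norm_nonneg _)
    · rw [norm_mul]; exact mul_le_mul_of_nonneg_right hp (norm_nonneg _)
  have h2 : ‖waveOp₀ Ω t₁ t₂ A u z‖ ≤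
      ‖waveOp Ω t₁ t₂ A q₀ q p u z‖ + (m * S + m * ‖u z‖) := by
    rw [e]; exact (norm_sub_le _ _).trans (add_le_add_right h1 _)
  have h3 : S ^ 2 ≤ (n + 1) * ∑ i, ‖weakDeriv (cyl Ω t₁ t₂) (dirQ i) u z‖ ^ 2 := by
    have h := sq_sum_le_card_mul_sum_sq (s := (Finset.univ : Finset (Option (Fin n))))
      (f := fun i => ‖weakDeriv (cyl Ω t₁ t₂) (dirQ i) u z‖)
    rw [hS]; simpa using h
  have h4 := pow_le_pow_left₀ (norm_nonneg _) h2 2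
  have h5 : ‖u z‖ ^ 2 ≤ (n + 1) * ‖u z‖ ^ 2 :=
    le_mul_of_one_le_left (sq_nonneg _) (by linarith [(Nat.cast_nonneg n : (0 : ℝ) ≤ n)])
  have h6 := mul_le_mul_of_nonneg_left (add_le_add h3 h5) (by positivity : 0 ≤ 4 * m ^ 2)
  calc _ ≤ _ := h4
    _ ≤ 2 * ‖waveOp Ω t₁ t₂ A q₀ q p u z‖ ^ 2 + 4 * m ^ 2 * (S ^ 2 + ‖u z‖ ^ 2) := by
      have a1 := sq_nonneg (‖waveOp Ω t₁ t₂ A q₀ q p u z‖ - (m * S + m * ‖u z‖))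
      have a2 := sq_nonneg (m * S - m * ‖u z‖)
      linear_combination a1 + 2 * a2
    _ ≤ _ := by linear_combination h6

theorem carlemanDensity_nonneg {lam τ : ℝ} (hlam : 0 ≤ lam) (hτ : 0 ≤ τ) (u : E n × ℝ → ℝ)
    (z : E n × ℝ) : 0 ≤ carlemanDensity Ω t₁ t₂ ψ₀ ψ₁ lam τ u z := by
  have h1 : 0 < phi ψ₀ ψ₁ lam z := Real.exp_pos _
  have h2 : 0 ≤ ∑ i, weakDeriv (cyl Ω t₁ t₂) (dirQ i) u z ^ 2 :=
    Finset.sum_nonneg fun i _ => sq_nonneg _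
  rw [carlemanDensity]; positivity

theorem carlemanDensity_re_add_im (hΩ : IsLipschitzDomain Ω) {lam τ : ℝ} {u : E n × ℝ → ℂ}
    (hu : MemH1 (cyl Ω t₁ t₂) u) : ∀ᵐ z ∂volume.restrict (cyl Ω t₁ t₂),
    carlemanDensity Ω t₁ t₂ ψ₀ ψ₁ lam τ (fun z => Complex.reCLM (u z)) z +
      carlemanDensity Ω t₁ t₂ ψ₀ ψ₁ lam τ (fun z => Complex.imCLM (u z)) z =
    Real.exp (2 * τ * phi ψ₀ ψ₁ lam z) * (τ ^ 3 * lam ^ 4 * phi ψ₀ ψ₁ lam z ^ 3 * ‖u z‖ ^ 2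
      + τ * lam * phi ψ₀ ψ₁ lam z * ∑ i, ‖weakDeriv (cyl Ω t₁ t₂) (dirQ i) u z‖ ^ 2) := by
  have hD := isOpen_cyl (t₁ := t₁) (t₂ := t₂) hΩ
  filter_upwards [ae_all_iff.2 fun i => hu.weakDeriv_clm_comp hD Complex.reCLM (dirQ i),
    ae_all_iff.2 fun i => hu.weakDeriv_clm_comp hD Complex.imCLM (dirQ i)] with z h1 h2
  have e : ∀ w : ℂ, ‖w‖ ^ 2 = w.re ^ 2 + w.im ^ 2 := fun w => by
    rw [Complex.sq_norm, Complex.normSq_apply, ← sq, ← sq]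
  simp only [carlemanDensity, h1, h2]
  simp only [e, Finset.sum_add_distrib, Complex.reCLM_apply,
    Complex.imCLM_apply]
  ring

/-- The Carleman estimate for complex-valued functions and the principal part. -/
theorem carleman_complex (hn : 1 ≤ n) (hΩ : IsLipschitzDomain Ω) (ht : t₁ < t₂)
    (hA : IsAdmissible Ω ϰ m A) (hψ : ContinuousOn (psi ψ₀ ψ₁) (closure (cyl Ω t₁ t₂)))
    {c lam τ : ℝ} (hlam : 0 ≤ lam) (hτ : 0 ≤ τ)
    (hreal : ∀ u : E n × ℝ → ℝ, IsAdmissibleFun Ω t₁ t₂ u →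
        ENNReal.ofReal c * ∫⁻ z in cyl Ω t₁ t₂,
            ENNReal.ofReal (carlemanDensity Ω t₁ t₂ ψ₀ ψ₁ lam τ u z)
          ≤ (∫⁻ z in cyl Ω t₁ t₂, ENNReal.ofReal
              (Real.exp (2 * τ * phi ψ₀ ψ₁ lam z) * waveOp₀ Ω t₁ t₂ A u z ^ 2))
            + ENNReal.ofReal (τ * lam) *
              ∫⁻ z in sigmaPlus Ω t₁ t₂ A ψ₀, ENNReal.ofReal
                (Real.exp (2 * τ * phi ψ₀ ψ₁ lam z) * phi ψ₀ ψ₁ lam z *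
                  normalDeriv Ω t₁ t₂ u z ^ 2) ∂(lateralMeasure Ω t₁ t₂))
    {u : E n × ℝ → ℂ} (hu : IsAdmissibleFun Ω t₁ t₂ u) :
    ENNReal.ofReal c * ∫⁻ z in cyl Ω t₁ t₂, ENNReal.ofReal
        (carlemanDensity Ω t₁ t₂ ψ₀ ψ₁ lam τ (fun z => Complex.reCLM (u z)) z +
          carlemanDensity Ω t₁ t₂ ψ₀ ψ₁ lam τ (fun z => Complex.imCLM (u z)) z)
      ≤ (∫⁻ z in cyl Ω t₁ t₂, ENNReal.ofReal
          (Real.exp (2 * τ * phi ψ₀ ψ₁ lam z) * ‖waveOp₀ Ω t₁ t₂ A u z‖ ^ 2))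
        + ENNReal.ofReal (τ * lam) *
          ∫⁻ z in sigmaPlus Ω t₁ t₂ A ψ₀, ENNReal.ofReal
            (Real.exp (2 * τ * phi ψ₀ ψ₁ lam z) * phi ψ₀ ψ₁ lam z *
              ‖normalDeriv Ω t₁ t₂ u z‖ ^ 2) ∂(lateralMeasure Ω t₁ t₂) := by
  have hre : ∀ w : ℂ, |Complex.reCLM w| ≤ ‖w‖ := Complex.abs_re_le_norm
  have him : ∀ w : ℂ, |Complex.imCLM w| ≤ ‖w‖ := Complex.abs_im_le_norm
  have hur := hu.clm_comp hn hΩ ht hre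
  have hui := hu.clm_comp hn hΩ ht him
  have e : ∀ w : ℂ, ‖w‖ ^ 2 = Complex.reCLM w ^ 2 + Complex.imCLM w ^ 2 := fun w => by
    rw [Complex.sq_norm, Complex.normSq_apply, ← sq, ← sq]; rfl
  have hmeas : AEMeasurable (fun z => ENNReal.ofReal (carlemanDensity Ω t₁ t₂ ψ₀ ψ₁ lam τ
      (fun z => Complex.reCLM (u z)) z)) (volume.restrict (cyl Ω t₁ t₂)) := by
    refine ((integrable_carlemanDensity hΩ ht hψ 1 1 (lam := lam) (τ := τ)
      hur.memH2.1).congr (Eventually.of_forall fun z => ?_)).1.aemeasurable.ennreal_ofReal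
    simp only [one_mul, carlemanDensity]
  have hX : ∫⁻ z in cyl Ω t₁ t₂, ENNReal.ofReal
        (carlemanDensity Ω t₁ t₂ ψ₀ ψ₁ lam τ (fun z => Complex.reCLM (u z)) z +
          carlemanDensity Ω t₁ t₂ ψ₀ ψ₁ lam τ (fun z => Complex.imCLM (u z)) z) =
      (∫⁻ z in cyl Ω t₁ t₂, ENNReal.ofReal
        (carlemanDensity Ω t₁ t₂ ψ₀ ψ₁ lam τ (fun z => Complex.reCLM (u z)) z)) +
      ∫⁻ z in cyl Ω t₁ t₂, ENNReal.ofReal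
        (carlemanDensity Ω t₁ t₂ ψ₀ ψ₁ lam τ (fun z => Complex.imCLM (u z)) z) := by
    rw [← lintegral_add_left' hmeas]
    exact lintegral_congr fun z => ENNReal.ofReal_add (carlemanDensity_nonneg hlam hτ _ z)
      (carlemanDensity_nonneg hlam hτ _ z)
  rw [hX, mul_add]
  refine (add_le_add (hreal _ hur) (hreal _ hui)).trans ?_
  rw [add_add_add_comm, ← mul_add]
  -- The lower Lebesgue integral is superadditive for arbitrary functions, so no measurability is
  -- needed on the right-hand side.
  refine add_le_add ((le_lintegral_add _ _).trans (le_of_eq (lintegral_congr_ae ?_)))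
    (mul_le_mul' le_rfl ((le_lintegral_add _ _).trans (le_of_eq (lintegral_congr_ae ?_))))
  · filter_upwards [waveOp₀_clm_comp hn hΩ ht hA hu.memH2 Complex.reCLM,
      waveOp₀_clm_comp hn hΩ ht hA hu.memH2 Complex.imCLM] with z h1 h2
    rw [h1, h2, ← ENNReal.ofReal_add (by positivity) (by positivity), ← mul_add, ← e]
  · filter_upwards [ae_restrict_of_ae (normalDeriv_clm_comp hn hΩ ht hu.memH2 hre),
      ae_restrict_of_ae (normalDeriv_clm_comp hn hΩ ht hu.memH2 him)] with z h1 h2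
    have hφ : 0 < phi ψ₀ ψ₁ lam z := Real.exp_pos _
    rw [h1, h2, ← ENNReal.ofReal_add (by positivity) (by positivity), ← mul_add, ← e]

/-- Finiteness of `X` is essential, as `2cX` is cancelled from both sides. It is available because
`u` lies in `H¹`. -/
theorem ennreal_absorb {X Y Z c : ENNReal} (hX : X ≠ ⊤) (hc : c ≠ ⊤)
    (h : (4 * c) * X ≤ (2 * Y + (2 * c) * X) + Z) : c * X ≤ Y + Z := by
  have h1 : (2 * c) * X + (2 * c) * X ≤ (2 * c) * X + (2 * Y + Z) := by
    refine le_trans (le_of_eq ?_) (h.trans (le_of_eq ?_)) <;> ring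
  have hfin : (2 * c) * X ≠ ⊤ := ENNReal.mul_ne_top (ENNReal.mul_ne_top (by simp) hc) hX
  have h2 : 2 * (c * X) ≤ 2 * (Y + Z) := by
    rw [← mul_assoc, mul_add]
    exact ((ENNReal.add_le_add_iff_left hfin).1 h1).trans
      (add_le_add_right (le_mul_of_one_le_left zero_le (by norm_num)) _)
  exact (ENNReal.mul_le_mul_iff_right (by simp) (by simp)).1 h2

/-- Ellipticity bounds the `A`-energy by `ϰ` times the Euclidean one, whence the division of the
constant by `ϰ`. -/
theorem carleman_energy_real (hn : 1 ≤ n) (hΩ : IsLipschitzDomain Ω) (ht : t₁ < t₂) (hϰ : 1 ≤ ϰ)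
    (hm : 0 < m) (hκ : 0 < κ) (hδ : 0 < δ) : ∃ c lam₀ τ₀ : ℝ, 0 < c ∧ 0 < lam₀ ∧ 0 < τ₀ ∧
      ∀ A : E n → Matrix (Fin n) (Fin n) ℝ, IsAdmissible Ω ϰ m A →
      ∀ (ψ₀ : E n → ℝ) (ψ₁ : ℝ → ℝ), IsWaveWeight Ω t₁ t₂ A ϰ κ ψ₀ ψ₁ →
      IsLeast (chiSq Ω t₁ t₂ A ψ₀ ψ₁ '' closure (cyl Ω t₁ t₂)) δ →
      C4Bound Ω t₁ t₂ B (psi ψ₀ ψ₁) →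
      ∀ lam ≥ lam₀, ∀ τ ≥ τ₀, ∀ u : E n × ℝ → ℝ, IsAdmissibleFun Ω t₁ t₂ u →
        ENNReal.ofReal c * ∫⁻ z in cyl Ω t₁ t₂, ENNReal.ofReal
            (Real.exp (2 * τ * phi ψ₀ ψ₁ lam z) *
              (τ ^ 3 * lam ^ 4 * phi ψ₀ ψ₁ lam z ^ 3 * u z ^ 2
                + τ * lam * phi ψ₀ ψ₁ lam z * energy Ω t₁ t₂ A u z))
          ≤ (∫⁻ z in cyl Ω t₁ t₂, ENNReal.ofReal
              (Real.exp (2 * τ * phi ψ₀ ψ₁ lam z) * waveOp₀ Ω t₁ t₂ A u z ^ 2))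
            + ENNReal.ofReal (τ * lam) *
              ∫⁻ z in sigmaPlus Ω t₁ t₂ A ψ₀, ENNReal.ofReal
                (Real.exp (2 * τ * phi ψ₀ ψ₁ lam z) * phi ψ₀ ψ₁ lam z *
                  normalDeriv Ω t₁ t₂ u z ^ 2) ∂(lateralMeasure Ω t₁ t₂) := by
  obtain ⟨c, lam₀, hc, hlam₀, H⟩ := carleman_real (B := B) hn hΩ ht hϰ hm hκ hδ
  have hϰ0 : 0 < ϰ := by linarith
  refine ⟨c / ϰ, lam₀, 1, by positivity, by linarith, one_pos, ?_⟩
  intro A hA ψ₀ ψ₁ hw hl hB lam hlam τ hτ u hu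
  refine le_trans ?_ (H A hA ψ₀ ψ₁ hw hl hB lam hlam τ hτ u hu)
  rw [← lintegral_const_mul' _ _ ENNReal.ofReal_ne_top,
    ← lintegral_const_mul' _ _ ENNReal.ofReal_ne_top]
  refine lintegral_mono_ae ?_
  filter_upwards [ae_restrict_mem (isOpen_cyl hΩ).measurableSet] with z hz
  rw [← ENNReal.ofReal_mul (by positivity), ← ENNReal.ofReal_mul hc.le]
  refine ENNReal.ofReal_le_ofReal ?_
  have hφ : 0 < phi ψ₀ ψ₁ lam z := Real.exp_pos _
  have hlam0 : 0 ≤ lam := by linarith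
  have hτ0 : 0 ≤ τ := by linarith
  rw [div_mul_eq_mul_div, div_le_iff₀ hϰ0, mul_assoc c (carlemanDensity Ω t₁ t₂ ψ₀ ψ₁ lam τ u z)]
  refine mul_le_mul_of_nonneg_left ?_ hc.le
  rw [carlemanDensity, mul_assoc (Real.exp _), add_mul]
  refine mul_le_mul_of_nonneg_left (add_le_add ?_ ?_) (Real.exp_pos _).le
  · exact le_mul_of_one_le_right (by positivity) hϰ
  · rw [mul_assoc (τ * lam * phi ψ₀ ψ₁ lam z), mul_comm _ ϰ]
    exact mul_le_mul_of_nonneg_left (energy_real_le hϰ hA u hz) (by positivity)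

theorem carleman_energy_complex (hn : 1 ≤ n) (hΩ : IsLipschitzDomain Ω) (ht : t₁ < t₂)
    (hϰ : 1 ≤ ϰ) (hm : 0 < m) (hκ : 0 < κ) (hδ : 0 < δ) :
    ∃ c lam₀ τ₀ : ℝ, 0 < c ∧ 0 < lam₀ ∧ 0 < τ₀ ∧
      ∀ A : E n → Matrix (Fin n) (Fin n) ℝ, IsAdmissible Ω ϰ m A →
      ∀ (q₀ : E n × ℝ → ℂ) (q : Fin n → E n × ℝ → ℂ) (p : E n × ℝ → ℂ),
      LinftyBound Ω t₁ t₂ m q₀ → (∀ j, LinftyBound Ω t₁ t₂ m (q j)) → LinftyBound Ω t₁ t₂ m p →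
      ∀ (ψ₀ : E n → ℝ) (ψ₁ : ℝ → ℝ), IsWaveWeight Ω t₁ t₂ A ϰ κ ψ₀ ψ₁ →
      IsLeast (chiSq Ω t₁ t₂ A ψ₀ ψ₁ '' closure (cyl Ω t₁ t₂)) δ →
      C4Bound Ω t₁ t₂ B (psi ψ₀ ψ₁) →
      ∀ lam ≥ lam₀, ∀ τ ≥ τ₀, ∀ u : E n × ℝ → ℂ, IsAdmissibleFun Ω t₁ t₂ u →
        ENNReal.ofReal c * ∫⁻ z in cyl Ω t₁ t₂, ENNReal.ofReal
            (Real.exp (2 * τ * phi ψ₀ ψ₁ lam z) *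
              (τ ^ 3 * lam ^ 4 * phi ψ₀ ψ₁ lam z ^ 3 * ‖u z‖ ^ 2
                + τ * lam * phi ψ₀ ψ₁ lam z * energy Ω t₁ t₂ A u z))
          ≤ (∫⁻ z in cyl Ω t₁ t₂, ENNReal.ofReal
              (Real.exp (2 * τ * phi ψ₀ ψ₁ lam z) * ‖waveOp Ω t₁ t₂ A q₀ q p u z‖ ^ 2))
            + ENNReal.ofReal (τ * lam) *
              ∫⁻ z in sigmaPlus Ω t₁ t₂ A ψ₀, ENNReal.ofReal
                (Real.exp (2 * τ * phi ψ₀ ψ₁ lam z) * phi ψ₀ ψ₁ lam z *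
                  ‖normalDeriv Ω t₁ t₂ u z‖ ^ 2) ∂(lateralMeasure Ω t₁ t₂) := by
  obtain ⟨c, lam₀, hc, hlam₀, H⟩ := carleman_real (B := B) hn hΩ ht hϰ hm hκ hδ
  have hϰ0 : 0 < ϰ := by linarith
  set N : ℝ := 4 * (n + 1) * m ^ 2 with hN
  -- The threshold for `τ` makes the lower-order constant `N` at most `cτ/2`, so the lower-order
  -- terms take half of the left side. The factor `2` in front of the operator accounts for the
  -- other halving, and `ϰ` for the passage to the `A`-energy.
  refine ⟨c / 4 / ϰ, lam₀, max 1 (2 * N / c), by positivity, by linarith,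
    lt_max_of_lt_left one_pos, ?_⟩
  intro A hA q₀ q p hq₀ hq hp ψ₀ ψ₁ hw hl hB lam hlam τ hτ u hu
  have hτ1 : 1 ≤ τ := (le_max_left _ _).trans hτ
  have hτN : N ≤ c / 2 * τ := by
    have := (le_max_right _ _).trans hτ
    rw [div_le_iff₀ hc] at this
    linarith
  have hlam1 : 1 ≤ lam := hlam₀.trans hlam
  have hlam0 : 0 ≤ lam := by linarith
  have hτ0 : 0 ≤ τ := by linarith
  have hψ := hw.contDiffOn.continuousOn
  set F : E n × ℝ → ℝ := fun z =>
    carlemanDensity Ω t₁ t₂ ψ₀ ψ₁ lam τ (fun z => Complex.reCLM (u z)) z +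
      carlemanDensity Ω t₁ t₂ ψ₀ ψ₁ lam τ (fun z => Complex.imCLM (u z)) z with hF
  have hF0 : ∀ z, 0 ≤ F z := fun z => add_nonneg (carlemanDensity_nonneg hlam0 hτ0 _ z)
    (carlemanDensity_nonneg hlam0 hτ0 _ z)
  have hFint : Integrable F (volume.restrict (cyl Ω t₁ t₂)) := by
    have h : ∀ L : ℂ →L[ℝ] ℝ, Integrable (carlemanDensity Ω t₁ t₂ ψ₀ ψ₁ lam τ
        (fun z => L (u z))) (volume.restrict (cyl Ω t₁ t₂)) := fun L => by
      refine (integrable_carlemanDensity hΩ ht hψ 1 1 (lam := lam) (τ := τ)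
        (hu.memH2.clm_comp (isOpen_cyl hΩ) L).1).congr (Eventually.of_forall fun z => ?_)
      simp only [one_mul, carlemanDensity]
    exact (h Complex.reCLM).add (h Complex.imCLM)
  have hFm : AEMeasurable (fun z => ENNReal.ofReal (c / 2 * F z))
      (volume.restrict (cyl Ω t₁ t₂)) := (hFint.const_mul _).1.aemeasurable.ennreal_ofReal
  have hae := carlemanDensity_re_add_im (ψ₀ := ψ₀) (ψ₁ := ψ₁) hΩ (lam := lam) (τ := τ) hu.memH2.1
  have hmem := ae_restrict_mem (μ := (volume : Measure (E n × ℝ)))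
    (isOpen_cyl (t₁ := t₁) (t₂ := t₂) hΩ).measurableSet
  have hφ : ∀ z, 0 < phi ψ₀ ψ₁ lam z := fun z => Real.exp_pos _
  have hmain := carleman_complex hn hΩ ht hA hψ hlam0 hτ0
    (fun v hv => H A hA ψ₀ ψ₁ hw hl hB lam hlam τ hτ1 v hv) hu
  have hlow : ∫⁻ z in cyl Ω t₁ t₂, ENNReal.ofReal
      (Real.exp (2 * τ * phi ψ₀ ψ₁ lam z) * ‖waveOp₀ Ω t₁ t₂ A u z‖ ^ 2) ≤
      2 * (∫⁻ z in cyl Ω t₁ t₂, ENNReal.ofReal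
      (Real.exp (2 * τ * phi ψ₀ ψ₁ lam z) * ‖waveOp Ω t₁ t₂ A q₀ q p u z‖ ^ 2)) +
      ENNReal.ofReal (c / 2) * ∫⁻ z in cyl Ω t₁ t₂, ENNReal.ofReal (F z) := by
    rw [← lintegral_const_mul' _ _ ENNReal.ofReal_ne_top,
      ← lintegral_const_mul' _ _ (by simp : (2 : ENNReal) ≠ ⊤)]
    simp only [← ENNReal.ofReal_mul (by positivity : 0 ≤ c / 2)]
    rw [← lintegral_add_right' _ hFm]
    refine lintegral_mono_ae ?_
    filter_upwards [hae, hmem, hq₀.ae_norm_le hm.le, ae_all_iff.2 fun j => (hq j).ae_norm_le hm.le,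
      hp.ae_norm_le hm.le] with z hz hzm h0 hj hp'
    have e2 : (2 : ENNReal) = ENNReal.ofReal 2 := by simp
    rw [e2, ← ENNReal.ofReal_mul (by norm_num), ← ENNReal.ofReal_add (by positivity)
      (mul_nonneg (by positivity) (hF0 z))]
    refine ENNReal.ofReal_le_ofReal ?_
    have h1 := norm_sq_waveOp₀_le (Ω := Ω) (t₁ := t₁) (t₂ := t₂) (A := A) (u := u) h0 hj hp'
    have hφ1 : 1 ≤ phi ψ₀ ψ₁ lam z :=
      Real.one_le_exp (mul_nonneg hlam0 (hw.nonneg z (subset_closure hzm)))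
    have hS0 : 0 ≤ ∑ i, ‖weakDeriv (cyl Ω t₁ t₂) (dirQ i) u z‖ ^ 2 :=
      Finset.sum_nonneg fun i _ => sq_nonneg _
    set S := ∑ i, ‖weakDeriv (cyl Ω t₁ t₂) (dirQ i) u z‖ ^ 2
    set P := phi ψ₀ ψ₁ lam z
    set W := Real.exp (2 * τ * P)
    have hW : 0 ≤ W := (Real.exp_pos _).le
    have hFz : F z = W * (τ ^ 3 * lam ^ 4 * P ^ 3 * ‖u z‖ ^ 2 + τ * lam * P * S) := hz
    rw [hFz]
    -- Because `ψ ≥ 0`, the weight `φ` is at least `1`. With `λ ≥ 1` and `τ ≥ 1`, both coefficients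
    -- of the Carleman density then dominate `τ`.
    have a1 : τ ≤ τ ^ 3 * lam ^ 4 * P ^ 3 := by
      have b1 : τ ≤ τ ^ 3 := le_self_pow₀ hτ1 (by norm_num)
      have b2 : 1 ≤ lam ^ 4 := one_le_pow₀ hlam1
      have b3 : 1 ≤ P ^ 3 := one_le_pow₀ hφ1
      exact b1.trans ((le_mul_of_one_le_right (by positivity) b2).trans
        (le_mul_of_one_le_right (by positivity) b3))
    have a2 : τ ≤ τ * lam * P :=
      (le_mul_of_one_le_right hτ0 hlam1).trans (le_mul_of_one_le_right (by positivity) hφ1)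
    have a3 : N * (‖u z‖ ^ 2 + S) ≤
        c / 2 * (τ ^ 3 * lam ^ 4 * P ^ 3 * ‖u z‖ ^ 2 + τ * lam * P * S) := by
      refine (mul_le_mul_of_nonneg_right hτN (by positivity)).trans ?_
      rw [mul_assoc, mul_add τ]
      exact mul_le_mul_of_nonneg_left (add_le_add
        (mul_le_mul_of_nonneg_right a1 (sq_nonneg _)) (mul_le_mul_of_nonneg_right a2 hS0))
        (by positivity)
    have a4 := mul_le_mul_of_nonneg_left (h1.trans (add_le_add_right a3 _)) hW
    linear_combination a4
  have hXfin : ∫⁻ z in cyl Ω t₁ t₂, ENNReal.ofReal (F z) ≠ ⊤ := by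
    rw [← ofReal_integral_eq_lintegral_ofReal hFint (Eventually.of_forall hF0)]
    exact ENNReal.ofReal_ne_top
  have e4 : ENNReal.ofReal c = 4 * ENNReal.ofReal (c / 4) := by
    rw [show (4 : ENNReal) = ENNReal.ofReal 4 by simp, ← ENNReal.ofReal_mul (by norm_num)]
    congr 1; ring
  have e2 : ENNReal.ofReal (c / 2) = 2 * ENNReal.ofReal (c / 4) := by
    rw [show (2 : ENNReal) = ENNReal.ofReal 2 by simp, ← ENNReal.ofReal_mul (by norm_num)]
    congr 1; ring
  rw [e2] at hlow
  rw [e4] at hmain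
  refine le_trans ?_ (ennreal_absorb hXfin ENNReal.ofReal_ne_top
    (hmain.trans (add_le_add_left hlow _)))
  rw [← lintegral_const_mul' _ _ ENNReal.ofReal_ne_top,
    ← lintegral_const_mul' _ _ ENNReal.ofReal_ne_top]
  refine lintegral_mono_ae ?_
  filter_upwards [hae, hmem] with z hz hzm
  rw [← ENNReal.ofReal_mul (by positivity), ← ENNReal.ofReal_mul (by positivity)]
  refine ENNReal.ofReal_le_ofReal ?_
  have hφz := hφ z
  rw [div_mul_eq_mul_div, div_le_iff₀ hϰ0, mul_assoc (c / 4) (F z)]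
  refine mul_le_mul_of_nonneg_left ?_ (by positivity)
  have hFz : F z = _ := hz
  rw [hFz, mul_assoc (Real.exp _), add_mul]
  refine mul_le_mul_of_nonneg_left (add_le_add ?_ ?_) (Real.exp_pos _).le
  · exact le_mul_of_one_le_right (by positivity) hϰ
  · rw [mul_assoc (τ * lam * phi ψ₀ ψ₁ lam z), mul_comm _ ϰ]
    exact mul_le_mul_of_nonneg_left (energy_complex_le hϰ hA u hzm) (by positivity)

end Final

end WaveCarleman

end

theorem mainTheorem2 (n : ℕ) (hn : 2 ≤ n) (Ω : Set (E n)) (hΩ : IsLipschitzDomain Ω)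
    (t₁ t₂ : ℝ) (ht : t₁ < t₂) (ϰ m κ δ b : ℝ) (hϰ : 1 ≤ ϰ) (hm : 0 < m) (hκ : 0 < κ)
    (hδ : 0 < δ) :
    (∃ c lam₀ τ₀ : ℝ, 0 < c ∧ 0 < lam₀ ∧ 0 < τ₀ ∧
      ∀ A : E n → Matrix (Fin n) (Fin n) ℝ, IsAdmissible Ω ϰ m A →
      ∀ (ψ₀ : E n → ℝ) (ψ₁ : ℝ → ℝ), IsWaveWeight Ω t₁ t₂ A ϰ κ ψ₀ ψ₁ →
      IsLeast (chiSq Ω t₁ t₂ A ψ₀ ψ₁ '' closure (cyl Ω t₁ t₂)) δ →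
      C4Bound Ω t₁ t₂ b (psi ψ₀ ψ₁) →
      ∀ lam ≥ lam₀, ∀ τ ≥ τ₀, ∀ u : E n × ℝ → ℝ, IsAdmissibleFun Ω t₁ t₂ u →
        ENNReal.ofReal c * ∫⁻ z in cyl Ω t₁ t₂, ENNReal.ofReal
            (Real.exp (2 * τ * phi ψ₀ ψ₁ lam z) *
              (τ ^ 3 * lam ^ 4 * phi ψ₀ ψ₁ lam z ^ 3 * u z ^ 2
                + τ * lam * phi ψ₀ ψ₁ lam z * energy Ω t₁ t₂ A u z))
          ≤ (∫⁻ z in cyl Ω t₁ t₂, ENNReal.ofReal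
              (Real.exp (2 * τ * phi ψ₀ ψ₁ lam z) * waveOp₀ Ω t₁ t₂ A u z ^ 2))
            + ENNReal.ofReal (τ * lam) *
              ∫⁻ z in sigmaPlus Ω t₁ t₂ A ψ₀, ENNReal.ofReal
                (Real.exp (2 * τ * phi ψ₀ ψ₁ lam z) * phi ψ₀ ψ₁ lam z *
                  normalDeriv Ω t₁ t₂ u z ^ 2) ∂(lateralMeasure Ω t₁ t₂)) ∧
    (∃ c lam₀ τ₀ : ℝ, 0 < c ∧ 0 < lam₀ ∧ 0 < τ₀ ∧
      ∀ A : E n → Matrix (Fin n) (Fin n) ℝ, IsAdmissible Ω ϰ m A →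
      ∀ (q₀ : E n × ℝ → ℂ) (q : Fin n → E n × ℝ → ℂ) (p : E n × ℝ → ℂ),
      LinftyBound Ω t₁ t₂ m q₀ → (∀ j, LinftyBound Ω t₁ t₂ m (q j)) → LinftyBound Ω t₁ t₂ m p →
      ∀ (ψ₀ : E n → ℝ) (ψ₁ : ℝ → ℝ), IsWaveWeight Ω t₁ t₂ A ϰ κ ψ₀ ψ₁ →
      IsLeast (chiSq Ω t₁ t₂ A ψ₀ ψ₁ '' closure (cyl Ω t₁ t₂)) δ →
      C4Bound Ω t₁ t₂ b (psi ψ₀ ψ₁) →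
      ∀ lam ≥ lam₀, ∀ τ ≥ τ₀, ∀ u : E n × ℝ → ℂ, IsAdmissibleFun Ω t₁ t₂ u →
        ENNReal.ofReal c * ∫⁻ z in cyl Ω t₁ t₂, ENNReal.ofReal
            (Real.exp (2 * τ * phi ψ₀ ψ₁ lam z) *
              (τ ^ 3 * lam ^ 4 * phi ψ₀ ψ₁ lam z ^ 3 * ‖u z‖ ^ 2
                + τ * lam * phi ψ₀ ψ₁ lam z * energy Ω t₁ t₂ A u z))
          ≤ (∫⁻ z in cyl Ω t₁ t₂, ENNReal.ofReal
              (Real.exp (2 * τ * phi ψ₀ ψ₁ lam z) * ‖waveOp Ω t₁ t₂ A q₀ q p u z‖ ^ 2))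
            + ENNReal.ofReal (τ * lam) *
              ∫⁻ z in sigmaPlus Ω t₁ t₂ A ψ₀, ENNReal.ofReal
                (Real.exp (2 * τ * phi ψ₀ ψ₁ lam z) * phi ψ₀ ψ₁ lam z *
                  ‖normalDeriv Ω t₁ t₂ u z‖ ^ 2) ∂(lateralMeasure Ω t₁ t₂)) := by
  exact ⟨carleman_energy_real (by omega) hΩ ht hϰ hm hκ hδ,
    carleman_energy_complex (by omega) hΩ ht hϰ hm hκ hδ⟩
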